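/- Conventions. Inner products on Hilbert modules are linear in the second variable. A representation of a $\mathrm C^*$-algebra $C$ on a Hilbert $D$-module $\mathcal F$ is a $*$-homomorphism from $C$ to the $\mathrm C^*$-algebra of adjointable operators on $\mathcal F$; it is nondegenerate if $C\cdot\mathcal F$ spans a dense subspace. A $\mathrm C^*$-correspondence from $D$ to $D'$ is a Hilbert $D'$-module with a nondegenerate representation of $D$. An isometry of Hilbert $D$-modules is a linear map that preserves the $D$-valued inner products (not necessarily adjointable). Let $G$ be a locally compact Hausdorff groupoid with object space $G^0$, range and source maps $r,s$, and a continuous left invariant Haar system $\alpha=(\alpha^x)_{x\in G^0}$, where $\alpha^x$ has support $G^x=r^{-1}(x)$; let $\tilde\alpha_x$ on $G_x=s^{-1}(x)$ be the image of $\alpha^x$ under inversion. Let $\mathcal A$ be a (possibly unsaturated) Fell bundle over $G$: an upper semicontinuous bundle of Banach spaces $(\mathcal A_g)_{g\in G}$ with enough continuous sections, with continuous, associative, bilinear multiplications $\mathcal A_g\times\mathcal A_h\to\mathcal A_{gh}$ for $s(g)=r(h)$ and continuous conjugate-linear involutions $\mathcal A_g\to\mathcal A_{g^{-1}}$, such that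 $(ab)^*=b^*a^*$, $a^{**}=a$, $\|ab\|\le\|a\|\|b\|$, $\|a^*a\|=\|a\|^2$, and $a^*a\ge0$ in the $\mathrm C^*$-algebra $\mathcal A_{s(g)}$ for $a\in\mathcal A_g$. Write $\mathcal A^0$ for the restriction of $\mathcal A$ to $G^0$; products of fibres such as $\mathcal A_g\mathcal A_h$ denote closed linear spans. The space $C_c(G,\mathcal A)$ of compactly supported continuous sections is a $*$-algebra with $(\xi*\eta)(g)=\int_{G^{r(g)}}\xi(h)\eta(h^{-1}g)\,d\alpha^{r(g)}(h)$ and $\xi^*(g)=\xi(g^{-1})^*$. Its $I$-norm is the larger one of $\sup_x\int\|\xi(g)\|\,d\alpha^x(g)$ and $\sup_x\int\|\xi(g)\|\,d\tilde\alpha_x(g)$, and $\mathrm C^*(G,\mathcal A)$ is the Hausdorff completion of $C_c(G,\mathcal A)$ in the largest $\mathrm C^*$-seminorm that is bounded by the $I$-norm. For a continuous map $\pi\colon Z\to Y$, a continuous family of measures $\lambda=(\lambda_y)_{y\in Y}$ on the fibres of $\pi$, and a field $\mathcal E$ of subspaces of a pull-back of $\mathcal A$ to $Z$, let $L^2(Z,\mathcal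 E,\pi,\lambda)$ be the Hilbert module that is the completion of $C_c(Z,\mathcal E)$ for the inner product $\langle f_1,f_2\rangle(y)=\int f_1(z)^*f_2(z)\,d\lambda_y(z)$. Let $G^2=\{(g,h):s(g)=r(h)\}$, $d_0(g,h)=h$, $d_1(g,h)=gh$, $d_2(g,h)=g$, and let $\lambda_0,\lambda_1,\lambda_2$ be the measure families along $d_0,d_1,d_2$ given by \[\lambda_0f(h)=\int f(g,h)\,d\tilde\alpha_{r(h)}(g),\quad \lambda_1f(k)=\int f(g,g^{-1}k)\,d\alpha^{r(k)}(g),\quad \lambda_2f(g)=\int f(g,h)\,d\alpha^{s(g)}(h).\] Let $v_0(g,h)=r(g)$, $v_1(g,h)=s(g)$, $v_2(g,h)=s(h)$, with the measure families $\mu_0=\alpha\circ\lambda_2$, $\mu_1=\tilde\alpha\circ\lambda_2$, $\mu_2=\tilde\alpha\circ\lambda_0$. Let $\mathcal E_0$, $\mathcal E_1$, $\mathcal E_2$ be the fields over $G^2$ with fibres $\mathcal I_{(g,h)}=\mathcal A_g\mathcal A_h\mathcal A_h^*\mathcal A_g^*$, $\mathcal I_{(g,h)}\mathcal A_g$ and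 $\mathcal I_{(g,h)}\mathcal A_{gh}$ at $(g,h)$. Let $\mathcal A\mathcal A^*$ be the field over $G$ with fibres $\mathcal A_g\mathcal A_g^*\subseteq\mathcal A_{r(g)}$. Then $L^2(G,\mathcal A,s,\tilde\alpha)$, $L^2(G,\mathcal A\mathcal A^*,r,\alpha)$ and $L^2(G^2,\mathcal E_i,v_i,\mu_i)$ are Hilbert modules over $C_0(G^0,\mathcal A^0)$; $L^2(G^2,\mathcal E_1,d_0,\lambda_0)$, $L^2(G^2,\mathcal E_0,d_1,\lambda_1)$ and $L^2(G^2,\mathcal E_0,d_2,\lambda_2)$ are Hilbert modules over $C_0(G,\mathcal A\mathcal A^*)$; and $C_0(G,\mathcal A\mathcal A^*)$ acts on the first two modules by pointwise multiplication. A Fell-bundle representation of $\mathcal A$ on a Hilbert $D$-module $\mathcal F$ is a pair $(\varphi,U)$ of a nondegenerate representation $\varphi$ of $C_0(G^0,\mathcal A^0)$ on $\mathcal F$ and a unitary \[U\colon L^2(G,\mathcal A,s,\tilde\alpha)\otimes_\varphi\mathcal F\to L^2(G,\mathcal A\mathcal A^*,r,\alpha)\otimes_\varphi\mathcal F\] that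 intertwines the left actions of $C_0(G,\mathcal A\mathcal A^*)$, such that $d_2^*(U)\,d_0^*(U)=d_1^*(U)$. Here \[d_0^*(U)\colon L^2(G^2,\mathcal E_2,v_2,\mu_2)\otimes_\varphi\mathcal F\to L^2(G^2,\mathcal E_1,v_1,\mu_1)\otimes_\varphi\mathcal F,\] \[d_2^*(U)\colon L^2(G^2,\mathcal E_1,v_1,\mu_1)\otimes_\varphi\mathcal F\to L^2(G^2,\mathcal E_0,v_0,\mu_0)\otimes_\varphi\mathcal F,\] \[d_1^*(U)\colon L^2(G^2,\mathcal E_2,v_2,\mu_2)\otimes_\varphi\mathcal F\to L^2(G^2,\mathcal E_0,v_0,\mu_0)\otimes_\varphi\mathcal F\] are the unitaries $\mathrm{id}\otimes U$ on $L^2(G^2,\mathcal E_1,d_0,\lambda_0)$, $L^2(G^2,\mathcal E_0,d_2,\lambda_2)$ and $L^2(G^2,\mathcal E_0,d_1,\lambda_1)$, respectively, tensored over $C_0(G,\mathcal A\mathcal A^*)$ with the domain and codomain of $U$, after identifying both sides by the canonical unitaries $y\otimes(x\otimes\xi)\mapsto w\otimes\xi$, $w(z)=y(z)\,x(d_i(z))$.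 Theorem. For all $\mathrm C^*$-algebras $D$ and Hilbert $D$-modules $\mathcal F$ there are bijections $\Phi_{D,\mathcal F}$ from the nondegenerate representations of $\mathrm C^*(G,\mathcal A)$ on $\mathcal F$ to the Fell-bundle representations of $\mathcal A$ on $\mathcal F$, such that: 1. If $V\colon\mathcal F_1\to\mathcal F_2$ is an isometry of Hilbert $D$-modules and $L_i$ is a nondegenerate representation of $\mathrm C^*(G,\mathcal A)$ on $\mathcal F_i$ for $i=1,2$, with $\Phi(L_i)=(\varphi_i,U_i)$, then $V$ intertwines $L_1$ and $L_2$ if and only if $V$ intertwines $\varphi_1$ and $\varphi_2$ and $(1\otimes V)U_1=U_2(1\otimes V)$. 2. Let $\mathcal E$ be a $\mathrm C^*$-correspondence from $D$ to a $\mathrm C^*$-algebra $D'$. A nondegenerate representation $L$ of a $\mathrm C^*$-algebra on $\mathcal F$ induces a unique nondegenerate representation $L\otimes1$ on $\mathcal F\otimes_D\mathcal E$, and a Fell-bundle representation $(\varphi,U)$ on $\mathcal F$ induces a unique Fell-bundle representation $(\varphi\otimes1,U\otimes1)$ on $\mathcal F\otimes_D\mathcal E$ (where $(X\otimes_\varphi\mathcal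 F)\otimes_D\mathcal E$ is identified with $X\otimes_{\varphi\otimes1}(\mathcal F\otimes_D\mathcal E)$ in the canonical way). If $\Phi(L)=(\varphi,U)$, then $\Phi(L\otimes1)=(\varphi\otimes1,U\otimes1)$. This characterises $\mathrm C^*(G,\mathcal A)$ up to canonical isomorphism: if $C$ is a $\mathrm C^*$-algebra with bijections $\Psi_{D,\mathcal F}$ from the nondegenerate representations of $C$ on $\mathcal F$ to the Fell-bundle representations of $\mathcal A$ on $\mathcal F$, for all $D$ and $\mathcal F$, that also satisfy 1 and the last sentence of 2, then there is a unique $*$-isomorphism $\theta\colon\mathrm C^*(G,\mathcal A)\to C$ with $\Psi(\varrho)=\Phi(\varrho\circ\theta)$ for all nondegenerate representations $\varrho$ of $C$. -/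

import Mathlib

universe u

namespace FellUniv
noncomputable section
open scoped TensorProduct Topology
open MeasureTheory Filter

section

/-! ### Hilbert modules over C*-algebras -/

section HilbertModules

/-- Positive elements of a C*-algebra. -/
def IsPos {D : Type*} [NonUnitalCStarAlgebra D] (a : D) : Prop := ∃ c : D, a = star c * c

/-- A semi-inner product (right) module over a C*-algebra `D`: the `D`-valued inner product
is `ℂ`-linear and `D`-linear in the second variable.  (Neither definiteness nor completeness
is required.) -/
class PreHilbertModule (D V : Type*) [NonUnitalCStarAlgebra D] [AddCommGroup V] [Module ℂ V] where
  inn : V → V → D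
  rsmul : V → D → V
  inn_add_right : ∀ x y z, inn x (y + z) = inn x y + inn x z
  inn_smul_right : ∀ (c : ℂ) x y, inn x (c • y) = c • inn x y
  star_inn : ∀ x y, star (inn x y) = inn y x
  inn_rsmul_right : ∀ x y d, inn x (rsmul y d) = inn x y * d
  inn_self_pos : ∀ x, IsPos (inn x x)

open PreHilbertModule (inn rsmul)

/-- A (right) Hilbert module over a C*-algebra `D`: the norm is the one induced by the
inner product, and it is complete.  (The norm being definite, the module axioms for the right
action, such as `(x · d) · e = x · (d e)`, follow from `inn_rsmul_right`.) -/
class HilbertModule (D F : Type*) [NonUnitalCStarAlgebra D] [NormedAddCommGroup F]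
    [NormedSpace ℂ F] extends PreHilbertModule D F where
  norm_sq_eq : ∀ x : F, ‖x‖ ^ 2 = ‖inn x x‖
  complete : CompleteSpace F

attribute [local instance] CStarAlgebra.spectralOrder CStarAlgebra.spectralOrderedRing

theorem isPos_iff {D : Type*} [NonUnitalCStarAlgebra D] {a : D} : IsPos a ↔ 0 ≤ a :=
  CStarAlgebra.nonneg_iff_eq_star_mul_self.symm

namespace PreHilbertModule

variable {D V : Type*} [NonUnitalCStarAlgebra D] [AddCommGroup V] [Module ℂ V]
  [PreHilbertModule D V]

theorem inn_nonneg (x : V) : 0 ≤ (inn x x : D) := isPos_iff.1 (inn_self_pos x)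

theorem inn_add_left (x y z : V) : (inn (x + y) z : D) = inn x z + inn y z := by
  rw [← star_inn, inn_add_right, star_add, star_inn, star_inn]

theorem inn_smul_left (c : ℂ) (x y : V) : (inn (c • x) y : D) = star c • inn x y := by
  rw [← star_inn, inn_smul_right, star_smul, star_inn]

theorem inn_rsmul_left (x y : V) (d : D) : (inn (rsmul x d) y : D) = star d * inn x y := by
  rw [← star_inn, inn_rsmul_right, star_mul, star_inn]

variable (D V) in
/-- The inner product as a sesquilinear map. -/
def innₗ : V →ₗ⋆[ℂ] V →ₗ[ℂ] D :=
  LinearMap.mk₂'ₛₗ (starRingEnd ℂ) (RingHom.id ℂ) (fun x y => (inn x y : D))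
    inn_add_left (fun c x y => inn_smul_left c x y) inn_add_right inn_smul_right

@[simp] theorem innₗ_apply (x y : V) : innₗ D V x y = inn x y := rfl

theorem inn_sub_left (x y z : V) : (inn (x - y) z : D) = inn x z - inn y z := by
  simp only [← innₗ_apply, map_sub, LinearMap.sub_apply]

theorem inn_sub_right (x y z : V) : (inn x (y - z) : D) = inn x y - inn x z := by
  simp only [← innₗ_apply, map_sub]

theorem inn_zero_left (z : V) : (inn 0 z : D) = 0 := by
  simp only [← innₗ_apply, map_zero, LinearMap.zero_apply]

theorem inn_zero_right (z : V) : (inn z 0 : D) = 0 := by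
  simp only [← innₗ_apply, map_zero]

theorem inn_sum_left {ι : Type*} (s : Finset ι) (f : ι → V) (z : V) :
    (inn (∑ i ∈ s, f i) z : D) = ∑ i ∈ s, inn (f i) z := by
  simp only [← innₗ_apply, map_sum, LinearMap.sum_apply]

theorem inn_sum_right {ι : Type*} (s : Finset ι) (f : ι → V) (z : V) :
    (inn z (∑ i ∈ s, f i) : D) = ∑ i ∈ s, inn z (f i) := by
  simp only [← innₗ_apply, map_sum]

/-- Cauchy-Schwarz inequality. -/
theorem norm_inn_le (x y : V) :
    ‖(inn x y : D)‖ ≤ √‖(inn x x : D)‖ * √‖(inn y y : D)‖ := by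
  have key : ∀ M : ℝ, ‖(inn x x : D)‖ < M → ‖(inn x y : D)‖ ^ 2 ≤ M * ‖(inn y y : D)‖ := by
    intro M hM
    have hM0 : 0 < M := lt_of_le_of_lt (norm_nonneg _) hM
    set a : D := inn x y with ha
    have h1 : (0 : D) ≤ inn (rsmul x a - (M : ℂ) • y) (rsmul x a - (M : ℂ) • y) := inn_nonneg _
    have h2 : (inn (rsmul x a - (M : ℂ) • y) (rsmul x a - (M : ℂ) • y) : D)
        = star a * inn x x * a - (2 * M) • (star a * a) + (M * M) • inn y y := by
      have hyx : (inn y x : D) = star a := by rw [ha, star_inn]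
      simp only [inn_sub_left, inn_sub_right, inn_rsmul_left, inn_rsmul_right, inn_smul_left,
        inn_smul_right, ← ha, hyx]
      have e1 : ∀ d : D, ((M : ℂ)) • d = M • d := fun d => Complex.coe_smul M d
      simp only [Complex.star_def, Complex.conj_ofReal, e1, sub_mul,
        smul_mul_assoc, two_mul, add_smul, mul_smul, mul_assoc, smul_sub]
      abel
    have h3 : star a * inn x x * a ≤ M • (star a * a) :=
      (CStarAlgebra.star_left_conjugate_le_norm_smul
        (hb := IsSelfAdjoint.of_nonneg (inn_nonneg x))).trans
        (smul_le_smul_of_nonneg_right hM.le (star_mul_self_nonneg a))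
    rw [h2] at h1
    have h4 : M • (star a * a) ≤ M • (M • (inn y y : D)) := by
      have h5 : star a * inn x x * a - (2 * M) • (star a * a) + (M * M) • inn y y
          ≤ M • (star a * a) - (2 * M) • (star a * a) + (M * M) • inn y y := by gcongr
      have h6 := h1.trans h5
      have h7 : M • (star a * a) - (2 * M) • (star a * a) + (M * M) • (inn y y : D)
          = M • (M • (inn y y : D)) - M • (star a * a) := by
        rw [two_mul, add_smul, mul_smul]; abel
      rw [h7] at h6
      exact sub_nonneg.1 h6
    have h5 : star a * a ≤ M • (inn y y : D) := (smul_le_smul_iff_of_pos_left hM0).1 h4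
    have h6 := CStarAlgebra.norm_le_norm_of_nonneg_of_le (star_mul_self_nonneg a) h5
    rw [CStarRing.norm_star_mul_self, norm_smul, Real.norm_of_nonneg hM0.le] at h6
    nlinarith
  have h : ‖(inn x y : D)‖ ^ 2 ≤ ‖(inn x x : D)‖ * ‖(inn y y : D)‖ := by
    refine le_of_forall_pos_le_add fun ε hε => ?_
    have hδ : 0 < ε / (‖(inn y y : D)‖ + 1) := by positivity
    refine (key (‖(inn x x : D)‖ + ε / (‖(inn y y : D)‖ + 1)) (by linarith)).trans ?_
    rw [add_mul]
    gcongr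
    rw [div_mul_eq_mul_div, div_le_iff₀ (by positivity)]
    nlinarith [norm_nonneg (inn y y : D)]
  rw [← Real.sqrt_mul (norm_nonneg _)]
  exact Real.le_sqrt_of_sq_le h

/-- The vector space `V`, equipped with the seminorm of the `D`-valued semi-inner product. -/

def Semi (D V : Type*) [NonUnitalCStarAlgebra D] [AddCommGroup V] [Module ℂ V]
    [PreHilbertModule D V] : Type _ := V

instance : AddCommGroup (Semi D V) := inferInstanceAs (AddCommGroup V)
instance : Module ℂ (Semi D V) := inferInstanceAs (Module ℂ V)
instance : PreHilbertModule D (Semi D V) := inferInstanceAs (PreHilbertModule D V)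

variable (D V) in
/-- The identity map to the seminormed space. -/
def toSemi : V ≃ₗ[ℂ] Semi D V := LinearEquiv.refl ℂ V

theorem inn_toSemi (x y : V) : (inn (toSemi D V x) (toSemi D V y) : D) = inn x y := rfl

instance : Norm (Semi D V) := ⟨fun x => √‖(inn x x : D)‖⟩

theorem norm_def (x : Semi D V) : ‖x‖ = √‖(inn x x : D)‖ := rfl

theorem semi_core : SeminormedSpace.Core ℂ (Semi D V) where
  norm_nonneg x := Real.sqrt_nonneg _
  norm_smul c x := by
    rw [norm_def, norm_def, inn_smul_left, inn_smul_right, smul_smul, norm_smul]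
    rw [Real.sqrt_mul (norm_nonneg _), norm_mul, norm_star, Real.sqrt_mul_self (norm_nonneg _)]
  norm_triangle x y := by
    have n0 : ∀ z : Semi D V, 0 ≤ ‖z‖ := fun z => Real.sqrt_nonneg _
    rw [norm_def, Real.sqrt_le_left (add_nonneg (n0 _) (n0 _))]
    rw [inn_add_left, inn_add_right, inn_add_right]
    have hx : ‖(inn x x : D)‖ = ‖x‖ ^ 2 := by rw [norm_def, Real.sq_sqrt (norm_nonneg _)]
    have hy : ‖(inn y y : D)‖ = ‖y‖ ^ 2 := by rw [norm_def, Real.sq_sqrt (norm_nonneg _)]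
    have h1 : ‖(inn x y : D)‖ ≤ ‖x‖ * ‖y‖ := norm_inn_le x y
    have h2 : ‖(inn y x : D)‖ ≤ ‖y‖ * ‖x‖ := norm_inn_le y x
    have h3 := norm_add_le ((inn x x : D) + inn x y) (inn y x + inn y y)
    have h4 := norm_add_le (inn x x : D) (inn x y)
    have h5 := norm_add_le (inn y x : D) (inn y y)
    nlinarith

instance : SeminormedAddCommGroup (Semi D V) := SeminormedAddCommGroup.ofCore semi_core
instance : NormedSpace ℂ (Semi D V) where
  norm_smul_le c x := (semi_core.norm_smul c x).le

theorem continuous_inn_semi : Continuous fun p : Semi D V × Semi D V => (inn p.1 p.2 : D) := by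
  have h := (LinearMap.mkContinuous₂ (innₗ D (Semi D V)) 1 (fun x y => by
    rw [one_mul]; exact norm_inn_le x y))
  have h2 : Continuous fun p : Semi D V × Semi D V =>
      (LinearMap.mkContinuous₂ (innₗ D (Semi D V)) 1 (fun x y => by
        rw [one_mul]; exact norm_inn_le x y)) p.1 p.2 := by fun_prop
  exact h2

end PreHilbertModule

open PreHilbertModule UniformSpace

/-- The Hilbert module obtained from a semi-inner product module by (Hausdorff) completion. -/
def HilbertCompletion (D V : Type*) [NonUnitalCStarAlgebra D] [AddCommGroup V] [Module ℂ V]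
    [PreHilbertModule D V] : Type _ := Completion (Semi D V)

namespace HilbertCompletion

variable {D V : Type*} [NonUnitalCStarAlgebra D] [AddCommGroup V] [Module ℂ V]
  [PreHilbertModule D V]

instance : NormedAddCommGroup (HilbertCompletion D V) :=
  inferInstanceAs (NormedAddCommGroup (Completion (Semi D V)))
instance : NormedSpace ℂ (HilbertCompletion D V) :=
  inferInstanceAs (NormedSpace ℂ (Completion (Semi D V)))
instance : CompleteSpace (HilbertCompletion D V) :=
  inferInstanceAs (CompleteSpace (Completion (Semi D V)))

variable (D V) in
/-- The canonical map to the completion. -/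
def of : V →ₗ[ℂ] HilbertCompletion D V :=
  (Completion.toComplL (𝕜 := ℂ) (E := Semi D V)).toLinearMap ∘ₗ (toSemi D V).toLinearMap

theorem of_eq_coe (x : V) : of D V x = (toSemi D V x : Completion (Semi D V)) := rfl

theorem norm_of (x : V) : ‖of D V x‖ = √‖(inn x x : D)‖ :=
  Completion.norm_coe (E := Semi D V) (toSemi D V x)

theorem denseRange_of : DenseRange (of D V) := Completion.denseRange_coe (α := Semi D V)

@[elab_as_elim]
theorem induction_on {p : HilbertCompletion D V → Prop} (x : HilbertCompletion D V)
    (hp : IsClosed {x | p x}) (h : ∀ v, p (of D V v)) : p x :=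
  Completion.induction_on (α := Semi D V) x hp h

@[elab_as_elim]
theorem induction_on₂ {W : Type*} [AddCommGroup W] [Module ℂ W] [PreHilbertModule D W]
    {p : HilbertCompletion D V → HilbertCompletion D W → Prop}
    (x : HilbertCompletion D V) (y : HilbertCompletion D W)
    (hp : IsClosed {x : HilbertCompletion D V × HilbertCompletion D W | p x.1 x.2})
    (h : ∀ v w, p (of D V v) (of D W w)) : p x y :=
  Completion.induction_on₂ (α := Semi D V) (β := Semi D W) x y hp h

@[elab_as_elim]
theorem induction_on₃ {p : HilbertCompletion D V → HilbertCompletion D V →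
      HilbertCompletion D V → Prop} (x y z : HilbertCompletion D V)
    (hp : IsClosed {x : HilbertCompletion D V × HilbertCompletion D V × HilbertCompletion D V |
      p x.1 x.2.1 x.2.2}) (h : ∀ u v w, p (of D V u) (of D V v) (of D V w)) : p x y z :=
  Completion.induction_on₃ (α := Semi D V) (β := Semi D V) (γ := Semi D V) x y z hp h

/-- The extension of the inner product to the completion. -/
def innC (x y : HilbertCompletion D V) : D :=
  (Completion.isDenseInducing_coe (α := Semi D V) |>.prodMap
    (Completion.isDenseInducing_coe (α := Semi D V))).extend
      (fun p : Semi D V × Semi D V => (inn p.1 p.2 : D)) (x, y)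

theorem innC_of (x y : V) : innC (of D V x) (of D V y) = (inn x y : D) :=
  (Completion.isDenseInducing_coe (α := Semi D V) |>.prodMap
    (Completion.isDenseInducing_coe (α := Semi D V))).extend_eq continuous_inn_semi (x, y)

theorem continuous_innC :
    Continuous fun p : HilbertCompletion D V × HilbertCompletion D V => (innC p.1 p.2 : D) := by
  let inner' : Semi D V →+ Semi D V →+ D :=
    { toFun := fun x => (innₗ D (Semi D V) x).toAddMonoidHom
      map_zero' := by ext x; exact inn_zero_left _
      map_add' := fun x y => by ext z; exact inn_add_left _ _ _ }
  have : Continuous fun p : Semi D V × Semi D V => inner' p.1 p.2 := continuous_inn_semi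
  exact (Completion.isDenseInducing_toCompl (Semi D V)).extend_Z_bilin
    (Completion.isDenseInducing_toCompl (Semi D V)) this

theorem norm_rsmul_semi (x : Semi D V) (d : D) : ‖(rsmul x d : Semi D V)‖ ≤ ‖d‖ * ‖x‖ := by
  rw [norm_def, norm_def, inn_rsmul_left, inn_rsmul_right, ← mul_assoc]
  rw [Real.sqrt_le_left (by positivity), mul_pow, Real.sq_sqrt (norm_nonneg _)]
  calc _ ≤ ‖star d‖ * ‖(inn x x : D)‖ * ‖d‖ :=
        (norm_mul_le _ _).trans (mul_le_mul_of_nonneg_right (norm_mul_le _ _) (norm_nonneg _))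
    _ = _ := by rw [norm_star]; ring

theorem of_eq_zero {x : V} (h : ∀ z : V, (inn z x : D) = 0) : of D V x = 0 := by
  rw [← norm_eq_zero, norm_of, h, norm_zero, Real.sqrt_zero]

theorem of_eq_of {x y : V} (h : ∀ z : V, (inn z x : D) = inn z y) : of D V x = of D V y := by
  rw [← sub_eq_zero, ← map_sub]
  exact of_eq_zero fun z => by
    rw [inn_sub_right]; exact sub_eq_zero.2 (h z)

/-- The right multiplication by `d`, as a map into the completion. -/
def rsmulLin (d : D) : V →ₗ[ℂ] HilbertCompletion D V where
  toFun x := of D V (rsmul x d)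
  map_add' x y := by
    rw [← map_add]
    exact of_eq_of fun z => by rw [inn_add_right, inn_rsmul_right, inn_rsmul_right,
      inn_rsmul_right, ← add_mul, inn_add_right]
  map_smul' c x := by
    rw [RingHom.id_apply, ← map_smul]
    exact of_eq_of fun z => by rw [inn_smul_right, inn_rsmul_right, inn_rsmul_right,
      inn_smul_right, smul_mul_assoc]

theorem norm_rsmulLin (x : V) (d : D) :
    ‖rsmulLin d x‖ ≤ ‖d‖ * √‖(inn x x : D)‖ :=
  (norm_of _).le.trans (norm_rsmul_semi (toSemi D V x) d)

/-- The extension of a bounded linear map to the completion. -/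
def extend {W : Type*} [NormedAddCommGroup W] [NormedSpace ℂ W] [CompleteSpace W]
    (f : V →ₗ[ℂ] W) (c : ℝ) (hf : ∀ x, ‖f x‖ ≤ c * √‖(inn x x : D)‖) :
    HilbertCompletion D V →L[ℂ] W :=
  (LinearMap.mkContinuous (f ∘ₗ (toSemi D V).symm.toLinearMap) c fun x => hf _).fromCompletion

theorem extend_of {W : Type*} [NormedAddCommGroup W] [NormedSpace ℂ W] [CompleteSpace W]
    (f : V →ₗ[ℂ] W) (c : ℝ) (hf : ∀ x, ‖f x‖ ≤ c * √‖(inn x x : D)‖) (x : V) :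
    extend f c hf (of D V x) = f x :=
  ContinuousLinearMap.fromCompletion_apply_coe
    (LinearMap.mkContinuous (f ∘ₗ (toSemi D V).symm.toLinearMap) c fun x => hf _) (toSemi D V x)

/-- The extension of the right multiplication to the completion. -/
def rsmulC (x : HilbertCompletion D V) (d : D) : HilbertCompletion D V :=
  extend (rsmulLin d) ‖d‖ (fun _ => norm_rsmulLin _ d) x

theorem rsmulC_of (x : V) (d : D) : rsmulC (of D V x) d = of D V (rsmul x d) :=
  extend_of (rsmulLin d) ‖d‖ (fun _ => norm_rsmulLin _ d) x

theorem continuous_rsmulC (d : D) : Continuous fun x : HilbertCompletion D V => rsmulC x d :=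
  (extend (rsmulLin d) ‖d‖ (fun _ => norm_rsmulLin _ d)).continuous

instance : PreHilbertModule D (HilbertCompletion D V) where
  inn := innC
  rsmul := rsmulC
  inn_add_right x y z := by
    refine induction_on₃ x y z ?_ ?_
    · exact isClosed_eq (continuous_innC.comp (continuous_fst.prodMk
        ((continuous_fst.comp continuous_snd).add (continuous_snd.comp continuous_snd))))
        ((continuous_innC.comp (continuous_fst.prodMk (continuous_fst.comp continuous_snd))).add
          (continuous_innC.comp (continuous_fst.prodMk (continuous_snd.comp continuous_snd))))
    · intro a b c
      rw [← map_add, innC_of, innC_of, innC_of, inn_add_right]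
  inn_smul_right c x y := by
    refine induction_on₂ x y ?_ ?_
    · exact isClosed_eq (continuous_innC.comp (continuous_fst.prodMk
        (continuous_snd.const_smul c))) (continuous_innC.const_smul c)
    · intro a b
      rw [← map_smul, innC_of, innC_of, inn_smul_right]
  star_inn x y := by
    refine induction_on₂ x y ?_ ?_
    · exact isClosed_eq continuous_innC.star (continuous_innC.comp continuous_swap)
    · intro a b
      rw [innC_of, innC_of, star_inn]
  inn_rsmul_right x y d := by
    refine induction_on₂ x y ?_ ?_
    · exact isClosed_eq (continuous_innC.comp (continuous_fst.prodMk
        ((continuous_rsmulC d).comp continuous_snd))) (continuous_innC.mul continuous_const)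
    · intro a b
      rw [rsmulC_of, innC_of, innC_of, inn_rsmul_right]
  inn_self_pos x := by
    rw [isPos_iff]
    refine induction_on x ?_ ?_
    · exact isClosed_le continuous_const
        (continuous_innC.comp (continuous_id.prodMk continuous_id))
    · intro a
      rw [innC_of]; exact inn_nonneg a

theorem inn_of (x y : V) : (inn (of D V x) (of D V y) : D) = inn x y := innC_of x y

instance : HilbertModule D (HilbertCompletion D V) where
  norm_sq_eq x := by
    refine induction_on x ?_ ?_
    · exact isClosed_eq (continuous_norm.pow 2)
        (continuous_innC.comp (continuous_id.prodMk continuous_id)).norm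
    · intro a
      rw [inn_of]
      rw [norm_of, Real.sq_sqrt (norm_nonneg _)]
  complete := inferInstance

end HilbertCompletion

end HilbertModules

end

section

section Tensor

open PreHilbertModule

attribute [local instance] CStarAlgebra.spectralOrder CStarAlgebra.spectralOrderedRing

/-- Vectors in a Hilbert module are determined by their inner products. -/
theorem HilbertModule.ext_inn {D F : Type*} [NonUnitalCStarAlgebra D]
    [NormedAddCommGroup F] [NormedSpace ℂ F] [HilbertModule D F] {x y : F}
    (h : ∀ z : F, (inn z x : D) = inn z y) : x = y := by
  rw [← sub_eq_zero, ← norm_eq_zero, ← sq_eq_zero_iff, HilbertModule.norm_sq_eq (D := D),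
    inn_sub_right, h, sub_self, norm_zero]

/-- Right multiplication on a Hilbert module as a linear map. -/
def HilbertModule.rsmulₗ {D : Type*} (F : Type*) [NonUnitalCStarAlgebra D]
    [NormedAddCommGroup F] [NormedSpace ℂ F] [HilbertModule D F] (d : D) : F →ₗ[ℂ] F where
  toFun x := rsmul x d
  map_add' x y := HilbertModule.ext_inn (D := D) fun z => by
    simp only [inn_add_right, inn_rsmul_right, add_mul]
  map_smul' c x := HilbertModule.ext_inn (D := D) fun z => by
    simp only [inn_smul_right, inn_rsmul_right, smul_mul_assoc, RingHom.id_apply]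

/-- A criterion for positivity. -/
theorem isPos_of_forall {M : Type*} [NonUnitalCStarAlgebra M] {T : M} (hT : IsSelfAdjoint T)
    (h : ∀ N R : M, IsSelfAdjoint N → N * T * N = -(star R * R) → R = 0) : IsPos T := by
  have hN : IsSelfAdjoint (T⁻) := .of_nonneg (CFC.negPart_nonneg T)
  obtain ⟨R, hR⟩ := isPos_iff.2 (CFC.negPart_nonneg T)
  have h1 : T⁻ * T * T⁻ = -(star (R * T⁻) * (R * T⁻)) := by
    have h2 : T⁻ * T = - (T⁻ * T⁻) := by
      calc T⁻ * T = T⁻ * (T⁺ - T⁻) := by rw [CFC.posPart_sub_negPart T hT]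
        _ = _ := by rw [mul_sub, CFC.negPart_mul_posPart, zero_sub]
    rw [h2, star_mul, hN.star_eq, mul_assoc, ← mul_assoc (star R), ← hR, neg_mul, mul_assoc]
  have h3 : T⁻ * T⁻ = 0 := by
    nth_rewrite 1 [hR]
    rw [mul_assoc, h _ _ hN h1, mul_zero]
  have h4 : T⁻ = 0 := by
    rw [← CStarRing.star_mul_self_eq_zero_iff, hN.star_eq, h3]
  rw [isPos_iff, ← CFC.posPart_sub_negPart T hT, h4, sub_zero]
  exact CFC.posPart_nonneg T

/-- The Gram matrix of finitely many vectors in a semi-inner product module is positive. -/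
theorem exists_gram {B X : Type*} [NonUnitalCStarAlgebra B] [AddCommGroup X] [Module ℂ X]
    [PreHilbertModule B X] {n : ℕ} (x : Fin n → X) :
    ∃ S : Fin n → Fin n → B, ∀ i j, (inn (x i) (x j) : B) = ∑ k, star (S k i) * S k j := by
  let T : CStarMatrix (Fin n) (Fin n) B := CStarMatrix.ofMatrix fun i j => inn (x i) (x j)
  have hTa : ∀ i j, T i j = inn (x i) (x j) := fun i j => rfl
  have hT : IsSelfAdjoint T := by
    ext i j
    rw [CStarMatrix.star_apply, hTa, hTa, star_inn]
  have : IsPos T := by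
    refine isPos_of_forall hT fun N R hN h => ?_
    have hpos : ∀ i, ∑ k, star (R k i) * R k i ≤ 0 := fun i => by
      have h1 : (N * T * N) i i = (inn (∑ l, rsmul (x l) (N l i)) (∑ l, rsmul (x l) (N l i)) : B) := by
        simp only [inn_sum_left, inn_sum_right, inn_rsmul_left, inn_rsmul_right]
        simp only [CStarMatrix.mul_apply, Finset.sum_mul, hTa, mul_assoc]
        refine Finset.sum_congr rfl fun k _ => Finset.sum_congr rfl fun l _ => ?_
        rw [← CStarMatrix.star_apply_of_isSelfAdjoint hN]
      have h2 : (star R * R) i i = ∑ k, star (R k i) * R k i := by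
        simp only [CStarMatrix.mul_apply, CStarMatrix.star_apply]
      have h3 : (N * T * N) i i = -∑ k, star (R k i) * R k i := by
        rw [h, ← h2]; rfl
      rw [← neg_nonneg, ← h3, h1]
      exact inn_nonneg _
    ext k i
    have h4 := (Finset.sum_eq_zero_iff_of_nonneg (fun k _ => star_mul_self_nonneg (R k i))).1
      (le_antisymm (hpos i) (Finset.sum_nonneg fun k _ => star_mul_self_nonneg (R k i))) k
        (Finset.mem_univ k)
    exact (CStarRing.star_mul_self_eq_zero_iff _).1 h4
  obtain ⟨S, hS⟩ := this
  refine ⟨fun k i => S k i, fun i j => ?_⟩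
  rw [← hTa, hS]
  simp only [CStarMatrix.mul_apply, CStarMatrix.star_apply]

/-- A `*`-representation of a C*-algebra `C` by adjointable operators on a (semi-)inner
product module `V`.  If `V` is a Hilbert module, then this is the same as a `*`-homomorphism from
`C` to the C*-algebra of adjointable operators on `V`: the relation `adj` says that `act c` is
adjointable with adjoint `act (star c)`, and it implies that `act c` is bounded and
`D`-linear. -/
@[ext]
structure LeftAction (C D V : Type*) [NonUnitalCStarAlgebra C] [NonUnitalCStarAlgebra D]
    [AddCommGroup V] [Module ℂ V] [PreHilbertModule D V] where
  act : C →ₗ[ℂ] V →ₗ[ℂ] V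
  act_mul : ∀ c d v, act (c * d) v = act c (act d v)
  adj : ∀ c v w, (inn (act c v) w : D) = inn v (act (star c) w)

namespace LeftAction
section

variable {C D V : Type*} [NonUnitalCStarAlgebra C] [NonUnitalCStarAlgebra D]
    [AddCommGroup V] [Module ℂ V] [PreHilbertModule D V] (φ : LeftAction C D V)

theorem inn_act_le_of_norm_le_one {c : C} (hc : ‖c‖ ≤ 1) (v : V) :
    (inn (φ.act c v) (φ.act c v) : D) ≤ inn v v := by
  set T : C := star c * c
  have hT : 0 ≤ T := star_mul_self_nonneg c
  have hTs : IsSelfAdjoint T := .of_nonneg hT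
  have hT1 : ‖T‖ ≤ 1 := by
    rw [CStarRing.norm_star_mul_self]; nlinarith [norm_nonneg c]
  let f : ℝ → ℝ := fun x => 1 - √(1 - x)
  have hf : Continuous f := by fun_prop
  have hf0 : f 0 = 0 := by simp [f]
  set b : C := cfcₙ f T
  have hb : IsSelfAdjoint b := cfcₙ_predicate f T
  have hbT : T = (2 : ℝ) • b - b * b := by
    rw [← cfcₙ_mul f f T hf.continuousOn hf0 hf.continuousOn hf0,
      ← cfcₙ_smul (2 : ℝ) f T hf.continuousOn hf0,
      ← cfcₙ_sub _ _ T (by fun_prop) (by simp [hf0]) (by fun_prop) (by simp [hf0])]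
    conv_lhs => rw [← cfcₙ_id ℝ T]
    refine cfcₙ_congr fun x hx => ?_
    have hx1 : x ≤ 1 := ((le_abs_self x).trans
      (NonUnitalIsometricContinuousFunctionalCalculus.norm_quasispectrum_le T hx hTs)).trans hT1
    have := Real.mul_self_sqrt (sub_nonneg.2 hx1)
    simp only [id, f, smul_eq_mul]
    nlinarith
  have key : (inn v v : D) - inn (φ.act c v) (φ.act c v)
      = inn (v - φ.act b v) (v - φ.act b v) := by
    have h2 : (2 : ℝ) • b = b + b := two_smul ℝ b
    rw [φ.adj c, ← φ.act_mul, show star c * c = T from rfl, hbT, h2]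
    simp only [inn_sub_left, inn_sub_right, map_sub, map_add, LinearMap.sub_apply,
      LinearMap.add_apply, inn_add_right, φ.act_mul, φ.adj b, hb.star_eq]
    abel
  rw [← sub_nonneg, key]
  exact inn_nonneg _

theorem norm_inn_act_le (c : C) (v : V) :
    √‖(inn (φ.act c v) (φ.act c v) : D)‖ ≤ ‖c‖ * √‖(inn v v : D)‖ := by
  rcases eq_or_ne c 0 with rfl | hc
  · simp [inn_zero_left]
  have hn : 0 < ‖c‖ := norm_pos_iff.2 hc
  set d : C := ((‖c‖⁻¹ : ℝ) : ℂ) • c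
  have hd : ‖d‖ ≤ 1 := by
    simp only [d, norm_smul, Complex.norm_real, norm_inv, norm_norm]
    rw [inv_mul_cancel₀ hn.ne']
  have hcd : c = ((‖c‖ : ℝ) : ℂ) • d := by
    simp only [d, smul_smul, ← Complex.ofReal_mul, mul_inv_cancel₀ hn.ne', Complex.ofReal_one,
      one_smul]
  have h1 := CStarAlgebra.norm_le_norm_of_nonneg_of_le (inn_nonneg (D := D) (φ.act d v))
    (φ.inn_act_le_of_norm_le_one hd v)
  have h2 : ‖(inn (φ.act c v) (φ.act c v) : D)‖
      = ‖c‖ ^ 2 * ‖(inn (φ.act d v) (φ.act d v) : D)‖ := by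
    conv_lhs => rw [hcd]
    simp only [map_smul, LinearMap.smul_apply, inn_smul_left, inn_smul_right, smul_smul, norm_smul,
      norm_mul, norm_star, Complex.norm_real, norm_norm]
    ring
  rw [h2, Real.sqrt_mul (by positivity), Real.sqrt_sq hn.le]
  gcongr

/-- The extension of a single operator to the completion. -/
def actC (c : C) : HilbertCompletion D V →L[ℂ] HilbertCompletion D V :=
  HilbertCompletion.extend (HilbertCompletion.of D V ∘ₗ φ.act c) ‖c‖
    (fun v => (HilbertCompletion.norm_of _).le.trans (φ.norm_inn_act_le c v))

theorem actC_of (c : C) (v : V) :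
    φ.actC c (HilbertCompletion.of D V v) = HilbertCompletion.of D V (φ.act c v) :=
  HilbertCompletion.extend_of _ _ _ v

/-- The extension of a representation to the completion. -/
def completion : LeftAction C D (HilbertCompletion D V) where
  act :=
    { toFun := fun c => (φ.actC c).toLinearMap
      map_add' := fun c d => by
        ext v
        change φ.actC (c + d) v = φ.actC c v + φ.actC d v
        refine HilbertCompletion.induction_on v ?_ ?_
        · exact isClosed_eq (φ.actC (c + d)).continuous
            ((φ.actC c).continuous.add (φ.actC d).continuous)
        · intro v
          rw [actC_of, actC_of, actC_of, map_add, LinearMap.add_apply, map_add]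
      map_smul' := fun c d => by
        ext v
        change φ.actC (c • d) v = c • φ.actC d v
        refine HilbertCompletion.induction_on v ?_ ?_
        · exact isClosed_eq (φ.actC (c • d)).continuous ((φ.actC d).continuous.const_smul c)
        · intro v
          rw [actC_of, actC_of, map_smul, LinearMap.smul_apply, map_smul] }
  act_mul c d v := by
    change φ.actC (c * d) v = φ.actC c (φ.actC d v)
    refine HilbertCompletion.induction_on v ?_ ?_
    · exact isClosed_eq (φ.actC (c * d)).continuous
        ((φ.actC c).continuous.comp (φ.actC d).continuous)
    · intro v
      rw [actC_of, actC_of, actC_of, φ.act_mul]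
  adj c v w := by
    change inn (φ.actC c v) w = inn v (φ.actC (star c) w)
    refine HilbertCompletion.induction_on₂ v w ?_ ?_
    · exact isClosed_eq
        (HilbertCompletion.continuous_innC.comp
          (((φ.actC c).continuous.comp continuous_fst).prodMk continuous_snd))
        (HilbertCompletion.continuous_innC.comp
          (continuous_fst.prodMk ((φ.actC (star c)).continuous.comp continuous_snd)))
    · intro v w
      rw [actC_of, actC_of, HilbertCompletion.inn_of, HilbertCompletion.inn_of, φ.adj]

theorem completion_act_of (c : C) (v : V) :
    φ.completion.act c (HilbertCompletion.of D V v) = HilbertCompletion.of D V (φ.act c v) :=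
  φ.actC_of c v

/-- Composition of a representation with a `*`-homomorphism. -/
def comp {C' : Type*} [NonUnitalCStarAlgebra C'] (θ : C' →⋆ₙₐ[ℂ] C) : LeftAction C' D V where
  act := φ.act ∘ₗ (θ : C' →ₗ[ℂ] C)
  act_mul c d v := by simp [φ.act_mul]
  adj c v w := by simp [φ.adj, map_star]

/-- A representation on a Hilbert module `V` is nondegenerate if the vectors `c · v`
span a dense subspace. -/
def IsNondegenerate {C D F : Type*} [NonUnitalCStarAlgebra C] [NonUnitalCStarAlgebra D]
    [NormedAddCommGroup F] [NormedSpace ℂ F] [PreHilbertModule D F] (φ : LeftAction C D F) : Prop :=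
  (Submodule.span ℂ (Set.range fun p : C × F => φ.act p.1 p.2)).topologicalClosure = ⊤

end
end LeftAction

/-! #### Interior tensor products -/

namespace LeftAction

variable {B X : Type*} [NonUnitalCStarAlgebra B] [AddCommGroup X] [Module ℂ X]
    [PreHilbertModule B X] {D F : Type*} [NonUnitalCStarAlgebra D]
    [NormedAddCommGroup F] [NormedSpace ℂ F] [HilbertModule D F] (φ : LeftAction B D F)

/-- The algebraic tensor product `X ⊗ F`, to be equipped with the semi-inner product
`⟨x ⊗ ξ, y ⊗ η⟩ = ⟨ξ, φ(⟨x,y⟩) η⟩`. -/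
def AlgTensor (_φ : LeftAction B D F) (X : Type*) [AddCommGroup X] [Module ℂ X]
    [PreHilbertModule B X] : Type _ := X ⊗[ℂ] F

instance : AddCommGroup (φ.AlgTensor X) := inferInstanceAs (AddCommGroup (X ⊗[ℂ] F))
instance : Module ℂ (φ.AlgTensor X) := inferInstanceAs (Module ℂ (X ⊗[ℂ] F))

/-- The elementary tensors. -/
def tmul : X →ₗ[ℂ] F →ₗ[ℂ] φ.AlgTensor X := TensorProduct.mk ℂ X F

@[elab_as_elim]
theorem algTensor_induction {p : φ.AlgTensor X → Prop} (t : φ.AlgTensor X) (zero : p 0)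
    (tmul : ∀ x v, p (φ.tmul x v)) (add : ∀ s t, p s → p t → p (s + t)) : p t :=
  TensorProduct.induction_on t zero tmul add

/-- The linear map on the algebraic tensor product induced by a bilinear map. -/
def lift {P : Type*} [AddCommGroup P] [Module ℂ P] (f : X →ₗ[ℂ] F →ₗ[ℂ] P) :
    φ.AlgTensor X →ₗ[ℂ] P := TensorProduct.lift f

theorem lift_tmul {P : Type*} [AddCommGroup P] [Module ℂ P] (f : X →ₗ[ℂ] F →ₗ[ℂ] P) (x : X)
    (v : F) : φ.lift f (φ.tmul x v) = f x v := rfl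

/-- The semi-inner product on the algebraic tensor product. -/
def tensorInn : φ.AlgTensor X →ₗ⋆[ℂ] φ.AlgTensor X →ₗ[ℂ] D :=
  TensorProduct.lift (LinearMap.mk₂'ₛₗ (starRingEnd ℂ) (starRingEnd ℂ)
    (fun x v => φ.lift ((φ.act.compr₂ (innₗ D F v)) ∘ₗ innₗ B X x))
    (fun x x' v => by
      refine TensorProduct.ext' fun y w => ?_
      change innₗ D F v (φ.act (innₗ B X (x + x') y) w)
        = innₗ D F v (φ.act (innₗ B X x y) w) + innₗ D F v (φ.act (innₗ B X x' y) w)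
      simp only [map_add, LinearMap.add_apply])
    (fun c x v => by
      refine TensorProduct.ext' fun y w => ?_
      change innₗ D F v (φ.act (innₗ B X (c • x) y) w)
        = star c • innₗ D F v (φ.act (innₗ B X x y) w)
      simp)
    (fun x v v' => by
      refine TensorProduct.ext' fun y w => ?_
      change innₗ D F (v + v') (φ.act (innₗ B X x y) w)
        = innₗ D F v (φ.act (innₗ B X x y) w) + innₗ D F v' (φ.act (innₗ B X x y) w)
      simp only [map_add, LinearMap.add_apply])
    (fun c x v => by
      refine TensorProduct.ext' fun y w => ?_
      change innₗ D F (c • v) (φ.act (innₗ B X x y) w)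
        = star c • innₗ D F v (φ.act (innₗ B X x y) w)
      simp))

theorem tensorInn_tmul (x y : X) (v w : F) :
    φ.tensorInn (φ.tmul x v) (φ.tmul y w) = inn v (φ.act (inn x y) w) := rfl

theorem star_tensorInn (s t : φ.AlgTensor X) : star (φ.tensorInn s t) = φ.tensorInn t s := by
  refine φ.algTensor_induction s (by simp) (fun x v => ?_) fun s s' h h' => ?_
  · refine φ.algTensor_induction t (by simp) (fun y w => ?_) fun s s' h h' => ?_
    · rw [tensorInn_tmul, tensorInn_tmul, star_inn, φ.adj, star_inn]
    · rw [map_add, star_add, h, h', map_add, LinearMap.add_apply]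
  · rw [map_add, LinearMap.add_apply, star_add, h, h', map_add]

theorem algTensor_eq_sum (t : φ.AlgTensor X) :
    ∃ (n : ℕ) (x : Fin n → X) (v : Fin n → F), t = ∑ i, φ.tmul (x i) (v i) := by
  refine φ.algTensor_induction t ⟨0, 0, 0, by simp⟩
    (fun x v => ⟨1, fun _ => x, fun _ => v, by simp⟩) ?_
  rintro s t ⟨n, x, v, rfl⟩ ⟨m, y, w, rfl⟩
  refine ⟨n + m, Fin.append x y, Fin.append v w, ?_⟩
  rw [Fin.sum_univ_add]
  simp

theorem tensorInn_self_nonneg (t : φ.AlgTensor X) : 0 ≤ φ.tensorInn t t := by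
  obtain ⟨n, x, v, rfl⟩ := φ.algTensor_eq_sum t
  obtain ⟨S, hS⟩ := exists_gram (B := B) x
  have h : φ.tensorInn (∑ i, φ.tmul (x i) (v i)) (∑ i, φ.tmul (x i) (v i))
      = ∑ k, inn (∑ i, φ.act (S k i) (v i)) (∑ i, φ.act (S k i) (v i)) := by
    have h1 : ∀ i j, φ.tensorInn (φ.tmul (x i) (v i)) (φ.tmul (x j) (v j))
        = ∑ k, inn (φ.act (S k i) (v i)) (φ.act (S k j) (v j)) := fun i j => by
      simp only [tensorInn_tmul, hS, map_sum, LinearMap.sum_apply, inn_sum_right, φ.adj, φ.act_mul]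
    simp only [map_sum, LinearMap.sum_apply, h1, inn_sum_left, inn_sum_right]
    conv_rhs => rw [Finset.sum_comm]
    refine Finset.sum_congr rfl fun i _ => ?_
    conv_rhs => rw [Finset.sum_comm]
  rw [h]
  exact Finset.sum_nonneg fun k _ => inn_nonneg _

instance : PreHilbertModule D (φ.AlgTensor X) where
  inn s t := φ.tensorInn s t
  rsmul t d := φ.lift (φ.tmul.compl₂ (HilbertModule.rsmulₗ F d)) t
  inn_add_right s t t' := map_add _ _ _
  inn_smul_right c s t := map_smul _ _ _
  star_inn := φ.star_tensorInn
  inn_rsmul_right s t d := by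
    refine φ.algTensor_induction t (by simp) (fun y w => ?_) fun t t' h h' => ?_
    · refine φ.algTensor_induction s (by simp) (fun x v => ?_) fun s s' h h' => ?_
      · rw [lift_tmul, tensorInn_tmul]
        change φ.tensorInn (φ.tmul x v) (φ.tmul y (rsmul w d)) = _
        have := φ.adj (star (inn x y)) v (rsmul w d)
        rw [star_star] at this
        rw [tensorInn_tmul, ← this, inn_rsmul_right, φ.adj, star_star]
      · rw [map_add, LinearMap.add_apply, LinearMap.add_apply, h, h', add_mul]
    · rw [map_add, map_add, h, h', map_add, add_mul]
  inn_self_pos t := isPos_iff.2 (φ.tensorInn_self_nonneg t)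

theorem inn_tmul (x y : X) (v w : F) :
    (inn (φ.tmul x v) (φ.tmul y w) : D) = inn v (φ.act (inn x y) w) := rfl

variable (X) in
/-- The interior tensor product `X ⊗_φ F`, a Hilbert `D`-module. -/
abbrev Tensor : Type _ := HilbertCompletion D (φ.AlgTensor X)

/-- The elementary tensor `x ⊗ v` in `X ⊗_φ F`. -/
def tens (x : X) (v : F) : φ.Tensor X := HilbertCompletion.of D (φ.AlgTensor X) (φ.tmul x v)

/-- A left action on `X` induces one on `X ⊗_φ F`. -/
def leftTensor {C : Type*} [NonUnitalCStarAlgebra C] (ψ : LeftAction C B X) :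
    LeftAction C D (φ.Tensor X) :=
  LeftAction.completion (V := φ.AlgTensor X)
    { act :=
        { toFun := fun c => φ.lift (φ.tmul ∘ₗ ψ.act c)
          map_add' := fun c d => by
            refine TensorProduct.ext' fun x v => ?_
            change φ.tmul (ψ.act (c + d) x) v = φ.tmul (ψ.act c x) v + φ.tmul (ψ.act d x) v
            simp
          map_smul' := fun c d => by
            refine TensorProduct.ext' fun x v => ?_
            change φ.tmul (ψ.act (c • d) x) v = c • φ.tmul (ψ.act d x) v
            simp }
      act_mul := fun c d t => by
        change φ.lift (φ.tmul ∘ₗ ψ.act (c * d)) t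
          = φ.lift (φ.tmul ∘ₗ ψ.act c) (φ.lift (φ.tmul ∘ₗ ψ.act d) t)
        refine φ.algTensor_induction t (by simp) (fun y w => ?_) fun t t' h h' => ?_
        · simp only [lift_tmul, LinearMap.comp_apply, ψ.act_mul]
        · simp only [map_add, h, h']
      adj := fun c s t => by
        change inn (φ.lift (φ.tmul ∘ₗ ψ.act c) s) t = inn s (φ.lift (φ.tmul ∘ₗ ψ.act (star c)) t)
        refine φ.algTensor_induction t (by simp [inn_zero_right]) (fun y w => ?_)
          fun t t' h h' => ?_
        · refine φ.algTensor_induction s (by simp [inn_zero_left]) (fun x v => ?_)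
            fun s s' h h' => ?_
          · simp only [lift_tmul, LinearMap.comp_apply, inn_tmul, ψ.adj]
          · simp only [map_add, inn_add_left, h, h']
        · simp only [map_add, inn_add_right, h, h'] }

end LeftAction

namespace HilbertCompletion

variable {D V W : Type*} [NonUnitalCStarAlgebra D] [AddCommGroup V] [Module ℂ V]
  [PreHilbertModule D V] [AddCommGroup W] [Module ℂ W] [PreHilbertModule D W]

/-- The map of completions induced by a map that preserves the inner products. -/
def map (f : V →ₗ[ℂ] W) (hf : ∀ x y, (inn (f x) (f y) : D) = inn x y) :
    HilbertCompletion D V →L[ℂ] HilbertCompletion D W :=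
  extend (of D W ∘ₗ f) 1 fun x => by rw [LinearMap.comp_apply, norm_of, hf, one_mul]

end HilbertCompletion

namespace LeftAction

variable {B X Y : Type*} [NonUnitalCStarAlgebra B] [AddCommGroup X] [Module ℂ X]
    [PreHilbertModule B X] [AddCommGroup Y] [Module ℂ Y]
    [PreHilbertModule B Y] {D F F' : Type*} [NonUnitalCStarAlgebra D]
    [NormedAddCommGroup F] [NormedSpace ℂ F] [HilbertModule D F]
    [NormedAddCommGroup F'] [NormedSpace ℂ F'] [HilbertModule D F']

variable (X) in
/-- The map `1 ⊗ T : X ⊗_φ F → X ⊗_φ' F'` for an isometric intertwiner `T` of `φ`, `φ'`. -/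
def mapRight (φ : LeftAction B D F) (φ' : LeftAction B D F') (T : F →ₗ[ℂ] F')
    (hT : ∀ x y, (inn (T x) (T y) : D) = inn x y) (h : ∀ b v, T (φ.act b v) = φ'.act b (T v)) :
    φ.Tensor X →L[ℂ] φ'.Tensor X :=
  HilbertCompletion.map (φ.lift (φ'.tmul.compl₂ T)) fun s t => by
    refine φ.algTensor_induction t (by simp [inn_zero_right]) (fun y w => ?_) fun t t' h h' => ?_
    · refine φ.algTensor_induction s (by simp [inn_zero_left]) (fun x v => ?_) fun s s' h h' => ?_
      · simp only [lift_tmul, LinearMap.compl₂_apply, inn_tmul, ← h, hT]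
      · simp only [map_add, inn_add_left, h, h']
    · simp only [map_add, inn_add_right, h, h']

/-- The map `T ⊗ 1 : X ⊗_φ F → Y ⊗_φ F` for an isometry `T : X → Y`. -/
def mapLeft (φ : LeftAction B D F) (T : X →ₗ[ℂ] Y)
    (hT : ∀ x y, (inn (T x) (T y) : B) = inn x y) : φ.Tensor X →L[ℂ] φ.Tensor Y :=
  HilbertCompletion.map (φ.lift (φ.tmul ∘ₗ T)) fun s t => by
    refine φ.algTensor_induction t (by simp [inn_zero_right]) (fun y w => ?_) fun t t' h h' => ?_
    · refine φ.algTensor_induction s (by simp [inn_zero_left]) (fun x v => ?_) fun s s' h h' => ?_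
      · simp only [lift_tmul, LinearMap.comp_apply, inn_tmul, hT]
      · simp only [map_add, inn_add_left, h, h']
    · simp only [map_add, inn_add_right, h, h']

end LeftAction


/-- Unitary operators between Hilbert modules. -/
@[ext]
structure Unitary (D T T' : Type*) [NonUnitalCStarAlgebra D] [AddCommGroup T] [Module ℂ T]
    [PreHilbertModule D T] [AddCommGroup T'] [Module ℂ T'] [PreHilbertModule D T'] where
  toEquiv : T ≃ₗ[ℂ] T'
  inn_map : ∀ x y, (inn (toEquiv x) (toEquiv y) : D) = inn x y

end Tensor

end

section

section Bundles

/-! ### Groupoids -/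

/-- A locally compact Hausdorff groupoid: objects, arrows, range, source, units, inverse and
multiplication.  The product `mul g h` is only meaningful if `s g = r h`. -/
structure LCGroupoid where
  Obj : Type u
  Arr : Type u
  [topObj : TopologicalSpace Obj]
  [topArr : TopologicalSpace Arr]
  [t2 : T2Space Arr]
  [lc : LocallyCompactSpace Arr]
  r : C(Arr, Obj)
  s : C(Arr, Obj)
  u : C(Obj, Arr)
  inv : C(Arr, Arr)
  mul : Arr → Arr → Arr
  continuous_mul : Continuous fun p : {p : Arr × Arr // s p.1 = r p.2} => mul p.1.1 p.1.2
  r_u : ∀ x, r (u x) = x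
  s_u : ∀ x, s (u x) = x
  r_mul : ∀ g h, s g = r h → r (mul g h) = r g
  s_mul : ∀ g h, s g = r h → s (mul g h) = s h
  mul_assoc : ∀ g h k, s g = r h → s h = r k → mul (mul g h) k = mul g (mul h k)
  u_mul : ∀ g, mul (u (r g)) g = g
  mul_u : ∀ g, mul g (u (s g)) = g
  r_inv : ∀ g, r (inv g) = s g
  s_inv : ∀ g, s (inv g) = r g
  mul_inv : ∀ g, mul g (inv g) = u (r g)
  inv_mul : ∀ g, mul (inv g) g = u (s g)

attribute [instance] LCGroupoid.topObj LCGroupoid.topArr LCGroupoid.t2 LCGroupoid.lc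

namespace LCGroupoid

variable (G : LCGroupoid.{u})

/-- The arrows `g` and `h` are composable, with composite `k`. -/
def IsMul (g h k : G.Arr) : Prop := G.s g = G.r h ∧ G.mul g h = k

variable {G} {g h k g' h' k' : G.Arr}

theorem inv_unique (h1 : G.s g = G.r h) (h2 : G.mul g h = G.u (G.r g)) : h = G.inv g := by
  have h3 := G.mul_assoc (G.inv g) g h (G.s_inv g) h1
  rw [G.inv_mul, h2, h1, G.u_mul] at h3
  rw [h3]
  have := G.mul_u (G.inv g)
  rwa [G.s_inv] at this

theorem inv_inv (g : G.Arr) : G.inv (G.inv g) = g :=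
  (inv_unique (G.s_inv g) (by rw [G.inv_mul, G.r_inv])).symm

theorem isMul_u (x : G.Obj) : G.IsMul (G.u x) (G.u x) (G.u x) :=
  ⟨by rw [G.r_u, G.s_u], by have := G.u_mul (G.u x); rwa [G.r_u] at this⟩

theorem inv_u (x : G.Obj) : G.inv (G.u x) = G.u x :=
  (inv_unique (isMul_u x).1 (by rw [(isMul_u x).2, G.r_u])).symm

theorem isMul_u_left {x : G.Obj} (hx : G.r g = x) : G.IsMul (G.u x) g g := by
  subst hx; exact ⟨G.s_u _, G.u_mul g⟩

theorem isMul_u_right {x : G.Obj} (hx : G.s g = x) : G.IsMul g (G.u x) g := by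
  subst hx; exact ⟨(G.r_u _).symm, G.mul_u g⟩

theorem isMul_inv_self {x : G.Obj} (hx : G.s g = x) : G.IsMul (G.inv g) g (G.u x) := by
  subst hx; exact ⟨G.s_inv g, G.inv_mul g⟩

theorem isMul_self_inv {x : G.Obj} (hx : G.r g = x) : G.IsMul g (G.inv g) (G.u x) := by
  subst hx; exact ⟨(G.r_inv g).symm, G.mul_inv g⟩

theorem IsMul.r_eq (m : G.IsMul g h k) : G.r k = G.r g := by
  rw [← m.2, G.r_mul _ _ m.1]

theorem IsMul.s_eq (m : G.IsMul g h k) : G.s k = G.s h := by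
  rw [← m.2, G.s_mul _ _ m.1]

theorem IsMul.inv (m : G.IsMul g h k) : G.IsMul (G.inv h) (G.inv g) (G.inv k) := by
  refine ⟨by rw [G.s_inv, G.r_inv, m.1], inv_unique ?_ ?_⟩
  · rw [G.r_mul _ _ (by rw [G.s_inv, G.r_inv, m.1]), G.r_inv, m.s_eq]
  · have e : G.s (G.inv h) = G.r (G.inv g) := by rw [G.s_inv, G.r_inv, m.1]
    rw [← m.2, G.mul_assoc g h _ m.1 (by rw [G.r_mul _ _ e, G.r_inv]),
      ← G.mul_assoc h (G.inv h) (G.inv g) (G.r_inv h).symm e, G.mul_inv,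
      show G.r h = G.r (G.inv g) by rw [G.r_inv, m.1], G.u_mul, G.mul_inv, G.r_mul _ _ m.1]

theorem IsMul.inv_mul_left (m : G.IsMul g h k) : G.IsMul (G.inv g) k h := by
  refine ⟨by rw [G.s_inv, m.r_eq], ?_⟩
  rw [← m.2, ← G.mul_assoc _ _ _ (G.s_inv g) m.1, G.inv_mul, m.1, G.u_mul]

instance instT2Obj : T2Space G.Obj :=
  T2Space.of_injective_continuous (f := G.u)
    (fun x y hxy => by rw [← G.r_u x, hxy, G.r_u]) G.u.continuous

end LCGroupoid

/-! ### Upper semicontinuous Banach bundles -/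

/-- The total space of a family of sets. -/
@[ext]
structure Tot {X : Type u} (fib : X → Type u) where
  pt : X
  vec : fib pt

/-- An upper semicontinuous bundle of complex Banach spaces over `X`, with enough continuous
sections. -/
structure BanachBundle (X : Type u) [TopologicalSpace X] where
  fib : X → Type u
  [nacg : ∀ x, NormedAddCommGroup (fib x)]
  [nsp : ∀ x, NormedSpace ℂ (fib x)]
  [complete : ∀ x, CompleteSpace (fib x)]
  [top : TopologicalSpace (Tot fib)]
  continuous_pt : Continuous fun p : Tot fib => p.pt
  usc_norm : UpperSemicontinuous fun p : Tot fib => ‖p.vec‖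
  continuous_add : Continuous fun p : {p : Tot fib × Tot fib // p.1.pt = p.2.pt} =>
    (⟨p.1.2.pt, (p.2 ▸ p.1.1.vec) + p.1.2.vec⟩ : Tot fib)
  continuous_smul : Continuous fun p : ℂ × Tot fib => (⟨p.2.pt, p.1 • p.2.vec⟩ : Tot fib)
  /-- If `g_i → g` and `‖a_i‖ → 0`, then `a_i → 0_g`. -/
  small : ∀ x, ∀ W ∈ 𝓝 (⟨x, 0⟩ : Tot fib), ∃ V ∈ 𝓝 x, ∃ ε > 0, ∀ p : Tot fib,
    p.pt ∈ V → ‖p.vec‖ < ε → p ∈ W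
  exists_section : ∀ p : Tot fib, ∃ σ : ∀ x, fib x,
    Continuous (fun x => (⟨x, σ x⟩ : Tot fib)) ∧ σ p.pt = p.vec

attribute [instance] BanachBundle.nacg BanachBundle.nsp BanachBundle.complete BanachBundle.top

namespace BanachBundle

variable {X : Type u} [TopologicalSpace X] (A : BanachBundle.{u} X)

/-- Identification of the fibres over equal points. -/
def cast {x y : X} (h : x = y) : A.fib x ≃ₗᵢ[ℂ] A.fib y := h ▸ LinearIsometryEquiv.refl ℂ (A.fib x)

@[simp] theorem cast_rfl {x : X} (h : x = x) (a : A.fib x) : A.cast h a = a := rfl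

theorem mk_cast {x y : X} (h : x = y) (a : A.fib x) : (⟨y, A.cast h a⟩ : Tot A.fib) = ⟨x, a⟩ := by
  subst h; rfl

variable {Z W : Type*} [TopologicalSpace Z] [TopologicalSpace W]

/-- Continuity of a section of the pullback of the bundle along `ℓ`. -/
def IsCont (ℓ : Z → X) (f : ∀ z, A.fib (ℓ z)) : Prop :=
  Continuous fun z => (⟨ℓ z, f z⟩ : Tot A.fib)

variable {A} {ℓ : Z → X} {f g : ∀ z, A.fib (ℓ z)}

theorem IsCont.continuous_label (hf : A.IsCont ℓ f) : Continuous ℓ := A.continuous_pt.comp hf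

theorem IsCont.comp (hf : A.IsCont ℓ f) {p : W → Z} (hp : Continuous p) :
    A.IsCont (fun w => ℓ (p w)) (fun w => f (p w)) := Continuous.comp hf hp

theorem continuousAt_add {z₀ : Z}
    (hf : ContinuousAt (fun z => (⟨ℓ z, f z⟩ : Tot A.fib)) z₀)
    (hg : ContinuousAt (fun z => (⟨ℓ z, g z⟩ : Tot A.fib)) z₀) :
    ContinuousAt (fun z => (⟨ℓ z, f z + g z⟩ : Tot A.fib)) z₀ := by
  have : ContinuousAt (fun z => (⟨(⟨ℓ z, f z⟩, ⟨ℓ z, g z⟩), rfl⟩ :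
      {p : Tot A.fib × Tot A.fib // p.1.pt = p.2.pt})) z₀ := by
    rw [(Topology.IsEmbedding.subtypeVal (p := fun p : Tot A.fib × Tot A.fib =>
      p.1.pt = p.2.pt)).isInducing.continuousAt_iff]
    exact ContinuousAt.prodMk hf hg
  exact A.continuous_add.continuousAt.comp this

theorem IsCont.add (hf : A.IsCont ℓ f) (hg : A.IsCont ℓ g) :
    A.IsCont ℓ (fun z => f z + g z) :=
  continuous_iff_continuousAt.2 fun _ =>
    continuousAt_add (Continuous.continuousAt hf) (Continuous.continuousAt hg)

theorem IsCont.smul {c : Z → ℂ} (hc : Continuous c) (hf : A.IsCont ℓ f) :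
    A.IsCont ℓ (fun z => c z • f z) :=
  A.continuous_smul.comp (hc.prodMk hf)

theorem IsCont.sub (hf : A.IsCont ℓ f) (hg : A.IsCont ℓ g) :
    A.IsCont ℓ (fun z => f z - g z) := by
  have := hf.add (hg.smul (c := fun _ => -1) continuous_const)
  simpa only [neg_one_smul, ← sub_eq_add_neg] using this

theorem IsCont.eventually_lt (hf : A.IsCont ℓ f) {z₀ : Z} {c : ℝ} (h : ‖f z₀‖ < c) :
    ∀ᶠ z in 𝓝 z₀, ‖f z‖ < c :=
  (Continuous.tendsto hf z₀).eventually (A.usc_norm ⟨ℓ z₀, f z₀⟩ c h)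

theorem isCont_zero (hℓ : Continuous ℓ) : A.IsCont ℓ (fun _ => 0) := by
  refine continuous_iff_continuousAt.2 fun z => ?_
  intro W hW
  obtain ⟨V, hV, ε, hε, h⟩ := A.small _ W hW
  rw [mem_map]
  filter_upwards [hℓ.continuousAt hV] with y hy
  exact h _ hy (by simpa using hε)

/-- A locally uniform limit of continuous sections is continuous. -/
theorem isCont_of_approx (hℓ : Continuous ℓ) (h : ∀ z₀, ∀ ε > 0, ∃ β : ∀ z, A.fib (ℓ z),
    A.IsCont ℓ β ∧ ∀ᶠ z in 𝓝 z₀, ‖f z - β z‖ < ε) : A.IsCont ℓ f := by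
  refine continuous_iff_continuousAt.2 fun z₀ => ?_
  obtain ⟨σ, hσ, hσ0⟩ := A.exists_section ⟨ℓ z₀, f z₀⟩
  have hσ' : A.IsCont ℓ (fun z => σ (ℓ z)) := Continuous.comp hσ hℓ
  have key : ContinuousAt (fun z => (⟨ℓ z, f z - σ (ℓ z)⟩ : Tot A.fib)) z₀ := by
    intro W hW
    have h0 : f z₀ - σ (ℓ z₀) = 0 := sub_eq_zero.2 hσ0.symm
    simp only [h0] at hW
    obtain ⟨V, hV, ε, hε, hs⟩ := A.small _ W hW
    obtain ⟨β, hβ, hfβ⟩ := h z₀ (ε / 2) (half_pos hε)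
    have h1 : ‖β z₀ - σ (ℓ z₀)‖ < ε / 2 := by
      rw [hσ0, norm_sub_rev]; exact hfβ.self_of_nhds
    rw [mem_map]
    filter_upwards [hℓ.continuousAt hV, hfβ, (hβ.sub hσ').eventually_lt h1] with z hz1 hz2 hz3
    refine hs _ hz1 ?_
    calc ‖f z - σ (ℓ z)‖ ≤ ‖f z - β z‖ + ‖β z - σ (ℓ z)‖ := norm_sub_le_norm_sub_add_norm_sub ..
      _ < ε := by linarith
  have := continuousAt_add key (Continuous.continuousAt hσ')
  simpa only [sub_add_cancel] using this

variable (A) in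
/-- The space of compactly supported continuous sections of the pullback of the bundle along
`ℓ`, with values in the given family of subspaces. -/
def Cc (ℓ : C(Z, X)) (E : ∀ z, Submodule ℂ (A.fib (ℓ z))) : Submodule ℂ (∀ z, A.fib (ℓ z)) where
  carrier := {f | A.IsCont ℓ f ∧ (∃ K : Set Z, IsCompact K ∧ ∀ z ∉ K, f z = 0) ∧ ∀ z, f z ∈ E z}
  add_mem' := by
    rintro f g ⟨hf, ⟨K, hK, hfK⟩, hfE⟩ ⟨hg, ⟨L, hL, hgL⟩, hgE⟩
    refine ⟨hf.add hg, ⟨K ∪ L, hK.union hL, fun z hz => ?_⟩, fun z => (E z).add_mem (hfE z) (hgE z)⟩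
    simp only [Set.mem_union, not_or] at hz
    simp [hfK z hz.1, hgL z hz.2]
  zero_mem' := ⟨isCont_zero ℓ.continuous, ⟨∅, isCompact_empty, fun _ _ => rfl⟩,
    fun z => (E z).zero_mem⟩
  smul_mem' := by
    rintro c f ⟨hf, ⟨K, hK, hfK⟩, hfE⟩
    exact ⟨hf.smul continuous_const, ⟨K, hK, fun z hz => by simp [hfK z hz]⟩,
      fun z => (E z).smul_mem c (hfE z)⟩

/-- A continuous section of the bundle `A` with compact support. -/
abbrev CcTop (A : BanachBundle.{u} X) (ℓ : C(Z, X)) := A.Cc ℓ fun _ => ⊤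

end BanachBundle

/-! ### Fell bundles -/

/-- A (not necessarily saturated) Fell bundle over a locally compact groupoid.  The product
of the fibres over `g` and `h` is indexed by a proof that `k` is the product of `g` and `h`. -/
structure FellBundle (G : LCGroupoid.{u}) extends BanachBundle.{u} G.Arr where
  mul : ∀ {g h k : G.Arr}, G.IsMul g h k → fib g →ₗ[ℂ] fib h →ₗ[ℂ] fib k
  adj : ∀ {g g' : G.Arr}, G.inv g = g' → fib g →ₗ⋆[ℂ] fib g'
  mul_assoc : ∀ {g h k gh hk ghk : G.Arr} (m₁ : G.IsMul g h gh) (m₂ : G.IsMul gh k ghk)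
    (m₃ : G.IsMul h k hk) (m₄ : G.IsMul g hk ghk) (a : fib g) (b : fib h) (c : fib k),
    mul m₂ (mul m₁ a b) c = mul m₄ a (mul m₃ b c)
  adj_adj : ∀ {g g' : G.Arr} (i : G.inv g = g') (i' : G.inv g' = g) (a : fib g),
    adj i' (adj i a) = a
  adj_mul : ∀ {g h k g' h' k' : G.Arr} (m : G.IsMul g h k) (m' : G.IsMul h' g' k')
    (ig : G.inv g = g') (ih : G.inv h = h') (ik : G.inv k = k') (a : fib g) (b : fib h),
    adj ik (mul m a b) = mul m' (adj ih b) (adj ig a)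
  norm_mul_le : ∀ {g h k : G.Arr} (m : G.IsMul g h k) (a : fib g) (b : fib h),
    ‖mul m a b‖ ≤ ‖a‖ * ‖b‖
  norm_adj_mul_self : ∀ {g g' k : G.Arr} (i : G.inv g = g') (m : G.IsMul g' g k) (a : fib g),
    ‖mul m (adj i a) a‖ = ‖a‖ * ‖a‖
  /-- `a^* a` is positive in the fibre over the unit `s(g)`. -/
  exists_adj_mul_self : ∀ (g : G.Arr) (a : fib g), ∃ b : fib (G.u (G.s g)),
    mul (LCGroupoid.isMul_inv_self rfl) (adj rfl a) a
      = mul (LCGroupoid.isMul_u _) (adj (LCGroupoid.inv_u _) b) b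
  continuous_mul : Continuous fun p : {p : Tot fib × Tot fib // G.s p.1.pt = G.r p.2.pt} =>
    (⟨G.mul p.1.1.pt p.1.2.pt, mul ⟨p.2, rfl⟩ p.1.1.vec p.1.2.vec⟩ : Tot fib)
  continuous_adj : Continuous fun p : Tot fib => (⟨G.inv p.pt, adj rfl p.vec⟩ : Tot fib)

namespace FellBundle

variable {G : LCGroupoid.{u}} (A : FellBundle.{u} G)

theorem norm_adj {g g' : G.Arr} (i : G.inv g = g') (a : A.fib g) : ‖A.adj i a‖ = ‖a‖ := by
  have key : ∀ {g g' : G.Arr} (i : G.inv g = g') (a : A.fib g), ‖a‖ ≤ ‖A.adj i a‖ := by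
    intro g g' i a
    subst i
    have h1 := A.norm_adj_mul_self rfl (LCGroupoid.isMul_inv_self rfl) a
    have h2 := A.norm_mul_le (LCGroupoid.isMul_inv_self rfl) (A.adj rfl a) a
    rw [h1] at h2
    by_contra! h3
    have h4 : 0 < ‖a‖ := (norm_nonneg _).trans_lt h3
    nlinarith
  refine le_antisymm ?_ (key i a)
  have i' : G.inv g' = g := by rw [← i, LCGroupoid.inv_inv]
  have := key i' (A.adj i a)
  rwa [A.adj_adj] at this

/-- The fibre of a Fell bundle over a unit is a C*-algebra. -/
instance instAlg (x : G.Obj) : NonUnitalCStarAlgebra (A.fib (G.u x)) where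
  __ := A.nacg (G.u x)
  __ := A.nsp (G.u x)
  mul a b := A.mul (LCGroupoid.isMul_u x) a b
  left_distrib a b c := map_add _ b c
  right_distrib a b c := by
    change A.mul (LCGroupoid.isMul_u x) (a + b) c = _
    rw [map_add]; rfl
  zero_mul a := by
    change A.mul (LCGroupoid.isMul_u x) 0 a = _
    rw [map_zero]; rfl
  mul_zero a := map_zero (A.mul (LCGroupoid.isMul_u x) a)
  mul_assoc a b c := A.mul_assoc _ _ _ _ a b c
  norm_mul_le a b := A.norm_mul_le _ a b
  complete := (A.complete (G.u x)).complete
  star a := A.adj (LCGroupoid.inv_u x) a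
  star_involutive a := A.adj_adj _ _ a
  star_mul a b := A.adj_mul _ _ _ _ _ a b
  star_add a b := map_add (A.adj (LCGroupoid.inv_u x)) a b
  norm_mul_self_le a := (A.norm_adj_mul_self (LCGroupoid.inv_u x) (LCGroupoid.isMul_u x) a).ge
  smul_assoc c a b := by
    change A.mul (LCGroupoid.isMul_u x) (c • a) b = _
    rw [map_smul]; rfl
  smul_comm c a b := (map_smul (A.mul (LCGroupoid.isMul_u x) a) c b).symm
  star_smul c a := LinearMap.map_smulₛₗ (A.adj (LCGroupoid.inv_u x)) c a

theorem mul_def {x : G.Obj} (a b : A.fib (G.u x)) : a * b = A.mul (LCGroupoid.isMul_u x) a b := rfl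

theorem star_def {x : G.Obj} (a : A.fib (G.u x)) : star a = A.adj (LCGroupoid.inv_u x) a := rfl

/-- The product of the fibres as a continuous bilinear map. -/
def mulL {g h k : G.Arr} (m : G.IsMul g h k) : A.fib g →L[ℂ] A.fib h →L[ℂ] A.fib k :=
  LinearMap.mkContinuous₂ (A.mul m) 1 fun a b => by rw [one_mul]; exact A.norm_mul_le m a b

variable {Z : Type*} [TopologicalSpace Z] {A}

theorem isCont_mul {ℓ₁ ℓ₂ ℓ₃ : Z → G.Arr} {f : ∀ z, A.fib (ℓ₁ z)} {g : ∀ z, A.fib (ℓ₂ z)}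
    (hf : A.IsCont ℓ₁ f) (hg : A.IsCont ℓ₂ g) (m : ∀ z, G.IsMul (ℓ₁ z) (ℓ₂ z) (ℓ₃ z)) :
    A.IsCont ℓ₃ (fun z => A.mul (m z) (f z) (g z)) := by
  have h : Continuous fun z => (⟨(⟨ℓ₁ z, f z⟩, ⟨ℓ₂ z, g z⟩), (m z).1⟩ :
      {p : Tot A.fib × Tot A.fib // G.s p.1.pt = G.r p.2.pt}) :=
    (Continuous.prodMk hf hg).subtype_mk _
  have h2 := A.continuous_mul.comp h
  have h3 : ∀ {g₁ g₂ g₃ : G.Arr} (m : G.IsMul g₁ g₂ g₃) (a : A.fib g₁) (b : A.fib g₂),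
      (⟨g₃, A.mul m a b⟩ : Tot A.fib) = ⟨G.mul g₁ g₂, A.mul ⟨m.1, rfl⟩ a b⟩ := by
    intro g₁ g₂ g₃ m a b
    obtain ⟨m1, rfl⟩ := m
    rfl
  unfold BanachBundle.IsCont
  simp only [h3]
  exact h2

theorem isCont_adj {ℓ₁ ℓ₂ : Z → G.Arr} {f : ∀ z, A.fib (ℓ₁ z)}
    (hf : A.IsCont ℓ₁ f) (i : ∀ z, G.inv (ℓ₁ z) = ℓ₂ z) :
    A.IsCont ℓ₂ (fun z => A.adj (i z) (f z)) := by
  have h2 := A.continuous_adj.comp hf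
  have h3 : ∀ {g₁ g₂ : G.Arr} (i : G.inv g₁ = g₂) (a : A.fib g₁),
      (⟨g₂, A.adj i a⟩ : Tot A.fib) = ⟨G.inv g₁, A.adj rfl a⟩ := by
    intro g₁ g₂ i a
    subst i
    rfl
  unfold BanachBundle.IsCont
  simp only [h3]
  exact h2

end FellBundle
end Bundles

end

section

section SectionAlgebras

open scoped ENNReal
attribute [local instance] CStarAlgebra.spectralOrder CStarAlgebra.spectralOrderedRing

/-! ### C*-algebras of sections -/

/-- A family of closed `*`-subalgebras `S y` of the C*-algebras `A_{u(q(y))}`. -/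
structure SubAlgFamily {G : LCGroupoid.{u}} (A : FellBundle.{u} G) (Y : Type u)
    [TopologicalSpace Y] where
  q : C(Y, G.Obj)
  S : ∀ y, Submodule ℂ (A.fib (G.u (q y)))
  isClosed : ∀ y, IsClosed (S y : Set (A.fib (G.u (q y))))
  mul_mem : ∀ y (a b : A.fib (G.u (q y))), a ∈ S y → b ∈ S y → a * b ∈ S y
  star_mem : ∀ y (a : A.fib (G.u (q y))), a ∈ S y → star a ∈ S y

namespace SubAlgFamily

variable {G : LCGroupoid.{u}} {A : FellBundle.{u} G} {Y : Type u} [TopologicalSpace Y]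
  (S : SubAlgFamily A Y)

/-- The map `Y → G`, `y ↦ u(q(y))`. -/
def label : C(Y, G.Arr) := G.u.comp S.q

/-- The continuous sections vanishing at infinity of the family of C*-algebras `S`, as a subalgebra
of the C*-algebra of all bounded sections. -/
def c0 : NonUnitalStarSubalgebra ℂ (lp (fun y => A.fib (G.u (S.q y))) ∞) where
  carrier := {f | A.IsCont (fun y => G.u (S.q y)) (fun y => f y) ∧
    (∀ ε > 0, ∃ K : Set Y, IsCompact K ∧ ∀ y ∉ K, ‖f y‖ < ε) ∧ ∀ y, f y ∈ S.S y}
  add_mem' := by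
    rintro f g ⟨hf, hf0, hfS⟩ ⟨hg, hg0, hgS⟩
    refine ⟨hf.add hg, fun ε hε => ?_, fun y => (S.S y).add_mem (hfS y) (hgS y)⟩
    obtain ⟨K, hK, hfK⟩ := hf0 (ε / 2) (half_pos hε)
    obtain ⟨L, hL, hgL⟩ := hg0 (ε / 2) (half_pos hε)
    refine ⟨K ∪ L, hK.union hL, fun y hy => ?_⟩
    simp only [Set.mem_union, not_or] at hy
    have h1 := hfK y hy.1
    have h2 := hgL y hy.2
    exact (norm_add_le _ _).trans_lt (by linarith)
  zero_mem' := ⟨BanachBundle.isCont_zero S.label.continuous,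
    fun ε hε => ⟨∅, isCompact_empty, fun y _ => by simpa using hε⟩, fun y => (S.S y).zero_mem⟩
  mul_mem' := by
    rintro f g ⟨hf, hf0, hfS⟩ ⟨hg, hg0, hgS⟩
    refine ⟨FellBundle.isCont_mul hf hg fun y => LCGroupoid.isMul_u _, fun ε hε => ?_,
      fun y => S.mul_mem y _ _ (hfS y) (hgS y)⟩
    obtain ⟨K, hK, hfK⟩ := hf0 (ε / (‖g‖ + 1)) (by positivity)
    refine ⟨K, hK, fun y hy => ?_⟩
    have h1 := hfK y hy
    have h2 : ‖g y‖ ≤ ‖g‖ := lp.norm_apply_le_norm (by simp) g y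
    calc ‖f y * g y‖ ≤ ‖f y‖ * ‖g y‖ := norm_mul_le _ _
      _ ≤ ‖f y‖ * (‖g‖ + 1) := by gcongr; linarith
      _ < ε := by rwa [lt_div_iff₀ (by positivity)] at h1
  smul_mem' := by
    rintro c f ⟨hf, hf0, hfS⟩
    refine ⟨hf.smul continuous_const, fun ε hε => ?_, fun y => (S.S y).smul_mem c (hfS y)⟩
    obtain ⟨K, hK, hfK⟩ := hf0 (ε / (‖c‖ + 1)) (by positivity)
    refine ⟨K, hK, fun y hy => ?_⟩
    have h1 := hfK y hy
    calc ‖c • f y‖ = ‖f y‖ * ‖c‖ := by rw [norm_smul, mul_comm]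
      _ ≤ ‖f y‖ * (‖c‖ + 1) := by gcongr; linarith
      _ < ε := by rwa [lt_div_iff₀ (by positivity)] at h1
  star_mem' := by
    rintro f ⟨hf, hf0, hfS⟩
    refine ⟨FellBundle.isCont_adj hf fun y => LCGroupoid.inv_u _, fun ε hε => ?_,
      fun y => S.star_mem y _ (hfS y)⟩
    obtain ⟨K, hK, hfK⟩ := hf0 ε hε
    exact ⟨K, hK, fun y hy => by
      rw [lp.star_apply, norm_star]; exact hfK y hy⟩

instance isClosed_c0 : IsClosed (S.c0 : Set (lp (fun y => A.fib (G.u (S.q y))) ∞)) := by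
  rw [← isSeqClosed_iff_isClosed]
  intro f g hf hg
  have happ : ∀ ε > 0, ∃ n, ∀ y, ‖g y - f n y‖ < ε := fun ε hε => by
    obtain ⟨n, hn⟩ := ((Metric.tendsto_atTop.1 hg) ε hε)
    refine ⟨n, fun y => ?_⟩
    have h1 := lp.norm_apply_le_norm (by simp) (g - f n) y
    have h2 := hn n le_rfl
    rw [dist_comm, dist_eq_norm] at h2
    exact h1.trans_lt h2
  refine ⟨BanachBundle.isCont_of_approx S.label.continuous fun y₀ ε hε => ?_, fun ε hε => ?_,
    fun y => ?_⟩
  · obtain ⟨n, hn⟩ := happ ε hε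
    exact ⟨fun y => f n y, (hf n).1, Eventually.of_forall hn⟩
  · obtain ⟨n, hn⟩ := happ (ε / 2) (half_pos hε)
    obtain ⟨K, hK, hfK⟩ := (hf n).2.1 (ε / 2) (half_pos hε)
    refine ⟨K, hK, fun y hy => ?_⟩
    have h1 := hfK y hy
    have h2 := hn y
    calc ‖g y‖ = ‖(g y - f n y) + f n y‖ := by rw [sub_add_cancel]
      _ ≤ _ := norm_add_le _ _
      _ < ε := by linarith
  · rw [← SetLike.mem_coe, ← (S.isClosed y).closure_eq, Metric.mem_closure_iff]
    intro ε hε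
    obtain ⟨n, hn⟩ := happ ε hε
    exact ⟨f n y, (hf n).2.2 y, by rw [dist_eq_norm]; exact hn y⟩

/-- The C*-algebra `C₀(Y, S)`. -/
def C0 : Type u := S.c0

instance : NonUnitalCStarAlgebra S.C0 := inferInstanceAs (NonUnitalCStarAlgebra S.c0)

variable {S}

theorem C0.ext {f g : S.C0} (h : ∀ y, f.1 y = g.1 y) : f = g :=
  Subtype.ext (lp.ext (funext h))

/-- Positivity in `C₀(Y, S)` is pointwise positivity. -/
theorem C0.isPos {f : S.C0} (hf : ∀ y, IsPos (f.1 y)) : IsPos f := by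
  have hs : IsSelfAdjoint f := C0.ext fun y => IsSelfAdjoint.of_nonneg (isPos_iff.1 (hf y))
  refine isPos_of_forall hs fun N R hN h => C0.ext fun y => ?_
  have h1 : N.1 y * f.1 y * N.1 y = -(star (R.1 y) * R.1 y) := congrArg (fun t : S.C0 => t.1 y) h
  have h2 : star (N.1 y) = N.1 y := congrArg (fun t : S.C0 => t.1 y) hN
  have h3 : 0 ≤ N.1 y * f.1 y * N.1 y := by
    have := star_left_conjugate_nonneg (isPos_iff.1 (hf y)) (N.1 y)
    rwa [h2] at this
  rw [h1, neg_nonneg] at h3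
  exact (CStarRing.star_mul_self_eq_zero_iff _).1 (le_antisymm h3 (star_mul_self_nonneg _))

theorem exists_bound {X : Type u} [TopologicalSpace X] {A : BanachBundle.{u} X} {Z : Type*}
    [TopologicalSpace Z] {ℓ : C(Z, X)} {E : ∀ z, Submodule ℂ (A.fib (ℓ z))} (f : A.Cc ℓ E) :
    ∃ C : ℝ, ∀ z, ‖f.1 z‖ ≤ C := by
  obtain ⟨hf, ⟨K, hK, hfK⟩, -⟩ := f.2
  obtain ⟨C, hC⟩ : ∃ C : ℝ, ∀ z ∈ K, ‖f.1 z‖ ≤ C := by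
    refine hK.induction_on (p := fun s => ∃ C : ℝ, ∀ z ∈ s, ‖f.1 z‖ ≤ C) ⟨0, by simp⟩ ?_ ?_ ?_
    · rintro s t hst ⟨C, hC⟩
      exact ⟨C, fun z hz => hC z (hst hz)⟩
    · rintro s t ⟨C, hC⟩ ⟨C', hC'⟩
      exact ⟨max C C', fun z hz => hz.elim (fun h => (hC z h).trans (le_max_left _ _))
        fun h => (hC' z h).trans (le_max_right _ _)⟩
    · intro z _
      refine ⟨_, mem_nhdsWithin_of_mem_nhds (hf.eventually_lt (lt_add_one ‖f.1 z‖)),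
        ‖f.1 z‖ + 1, fun y hy => le_of_lt hy⟩
  refine ⟨max C 0, fun z => ?_⟩
  by_cases hz : z ∈ K
  · exact (hC z hz).trans (le_max_left _ _)
  · rw [hfK z hz, norm_zero]; exact le_max_right _ _

variable (S) in
/-- Compactly supported continuous sections belong to `C₀(Y, S)`. -/
def ofCc (f : A.Cc S.label S.S) : S.C0 :=
  ⟨⟨fun y => f.1 y, memℓp_infty (by
    obtain ⟨C, hC⟩ := exists_bound f
    exact ⟨C, by rintro _ ⟨y, rfl⟩; exact hC y⟩)⟩, f.2.1, fun ε hε => by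
      obtain ⟨K, hK, hfK⟩ := f.2.2.1
      exact ⟨K, hK, fun y hy => by
        have : f.1 y = 0 := hfK y hy
        change ‖f.1 y‖ < ε
        rwa [this, norm_zero]⟩, f.2.2.2⟩

end SubAlgFamily
end SectionAlgebras

end

section

section Integration

/-! ### Haar systems and integration along the fibres -/

instance (G : LCGroupoid.{u}) : MeasurableSpace G.Arr := borel _
instance (G : LCGroupoid.{u}) : BorelSpace G.Arr := ⟨rfl⟩

/-- A continuous family of Radon measures on the fibres of a map `v : G → G⁰`. -/
structure MeasFam (G : LCGroupoid.{u}) (v : C(G.Arr, G.Obj)) where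
  m : G.Obj → Measure G.Arr
  regular : ∀ x, (m x).Regular
  supp : ∀ x, m x {g | v g ≠ x} = 0
  cont : ∀ f : G.Arr → ℝ, Continuous f → HasCompactSupport f → Continuous fun x => ∫ g, f g ∂m x

attribute [instance] MeasFam.regular

/-- A (left invariant, continuous) Haar system on a groupoid: the measure `m x` is a Radon measure
on `G` whose support is the fibre `{g | r g = x}`. -/
structure HaarSystem (G : LCGroupoid.{u}) extends MeasFam G G.r where
  full : ∀ x (U : Set G.Arr), IsOpen U → (∃ g ∈ U, G.r g = x) → m x U ≠ 0
  inv : ∀ (g : G.Arr) (f : G.Arr → ℝ), Continuous f → HasCompactSupport f →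
    ∫ h, f (G.mul g h) ∂m (G.s g) = ∫ h, f h ∂m (G.r g)

variable {G : LCGroupoid.{u}}

/-- The inversion as a homeomorphism. -/
def LCGroupoid.invHomeo (G : LCGroupoid.{u}) : G.Arr ≃ₜ G.Arr where
  toFun := G.inv
  invFun := G.inv
  left_inv := LCGroupoid.inv_inv
  right_inv := LCGroupoid.inv_inv
  continuous_toFun := G.inv.continuous
  continuous_invFun := G.inv.continuous

/-- The family of measures `α̃_x` on the fibres of the source map: the images of the measures
`α^x` under inversion. -/
def HaarSystem.tilde (α : HaarSystem G) : MeasFam G G.s where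
  m x := (α.m x).map G.inv
  regular x := by
    have := MeasureTheory.Measure.Regular.map (μ := α.m x) G.invHomeo
    exact this
  supp x := by
    rw [Measure.map_apply G.inv.continuous.measurable
      (isOpen_ne_fun G.s.continuous continuous_const).measurableSet]
    convert α.supp x using 2
    ext g
    simp [G.s_inv]
  cont f hf hc := by
    have h : ∀ x, ∫ g, f g ∂(α.m x).map G.inv = ∫ g, f (G.inv g) ∂α.m x := fun x =>
      integral_map_equiv G.invHomeo.toMeasurableEquiv f
    simp only [h]
    exact α.cont (fun g => f (G.inv g)) (hf.comp G.inv.continuous)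
      (hc.comp_homeomorph G.invHomeo)

variable {Z W : Type u} [TopologicalSpace Z] [TopologicalSpace W] {π : C(Z, W)}

/-- An operator that integrates compactly supported sections along the fibres of `π : Z → W`: it maps
a section of the pullback along `π` of a bundle over `W` to a section of that bundle; it commutes
with fibrewise applied bounded real-linear operators, and it preserves closed convex cones. -/
structure IntegralOp (A : FellBundle.{u} G) (π : C(Z, W)) where
  int : ∀ ℓ : C(W, G.Arr), A.CcTop (ℓ.comp π) →ₗ[ℂ] A.CcTop ℓ
  map : ∀ (ℓ ℓ' : C(W, G.Arr)) (T : ∀ w, A.fib (ℓ w) →L[ℝ] A.fib (ℓ' w))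
    (f : A.CcTop (ℓ.comp π)) (f' : A.CcTop (ℓ'.comp π)),
    (∀ z, f'.1 z = T (π z) (f.1 z)) → ∀ w, (int ℓ' f').1 w = T w ((int ℓ f).1 w)
  mem : ∀ (ℓ : C(W, G.Arr)) (C : ∀ w, Set (A.fib (ℓ w))), (∀ w, Convex ℝ (C w)) →
    (∀ w, IsClosed (C w)) → (∀ w, 0 ∈ C w) → (∀ w (c : ℝ) a, 0 ≤ c → a ∈ C w → c • a ∈ C w) →
    ∀ f : A.CcTop (ℓ.comp π), (∀ z, f.1 z ∈ C (π z)) → ∀ w, (int ℓ f).1 w ∈ C w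

/-- Composition of integration operators. -/
def IntegralOp.comp {A : FellBundle.{u} G} {V : Type u} [TopologicalSpace V] {ρ : C(W, V)}
    (J : IntegralOp A ρ) (I : IntegralOp A π) : IntegralOp A (ρ.comp π) where
  int ℓ := J.int ℓ ∘ₗ I.int (ℓ.comp ρ)
  map ℓ ℓ' T f f' h := J.map ℓ ℓ' T _ _ (I.map (ℓ.comp ρ) (ℓ'.comp ρ) (fun w => T (ρ w)) f f' h)
  mem ℓ C h1 h2 h3 h4 f hf := J.mem ℓ C h1 h2 h3 h4 _
    (I.mem (ℓ.comp ρ) (fun w => C (ρ w)) (fun _ => h1 _) (fun _ => h2 _) (fun _ => h3 _)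
      (fun _ => h4 _) f hf)

/-- The data that exhibit `Z` as the fibre product of `c : W → G⁰` and `v : G → G⁰`, and a family
of measures on the fibres of `v`.  They induce a family of measures on the fibres of `π : Z → W`. -/
structure FibreProduct (π : C(Z, W)) (v : C(G.Arr, G.Obj)) where
  b : C(Z, G.Arr)
  c : C(W, G.Obj)
  comm : ∀ z, v (b z) = c (π z)
  isEmbedding : Topology.IsEmbedding fun z => (π z, b z)
  surj : ∀ w g, v g = c w → ∃ z, π z = w ∧ b z = g

namespace FibreProduct

variable {v : C(G.Arr, G.Obj)} (P : FibreProduct π v) {A : FellBundle.{u} G} {ℓ : C(W, G.Arr)}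

open scoped Classical in
/-- A section over `Z`, restricted to the fibre `π⁻¹(w) ≅ v⁻¹(c(w))` and extended by zero to
a function on `G` with values in the fibre over `w`. -/
def ext (f : ∀ z, A.fib (ℓ (π z))) (w : W) (g : G.Arr) : A.fib (ℓ w) :=
  if h : ∃ z, π z = w ∧ P.b z = g then A.cast (congrArg ℓ h.choose_spec.1) (f h.choose) else 0

theorem ext_apply (f : ∀ z, A.fib (ℓ (π z))) (z : Z) : P.ext f (π z) (P.b z) = f z := by
  have h : ∃ z', π z' = π z ∧ P.b z' = P.b z := ⟨z, rfl, rfl⟩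
  have h2 : h.choose = z := P.isEmbedding.injective (Prod.ext h.choose_spec.1 h.choose_spec.2)
  have h3 : ∀ (z' : Z) (h' : ℓ (π z') = ℓ (π z)), z' = z → A.cast h' (f z') = f z := by
    rintro z' h' rfl; rfl
  rw [ext, dif_pos h]
  exact h3 _ _ h2

theorem ext_of_ne (f : ∀ z, A.fib (ℓ (π z))) (w : W) (g : G.Arr) (h : v g ≠ P.c w) :
    P.ext f w g = 0 := by
  rw [ext, dif_neg]
  rintro ⟨z, rfl, rfl⟩
  exact h (P.comm z)

/-- Induction principle. -/
theorem ext_cases {p : ∀ w, G.Arr → A.fib (ℓ w) → Prop} (f : ∀ z, A.fib (ℓ (π z)))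
    (h : ∀ z, p (π z) (P.b z) (f z)) (h0 : ∀ w g, v g ≠ P.c w → p w g 0) (w : W) (g : G.Arr) :
    p w g (P.ext f w g) := by
  by_cases hg : v g = P.c w
  · obtain ⟨z, rfl, rfl⟩ := P.surj w g hg
    rw [ext_apply]; exact h z
  · rw [ext_of_ne _ _ _ _ hg]; exact h0 w g hg

theorem continuousOn_ext [T2Space W] {f : ∀ z, A.fib (ℓ (π z))}
    (hf : A.IsCont (fun z => ℓ (π z)) f) (w : W) :
    ContinuousOn (P.ext f w) {g | v g = P.c w} := by
  rw [continuousOn_iff_continuous_domRestrict]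
  choose σ hσ1 hσ2 using fun g : {g | v g = P.c w} => P.surj w g.1 g.2
  have hσ : Continuous σ := by
    rw [P.isEmbedding.continuous_iff]
    have : (fun z => (π z, P.b z)) ∘ σ = fun g => (w, g.1) := by
      ext g
      · exact hσ1 g
      · exact hσ2 g
    rw [this]
    exact continuous_const.prodMk continuous_subtype_val
  rw [continuous_iff_continuousAt]
  intro g₀
  rw [ContinuousAt, Metric.tendsto_nhds]
  intro ε hε
  obtain ⟨β, hβ, hβ0⟩ := A.exists_section ⟨ℓ w, P.ext f w g₀.1⟩
  have hβ' : A.IsCont (fun z => ℓ (π z)) (fun z => β (ℓ (π z))) :=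
    Continuous.comp hβ (ℓ.continuous.comp π.continuous)
  have key : ∀ g : {g | v g = P.c w}, ‖P.ext f w g.1 - P.ext f w g₀.1‖
      = ‖f (σ g) - β (ℓ (π (σ g)))‖ := by
    intro g
    have h1 : ∀ (w' : W) (g' : G.Arr) (z : Z), π z = w' → P.b z = g' →
        ‖P.ext f w' g' - β (ℓ w')‖ = ‖f z - β (ℓ (π z))‖ := by
      rintro _ _ z rfl rfl
      rw [ext_apply]
    rw [← h1 w g.1 (σ g) (hσ1 g) (hσ2 g), hβ0]
  have h0 : ‖f (σ g₀) - β (ℓ (π (σ g₀)))‖ < ε := by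
    rw [← key, sub_self, norm_zero]; exact hε
  filter_upwards [hσ.continuousAt ((hf.sub hβ').eventually_lt h0)] with g hg
  rw [dist_eq_norm]
  exact (key g).trans_lt hg

theorem exists_compact_support (f : A.CcTop (ℓ.comp π)) :
    ∃ M : Set G.Arr, IsCompact M ∧ ∀ w, ∀ g ∉ M, P.ext f.1 w g = 0 := by
  obtain ⟨K, hK, hfK⟩ := f.2.2.1
  refine ⟨P.b '' K, hK.image P.b.continuous, fun w g => ?_⟩
  refine P.ext_cases (p := fun _ g a => g ∉ P.b '' K → a = 0) f.1 (fun z hz => ?_)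
    (fun _ _ _ _ => rfl) w g
  exact hfK z fun hz' => hz ⟨z, hz', rfl⟩

theorem integrable_ext [T2Space W] (ν : MeasFam G v) (f : A.CcTop (ℓ.comp π)) (w : W) :
    Integrable (P.ext f.1 w) (ν.m (P.c w)) := by
  obtain ⟨M, hM, hfM⟩ := P.exists_compact_support f
  have hcl : IsClosed {g | v g = P.c w} := isClosed_eq v.continuous continuous_const
  have h := ((P.continuousOn_ext f.2.1 w).mono Set.inter_subset_right).integrableOn_compact
    (μ := ν.m (P.c w)) (hM.inter_right hcl)
  refine h.integrable_of_forall_notMem_eq_zero fun g hg => ?_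
  by_cases h1 : g ∈ M
  · exact P.ext_of_ne _ _ _ fun h2 => hg ⟨h1, h2⟩
  · exact hfM w g h1

/-- The integral of a section along the fibres of `π`. -/
def integral (ν : MeasFam G v) (f : ∀ z, A.fib (ℓ (π z))) (w : W) : A.fib (ℓ w) :=
  ∫ g, P.ext f w g ∂ν.m (P.c w)

theorem exists_partition [T2Space W] {K : Set Z} (hK : IsCompact K) (w₀ : W)
    {ι : Type*} (O : ι → Set Z) (hO : ∀ i, IsOpen (O i)) (hKO : K ⊆ ⋃ i, O i)
    {χ : Set G.Arr} (hχ : IsOpen χ) (hKχ : P.b '' K ⊆ χ) :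
    ∃ (n : ℕ) (i : Fin n → ι) (h : Fin n → G.Arr → ℝ),
      (∀ k, Continuous (h k)) ∧ (∀ k, HasCompactSupport (h k)) ∧ (∀ k g, 0 ≤ h k g) ∧
      (∀ g, ∑ k, h k g ≤ 1) ∧ (∀ k g, h k g ≠ 0 → g ∈ χ) ∧
      ∀ᶠ w in 𝓝 w₀, ∀ z, π z = w → (∀ k, h k (P.b z) ≠ 0 → z ∈ O (i k)) ∧
        (z ∈ K → ∑ k, h k (P.b z) = 1) := by
  have hK0 : IsCompact (K ∩ π ⁻¹' {w₀}) :=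
    hK.inter_right (isClosed_singleton.preimage π.continuous)
  have hloc : ∀ z : (K ∩ π ⁻¹' {w₀} : Set Z), ∃ (i : ι) (V : Set W) (U : Set G.Arr), V ∈ 𝓝 w₀ ∧
      IsOpen U ∧ P.b z.1 ∈ U ∧ U ⊆ χ ∧ ∀ z', π z' ∈ V → P.b z' ∈ U → z' ∈ O i := by
    rintro ⟨z, hz1, hz2⟩
    obtain ⟨i, hi⟩ := Set.mem_iUnion.1 (hKO hz1)
    have h1 : O i ∈ 𝓝 z := (hO i).mem_nhds hi
    rw [P.isEmbedding.isInducing.nhds_eq_comap, mem_comap] at h1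
    obtain ⟨T, hT, hTO⟩ := h1
    rw [nhds_prod_eq, mem_prod_iff] at hT
    obtain ⟨V, hV, U, hU, hVU⟩ := hT
    have hz2' : π z = w₀ := hz2
    rw [hz2'] at hV
    exact ⟨i, V, interior U ∩ χ, hV, isOpen_interior.inter hχ,
      ⟨mem_interior_iff_mem_nhds.2 hU, hKχ ⟨z, hz1, rfl⟩⟩, Set.inter_subset_right,
      fun z' h1 h2 => hTO (hVU ⟨h1, interior_subset h2.1⟩)⟩
  choose i V U hV hU hbU hUχ hVU using hloc
  obtain ⟨t, ht⟩ := (hK0.image P.b.continuous).elim_finite_subcover U hU (by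
    rintro _ ⟨z, hz, rfl⟩
    exact Set.mem_iUnion.2 ⟨⟨z, hz⟩, hbU _⟩)
  obtain ⟨L, hL, hL1, hL2⟩ := exists_compact_between (hK0.image P.b.continuous)
    (isOpen_biUnion fun z (_ : z ∈ t) => hU z) ht
  let e : Fin t.card ≃ t := t.equivFin.symm
  obtain ⟨f, hfs, hf1, hf01, hfc⟩ := exists_continuous_sum_one_of_isOpen_isCompact
    (s := fun k => U (e k)) (fun k => hU _) hL (fun g hg => by
      obtain ⟨z, hz, hzg⟩ := Set.mem_iUnion₂.1 (hL2 hg)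
      exact Set.mem_iUnion.2 ⟨e.symm ⟨z, hz⟩, by simpa using hzg⟩)
  have hpos : ∀ g, 0 < max 1 (∑ k, f k g) := fun g => lt_of_lt_of_le one_pos (le_max_left _ _)
  have hne : ∀ k g, f k g / max 1 (∑ k, f k g) ≠ 0 → f k g ≠ 0 := fun k g h h' =>
    h (by rw [h', zero_div])
  have hU' : ∀ k g, f k g ≠ 0 → g ∈ U (e k) := fun k g h => hfs k (subset_tsupport _ h)
  refine ⟨t.card, fun k => i (e k), fun k g => f k g / max 1 (∑ k, f k g), fun k => ?_, fun k => ?_,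
    fun k g => div_nonneg (hf01 k g).1 (hpos g).le, fun g => ?_, fun k g h => ?_, ?_⟩
  · exact (f k).continuous.div (by fun_prop) fun g => (hpos g).ne'
  · exact (hfc k).mono fun g hg => hne k g hg
  · rw [← Finset.sum_div, div_le_one (hpos g)]; exact le_max_right _ _
  · exact hUχ _ (hU' k g (hne k g h))
  · have hV' : (⋂ z ∈ t, V z) ∈ 𝓝 w₀ := (Filter.biInter_finset_mem t).2 fun z _ => hV z
    have hN : IsClosed (π '' (K \ P.b ⁻¹' interior L)) :=
      ((hK.diff (isOpen_interior.preimage P.b.continuous)).image π.continuous).isClosed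
    have hN' : (π '' (K \ P.b ⁻¹' interior L))ᶜ ∈ 𝓝 w₀ := by
      refine hN.isOpen_compl.mem_nhds ?_
      rintro ⟨z, hz, hz0⟩
      exact hz.2 (hL1 ⟨z, ⟨hz.1, hz0⟩, rfl⟩)
    filter_upwards [hV', hN'] with w hw1 hw2 z hzw
    refine ⟨fun k hk => hVU _ z ?_ (hU' k _ (hne k _ hk)), fun hz => ?_⟩
    · rw [hzw]; exact Set.mem_iInter₂.1 hw1 _ (e k).2
    · have hbz : P.b z ∈ L := by
        by_contra hb
        exact hw2 ⟨z, ⟨hz, fun h => hb (interior_subset h)⟩, hzw⟩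
      have h1 : ∑ k, f k (P.b z) = 1 := by
        have := hf1 hbz
        simpa using this
      simp only [h1, max_self, div_one]

theorem isCont_integral [T2Space W] (ν : MeasFam G v) (f : A.CcTop (ℓ.comp π)) :
    A.IsCont ℓ (P.integral ν f.1) := by
  refine BanachBundle.isCont_of_approx ℓ.continuous fun w₀ ε hε => ?_
  obtain ⟨K, hK, hfK⟩ := f.2.2.1
  obtain ⟨χ, -, hχ1, hχ01, hχc⟩ := exists_continuous_sum_one_of_isOpen_isCompact
    (n := 1) (s := fun _ => Set.univ) (fun _ => isOpen_univ)
    (exists_compact_superset (hK.image P.b.continuous)).choose_spec.1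
    (fun g _ => Set.mem_iUnion.2 ⟨0, trivial⟩)
  set M := (exists_compact_superset (hK.image P.b.continuous)).choose
  have hM : P.b '' K ⊆ interior M :=
    (exists_compact_superset (hK.image P.b.continuous)).choose_spec.2
  have hχM : ∀ g ∈ M, χ 0 g = 1 := fun g hg => by simpa using hχ1 hg
  set I : W → ℝ := fun w => ∫ g, χ 0 g ∂ν.m (P.c w)
  have hI : Continuous I := (ν.cont _ (χ 0).continuous (hχc 0)).comp P.c.continuous
  have hI0 : ∀ w, 0 ≤ I w := fun w => integral_nonneg fun g => (hχ01 0 g).1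
  set δ : ℝ := ε / (I w₀ + 2)
  have hδ : 0 < δ := div_pos hε (by linarith [hI0 w₀])
  choose β hβ hβ0 using fun z : Z => A.exists_section ⟨ℓ (π z), f.1 z⟩
  have hβ' : ∀ z₁, A.IsCont (fun z => ℓ (π z)) (fun z => β z₁ (ℓ (π z))) := fun z₁ =>
    Continuous.comp (hβ z₁) (ℓ.continuous.comp π.continuous)
  let F : ∀ z, A.fib (ℓ (π z)) := f.1
  obtain ⟨n, i, h, hc, hcs, h0, hs1, hM', hev⟩ := P.exists_partition hK w₀
    (fun z₁ : Z => {z | ‖F z - β z₁ (ℓ (π z))‖ < δ})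
    (fun z₁ => isOpen_iff_mem_nhds.2 fun z hz => (f.2.1.sub (hβ' z₁)).eventually_lt hz)
    (fun z _ => Set.mem_iUnion.2 ⟨z, by
      have : β z (ℓ (π z)) = F z := hβ0 z
      change ‖F z - β z (ℓ (π z))‖ < δ
      rw [this, sub_self, norm_zero]; exact hδ⟩)
    isOpen_interior hM
  refine ⟨fun w => ∑ k, ((∫ g, h k g ∂ν.m (P.c w) : ℝ) : ℂ) • β (i k) (ℓ w), ?_, ?_⟩
  · have : ∀ s : Finset (Fin n), A.IsCont ℓ
        (fun w => ∑ k ∈ s, ((∫ g, h k g ∂ν.m (P.c w) : ℝ) : ℂ) • β (i k) (ℓ w)) := by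
      intro s
      induction s using Finset.induction_on with
      | empty => simpa using BanachBundle.isCont_zero ℓ.continuous
      | insert k s hk ih =>
        simp only [Finset.sum_insert hk]
        refine BanachBundle.IsCont.add ?_ ih
        exact BanachBundle.IsCont.smul (Complex.continuous_ofReal.comp
          ((ν.cont _ (hc k) (hcs k)).comp P.c.continuous)) (Continuous.comp (hβ (i k)) ℓ.continuous)
    exact this Finset.univ
  · have hIlt : ∀ᶠ w in 𝓝 w₀, I w < I w₀ + 1 := hI.continuousAt.eventually_lt
      continuousAt_const (by linarith)
    filter_upwards [hev, hIlt] with w hw1 hw2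
    have hint : ∀ k, Integrable (fun g => h k g • β (i k) (ℓ w)) (ν.m (P.c w)) := fun k =>
      ((hc k).integrable_of_hasCompactSupport (hcs k)).smul_const _
    have e1 : P.integral ν f.1 w - ∑ k, ((∫ g, h k g ∂ν.m (P.c w) : ℝ) : ℂ) • β (i k) (ℓ w)
        = ∫ g, (P.ext f.1 w g - ∑ k, h k g • β (i k) (ℓ w)) ∂ν.m (P.c w) := by
      rw [integral_sub (P.integrable_ext ν f w) (integrable_finsetSum _ fun k _ => hint k),
        integral_finsetSum _ fun k _ => hint k]
      congr 1
      refine Finset.sum_congr rfl fun k _ => ?_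
      rw [integral_smul_const, Complex.coe_smul]
    have e2 : ∀ᵐ g ∂ν.m (P.c w), ‖P.ext f.1 w g - ∑ k, h k g • β (i k) (ℓ w)‖ ≤ δ * χ 0 g := by
      have : ∀ᵐ g ∂ν.m (P.c w), v g = P.c w := ν.supp (P.c w)
      filter_upwards [this] with g hg
      obtain ⟨z, rfl, rfl⟩ := P.surj w g hg
      obtain ⟨hz1, hz2⟩ := hw1 z rfl
      rw [ext_apply]
      have e3 : F z = ∑ k, h k (P.b z) • F z := by
        rw [← Finset.sum_smul]
        by_cases hz : z ∈ K
        · rw [hz2 hz, one_smul]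
        · have : F z = 0 := hfK z hz
          rw [this, smul_zero]
      have e4 : F z - ∑ k, h k (P.b z) • β (i k) (ℓ (π z))
          = ∑ k, h k (P.b z) • (F z - β (i k) (ℓ (π z))) := by
        conv_lhs => rw [e3]
        simp only [smul_sub, Finset.sum_sub_distrib]
      change ‖F z - _‖ ≤ _
      rw [e4]
      have e5 : ∀ k, ‖h k (P.b z) • (F z - β (i k) (ℓ (π z)))‖ ≤ δ * h k (P.b z) := fun k => by
        rw [norm_smul, Real.norm_of_nonneg (h0 k _), mul_comm]
        by_cases hk : h k (P.b z) = 0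
        · rw [hk, mul_zero, mul_zero]
        · exact mul_le_mul_of_nonneg_right (le_of_lt (hz1 k hk)) (h0 k _)
      refine (norm_sum_le_of_le _ fun k _ => e5 k).trans ?_
      rw [← Finset.mul_sum]
      refine mul_le_mul_of_nonneg_left ?_ hδ.le
      by_cases hz : P.b z ∈ M
      · rw [hχM _ hz]; exact hs1 _
      · have : ∀ k, h k (P.b z) = 0 := fun k => by
          by_contra hk
          exact hz (interior_subset (hM' k _ hk))
        simp only [this, Finset.sum_const_zero]
        exact (hχ01 0 _).1
    rw [e1]
    refine (norm_integral_le_of_norm_le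
      (((χ 0).continuous.integrable_of_hasCompactSupport (hχc 0)).const_mul δ) e2).trans_lt ?_
    rw [integral_const_mul]
    calc δ * I w < δ * (I w₀ + 2) := mul_lt_mul_of_pos_left (by linarith) hδ
      _ = ε := div_mul_cancel₀ _ (by linarith [hI0 w₀])

/-- The integration along the fibres of `π`. -/
def integralOp [T2Space W] (ν : MeasFam G v) : IntegralOp A π where
  int ℓ :=
    { toFun := fun f => ⟨P.integral ν f.1, P.isCont_integral ν f, by
        obtain ⟨K, hK, hfK⟩ := f.2.2.1
        refine ⟨π '' K, hK.image π.continuous, fun w hw => ?_⟩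
        have : P.ext f.1 w = fun _ => 0 := funext fun g =>
          P.ext_cases (p := fun w _ a => w ∉ π '' K → a = 0) f.1
            (fun z hz => hfK z fun hz' => hz ⟨z, hz', rfl⟩) (fun _ _ _ _ => rfl) w g hw
        rw [integral, this, integral_zero], fun _ => trivial⟩
      map_add' := fun f f' => by
        refine Subtype.ext (funext fun w => ?_)
        change P.integral ν (f.1 + f'.1) w = P.integral ν f.1 w + P.integral ν f'.1 w
        rw [integral, integral, integral,
          ← integral_add (P.integrable_ext ν f w) (P.integrable_ext ν f' w)]
        congr 1
        ext g
        by_cases hg : v g = P.c w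
        · obtain ⟨z, rfl, rfl⟩ := P.surj w g hg
          rw [ext_apply, ext_apply, ext_apply]; rfl
        · rw [P.ext_of_ne _ _ _ hg, P.ext_of_ne _ _ _ hg, P.ext_of_ne _ _ _ hg, add_zero]
      map_smul' := fun c f => by
        refine Subtype.ext (funext fun w => ?_)
        change P.integral ν (c • f.1) w = c • P.integral ν f.1 w
        rw [integral, integral, ← integral_smul]
        congr 1
        ext g
        by_cases hg : v g = P.c w
        · obtain ⟨z, rfl, rfl⟩ := P.surj w g hg
          rw [ext_apply, ext_apply]; rfl
        · rw [P.ext_of_ne _ _ _ hg, P.ext_of_ne _ _ _ hg, smul_zero] }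
  map ℓ ℓ' T f f' h w := by
    change P.integral ν f'.1 w = T w (P.integral ν f.1 w)
    rw [integral, integral, ← (T w).integral_comp_comm (P.integrable_ext ν f w)]
    congr 1
    ext g
    by_cases hg : v g = P.c w
    · obtain ⟨z, rfl, rfl⟩ := P.surj w g hg
      rw [ext_apply, ext_apply, h]
    · rw [P.ext_of_ne _ _ _ hg, P.ext_of_ne _ _ _ hg, map_zero]
  mem ℓ C h1 h2 h3 h4 f hf w := by
    change P.integral ν f.1 w ∈ C w
    obtain ⟨M, hM, hfM⟩ := P.exists_compact_support f
    have hC : ∀ g, P.ext f.1 w g ∈ C w :=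
      P.ext_cases (p := fun w _ a => a ∈ C w) f.1 hf (fun w _ _ => h3 w) w
    have hint : P.integral ν f.1 w = ∫ g in M, P.ext f.1 w g ∂ν.m (P.c w) :=
      (setIntegral_eq_integral_of_forall_compl_eq_zero (hfM w)).symm
    by_cases h0 : ν.m (P.c w) M = 0
    · rw [hint, Measure.restrict_eq_zero.2 h0, integral_zero_measure]; exact h3 w
    · have hav := (h1 w).set_average_mem (h2 w) h0 hM.measure_ne_top
        (Eventually.of_forall hC) (P.integrable_ext ν f w).integrableOn
      rw [setAverage_eq] at hav
      have := h4 w ((ν.m (P.c w)).real M) _ measureReal_nonneg hav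
      rw [smul_smul, mul_inv_cancel₀, one_smul] at this
      · rwa [hint]
      · exact (ENNReal.toReal_pos h0 hM.measure_ne_top).ne'

end FibreProduct
end Integration

end

section

section ConvolutionAlgebra
open scoped ENNReal

/-! ### Composable pairs -/

namespace LCGroupoid

variable (G : LCGroupoid.{u})

/-- The space `G²` of composable pairs of arrows. -/
abbrev Sq : Type u := {p : G.Arr × G.Arr // G.s p.1 = G.r p.2}

/-- `d₀(g,h) = h` -/
def d0 : C(G.Sq, G.Arr) := ⟨fun z => z.1.2, by fun_prop⟩
/-- `d₁(g,h) = gh` -/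
def d1 : C(G.Sq, G.Arr) := ⟨fun z => G.mul z.1.1 z.1.2, G.continuous_mul⟩
/-- `d₂(g,h) = g` -/
def d2 : C(G.Sq, G.Arr) := ⟨fun z => z.1.1, by fun_prop⟩

variable {G}

theorem isMul_sq (z : G.Sq) : G.IsMul (G.d2 z) (G.d0 z) (G.d1 z) := ⟨z.2, rfl⟩
theorem s_d2 (z : G.Sq) : G.s (G.d2 z) = G.r (G.d0 z) := z.2
theorem r_d1 (z : G.Sq) : G.r (G.d1 z) = G.r (G.d2 z) := (isMul_sq z).r_eq
theorem s_d1 (z : G.Sq) : G.s (G.d1 z) = G.s (G.d0 z) := (isMul_sq z).s_eq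

end LCGroupoid

variable {G : LCGroupoid.{u}} (A : FellBundle.{u} G) (α : HaarSystem G)

/-- Integration of functions on `G` over the fibres `G^x` of the range map. -/
def intR : IntegralOp A G.r :=
  FibreProduct.integralOp (v := G.r)
    { b := .id _, c := .id _, comm := fun _ => rfl
      isEmbedding := .of_leftInverse (f := Prod.snd) (fun _ => rfl) continuous_snd
        (G.r.continuous.prodMk continuous_id)
      surj := fun _ g hg => ⟨g, hg, rfl⟩ } α.toMeasFam

/-- Integration of functions on `G` over the fibres `G_x` of the source map. -/
def intS : IntegralOp A G.s :=
  FibreProduct.integralOp (v := G.s)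
    { b := .id _, c := .id _, comm := fun _ => rfl
      isEmbedding := .of_leftInverse (f := Prod.snd) (fun _ => rfl) continuous_snd
        (G.s.continuous.prodMk continuous_id)
      surj := fun _ g hg => ⟨g, hg, rfl⟩ } α.tilde

/-- `(λ₀ f)(h) = ∫ f(g,h) dα̃_{r(h)}(g)`. -/
def lam0 : IntegralOp A G.d0 :=
  FibreProduct.integralOp (v := G.s)
    { b := G.d2, c := G.r, comm := fun z => LCGroupoid.s_d2 z
      isEmbedding := (Homeomorph.prodComm _ _).isEmbedding.comp .subtypeVal
      surj := fun h g hg => ⟨⟨(g, h), hg⟩, rfl, rfl⟩ } α.tilde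

/-- `(λ₁ f)(k) = ∫ f(g,g⁻¹k) dα^{r(k)}(g)`. -/
def lam1 : IntegralOp A G.d1 :=
  FibreProduct.integralOp (v := G.r)
    { b := G.d2, c := G.r, comm := fun z => (LCGroupoid.r_d1 z).symm
      isEmbedding := by
        have h : ∀ z : G.Sq, G.s (G.inv (G.d2 z)) = G.r (G.d1 z) := fun z => by
          rw [G.s_inv, LCGroupoid.r_d1]
        let φ : G.Sq → {p : G.Arr × G.Arr // G.r p.1 = G.r p.2} :=
          fun z => ⟨(G.d1 z, G.d2 z), LCGroupoid.r_d1 z⟩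
        have hmul : Continuous fun p : {p : G.Arr × G.Arr // G.r p.1 = G.r p.2} =>
            G.mul (G.inv p.1.2) p.1.1 :=
          G.continuous_mul.comp (f := fun p : {p : G.Arr × G.Arr // G.r p.1 = G.r p.2} =>
            (⟨(G.inv p.1.2, p.1.1), by rw [G.s_inv, p.2]⟩ : G.Sq)) (by fun_prop)
        let ψ : {p : G.Arr × G.Arr // G.r p.1 = G.r p.2} → G.Sq := fun p =>
          ⟨(p.1.2, G.mul (G.inv p.1.2) p.1.1), by
            rw [G.r_mul _ _ (by rw [G.s_inv, p.2]), G.r_inv]⟩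
        have hψ : Continuous ψ := by fun_prop
        have hφ : Continuous φ := by fun_prop
        have hl : Function.LeftInverse ψ φ := fun z =>
          Subtype.ext (Prod.ext rfl (LCGroupoid.isMul_sq z).inv_mul_left.2)
        exact Topology.IsEmbedding.subtypeVal.comp (.of_leftInverse hl hψ hφ)
      surj := fun k g hg => by
        have m : G.s (G.inv g) = G.r k := by rw [G.s_inv]; exact hg
        refine ⟨⟨(g, G.mul (G.inv g) k), ?_⟩, ?_, rfl⟩
        · rw [G.r_mul _ _ m, G.r_inv]
        · change G.mul g (G.mul (G.inv g) k) = k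
          rw [← G.mul_assoc _ _ _ (G.r_inv g).symm m, G.mul_inv,
            show G.r g = G.r k from hg, G.u_mul] } α.toMeasFam

/-- `(λ₂ f)(g) = ∫ f(g,h) dα^{s(g)}(h)`. -/
def lam2 : IntegralOp A G.d2 :=
  FibreProduct.integralOp (v := G.r)
    { b := G.d0, c := G.s, comm := fun z => (LCGroupoid.s_d2 z).symm
      isEmbedding := .subtypeVal
      surj := fun g h hg => ⟨⟨(g, h), hg.symm⟩, rfl, rfl⟩ } α.toMeasFam

/-! ### The convolution algebra and its C*-completion -/

namespace FellBundle

/-- The space `C_c(G, A)` of compactly supported continuous sections. -/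
abbrev Sec := A.CcTop (.id G.Arr)

variable {A}

/-- The value of a section at a point. -/
def ev (ξ : A.Sec) (g : G.Arr) : A.fib g := ξ.1 g

theorem isCont_ev (ξ : A.Sec) : A.IsCont (fun g => g) (ev ξ) := ξ.2.1

theorem exists_compact_ev (ξ : A.Sec) : ∃ K : Set G.Arr, IsCompact K ∧ ∀ g ∉ K, ev ξ g = 0 := ξ.2.2.1

/-- The section `(g,h) ↦ ξ(g) η(h)` over `G²`. -/
def extMul (ξ η : A.Sec) : A.CcTop ((ContinuousMap.id G.Arr).comp G.d1) :=
  ⟨fun z => A.mul (LCGroupoid.isMul_sq z) (ev ξ (G.d2 z)) (ev η (G.d0 z)),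
    isCont_mul ((isCont_ev ξ).comp G.d2.continuous) ((isCont_ev η).comp G.d0.continuous) _, by
      obtain ⟨K, hK, hK0⟩ := exists_compact_ev ξ
      obtain ⟨L, hL, hL0⟩ := exists_compact_ev η
      have hcl : IsClosed {p : G.Arr × G.Arr | G.s p.1 = G.r p.2} :=
        isClosed_eq (by fun_prop) (by fun_prop)
      refine ⟨Subtype.val ⁻¹' (K ×ˢ L),
        hcl.isClosedEmbedding_subtypeVal.isCompact_preimage (hK.prod hL), fun z hz => ?_⟩
      change A.mul (LCGroupoid.isMul_sq z) (ev ξ (G.d2 z)) (ev η (G.d0 z)) = 0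
      by_cases h1 : G.d2 z ∈ K
      · have h2 : ev η (G.d0 z) = 0 := hL0 _ fun h2 => hz ⟨h1, h2⟩
        rw [h2, map_zero]
      · rw [hK0 _ h1, map_zero, LinearMap.zero_apply], fun _ => trivial⟩

/-- The convolution `(ξ * η)(g) = ∫ ξ(h) η(h⁻¹g) dα^{r(g)}(h)`. -/
def conv (ξ η : A.Sec) : A.Sec := (lam1 A α).int (.id G.Arr) (extMul ξ η)

/-- The involution `ξ^*(g) = ξ(g⁻¹)^*`. -/
def starSec (ξ : A.Sec) : A.Sec :=
  ⟨fun g => A.adj (LCGroupoid.inv_inv g) (ev ξ (G.inv g)),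
    isCont_adj ((isCont_ev ξ).comp G.inv.continuous) _, by
      obtain ⟨K, hK, hK0⟩ := exists_compact_ev ξ
      refine ⟨G.inv ⁻¹' K, G.invHomeo.isCompact_preimage.2 hK, fun g hg => ?_⟩
      change A.adj (LCGroupoid.inv_inv g) (ev ξ (G.inv g)) = 0
      rw [hK0 _ hg, map_zero], fun _ => trivial⟩

/-- The `I`-norm: the larger one of `sup_x ∫ ‖ξ(g)‖ dα^x(g)` and `sup_x ∫ ‖ξ(g)‖ dα̃_x(g)`. -/
def normI (ξ : A.Sec) : ℝ≥0∞ :=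
  (⨆ x, ∫⁻ g, ‖ev ξ g‖ₑ ∂α.m x) ⊔ (⨆ x, ∫⁻ g, ‖ev ξ g‖ₑ ∂α.tilde.m x)

variable (A) in
/-- The `*`-homomorphisms from the convolution algebra `C_c(G, A)` to C*-algebras `C` that are bounded
by the `I`-norm. -/
structure SecHom (C : Type u) [NonUnitalCStarAlgebra C] where
  toFun : A.Sec →ₗ[ℂ] C
  map_conv : ∀ ξ η, toFun (conv α ξ η) = toFun ξ * toFun η
  map_star : ∀ ξ, toFun (starSec ξ) = star (toFun ξ)
  bound : ∀ ξ, ‖toFun ξ‖ₑ ≤ normI α ξ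

variable (A) in
/-- The set of C*-seminorms on `C_c(G, A)` that are bounded by the `I`-norm. -/
def SemiIdx : Type u :=
  {p : A.Sec → ℝ // ∃ (C : Type u) (_ : NonUnitalCStarAlgebra C) (ρ : SecHom A α C),
    ∀ ξ, p ξ = ‖ρ.toFun ξ‖}

/-- A C*-algebra realising a C*-seminorm. -/
def SemiIdx.Alg (p : SemiIdx A α) : Type u := p.2.choose

instance (p : SemiIdx A α) : NonUnitalCStarAlgebra p.Alg := p.2.choose_spec.choose

/-- A `*`-homomorphism realising a C*-seminorm. -/
def SemiIdx.hom (p : SemiIdx A α) : SecHom A α p.Alg := p.2.choose_spec.choose_spec.choose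

theorem SemiIdx.hom_spec (p : SemiIdx A α) (ξ : A.Sec) : p.1 ξ = ‖p.hom.toFun ξ‖ :=
  p.2.choose_spec.choose_spec.choose_spec ξ

theorem lintegral_lt_top {v : C(G.Arr, G.Obj)} (ν : MeasFam G v) (ξ : A.Sec) :
    (⨆ x, ∫⁻ g, ‖ev ξ g‖ₑ ∂ν.m x) < ∞ := by
  obtain ⟨K, hK, hK0⟩ := exists_compact_ev ξ
  obtain ⟨C, hC⟩ := SubAlgFamily.exists_bound ξ
  obtain ⟨χ, -, hχ1, hχ01, hχc⟩ := exists_continuous_sum_one_of_isOpen_isCompact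
    (n := 1) (s := fun _ => Set.univ) (fun _ => isOpen_univ) hK
    (fun g _ => Set.mem_iUnion.2 ⟨0, trivial⟩)
  have hχK : ∀ g ∈ K, χ 0 g = 1 := fun g hg => by simpa using hχ1 hg
  have hI : HasCompactSupport fun x => ∫ g, χ 0 g ∂ν.m x := by
    refine HasCompactSupport.intro ((hχc 0).isCompact.image v.continuous) fun x hx => ?_
    have : ∀ᵐ g ∂ν.m x, χ 0 g = 0 := by
      filter_upwards [(ν.supp x : ∀ᵐ g ∂ν.m x, v g = x)] with g hg
      exact image_eq_zero_of_notMem_tsupport fun h => hx ⟨g, h, hg⟩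
    rw [integral_congr_ae this, integral_zero]
  obtain ⟨B, hB⟩ := hI.exists_bound_of_continuous (ν.cont _ (χ 0).continuous (hχc 0))
  refine lt_of_le_of_lt (iSup_le fun x => ?_)
    (ENNReal.ofReal_lt_top (r := |C| * B))
  calc ∫⁻ g, ‖ev ξ g‖ₑ ∂ν.m x ≤ ∫⁻ g, ENNReal.ofReal (|C| * χ 0 g) ∂ν.m x := by
        refine lintegral_mono fun g => ?_
        by_cases hg : g ∈ K
        · simp only [hχK g hg, mul_one]
          rw [← ofReal_norm]
          exact ENNReal.ofReal_le_ofReal ((hC g).trans (le_abs_self C))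
        · simp [hK0 g hg]
    _ = ENNReal.ofReal (∫ g, |C| * χ 0 g ∂ν.m x) :=
        (ofReal_integral_eq_lintegral_ofReal
          (((χ 0).continuous.integrable_of_hasCompactSupport (hχc 0)).const_mul _)
          (Eventually.of_forall fun g => mul_nonneg (abs_nonneg _) (hχ01 0 g).1)).symm
    _ ≤ _ := by
        rw [integral_const_mul]
        exact ENNReal.ofReal_le_ofReal (mul_le_mul_of_nonneg_left
          ((le_abs_self _).trans (hB x)) (abs_nonneg _))

theorem normI_lt_top (ξ : A.Sec) : normI α ξ < ∞ :=
  max_lt (lintegral_lt_top _ ξ) (lintegral_lt_top _ ξ)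

/-- The family of all `*`-homomorphisms from `C_c(G, A)` to C*-algebras that are bounded by the
`I`-norm (up to the induced seminorm), as a map to a direct product of C*-algebras. -/
def univHom (ξ : A.Sec) : lp (fun p : SemiIdx A α => p.Alg) ∞ :=
  ⟨fun p => p.hom.toFun ξ, memℓp_infty ⟨(normI α ξ).toReal, by
    rintro _ ⟨p, rfl⟩
    have := ENNReal.toReal_mono (normI_lt_top α ξ).ne (p.hom.bound ξ)
    simpa using this⟩⟩

variable (A) in
/-- The image of `C_c(G, A)`. -/
def univRange : NonUnitalStarSubalgebra ℂ (lp (fun p : SemiIdx A α => p.Alg) ∞) where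
  carrier := Set.range (univHom α)
  add_mem' := by
    rintro _ _ ⟨ξ, rfl⟩ ⟨η, rfl⟩
    exact ⟨ξ + η, lp.ext (funext fun p => map_add p.hom.toFun ξ η)⟩
  zero_mem' := ⟨0, lp.ext (funext fun p => map_zero p.hom.toFun)⟩
  mul_mem' := by
    rintro _ _ ⟨ξ, rfl⟩ ⟨η, rfl⟩
    exact ⟨conv α ξ η, lp.ext (funext fun p => p.hom.map_conv ξ η)⟩
  smul_mem' := by
    rintro c _ ⟨ξ, rfl⟩
    exact ⟨c • ξ, lp.ext (funext fun p => map_smul p.hom.toFun c ξ)⟩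
  star_mem' := by
    rintro _ ⟨ξ, rfl⟩
    exact ⟨starSec ξ, lp.ext (funext fun p => p.hom.map_star ξ)⟩

variable (A) in
/-- The full section C*-algebra `C*(G, A)`: the Hausdorff completion of `C_c(G, A)` in the maximal
C*-seminorm that is bounded by the `I`-norm, that is, the enveloping C*-algebra. -/
def CStar : Type u := (univRange A α).topologicalClosure

instance : NonUnitalCStarAlgebra (CStar A α) :=
  NonUnitalStarSubalgebra.nonUnitalCStarAlgebra (univRange A α).topologicalClosure
    (h_closed := NonUnitalStarSubalgebra.isClosed_topologicalClosure _)

end FellBundle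
end ConvolutionAlgebra

end

section

section L2
open scoped ENNReal
attribute [local instance] CStarAlgebra.spectralOrder CStarAlgebra.spectralOrderedRing

variable {G : LCGroupoid.{u}} (A : FellBundle.{u} G) (α : HaarSystem G)

namespace FellBundle

variable {A} in
/-- The adjoint as a real-linear map. -/
def adjL {g g' : G.Arr} (i : G.inv g = g') : A.fib g →L[ℝ] A.fib g' where
  toFun a := A.adj i a
  map_add' a b := map_add _ a b
  map_smul' c a := by
    rw [← Complex.coe_smul, map_smulₛₗ, Complex.conj_ofReal, Complex.coe_smul]; rfl
  cont := (AddMonoidHomClass.isometry_of_norm (A.adj i) fun a => A.norm_adj i a).continuous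

variable {A} in
/-- Right multiplication as a real-linear map. -/
def mulRightL {g h k : G.Arr} (m : G.IsMul g h k) (b : A.fib h) : A.fib g →L[ℝ] A.fib k :=
  ((A.mulL m).flip b).restrictScalars ℝ

/-- The closed linear span of the products `a · b` for `a ∈ P`, `b ∈ Q`. -/
def prodSpan {g h k : G.Arr} (m : G.IsMul g h k) (P : Submodule ℂ (A.fib g))
    (Q : Submodule ℂ (A.fib h)) : Submodule ℂ (A.fib k) :=
  (Submodule.span ℂ {c | ∃ a ∈ P, ∃ b ∈ Q, c = A.mul m a b}).topologicalClosure

variable {A} {g h k g' h' k' l hl n : G.Arr}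

theorem isClosed_prodSpan (m : G.IsMul g h k) (P : Submodule ℂ (A.fib g))
    (Q : Submodule ℂ (A.fib h)) : IsClosed (A.prodSpan m P Q : Set (A.fib k)) :=
  Submodule.isClosed_topologicalClosure _

theorem mul_mem_prodSpan (m : G.IsMul g h k) {P : Submodule ℂ (A.fib g)}
    {Q : Submodule ℂ (A.fib h)} {a : A.fib g} {b : A.fib h} (ha : a ∈ P) (hb : b ∈ Q) :
    A.mul m a b ∈ A.prodSpan m P Q :=
  Submodule.le_topologicalClosure _ (Submodule.subset_span ⟨a, ha, b, hb, rfl⟩)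

theorem prodSpan_le {m : G.IsMul g h k} {P : Submodule ℂ (A.fib g)}
    {Q : Submodule ℂ (A.fib h)} {R : Submodule ℂ (A.fib k)} (hR : IsClosed (R : Set (A.fib k)))
    (H : ∀ a ∈ P, ∀ b ∈ Q, A.mul m a b ∈ R) : A.prodSpan m P Q ≤ R :=
  Submodule.topologicalClosure_minimal _
    (Submodule.span_le.2 (by rintro _ ⟨a, ha, b, hb, rfl⟩; exact H a ha b hb)) hR

theorem prodSpan_mono (m : G.IsMul g h k) {P P' : Submodule ℂ (A.fib g)}
    {Q Q' : Submodule ℂ (A.fib h)} (hP : P ≤ P') (hQ : Q ≤ Q') :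
    A.prodSpan m P Q ≤ A.prodSpan m P' Q' :=
  prodSpan_le (isClosed_prodSpan _ _ _) fun _ ha _ hb => mul_mem_prodSpan m (hP ha) (hQ hb)

theorem mul_right_mem {P : Submodule ℂ (A.fib g)} {Q : Submodule ℂ (A.fib h)}
    {R : Submodule ℂ (A.fib n)} (hR : IsClosed (R : Set (A.fib n)))
    (m : G.IsMul g h k) (m₂ : G.IsMul k l n) {t : A.fib k}
    (ht : t ∈ A.prodSpan m P Q) (c : A.fib l)
    (H : ∀ a ∈ P, ∀ b ∈ Q, A.mul m₂ (A.mul m a b) c ∈ R) : A.mul m₂ t c ∈ R := by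
  refine prodSpan_le (R := R.comap ((A.mul m₂).flip c)) ?_ H ht
  exact hR.preimage ((A.mulL m₂).flip c).continuous

theorem mul_left_mem {P : Submodule ℂ (A.fib g)} {Q : Submodule ℂ (A.fib h)}
    {R : Submodule ℂ (A.fib n)} (hR : IsClosed (R : Set (A.fib n)))
    (m : G.IsMul g h k) (m₂ : G.IsMul l k n) {t : A.fib k}
    (ht : t ∈ A.prodSpan m P Q) (c : A.fib l)
    (H : ∀ a ∈ P, ∀ b ∈ Q, A.mul m₂ c (A.mul m a b) ∈ R) : A.mul m₂ c t ∈ R := by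
  refine prodSpan_le (R := R.comap (A.mul m₂ c)) ?_ H ht
  exact hR.preimage (A.mulL m₂ c).continuous

/-- `(P Q) · c ⊆ P Q'` if `Q · c ⊆ Q'`. -/
theorem prodSpan_mul {P : Submodule ℂ (A.fib g)} {Q : Submodule ℂ (A.fib h)}
    {Q' : Submodule ℂ (A.fib hl)} (m : G.IsMul g h k) (m₂ : G.IsMul k l n) (m₃ : G.IsMul h l hl)
    (m₄ : G.IsMul g hl n) {t : A.fib k} (ht : t ∈ A.prodSpan m P Q) (c : A.fib l)
    (H : ∀ b ∈ Q, A.mul m₃ b c ∈ Q') : A.mul m₂ t c ∈ A.prodSpan m₄ P Q' :=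
  mul_right_mem (isClosed_prodSpan _ _ _) m m₂ ht c fun a ha b hb => by
    rw [A.mul_assoc m m₂ m₃ m₄]
    exact mul_mem_prodSpan m₄ ha (H b hb)

theorem adj_mem_prodSpan (m : G.IsMul g h k) (ih : G.inv h = g) (ik : G.inv k = k)
    {t : A.fib k} (ht : t ∈ A.prodSpan m ⊤ ⊤) : A.adj ik t ∈ A.prodSpan m ⊤ ⊤ := by
  have ig : G.inv g = h := by rw [← ih, LCGroupoid.inv_inv]
  refine prodSpan_le (R := (A.prodSpan m ⊤ ⊤).comap (A.adj ik)) ?_ (fun a _ b _ => ?_) ht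
  · refine (isClosed_prodSpan m ⊤ ⊤).preimage (f := fun a => A.adj ik a) ?_
    exact (AddMonoidHomClass.isometry_of_norm (A.adj ik) fun a => A.norm_adj ik a).continuous
  · change A.adj ik (A.mul m a b) ∈ A.prodSpan m ⊤ ⊤
    rw [A.adj_mul m m ig ih ik]
    exact mul_mem_prodSpan m trivial trivial

variable (A) in
/-- The closed ideal `A_g A_g^*` in the C*-algebra over the unit `u(x)`, `x = r(g)`. -/
def rangeIdeal (g : G.Arr) {x : G.Obj} (hx : G.r g = x) : Submodule ℂ (A.fib (G.u x)) :=
  A.prodSpan (LCGroupoid.isMul_self_inv hx) ⊤ ⊤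

variable (A) in
/-- The closed ideal `A_g A_h A_h^* A_g^*` in the C*-algebra over the unit `u(x)`, `x = r(g)`, for
`z = (g,h)`. -/
def idealI (z : G.Sq) {x : G.Obj} (hx : G.r (G.d1 z) = x) : Submodule ℂ (A.fib (G.u x)) :=
  A.prodSpan (LCGroupoid.isMul_self_inv hx) (A.prodSpan (LCGroupoid.isMul_sq z) ⊤ ⊤)
    (A.prodSpan (LCGroupoid.isMul_sq z).inv ⊤ ⊤)

theorem idealI_le_rangeIdeal_d1 (z : G.Sq) {x : G.Obj} (hx : G.r (G.d1 z) = x) :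
    A.idealI z hx ≤ A.rangeIdeal (G.d1 z) hx :=
  prodSpan_mono _ le_top le_top

theorem isMul_aux (z : G.Sq) : G.IsMul (G.d0 z) (G.inv (G.d1 z)) (G.inv (G.d2 z)) := by
  have := (LCGroupoid.isMul_sq z).inv.inv_mul_left
  rwa [LCGroupoid.inv_inv] at this

theorem idealI_le_rangeIdeal_d2 (z : G.Sq) {x : G.Obj} (hx : G.r (G.d1 z) = x)
    (hx' : G.r (G.d2 z) = x) : A.idealI z hx ≤ A.rangeIdeal (G.d2 z) hx' :=
  prodSpan_le (isClosed_prodSpan _ _ _) fun _ ha b _ =>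
    prodSpan_mul _ _ (isMul_aux z) _ ha b fun _ _ => trivial

theorem rangeIdeal_mul {g : G.Arr} {x : G.Obj} (hx : G.r g = x) {t : A.fib (G.u x)}
    (ht : t ∈ A.rangeIdeal g hx) (c : A.fib (G.u x)) : t * c ∈ A.rangeIdeal g hx :=
  prodSpan_mul _ _ (LCGroupoid.isMul_u_right (by rw [G.s_inv, hx])) _ ht c fun _ _ => trivial

theorem rangeIdeal_star {g : G.Arr} {x : G.Obj} (hx : G.r g = x) {t : A.fib (G.u x)}
    (ht : t ∈ A.rangeIdeal g hx) : star t ∈ A.rangeIdeal g hx :=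
  adj_mem_prodSpan _ (LCGroupoid.inv_inv g) _ ht

theorem mul_rangeIdeal {g : G.Arr} {x : G.Obj} (hx : G.r g = x) {t : A.fib (G.u x)}
    (ht : t ∈ A.rangeIdeal g hx) (c : A.fib (G.u x)) : c * t ∈ A.rangeIdeal g hx := by
  have := rangeIdeal_star hx (rangeIdeal_mul hx (rangeIdeal_star hx ht) (star c))
  rwa [star_mul, star_star, star_star] at this

theorem idealI_mul (z : G.Sq) {x : G.Obj} (hx : G.r (G.d1 z) = x) {t : A.fib (G.u x)}
    (ht : t ∈ A.idealI z hx) (c : A.fib (G.u x)) : t * c ∈ A.idealI z hx := by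
  have hs : G.s (G.inv (G.d1 z)) = x := by rw [G.s_inv, hx]
  have hs' : G.s (G.inv (G.d2 z)) = x := by rw [G.s_inv, ← LCGroupoid.r_d1, hx]
  exact prodSpan_mul _ _ (LCGroupoid.isMul_u_right hs) _ ht c fun b hb =>
    prodSpan_mul _ _ (LCGroupoid.isMul_u_right hs') _ hb c fun _ _ => trivial

variable (A)

/-- The C*-algebra `C₀(G⁰, A⁰)` is the algebra of sections of this family. -/
def unitFam : SubAlgFamily A G.Obj where
  q := .id _
  S _ := ⊤
  isClosed _ := isClosed_univ
  mul_mem _ _ _ _ _ := trivial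
  star_mem _ _ _ := trivial

/-- The C*-algebra `C₀(G, A A^*)` is the algebra of sections of this family. -/
def rangeFam : SubAlgFamily A G.Arr where
  q := G.r
  S g := A.rangeIdeal g rfl
  isClosed _ := isClosed_prodSpan _ _ _
  mul_mem _ _ b ha _ := rangeIdeal_mul rfl ha b
  star_mem _ _ ha := rangeIdeal_star rfl ha

end FellBundle

/-! ### The Hilbert modules `L²(Z, E, π, λ)` -/

/-- The data needed to define the Hilbert module `L²(Z, E, π, λ)`: an integration map along `π`, a family
of subspaces `E` of the pullback of the Fell bundle along a map `p : Z → G`, and a family of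
C*-algebras of coefficients over `Y`. -/
structure L2Data (A : FellBundle.{u} G) {Z Y : Type u} [TopologicalSpace Z] [TopologicalSpace Y]
    (π : C(Z, Y)) (S : SubAlgFamily A Y) where
  J : IntegralOp A π
  p : C(Z, G.Arr)
  E : ∀ z, Submodule ℂ (A.fib (p z))
  s_eq : ∀ z, G.s (p z) = S.q (π z)
  inner_mem : ∀ z, ∀ a ∈ E z, ∀ b ∈ E z,
    A.mul (LCGroupoid.isMul_inv_self (s_eq z)) (A.adj rfl a) b ∈ S.S (π z)
  smul_mem : ∀ z, ∀ a ∈ E z, ∀ b ∈ S.S (π z),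
    A.mul (LCGroupoid.isMul_u_right (s_eq z)) a b ∈ E z

namespace L2Data

variable {A} {Z Y : Type u} [TopologicalSpace Z] [TopologicalSpace Y]
    {π : C(Z, Y)} {S : SubAlgFamily A Y} (X : L2Data A π S)

/-- The space of compactly supported continuous sections of `E`. -/
def Sec : Type u := A.Cc X.p X.E

instance : AddCommGroup X.Sec := inferInstanceAs (AddCommGroup (A.Cc X.p X.E))
instance : Module ℂ X.Sec := inferInstanceAs (Module ℂ (A.Cc X.p X.E))

variable {X}

/-- The value of a section at a point. -/
def ev (f : X.Sec) (z : Z) : A.fib (X.p z) := Subtype.val (p := (· ∈ A.Cc X.p X.E)) f z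

theorem isCont_ev (f : X.Sec) : A.IsCont X.p (ev f) := (Subtype.property f).1
theorem exists_compact_ev (f : X.Sec) : ∃ K : Set Z, IsCompact K ∧ ∀ z ∉ K, ev f z = 0 :=
  (Subtype.property f).2.1
theorem ev_mem (f : X.Sec) (z : Z) : ev f z ∈ X.E z := (Subtype.property f).2.2 z

theorem sec_ext {f g : X.Sec} (h : ∀ z, ev f z = ev g z) : f = g := Subtype.ext (funext h)

variable (X) in
/-- Construct a section from a function. -/
def mkSec (f : ∀ z, A.fib (X.p z)) (h : A.IsCont X.p f)
    (h' : ∃ K : Set Z, IsCompact K ∧ ∀ z ∉ K, f z = 0) (h'' : ∀ z, f z ∈ X.E z) : X.Sec :=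
  ⟨f, h, h', h''⟩

/-- The section `z ↦ ⟨f(z), g(z)⟩ = f(z)^* g(z)`. -/
def ptInn (f g : X.Sec) : A.CcTop (S.label.comp π) :=
  ⟨fun z => A.mul (LCGroupoid.isMul_inv_self (X.s_eq z)) (A.adj rfl (ev f z)) (ev g z),
    FellBundle.isCont_mul (FellBundle.isCont_adj (isCont_ev f) _) (isCont_ev g) _, by
      obtain ⟨K, hK, hK0⟩ := exists_compact_ev f
      refine ⟨K, hK, fun z hz => ?_⟩
      change A.mul (LCGroupoid.isMul_inv_self (X.s_eq z)) (A.adj rfl (ev f z)) (ev g z) = 0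
      rw [hK0 z hz, map_zero, map_zero, LinearMap.zero_apply], fun _ => trivial⟩

/-- The inner product `⟨f, g⟩(y) = ∫ f(z)^* g(z) dλ_y(z)`. -/
def inner (f g : X.Sec) : S.C0 :=
  S.ofCc ⟨(X.J.int S.label (ptInn f g)).1, (X.J.int S.label (ptInn f g)).2.1,
    (X.J.int S.label (ptInn f g)).2.2.1, fun y =>
      X.J.mem S.label (fun y => (S.S y : Set (A.fib (G.u (S.q y)))))
        (fun y => (Submodule.convex ((S.S y).restrictScalars ℝ)))
        (fun y => S.isClosed y) (fun y => (S.S y).zero_mem)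
        (fun y c a _ ha => by
          have := (S.S y).smul_mem (c : ℂ) ha
          exact (congrArg (· ∈ S.S y) (Complex.coe_smul c a)).mp this)
        (ptInn f g) (fun z => X.inner_mem z _ (ev_mem f z) _ (ev_mem g z)) y⟩

theorem inner_apply (f g : X.Sec) (y : Y) :
    (inner f g).1 y = (X.J.int S.label (ptInn f g)).1 y := rfl

theorem inner_congr {f g f' g' : X.Sec} (h : ∀ z, (ptInn f g).1 z = (ptInn f' g').1 z) :
    inner f g = inner f' g' := SubAlgFamily.C0.ext fun y => by
  have h' : ptInn f g = ptInn f' g' := Subtype.ext (funext h)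
  rw [inner_apply, inner_apply, h']

/-- The right action of `C₀(Y, S)`: `(f · b)(z) = f(z) b(π(z))`. -/
def rsmul (f : X.Sec) (b : S.C0) : X.Sec :=
  X.mkSec (fun z => A.mul (LCGroupoid.isMul_u_right (X.s_eq z)) (ev f z) (b.1 (π z)))
    (FellBundle.isCont_mul (isCont_ev f) (b.2.1.comp π.continuous) _) (by
      obtain ⟨K, hK, hK0⟩ := exists_compact_ev f
      exact ⟨K, hK, fun z hz => by rw [hK0 z hz, map_zero, LinearMap.zero_apply]⟩)
    fun z => X.smul_mem z _ (ev_mem f z) _ (b.2.2.2 (π z))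

instance : PreHilbertModule S.C0 X.Sec where
  inn := inner
  rsmul := rsmul
  inn_add_right f g g' := SubAlgFamily.C0.ext fun y => by
    have h : ptInn f (g + g') = ptInn f g + ptInn f g' := Subtype.ext (funext fun z =>
      map_add (A.mul (LCGroupoid.isMul_inv_self (X.s_eq z)) (A.adj rfl (ev f z))) (ev g z) (ev g' z))
    rw [inner_apply, h, map_add]
    rfl
  inn_smul_right c f g := SubAlgFamily.C0.ext fun y => by
    have h : ptInn f (c • g) = c • ptInn f g := Subtype.ext (funext fun z =>
      map_smul (A.mul (LCGroupoid.isMul_inv_self (X.s_eq z)) (A.adj rfl (ev f z))) c (ev g z))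
    rw [inner_apply, h, map_smul]
    rfl
  star_inn f g := SubAlgFamily.C0.ext fun y => by
    refine (X.J.map S.label S.label (fun y => FellBundle.adjL (LCGroupoid.inv_u (S.q y)))
      (ptInn f g) (ptInn g f) (fun z => ?_) y).symm
    have h := A.adj_mul (LCGroupoid.isMul_inv_self (X.s_eq z))
      (LCGroupoid.isMul_inv_self (X.s_eq z)) (LCGroupoid.inv_inv _) rfl (LCGroupoid.inv_u _)
      (A.adj rfl (ev f z)) (ev g z)
    rw [A.adj_adj] at h
    exact h.symm
  inn_rsmul_right f g b := SubAlgFamily.C0.ext fun y => by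
    refine X.J.map S.label S.label
      (fun y => FellBundle.mulRightL (LCGroupoid.isMul_u (S.q y)) (b.1 y))
      (ptInn f g) (ptInn f (rsmul g b)) (fun z => ?_) y
    exact (A.mul_assoc (LCGroupoid.isMul_inv_self (X.s_eq z)) (LCGroupoid.isMul_u _)
      (LCGroupoid.isMul_u_right (X.s_eq z)) (LCGroupoid.isMul_inv_self (X.s_eq z))
      (A.adj rfl (ev f z)) (ev g z) (b.1 (π z))).symm
  inn_self_pos f := SubAlgFamily.C0.isPos fun y => by
    rw [isPos_iff]
    let P : ∀ y, Set (A.fib (G.u (S.q y))) := fun y => {a | 0 ≤ a}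
    refine X.J.mem S.label P (fun y => ?_) (fun y => ?_) (fun y => ?_) (fun y c a hc ha => ?_)
      (ptInn f f) (fun z => ?_) y
    · exact convex_Ici (𝕜 := ℝ) (0 : A.fib (G.u (S.q y)))
    · exact isClosed_Ici (a := (0 : A.fib (G.u (S.q y))))
    · exact le_refl (0 : A.fib (G.u (S.q y)))
    · exact smul_nonneg (β := A.fib (G.u (S.q y))) hc ha
    · have key : ∀ {g : G.Arr} {x : G.Obj} (hx : G.s g = x) (a : A.fib g),
          (0 : A.fib (G.u x)) ≤ A.mul (LCGroupoid.isMul_inv_self hx) (A.adj rfl a) a := by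
        rintro g _ rfl a
        obtain ⟨b, hb⟩ := A.exists_adj_mul_self g a
        rw [hb]
        exact star_mul_self_nonneg b
      exact key (X.s_eq z) (ev f z)

/-- Pointwise multiplication by sections of `C₀(Z, S')`. -/
def leftAction (S' : SubAlgFamily A Z) (hr : ∀ z, G.r (X.p z) = S'.q z)
    (hE : ∀ z, ∀ c ∈ S'.S z, ∀ a ∈ X.E z, A.mul (LCGroupoid.isMul_u_left (hr z)) c a ∈ X.E z) :
    LeftAction S'.C0 S.C0 X.Sec where
  act := LinearMap.mk₂ ℂ
    (fun c f => X.mkSec (fun z => A.mul (LCGroupoid.isMul_u_left (hr z)) (c.1 z) (ev f z))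
      (FellBundle.isCont_mul c.2.1 (isCont_ev f) _) (by
        obtain ⟨K, hK, hK0⟩ := exists_compact_ev f
        exact ⟨K, hK, fun z hz => by rw [hK0 z hz, map_zero]⟩)
      fun z => hE z _ (c.2.2.2 z) _ (ev_mem f z))
    (fun c d f => sec_ext fun z => (congrFun (congrArg DFunLike.coe
      (map_add (A.mul (LCGroupoid.isMul_u_left (hr z))) (c.1 z) (d.1 z))) (ev f z)))
    (fun t c f => sec_ext fun z => (congrFun (congrArg DFunLike.coe
      (map_smul (A.mul (LCGroupoid.isMul_u_left (hr z))) t (c.1 z))) (ev f z)))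
    (fun c f f' => sec_ext fun z => map_add (A.mul _ (c.1 z)) (ev f z) (ev f' z))
    (fun t c f => sec_ext fun z => map_smul (A.mul _ (c.1 z)) t (ev f z))
  act_mul c d f := sec_ext fun z => A.mul_assoc (LCGroupoid.isMul_u _) _ _
    (LCGroupoid.isMul_u_left (hr z)) (c.1 z) (d.1 z) (ev f z)
  adj c f g := by
    refine inner_congr fun z => ?_
    have m : G.IsMul (G.inv (X.p z)) (G.u (S'.q z)) (G.inv (X.p z)) :=
      LCGroupoid.isMul_u_right (by rw [G.s_inv, hr])
    exact (congrArg (fun t => A.mul (LCGroupoid.isMul_inv_self (X.s_eq z)) t (ev g z))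
      (A.adj_mul (LCGroupoid.isMul_u_left (hr z)) m (LCGroupoid.inv_u _) rfl rfl
        (c.1 z) (ev f z))).trans
      (A.mul_assoc m _ (LCGroupoid.isMul_u_left (hr z)) _ (A.adj rfl (ev f z)) (star (c.1 z))
        (ev g z))

end L2Data
end L2

end

section

section Representations
open PreHilbertModule

variable {G : LCGroupoid.{u}} (A : FellBundle.{u} G) (α : HaarSystem G)

namespace FellBundle
variable {A}

theorem adj_mul_mem_rangeIdeal {g k : G.Arr} {x : G.Obj} (hx : G.r g = x) (i : G.inv (G.u x) = k)
    (m : G.IsMul k (G.u x) (G.u x)) (a : A.fib (G.u x)) {b : A.fib (G.u x)}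
    (hb : b ∈ A.rangeIdeal g hx) : A.mul m (A.adj i a) b ∈ A.rangeIdeal g hx := by
  have hk : k = G.u x := by rw [← i, LCGroupoid.inv_u]
  subst hk
  exact mul_rangeIdeal hx hb (A.adj i a)

/-- `c x y a'` with `c ∈ A_{g⁻¹}`, `x ∈ A_g A_h`, `y ∈ A_{h⁻¹} A_{g⁻¹}` and `a' ∈ A_g`. -/
theorem mul_ideal1_mem (z : G.Sq) {c : A.fib (G.inv (G.d2 z))} {b : A.fib (G.d2 z)}
    (hb : b ∈ A.prodSpan (LCGroupoid.isMul_u_left rfl) (A.idealI z (LCGroupoid.r_d1 z)) ⊤) :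
    A.mul (LCGroupoid.isMul_inv_self (LCGroupoid.s_d2 z)) c b ∈ A.rangeIdeal (G.d0 z) rfl := by
  have m : G.IsMul (G.d2 z) (G.d0 z) (G.d1 z) := LCGroupoid.isMul_sq z
  have mi : G.IsMul (G.inv (G.d0 z)) (G.inv (G.d2 z)) (G.inv (G.d1 z)) := m.inv
  have hcl := isClosed_prodSpan (A := A) (LCGroupoid.isMul_self_inv (g := G.d0 z) rfl) ⊤ ⊤
  refine mul_left_mem hcl _ _ hb c fun t ht a' _ => ?_
  have m1 : G.IsMul (G.inv (G.d2 z)) (G.u (G.r (G.d2 z))) (G.inv (G.d2 z)) :=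
    LCGroupoid.isMul_u_right (G.s_inv _)
  rw [← A.mul_assoc m1 (LCGroupoid.isMul_inv_self (LCGroupoid.s_d2 z)) _ _]
  have m2 : G.IsMul (G.inv (G.d2 z)) (G.d1 z) (G.d0 z) := m.inv_mul_left
  have m3 : G.IsMul (G.d0 z) (G.inv (G.d1 z)) (G.inv (G.d2 z)) := isMul_aux z
  have m4 : G.IsMul (G.inv (G.d1 z)) (G.d2 z) (G.inv (G.d0 z)) := by
    have := m2.inv
    rwa [LCGroupoid.inv_inv] at this
  have h1 : A.mul m1 c t ∈ A.prodSpan m3 ⊤ ⊤ := by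
    refine mul_left_mem (isClosed_prodSpan _ _ _) _ m1 ht c fun x _ y _ => ?_
    rw [← A.mul_assoc m2 m3 _ _]
    exact mul_mem_prodSpan m3 trivial trivial
  exact prodSpan_mul _ _ m4 _ h1 a' fun _ _ => trivial

end FellBundle

/-! ### The Hilbert modules attached to a Fell bundle -/

open FellBundle LCGroupoid in
/-- `L²(G, A, s, α̃)`, a Hilbert module over `C₀(G⁰, A⁰)`. -/
def Xs : L2Data A G.s (unitFam A) where
  J := intS A α
  p := .id _
  E _ := ⊤
  s_eq _ := rfl
  inner_mem _ _ _ _ _ := trivial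
  smul_mem _ _ _ _ _ := trivial

open FellBundle LCGroupoid in
/-- `L²(G, A A^*, r, α)`, a Hilbert module over `C₀(G⁰, A⁰)`. -/
def Xr : L2Data A G.r (unitFam A) where
  J := intR A α
  p := G.u.comp G.r
  E g := A.rangeIdeal g rfl
  s_eq _ := G.s_u _
  inner_mem _ _ _ _ _ := trivial
  smul_mem _ _ ha b _ := rangeIdeal_mul rfl ha b

open FellBundle LCGroupoid in
/-- The family with fibres `A_g A_h A_h^* A_g^* A_g`. -/
def ideal1 (z : G.Sq) : Submodule ℂ (A.fib (G.d2 z)) :=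
  A.prodSpan (isMul_u_left rfl) (A.idealI z (r_d1 z)) ⊤

open FellBundle LCGroupoid in
/-- The family with fibres `A_g A_h A_h^* A_g^* A_{gh}`. -/
def ideal2 (z : G.Sq) : Submodule ℂ (A.fib (G.d1 z)) :=
  A.prodSpan (isMul_u_left rfl) (A.idealI z rfl) ⊤

open FellBundle LCGroupoid in
/-- `L²(G², E₀, v₀, μ₀)` with `v₀(g,h) = r(g)` and `E₀` the family of ideals `A_g A_h A_h^* A_g^*`,
a Hilbert module over `C₀(G⁰, A⁰)`. -/
def W0 : L2Data A (G.r.comp G.d2) (unitFam A) where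
  J := (intR A α).comp (lam2 A α)
  p := G.u.comp (G.r.comp G.d2)
  E z := A.idealI z (r_d1 z)
  s_eq _ := G.s_u _
  inner_mem _ _ _ _ _ := trivial
  smul_mem z _ ha b _ := idealI_mul z _ ha b

open FellBundle LCGroupoid in
/-- `L²(G², E₁, v₁, μ₁)` with `v₁(g,h) = s(g)`, a Hilbert module over `C₀(G⁰, A⁰)`. -/
def W1 : L2Data A (G.s.comp G.d2) (unitFam A) where
  J := (intS A α).comp (lam2 A α)
  p := G.d2
  E := ideal1 A
  s_eq _ := rfl
  inner_mem _ _ _ _ _ := trivial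
  smul_mem _ _ ha b _ := prodSpan_mul _ _ (isMul_u_right rfl) _ ha b fun _ _ => trivial

open FellBundle LCGroupoid in
/-- `L²(G², E₂, v₂, μ₂)` with `v₂(g,h) = s(h)`, a Hilbert module over `C₀(G⁰, A⁰)`. -/
def W2 : L2Data A (G.s.comp G.d0) (unitFam A) where
  J := (intS A α).comp (lam0 A α)
  p := G.d1
  E := ideal2 A
  s_eq := s_d1
  inner_mem _ _ _ _ _ := trivial
  smul_mem z _ ha b _ := prodSpan_mul _ _ (isMul_u_right (s_d1 z)) _ ha b fun _ _ => trivial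

open FellBundle LCGroupoid in
/-- `L²(G², E₀, d₁, λ₁)`, a Hilbert module over `C₀(G, A A^*)`. -/
def Y1 : L2Data A G.d1 (rangeFam A) where
  J := lam1 A α
  p := G.u.comp (G.r.comp G.d1)
  E z := A.idealI z rfl
  s_eq _ := G.s_u _
  inner_mem z a _ _ hb :=
    adj_mul_mem_rangeIdeal rfl rfl _ a (idealI_le_rangeIdeal_d1 z rfl hb)
  smul_mem z _ ha b _ := idealI_mul z _ ha b

open FellBundle LCGroupoid in
/-- `L²(G², E₀, d₂, λ₂)`, a Hilbert module over `C₀(G, A A^*)`. -/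
def Y2 : L2Data A G.d2 (rangeFam A) where
  J := lam2 A α
  p := G.u.comp (G.r.comp G.d2)
  E z := A.idealI z (r_d1 z)
  s_eq _ := G.s_u _
  inner_mem z a _ _ hb :=
    adj_mul_mem_rangeIdeal rfl rfl _ a (idealI_le_rangeIdeal_d2 z _ rfl hb)
  smul_mem z _ ha b _ := idealI_mul z _ ha b

open FellBundle LCGroupoid in
/-- `L²(G², E₁, d₀, λ₀)`, a Hilbert module over `C₀(G, A A^*)`. -/
def Y0 : L2Data A G.d0 (rangeFam A) where
  J := lam0 A α
  p := G.d2
  E := ideal1 A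
  s_eq := s_d2
  inner_mem z _ _ _ hb := mul_ideal1_mem z hb
  smul_mem z _ ha b _ :=
    prodSpan_mul _ _ (isMul_u_right (s_d2 z)) _ ha b fun _ _ => trivial

open FellBundle LCGroupoid in
/-- The left action of `C₀(G, A A^*)` on `L²(G, A, s, α̃)`. -/
def actS : LeftAction (rangeFam A).C0 (unitFam A).C0 (Xs A α).Sec :=
  L2Data.leftAction (rangeFam A) (fun _ => rfl) fun _ _ _ _ _ => trivial

open FellBundle LCGroupoid in
/-- The left action of `C₀(G, A A^*)` on `L²(G, A A^*, r, α)`. -/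
def actR : LeftAction (rangeFam A).C0 (unitFam A).C0 (Xr A α).Sec :=
  L2Data.leftAction (rangeFam A) (fun _ => G.r_u _) fun _ _ hc a _ => rangeIdeal_mul rfl hc a

/-! ### Representations of Fell bundles -/

/-- A nondegenerate representation of a C*-algebra `C` on a Hilbert `D`-module `F`. -/
@[ext]
structure NondegRep (C D F : Type u) [NonUnitalCStarAlgebra C] [NonUnitalCStarAlgebra D]
    [NormedAddCommGroup F] [NormedSpace ℂ F] [HilbertModule D F] extends LeftAction C D F where
  nondeg : toLeftAction.IsNondegenerate

/-- The composite of a nondegenerate representation with an isomorphism of C*-algebras. -/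
def NondegRep.comp {C C' D F : Type u} [NonUnitalCStarAlgebra C] [NonUnitalCStarAlgebra C']
    [NonUnitalCStarAlgebra D] [NormedAddCommGroup F] [NormedSpace ℂ F] [HilbertModule D F]
    (ρ : NondegRep C D F) (θ : C' ≃⋆ₐ[ℂ] C) : NondegRep C' D F where
  toLeftAction := ρ.toLeftAction.comp (θ : C' →⋆ₙₐ[ℂ] C)
  nondeg := by
    have h := ρ.nondeg
    have e : (Set.range fun p : C' × F => (ρ.toLeftAction.comp (θ : C' →⋆ₙₐ[ℂ] C)).act p.1 p.2)
        = Set.range fun p : C × F => ρ.act p.1 p.2 := by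
      ext v
      constructor
      · rintro ⟨p, rfl⟩
        exact ⟨(θ p.1, p.2), rfl⟩
      · rintro ⟨p, rfl⟩
        refine ⟨(θ.symm p.1, p.2), ?_⟩
        change ρ.act (θ (θ.symm p.1)) p.2 = ρ.act p.1 p.2
        rw [StarAlgEquiv.apply_symm_apply]
    rw [LeftAction.IsNondegenerate] at h ⊢
    rw [e]
    exact h


/-- The canonical unitary `L²(Z,E,d,λ) ⊗ (L²(G,E',π,μ) ⊗_φ F) ≅ L²(Z,E'',π d,μ λ) ⊗_φ F`: it maps
`y ⊗ (x ⊗ ξ)` to `w ⊗ ξ`, where `w(z) = y(z) x(d(z))`. -/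
def IsCanonical {A : FellBundle.{u} G} {D F : Type u} [NonUnitalCStarAlgebra D]
    [NormedAddCommGroup F] [NormedSpace ℂ F] [HilbertModule D F]
    (φ : LeftAction (FellBundle.unitFam A).C0 D F)
    {π : C(G.Arr, G.Obj)} {d : C(G.Sq, G.Arr)} {ρ : C(G.Sq, G.Obj)}
    (X : L2Data A π (FellBundle.unitFam A))
    (act : LeftAction (FellBundle.rangeFam A).C0 (FellBundle.unitFam A).C0 X.Sec)
    (Y : L2Data A d (FellBundle.rangeFam A)) (W : L2Data A ρ (FellBundle.unitFam A))
    (m : ∀ z, G.IsMul (Y.p z) (X.p (d z)) (W.p z))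
    (γ : Unitary D ((φ.leftTensor act).Tensor Y.Sec) (φ.Tensor W.Sec)) : Prop :=
  ∀ (y : Y.Sec) (x : X.Sec) (w : W.Sec),
    (∀ z, L2Data.ev w z = A.mul (m z) (L2Data.ev y z) (L2Data.ev x (d z))) →
      ∀ ξ : F, γ.toEquiv ((φ.leftTensor act).tens y (φ.tens x ξ)) = φ.tens w ξ

theorem isMul_Y0Xr (z : G.Sq) : G.IsMul ((Y0 A α).p z) ((Xr A α).p (G.d0 z)) ((W1 A α).p z) :=
  LCGroupoid.isMul_u_right (LCGroupoid.s_d2 z)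

theorem isMul_Y0Xs (z : G.Sq) : G.IsMul ((Y0 A α).p z) ((Xs A α).p (G.d0 z)) ((W2 A α).p z) :=
  LCGroupoid.isMul_sq z

theorem isMul_Y1Xs (z : G.Sq) : G.IsMul ((Y1 A α).p z) ((Xs A α).p (G.d1 z)) ((W2 A α).p z) :=
  LCGroupoid.isMul_u_left rfl

theorem isMul_Y1Xr (z : G.Sq) : G.IsMul ((Y1 A α).p z) ((Xr A α).p (G.d1 z)) ((W0 A α).p z) :=
  ⟨(LCGroupoid.isMul_u _).1, (LCGroupoid.isMul_u _).2.trans (congrArg G.u (LCGroupoid.r_d1 z))⟩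

theorem isMul_Y2Xs (z : G.Sq) : G.IsMul ((Y2 A α).p z) ((Xs A α).p (G.d2 z)) ((W1 A α).p z) :=
  LCGroupoid.isMul_u_left rfl

theorem isMul_Y2Xr (z : G.Sq) : G.IsMul ((Y2 A α).p z) ((Xr A α).p (G.d2 z)) ((W0 A α).p z) :=
  LCGroupoid.isMul_u _

section
variable {A} {D F : Type u} [NonUnitalCStarAlgebra D] [NormedAddCommGroup F]
    [NormedSpace ℂ F] [HilbertModule D F] (φ : LeftAction (FellBundle.unitFam A).C0 D F)

/-- The left action of `C₀(G, A A^*)` on `L²(G, A, s, α̃) ⊗_φ F`. -/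
abbrev leftS : LeftAction (FellBundle.rangeFam A).C0 D (φ.Tensor (Xs A α).Sec) :=
  φ.leftTensor (actS A α)

/-- The left action of `C₀(G, A A^*)` on `L²(G, A A^*, r, α) ⊗_φ F`. -/
abbrev leftR : LeftAction (FellBundle.rangeFam A).C0 D (φ.Tensor (Xr A α).Sec) :=
  φ.leftTensor (actR A α)

/-- The operator `U` intertwines the left actions of `C₀(G, A A^*)`. -/
def IsEquivariant (U : Unitary D (φ.Tensor (Xs A α).Sec) (φ.Tensor (Xr A α).Sec)) : Prop :=
  ∀ c t, U.toEquiv ((leftS α φ).act c t) = (leftR α φ).act c (U.toEquiv t)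

/-- A unitary operator `L²(G, A, s, α̃) ⊗_φ F → L²(G, A A^*, r, α) ⊗_φ F` that intertwines the left
actions of `C₀(G, A A^*)`. -/
structure FellUnitary extends Unitary D (φ.Tensor (Xs A α).Sec) (φ.Tensor (Xr A α).Sec) where
  intertwines : IsEquivariant α φ toUnitary

end

namespace FellUnitary

variable {A α} {D F : Type u} [NonUnitalCStarAlgebra D] [NormedAddCommGroup F]
    [NormedSpace ℂ F] [HilbertModule D F]
    {φ : LeftAction (FellBundle.unitFam A).C0 D F} (U : FellUnitary α φ)

/-- The operator `1 ⊗ U` on `L²(G²,E,d,λ) ⊗ L²(G,A,s,α̃) ⊗_φ F`. -/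
def oneU {d : C(G.Sq, G.Arr)} (Y : L2Data A d (FellBundle.rangeFam A)) :
    (leftS α φ).Tensor Y.Sec →L[ℂ] (leftR α φ).Tensor Y.Sec :=
  LeftAction.mapRight Y.Sec (leftS α φ) (leftR α φ) U.toEquiv.toLinearMap U.inn_map U.intertwines

/-- The operator `d^*(U)`, obtained from `1 ⊗ U` through unitaries `γ`, `γ'`. -/
def pullU {d : C(G.Sq, G.Arr)} {Y : L2Data A d (FellBundle.rangeFam A)} {ρ ρ' : C(G.Sq, G.Obj)}
    {W : L2Data A ρ (FellBundle.unitFam A)} {W' : L2Data A ρ' (FellBundle.unitFam A)}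
    (γ : Unitary D ((leftS α φ).Tensor Y.Sec) (φ.Tensor W.Sec))
    (γ' : Unitary D ((leftR α φ).Tensor Y.Sec) (φ.Tensor W'.Sec)) (t : φ.Tensor W.Sec) :
    φ.Tensor W'.Sec :=
  γ'.toEquiv (U.oneU Y (γ.toEquiv.symm t))

/-- `d₂^*(U) d₀^*(U) = d₁^*(U)`, where `d_i^*(U)` is defined by the canonical unitaries. -/
def IsCoherent : Prop :=
  ∃ (γ₀s : Unitary D ((leftS α φ).Tensor (Y0 A α).Sec) (φ.Tensor (W2 A α).Sec))
    (γ₀r : Unitary D ((leftR α φ).Tensor (Y0 A α).Sec) (φ.Tensor (W1 A α).Sec))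
    (γ₁s : Unitary D ((leftS α φ).Tensor (Y1 A α).Sec) (φ.Tensor (W2 A α).Sec))
    (γ₁r : Unitary D ((leftR α φ).Tensor (Y1 A α).Sec) (φ.Tensor (W0 A α).Sec))
    (γ₂s : Unitary D ((leftS α φ).Tensor (Y2 A α).Sec) (φ.Tensor (W1 A α).Sec))
    (γ₂r : Unitary D ((leftR α φ).Tensor (Y2 A α).Sec) (φ.Tensor (W0 A α).Sec)),
    IsCanonical φ (Xs A α) (actS A α) (Y0 A α) (W2 A α) (isMul_Y0Xs A α) γ₀s ∧
    IsCanonical φ (Xr A α) (actR A α) (Y0 A α) (W1 A α) (isMul_Y0Xr A α) γ₀r ∧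
    IsCanonical φ (Xs A α) (actS A α) (Y1 A α) (W2 A α) (isMul_Y1Xs A α) γ₁s ∧
    IsCanonical φ (Xr A α) (actR A α) (Y1 A α) (W0 A α) (isMul_Y1Xr A α) γ₁r ∧
    IsCanonical φ (Xs A α) (actS A α) (Y2 A α) (W1 A α) (isMul_Y2Xs A α) γ₂s ∧
    IsCanonical φ (Xr A α) (actR A α) (Y2 A α) (W0 A α) (isMul_Y2Xr A α) γ₂r ∧
    ∀ t, U.pullU γ₂s γ₂r (U.pullU γ₀s γ₀r t) = U.pullU γ₁s γ₁r t

end FellUnitary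

/-- A representation `(φ, U)` of the Fell bundle on the Hilbert `D`-module `F`. -/
structure FellRep (D F : Type u) [NonUnitalCStarAlgebra D] [NormedAddCommGroup F]
    [NormedSpace ℂ F] [HilbertModule D F] where
  φ : LeftAction (FellBundle.unitFam A).C0 D F
  nondeg : φ.IsNondegenerate
  U : FellUnitary α φ
  coherent : U.IsCoherent

/-! ### Intertwiners and tensor products with C*-correspondences -/

section Naturality

variable {A α} {C D F F₁ F₂ : Type u} [NonUnitalCStarAlgebra C] [NonUnitalCStarAlgebra D]
    [NormedAddCommGroup F] [NormedSpace ℂ F] [HilbertModule D F]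
    [NormedAddCommGroup F₁] [NormedSpace ℂ F₁] [HilbertModule D F₁]
    [NormedAddCommGroup F₂] [NormedSpace ℂ F₂] [HilbertModule D F₂]

/-- The linear map `V` intertwines two representations of `C`. -/
def NondegRep.Intertwines (L₁ : NondegRep C D F₁) (L₂ : NondegRep C D F₂) (V : F₁ →ₗ[ℂ] F₂) :
    Prop := ∀ c v, V (L₁.act c v) = L₂.act c (V v)

/-- The isometry `V` intertwines two representations of the Fell bundle: it intertwines `φ₁` and
`φ₂`, and `(1 ⊗ V) U₁ = U₂ (1 ⊗ V)`. -/
def FellRep.Intertwines (R₁ : FellRep A α D F₁) (R₂ : FellRep A α D F₂) (V : F₁ →ₗ[ℂ] F₂)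
    (hV : ∀ x y, (inn (V x) (V y) : D) = inn x y) : Prop :=
  ∃ h : ∀ b v, V (R₁.φ.act b v) = R₂.φ.act b (V v), ∀ t,
    LeftAction.mapRight (Xr A α).Sec R₁.φ R₂.φ V hV h (R₁.U.toEquiv t)
      = R₂.U.toEquiv (LeftAction.mapRight (Xs A α).Sec R₁.φ R₂.φ V hV h t)

variable {D' E : Type u} [NonUnitalCStarAlgebra D'] [NormedAddCommGroup E] [NormedSpace ℂ E]
    [HilbertModule D' E]

/-- `L'` is the representation `L ⊗ 1` on `F ⊗_D E`, for a nondegenerate representation of `D` on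
a Hilbert `D'`-module `E`, that is, a C*-correspondence `E` from `D` to `D'`. -/
def NondegRep.IsInduced (ψ : NondegRep D D' E) (L : NondegRep C D F)
    (L' : NondegRep C D' (ψ.toLeftAction.Tensor F)) : Prop :=
  L'.toLeftAction = ψ.toLeftAction.leftTensor L.toLeftAction

/-- `κ` is the canonical unitary `(X ⊗_φ F) ⊗_D E ≅ X ⊗_φ' (F ⊗_D E)`. -/
def IsAssociator {B X : Type u} [NonUnitalCStarAlgebra B] [AddCommGroup X] [Module ℂ X]
    [PreHilbertModule B X] (ψ : LeftAction D D' E) (φ : LeftAction B D F)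
    (φ' : LeftAction B D' (ψ.Tensor F))
    (κ : Unitary D' (ψ.Tensor (φ.Tensor X)) (φ'.Tensor X)) : Prop :=
  ∀ (x : X) (v : F) (e : E), κ.toEquiv (ψ.tens (φ.tens x v) e) = φ'.tens x (ψ.tens v e)

/-- `R'` is the representation `(φ ⊗ 1, U ⊗ 1)` on `F ⊗_D E`. -/
def FellRep.IsInduced (ψ : NondegRep D D' E) (R : FellRep A α D F)
    (R' : FellRep A α D' (ψ.toLeftAction.Tensor F)) : Prop :=
  R'.φ = ψ.toLeftAction.leftTensor R.φ ∧
  ∃ (κs : Unitary D' (ψ.toLeftAction.Tensor (R.φ.Tensor (Xs A α).Sec)) (R'.φ.Tensor (Xs A α).Sec))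
    (κr : Unitary D' (ψ.toLeftAction.Tensor (R.φ.Tensor (Xr A α).Sec)) (R'.φ.Tensor (Xr A α).Sec)),
    IsAssociator ψ.toLeftAction R.φ R'.φ κs ∧ IsAssociator ψ.toLeftAction R.φ R'.φ κr ∧
    ∀ t, κr.toEquiv (LeftAction.mapLeft ψ.toLeftAction R.U.toEquiv.toLinearMap R.U.inn_map t)
      = R'.U.toEquiv (κs.toEquiv t)

end Naturality

/-- A family of bijections between the nondegenerate representations of `C` on Hilbert modules and
the representations of the Fell bundle on the same Hilbert modules. -/
def RepBij (C : Type u) [NonUnitalCStarAlgebra C] : Type (u + 1) :=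
  ∀ (D F : Type u) [NonUnitalCStarAlgebra D] [NormedAddCommGroup F] [NormedSpace ℂ F]
    [HilbertModule D F], NondegRep C D F ≃ FellRep A α D F

/-- Naturality for isometric intertwiners and for tensoring with C*-correspondences. -/
structure RepBij.IsNatural {A : FellBundle.{u} G} {α : HaarSystem G} {C : Type u}
    [NonUnitalCStarAlgebra C] (Φ : RepBij A α C) : Prop where
  intertwiner : ∀ (D F₁ F₂ : Type u) [NonUnitalCStarAlgebra D]
    [NormedAddCommGroup F₁] [NormedSpace ℂ F₁] [HilbertModule D F₁]
    [NormedAddCommGroup F₂] [NormedSpace ℂ F₂] [HilbertModule D F₂]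
    (L₁ : NondegRep C D F₁) (L₂ : NondegRep C D F₂) (V : F₁ →ₗ[ℂ] F₂)
    (hV : ∀ x y, (inn (V x) (V y) : D) = inn x y),
    L₁.Intertwines L₂ V ↔ (Φ D F₁ L₁).Intertwines (Φ D F₂ L₂) V hV
  tensor : ∀ (D D' F E : Type u) [NonUnitalCStarAlgebra D] [NonUnitalCStarAlgebra D']
    [NormedAddCommGroup F] [NormedSpace ℂ F] [HilbertModule D F]
    [NormedAddCommGroup E] [NormedSpace ℂ E] [HilbertModule D' E]
    (ψ : NondegRep D D' E) (L : NondegRep C D F) (L' : NondegRep C D' (ψ.toLeftAction.Tensor F)),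
    NondegRep.IsInduced ψ L L' →
      FellRep.IsInduced ψ (Φ D F L) (Φ D' (ψ.toLeftAction.Tensor F) L')

end Representations

end

end
end FellUniv

namespace FellUniv
noncomputable section
open scoped TensorProduct Topology
open MeasureTheory Filter PreHilbertModule

section HilbertTools

/-- A family of vectors whose linear span is dense. -/
def IsTotal {ι H : Type*} [NormedAddCommGroup H] [NormedSpace ℂ H] (e : ι → H) : Prop :=
  Dense (Submodule.span ℂ (Set.range e) : Set H)

namespace IsTotal

variable {ι H H' : Type*} [NormedAddCommGroup H] [NormedSpace ℂ H] [NormedAddCommGroup H']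
  [NormedSpace ℂ H'] {e : ι → H}

theorem clm_ext (he : IsTotal e) {S T : H →L[ℂ] H'} (h : ∀ i, S (e i) = T (e i)) : S = T :=
  ContinuousLinearMap.ext_on he (by rintro _ ⟨i, rfl⟩; exact h i)

theorem of_forall_mem_closure (he : IsTotal e) {ι' : Type*} {f : ι' → H}
    (h : ∀ i, e i ∈ (Submodule.span ℂ (Set.range f)).topologicalClosure) : IsTotal f := by
  rw [IsTotal, Submodule.dense_iff_topologicalClosure_eq_top] at he ⊢
  rw [← top_le_iff, ← he]
  refine Submodule.topologicalClosure_minimal _ (Submodule.span_le.2 ?_)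
    (Submodule.isClosed_topologicalClosure _)
  rintro _ ⟨i, rfl⟩
  exact h i

theorem of_forall_exists (he : IsTotal e) {ι' : Type*} {f : ι' → H} (h : ∀ i, ∃ j, f j = e i) :
    IsTotal f :=
  he.of_forall_mem_closure fun i =>
    Submodule.le_topologicalClosure _ (Submodule.subset_span (h i))

theorem mem_closure (he : IsTotal e) (x : H) :
    x ∈ (Submodule.span ℂ (Set.range e)).topologicalClosure := by
  rw [IsTotal, Submodule.dense_iff_topologicalClosure_eq_top] at he
  rw [he]; trivial

theorem mem_of_isClosed (he : IsTotal e) {S : Submodule ℂ H} (hS : IsClosed (S : Set H))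
    (h : ∀ i, e i ∈ S) (x : H) : x ∈ S :=
  Submodule.topologicalClosure_minimal _ (Submodule.span_le.2 (by rintro _ ⟨i, rfl⟩; exact h i))
    hS (he.mem_closure x)

end IsTotal

theorem LeftAction.isNondegenerate_iff {C D F : Type*} [NonUnitalCStarAlgebra C]
    [NonUnitalCStarAlgebra D] [NormedAddCommGroup F] [NormedSpace ℂ F] [PreHilbertModule D F]
    (φ : LeftAction C D F) :
    φ.IsNondegenerate ↔ IsTotal fun p : C × F => φ.act p.1 p.2 :=
  Submodule.dense_iff_topologicalClosure_eq_top.symm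

namespace HilbertModule

variable {D F : Type*} [NonUnitalCStarAlgebra D] [NormedAddCommGroup F] [NormedSpace ℂ F]
  [HilbertModule D F]

variable (D) in
theorem norm_eq (x : F) : ‖x‖ = √‖(inn x x : D)‖ := by
  rw [← norm_sq_eq, Real.sqrt_sq (norm_nonneg _)]

theorem norm_inn_le (x y : F) : ‖(inn x y : D)‖ ≤ ‖x‖ * ‖y‖ := by
  rw [norm_eq D x, norm_eq D y]; exact PreHilbertModule.norm_inn_le x y

variable (D F) in
/-- The inner product as a continuous sesquilinear map. -/
def innL : F →L⋆[ℂ] F →L[ℂ] D :=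
  LinearMap.mkContinuous₂ (innₗ D F) 1 fun x y => by rw [one_mul]; exact norm_inn_le x y

theorem innL_apply (x y : F) : innL D F x y = (inn x y : D) := rfl

variable (D F) in
theorem continuous_inn : Continuous fun p : F × F => (inn p.1 p.2 : D) := by
  exact ((innL D F).continuous.comp continuous_fst).clm_apply continuous_snd

theorem ext_total {ι : Type*} {e : ι → F} (he : IsTotal e) {x y : F}
    (h : ∀ i, (inn (e i) x : D) = inn (e i) y) : x = y := by
  refine ext_inn (D := D) fun z => ?_
  have h1 : ∀ i, (inn x (e i) : D) = inn y (e i) := fun i => by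
    rw [← star_inn, h, star_inn]
  have := he.clm_ext (S := innL D F x) (T := innL D F y) h1
  rw [← star_inn, ← innL_apply x z, this, innL_apply, star_inn]

theorem norm_le_of_inn {F' : Type*} [NormedAddCommGroup F'] [NormedSpace ℂ F'] [HilbertModule D F']
    {T : F → F'} {S : F' → F} (h : ∀ x y, (inn (T x) y : D) = inn x (S y)) {c : ℝ} (hc : 0 ≤ c)
    (hT : ∀ x, ‖T x‖ ≤ c * ‖x‖) (y : F') : ‖S y‖ ≤ c * ‖y‖ := by
  rcases (norm_nonneg (S y)).eq_or_lt with h0 | h0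
  · rw [← h0]; positivity
  have h1 : ‖S y‖ ^ 2 ≤ (c * ‖S y‖) * ‖y‖ := by
    rw [norm_sq_eq (D := D), ← h]
    exact (norm_inn_le _ _).trans (mul_le_mul_of_nonneg_right (hT _) (norm_nonneg _))
  nlinarith

end HilbertModule

namespace Unitary

variable {D H H' : Type*} [NonUnitalCStarAlgebra D] [NormedAddCommGroup H] [NormedSpace ℂ H]
  [HilbertModule D H] [NormedAddCommGroup H'] [NormedSpace ℂ H'] [HilbertModule D H']

theorem norm_map (U : Unitary D H H') (x : H) : ‖U.toEquiv x‖ = ‖x‖ := by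
  rw [HilbertModule.norm_eq D, HilbertModule.norm_eq D x, U.inn_map]

/-- A unitary operator as a linear isometry. -/
def toIso (U : Unitary D H H') : H ≃ₗᵢ[ℂ] H' := ⟨U.toEquiv, U.norm_map⟩

theorem inn_symm (U : Unitary D H H') (x : H') (y : H) :
    (inn (U.toEquiv.symm x) y : D) = inn x (U.toEquiv y) := by
  rw [← U.inn_map, LinearEquiv.apply_symm_apply]

theorem inn_symm_right (U : Unitary D H H') (x : H) (y : H') :
    (inn x (U.toEquiv.symm y) : D) = inn (U.toEquiv x) y := by
  rw [← U.inn_map, LinearEquiv.apply_symm_apply]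

theorem ext_total {ι : Type*} {e : ι → H} (he : IsTotal e) {U V : Unitary D H H'}
    (h : ∀ i, U.toEquiv (e i) = V.toEquiv (e i)) : U = V := by
  have : (U.toIso : H →L[ℂ] H') = V.toIso := he.clm_ext h
  exact Unitary.ext (LinearEquiv.ext fun x => congrArg (fun T : H →L[ℂ] H' => T x) this)

/-- A map with dense domain that preserves the inner products and has dense range extends to
a unitary operator. -/
theorem exists_of_dense {V : Type*} [AddCommGroup V] [Module ℂ V] (e : V →ₗ[ℂ] H)
    (f : V →ₗ[ℂ] H') (h : ∀ v w, (inn (e v) (e w) : D) = inn (f v) (f w)) (he : DenseRange e)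
    (hf : DenseRange f) : ∃ U : Unitary D H H', ∀ v, U.toEquiv (e v) = f v := by
  have := HilbertModule.complete (D := D) (F := H)
  have := HilbertModule.complete (D := D) (F := H')
  have h1 : ∀ v, ‖f v‖ ≤ 1 * ‖e v‖ := fun v => by
    rw [HilbertModule.norm_eq D, HilbertModule.norm_eq D (e v), h, one_mul]
  have h2 : ∀ v, ‖e v‖ ≤ 1 * ‖f v‖ := fun v => by
    rw [HilbertModule.norm_eq D, HilbertModule.norm_eq D (f v), h, one_mul]
  set S := f.extendOfNorm e
  set T := e.extendOfNorm f
  have hS : ∀ v, S (e v) = f v := LinearMap.extendOfNorm_eq he ⟨1, h1⟩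
  have hT : ∀ v, T (f v) = e v := LinearMap.extendOfNorm_eq hf ⟨1, h2⟩
  have hTS : ∀ x, T (S x) = x := fun x => he.induction_on x
    (isClosed_eq (T.continuous.comp S.continuous) continuous_id) fun v => by rw [hS, hT]
  have hST : ∀ x, S (T x) = x := fun x => hf.induction_on x
    (isClosed_eq (S.continuous.comp T.continuous) continuous_id) fun v => by rw [hT, hS]
  refine ⟨⟨LinearEquiv.ofLinearMap S.toLinearMap T.toLinearMap (LinearMap.ext hST)
    (LinearMap.ext hTS), fun x y => ?_⟩, hS⟩
  change (inn (S x) (S y) : D) = inn x y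
  have hc := HilbertModule.continuous_inn D H
  have hc' := HilbertModule.continuous_inn D H'
  refine he.induction_on₂ (p := fun x y => (inn (S x) (S y) : D) = inn x y) ?_ ?_ x y
  · exact isClosed_eq (hc'.comp ((S.continuous.comp continuous_fst).prodMk
      (S.continuous.comp continuous_snd))) hc
  · intro v w
    rw [hS, hS, h]

theorem exists_of_gram {ι : Type*} {e : ι → H} {f : ι → H'}
    (h : ∀ i j, (inn (e i) (e j) : D) = inn (f i) (f j)) (he : IsTotal e) (hf : IsTotal f) :
    ∃ U : Unitary D H H', ∀ i, U.toEquiv (e i) = f i := by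
  obtain ⟨U, hU⟩ := exists_of_dense (D := D) (Finsupp.linearCombination ℂ e)
    (Finsupp.linearCombination ℂ f) (fun v w => by
      simp only [Finsupp.linearCombination_apply, Finsupp.sum, inn_sum_left, inn_sum_right,
        inn_smul_left, inn_smul_right, h])
    (by rw [DenseRange, ← LinearMap.coe_range, Finsupp.range_linearCombination]; exact he)
    (by rw [DenseRange, ← LinearMap.coe_range, Finsupp.range_linearCombination]; exact hf)
  exact ⟨U, fun i => by simpa using hU (Finsupp.single i 1)⟩

end Unitary

namespace LeftAction

section Transport

variable {C D V F : Type*} [NonUnitalCStarAlgebra C] [NonUnitalCStarAlgebra D]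
  [AddCommGroup V] [Module ℂ V] [PreHilbertModule D V] [NormedAddCommGroup F] [NormedSpace ℂ F]
  [HilbertModule D F]

/-- The representation by bounded operators. -/
def op (φ : LeftAction C D F) (c : C) : F →L[ℂ] F :=
  (φ.act c).mkContinuous ‖c‖ fun v => by
    rw [HilbertModule.norm_eq D, HilbertModule.norm_eq D v]; exact φ.norm_inn_act_le c v

theorem op_apply (φ : LeftAction C D F) (c : C) (v : F) : φ.op c v = φ.act c v := rfl

theorem norm_act_le (φ : LeftAction C D F) (c : C) (v : F) : ‖φ.act c v‖ ≤ ‖c‖ * ‖v‖ := by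
  rw [HilbertModule.norm_eq D, HilbertModule.norm_eq D v]; exact φ.norm_inn_act_le c v

theorem continuous_act (φ : LeftAction C D F) : Continuous fun p : C × F => φ.act p.1 p.2 := by
  exact (LinearMap.mkContinuous₂ φ.act 1 fun c v => by
    rw [one_mul]; exact φ.norm_act_le c v).continuous₂

/-- A representation on a semi-inner product module is transported to a Hilbert module
along a map that preserves inner products and has dense range. -/
theorem exists_transport (φ : LeftAction C D V) (ι : V →ₗ[ℂ] F)
    (hι : ∀ v w, (inn (ι v) (ι w) : D) = inn v w) (hd : DenseRange ι) :
    ∃ ψ : LeftAction C D F, ∀ c v, ψ.act c (ι v) = ι (φ.act c v) := by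
  obtain ⟨U, hU⟩ := Unitary.exists_of_dense (D := D) (HilbertCompletion.of D V) ι
    (fun v w => by rw [HilbertCompletion.inn_of, hι]) HilbertCompletion.denseRange_of hd
  refine ⟨⟨LinearMap.mk₂ ℂ
    (fun c v => U.toEquiv (φ.completion.act c (U.toEquiv.symm v)))
    (fun c d v => by simp only [map_add, LinearMap.add_apply])
    (fun a c v => by simp only [map_smul, LinearMap.smul_apply])
    (fun c v w => by simp only [map_add])
    (fun a c v => by simp only [map_smul]), fun c d v => ?_, fun c v w => ?_⟩, fun c v => ?_⟩
  · simp only [LinearMap.mk₂_apply]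
    rw [LinearEquiv.symm_apply_apply, φ.completion.act_mul]
  · simp only [LinearMap.mk₂_apply]
    rw [← U.inn_symm_right, ← U.inn_symm, φ.completion.adj]
  · simp only [LinearMap.mk₂_apply]
    rw [← hU, LinearEquiv.symm_apply_apply, φ.completion_act_of, hU]

end Transport

/-! #### Creation and annihilation operators -/

section Creation

variable {B X : Type u} [NonUnitalCStarAlgebra B] [AddCommGroup X] [Module ℂ X]
    [PreHilbertModule B X] {D F : Type u} [NonUnitalCStarAlgebra D]
    [NormedAddCommGroup F] [NormedSpace ℂ F] [HilbertModule D F] (φ : LeftAction B D F)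

theorem inn_tens (x y : X) (v w : F) :
    (inn (φ.tens x v) (φ.tens y w) : D) = inn v (φ.act (inn x y) w) := by
  rw [tens, tens, HilbertCompletion.inn_of, inn_tmul]

theorem norm_tens_le (x : X) (v : F) : ‖φ.tens x v‖ ≤ √‖(inn x x : B)‖ * ‖v‖ := by
  rw [HilbertModule.norm_eq D, inn_tens, Real.sqrt_le_left (by positivity), mul_pow,
    Real.sq_sqrt (norm_nonneg _)]
  calc _ ≤ ‖v‖ * (‖(inn x x : B)‖ * ‖v‖) := (HilbertModule.norm_inn_le _ _).trans
        (mul_le_mul_of_nonneg_left (φ.norm_act_le _ _) (norm_nonneg _))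
    _ = _ := by ring

theorem tens_add_left (x y : X) (v : F) : φ.tens (x + y) v = φ.tens x v + φ.tens y v := by
  simp only [tens, map_add, LinearMap.add_apply]

theorem tens_sub_left (x y : X) (v : F) : φ.tens (x - y) v = φ.tens x v - φ.tens y v := by
  simp only [tens, map_sub, LinearMap.sub_apply]

theorem tens_smul_left (c : ℂ) (x : X) (v : F) : φ.tens (c • x) v = c • φ.tens x v := by
  simp only [tens, map_smul, LinearMap.smul_apply]

/-- The creation operator `v ↦ x ⊗ v`. -/
def cre (x : X) : F →L[ℂ] φ.Tensor X :=
  LinearMap.mkContinuous (HilbertCompletion.of D (φ.AlgTensor X) ∘ₗ φ.tmul x) (√‖(inn x x : B)‖)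
    (φ.norm_tens_le x)

theorem tens_add (x : X) (v w : F) : φ.tens x (v + w) = φ.tens x v + φ.tens x w :=
  map_add (φ.cre x) v w

theorem tens_smul (c : ℂ) (x : X) (v : F) : φ.tens x (c • v) = c • φ.tens x v :=
  map_smul (φ.cre x) c v

theorem inn_tmul_left (x : X) (v : F) (t : φ.AlgTensor X) :
    (inn (φ.tmul x v) t : D) = inn v (φ.lift (φ.act ∘ₗ innₗ B X x) t) := by
  refine φ.algTensor_induction t (by rw [map_zero, inn_zero_right, inn_zero_right])
    (fun y w => ?_) fun s t hs ht => ?_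
  · rw [inn_tmul]; rfl
  · rw [inn_add_right, hs, ht, map_add, inn_add_right]

/-- The annihilation operator, the adjoint of the creation operator. -/
def ann (x : X) : φ.Tensor X →L[ℂ] F :=
  have := HilbertModule.complete (D := D) (F := F)
  HilbertCompletion.extend (φ.lift (φ.act ∘ₗ innₗ B X x)) (√‖(inn x x : B)‖) fun t => by
    set a := φ.lift (φ.act ∘ₗ innₗ B X x) t with ha
    rcases (norm_nonneg a).eq_or_lt with h0 | h0
    · rw [← h0]; positivity
    have h1 : ‖a‖ ^ 2 ≤ (√‖(inn x x : B)‖ * ‖a‖) * √‖(inn t t : D)‖ := by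
      rw [HilbertModule.norm_sq_eq (D := D)]
      nth_rw 2 [ha]
      rw [← inn_tmul_left]
      refine (PreHilbertModule.norm_inn_le _ _).trans
        (mul_le_mul_of_nonneg_right ?_ (Real.sqrt_nonneg _))
      have := φ.norm_tens_le x a
      rwa [tens, HilbertCompletion.norm_of] at this
    nlinarith

theorem ann_of (x : X) (t : φ.AlgTensor X) :
    φ.ann x (HilbertCompletion.of D _ t) = φ.lift (φ.act ∘ₗ innₗ B X x) t :=
  have := HilbertModule.complete (D := D) (F := F)
  HilbertCompletion.extend_of _ _ _ t

theorem ann_tens (x y : X) (w : F) : φ.ann x (φ.tens y w) = φ.act (inn x y) w :=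
  φ.ann_of x (φ.tmul y w)

theorem inn_tens_left (x : X) (v : F) (t : φ.Tensor X) :
    (inn (φ.tens x v) t : D) = inn v (φ.ann x t) := by
  refine HilbertCompletion.induction_on t ?_ fun t => ?_
  · exact isClosed_eq ((HilbertModule.continuous_inn D _).comp (continuous_const.prodMk continuous_id))
      ((HilbertModule.continuous_inn D F).comp (continuous_const.prodMk (φ.ann x).continuous))
  · rw [ann_of, tens, HilbertCompletion.inn_of, inn_tmul_left]

theorem inn_tens_right (x : X) (v : F) (t : φ.Tensor X) :
    (inn t (φ.tens x v) : D) = inn (φ.ann x t) v := by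
  rw [← star_inn, inn_tens_left, star_inn]

theorem norm_ann_le (x : X) (t : φ.Tensor X) : ‖φ.ann x t‖ ≤ √‖(inn x x : B)‖ * ‖t‖ :=
  HilbertModule.norm_le_of_inn (D := D) (T := fun v => φ.tens x v) (φ.inn_tens_left x)
    (Real.sqrt_nonneg _) (φ.norm_tens_le x) t

theorem isTotal_tens : IsTotal fun p : X × F => φ.tens p.1 p.2 := by
  have h : (Set.range (HilbertCompletion.of D (φ.AlgTensor X)) : Set (φ.Tensor X)) ⊆
      Submodule.span ℂ (Set.range fun p : X × F => φ.tens p.1 p.2) := by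
    rintro _ ⟨t, rfl⟩
    refine φ.algTensor_induction t (by rw [map_zero]; exact Submodule.zero_mem _)
      (fun x v => Submodule.subset_span ⟨(x, v), rfl⟩) fun s t hs ht => ?_
    rw [map_add]; exact Submodule.add_mem _ hs ht
  exact Dense.mono h HilbertCompletion.denseRange_of

theorem isTotal_tens_of_total {ι : Type u} {e : ι → F} (he : IsTotal e) :
    IsTotal fun p : X × ι => φ.tens p.1 (e p.2) := by
  refine φ.isTotal_tens.of_forall_mem_closure fun p => ?_
  exact he.mem_of_isClosed (S := Submodule.comap (φ.cre p.1).toLinearMap (Submodule.span ℂ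
    (Set.range fun p : X × ι => φ.tens p.1 (e p.2))).topologicalClosure)
    ((Submodule.isClosed_topologicalClosure _).preimage (φ.cre p.1).continuous)
    (fun i => Submodule.le_topologicalClosure _ (Submodule.subset_span ⟨(p.1, i), rfl⟩)) p.2

theorem tensor_ext {s t : φ.Tensor X} (h : ∀ x, φ.ann x s = φ.ann x t) : s = t :=
  HilbertModule.ext_total (D := D) φ.isTotal_tens fun p => by
    rw [inn_tens_left, inn_tens_left, h]

theorem tens_rsmul (x : X) (b : B) (v : F) : φ.tens (rsmul x b) v = φ.tens x (φ.act b v) :=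
  φ.tensor_ext fun y => by rw [ann_tens, ann_tens, inn_rsmul_right, φ.act_mul]

theorem ann_sub (x y : X) (t : φ.Tensor X) : φ.ann (x - y) t = φ.ann x t - φ.ann y t := by
  refine HilbertModule.ext_inn (D := D) fun v => ?_
  rw [← inn_tens_left, inn_sub_right, tens_sub_left, inn_sub_left, inn_tens_left, inn_tens_left]

theorem ann_rsmul (x : X) (b : B) (t : φ.Tensor X) :
    φ.ann (rsmul x b) t = φ.act (star b) (φ.ann x t) := by
  refine HilbertModule.ext_inn (D := D) fun v => ?_
  rw [← inn_tens_left, tens_rsmul, inn_tens_left, φ.adj]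

variable {C : Type u} [NonUnitalCStarAlgebra C] (ψ : LeftAction C B X)

theorem leftTensor_tens (c : C) (x : X) (v : F) :
    (φ.leftTensor ψ).act c (φ.tens x v) = φ.tens (ψ.act c x) v :=
  LeftAction.completion_act_of _ c (φ.tmul x v)

theorem ann_act (c : C) (x : X) (t : φ.Tensor X) :
    φ.ann (ψ.act c x) t = φ.ann x ((φ.leftTensor ψ).act (star c) t) := by
  refine HilbertModule.ext_inn (D := D) fun v => ?_
  rw [← inn_tens_left, ← leftTensor_tens, (φ.leftTensor ψ).adj, inn_tens_left]

end Creation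

section Map

variable {B X Y : Type u} [NonUnitalCStarAlgebra B] [AddCommGroup X] [Module ℂ X]
    [PreHilbertModule B X] {D F F' : Type u} [NonUnitalCStarAlgebra D]
    [NormedAddCommGroup F] [NormedSpace ℂ F] [HilbertModule D F]
    [NormedAddCommGroup F'] [NormedSpace ℂ F'] [HilbertModule D F']

theorem mapRight_tens (φ : LeftAction B D F) (φ' : LeftAction B D F') (T : F →ₗ[ℂ] F')
    (hT : ∀ x y, (inn (T x) (T y) : D) = inn x y) (h : ∀ b v, T (φ.act b v) = φ'.act b (T v))
    (x : X) (v : F) : mapRight X φ φ' T hT h (φ.tens x v) = φ'.tens x (T v) :=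
  HilbertCompletion.extend_of _ _ _ (φ.tmul x v)

theorem ann_mapRight (φ : LeftAction B D F) (φ' : LeftAction B D F') (T : F →ₗ[ℂ] F')
    (hT : ∀ x y, (inn (T x) (T y) : D) = inn x y) (h : ∀ b v, T (φ.act b v) = φ'.act b (T v))
    (x : X) (t : φ.Tensor X) : φ'.ann x (mapRight X φ φ' T hT h t) = T (φ.ann x t) := by
  let T' : F →L[ℂ] F' := T.mkContinuous 1 fun v => by
    rw [one_mul, HilbertModule.norm_eq D, HilbertModule.norm_eq D v, hT]
  have := φ.isTotal_tens.clm_ext (S := (φ'.ann x).comp (mapRight X φ φ' T hT h))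
    (T := T'.comp (φ.ann x)) fun p => by
      change φ'.ann x (mapRight X φ φ' T hT h (φ.tens p.1 p.2)) = T (φ.ann x (φ.tens p.1 p.2))
      rw [mapRight_tens, ann_tens, ann_tens, h]
  exact congrArg (fun S : φ.Tensor X →L[ℂ] F' => S t) this

variable [NormedAddCommGroup Y] [NormedSpace ℂ Y] [HilbertModule B Y] {Y' : Type u}
  [NormedAddCommGroup Y'] [NormedSpace ℂ Y'] [HilbertModule B Y']

theorem mapLeft_tens {Z Z' : Type u} [AddCommGroup Z] [Module ℂ Z] [PreHilbertModule B Z]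
    [AddCommGroup Z'] [Module ℂ Z'] [PreHilbertModule B Z'] (φ : LeftAction B D F) (T : Z →ₗ[ℂ] Z')
    (hT : ∀ x y, (inn (T x) (T y) : B) = inn x y) (z : Z) (v : F) :
    φ.mapLeft T hT (φ.tens z v) = φ.tens (T z) v :=
  HilbertCompletion.extend_of _ _ _ (φ.tmul z v)

/-- The map `y ↦ y ⊗ v`. -/
def creLeft (φ : LeftAction B D F) (v : F) : Y →L[ℂ] φ.Tensor Y :=
  LinearMap.mkContinuous (HilbertCompletion.of D (φ.AlgTensor Y) ∘ₗ φ.tmul.flip v) ‖v‖ fun y => by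
    rw [mul_comm, HilbertModule.norm_eq B y]; exact φ.norm_tens_le y v

theorem isTotal_tens_of_total_left (φ : LeftAction B D F) {ι : Type u} {e : ι → Y}
    (he : IsTotal e) : IsTotal fun p : ι × F => φ.tens (e p.1) p.2 := by
  refine φ.isTotal_tens.of_forall_mem_closure fun p => ?_
  exact he.mem_of_isClosed (S := Submodule.comap (φ.creLeft p.2).toLinearMap (Submodule.span ℂ
    (Set.range fun p : ι × F => φ.tens (e p.1) p.2)).topologicalClosure)
    ((Submodule.isClosed_topologicalClosure _).preimage (φ.creLeft p.2).continuous)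
    (fun i => Submodule.le_topologicalClosure _ (Submodule.subset_span ⟨(i, p.2), rfl⟩)) p.1

theorem leftTensor_nondegenerate {C : Type u} [NonUnitalCStarAlgebra C] (φ : LeftAction B D F)
    (ψ : LeftAction C B Y) (h : ψ.IsNondegenerate) : (φ.leftTensor ψ).IsNondegenerate := by
  rw [isNondegenerate_iff] at h ⊢
  exact (φ.isTotal_tens_of_total_left h).of_forall_exists fun p =>
    ⟨(p.1.1, φ.tens p.1.2 p.2), φ.leftTensor_tens ψ _ _ _⟩

/-- Associativity of interior tensor products. -/
theorem exists_associator {D' E : Type u} [NonUnitalCStarAlgebra D'] [NormedAddCommGroup E]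
    [NormedSpace ℂ E] [HilbertModule D' E] (ψ : LeftAction D D' E) (φ : LeftAction B D F) :
    ∃ κ : Unitary D' (ψ.Tensor (φ.Tensor X)) ((ψ.leftTensor φ).Tensor X),
      ∀ (x : X) (v : F) (e : E),
        κ.toEquiv (ψ.tens (φ.tens x v) e) = (ψ.leftTensor φ).tens x (ψ.tens v e) := by
  have hg : ∀ p q : (X × F) × E, (inn (ψ.tens (φ.tens p.1.1 p.1.2) p.2)
      (ψ.tens (φ.tens q.1.1 q.1.2) q.2) : D') = inn ((ψ.leftTensor φ).tens p.1.1
        (ψ.tens p.1.2 p.2)) ((ψ.leftTensor φ).tens q.1.1 (ψ.tens q.1.2 q.2)) := fun p q =>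
    (ψ.inn_tens _ _ _ _).trans <| (congrArg (fun d => inn p.2 (ψ.act d q.2))
      (φ.inn_tens _ _ _ _)).trans <| .symm <| ((ψ.leftTensor φ).inn_tens _ _ _ _).trans <|
      (congrArg (fun t => inn (ψ.tens p.1.2 p.2) t) (ψ.leftTensor_tens φ _ _ _)).trans
        (ψ.inn_tens _ _ _ _)
  have h1 : IsTotal fun p : (X × F) × E => ψ.tens (φ.tens p.1.1 p.1.2) p.2 :=
    ψ.isTotal_tens_of_total_left (e := fun p : X × F => φ.tens p.1 p.2) φ.isTotal_tens
  have h2 : IsTotal fun p : (X × F) × E => (ψ.leftTensor φ).tens p.1.1 (ψ.tens p.1.2 p.2) := by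
    have h : IsTotal fun p : X × F × E => (ψ.leftTensor φ).tens p.1 (ψ.tens p.2.1 p.2.2) :=
      (ψ.leftTensor φ).isTotal_tens_of_total (X := X)
        (e := fun p : F × E => ψ.tens p.1 p.2) ψ.isTotal_tens
    exact h.of_forall_exists fun p => ⟨((p.1, p.2.1), p.2.2), rfl⟩
  obtain ⟨κ, hκ⟩ := Unitary.exists_of_gram hg h1 h2
  exact ⟨κ, fun x v e => hκ ((x, v), e)⟩

end Map

end LeftAction

end HilbertTools

section SelfModule

attribute [local instance] CStarAlgebra.spectralOrder CStarAlgebra.spectralOrderedRing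

variable (B : Type u) [NonUnitalCStarAlgebra B]

/-- A C*-algebra as a Hilbert module over itself. -/
@[reducible]
def selfModule : HilbertModule B B where
  inn a b := star a * b
  rsmul a b := a * b
  inn_add_right a b c := mul_add _ _ _
  inn_smul_right c a b := mul_smul_comm _ _ _
  star_inn a b := by rw [star_mul, star_star]
  inn_rsmul_right a b c := (mul_assoc _ _ _).symm
  inn_self_pos a := ⟨a, rfl⟩
  norm_sq_eq a := by rw [CStarRing.norm_star_mul_self, sq]
  complete := inferInstance

attribute [local instance] selfModule

theorem inn_self_def (a b : B) : (inn a b : B) = star a * b := rfl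

theorem isTotal_mul : IsTotal fun p : B × B => p.1 * p.2 := by
  have h : Submodule.span ℂ {a : B | 0 ≤ a} = ⊤ := CStarAlgebra.span_nonneg
  have h2 : Submodule.span ℂ (Set.range fun p : B × B => p.1 * p.2) = ⊤ := by
    rw [← top_le_iff, ← h]
    refine Submodule.span_mono fun a ha => ?_
    obtain ⟨c, hc⟩ := isPos_iff.2 ha
    exact ⟨(star c, c), hc.symm⟩
  rw [IsTotal, h2]
  exact dense_univ

/-- The representation of a C*-algebra on itself by left multiplication. -/
def leftReg : NondegRep B B B where
  act := LinearMap.mul ℂ B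
  act_mul a b c := mul_assoc a b c
  adj a b c := by
    rw [inn_self_def, inn_self_def]
    simp only [LinearMap.mul_apply', star_mul, mul_assoc]
  nondeg := (LeftAction.isNondegenerate_iff _).2 (isTotal_mul B)

theorem leftReg_act (a b : B) : (leftReg B).act a b = a * b := rfl

variable {B} {C : Type u} [NonUnitalCStarAlgebra C]

theorem eq_of_mul_eq {d e : B} (h : ∀ c, d * c = e * c) : d = e := by
  rw [← sub_eq_zero, ← CStarRing.mul_star_self_eq_zero_iff, sub_mul, h, sub_self]

/-- A family of bijections between the nondegenerate representations of two C*-algebras that is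
natural for isometric intertwiners and for C*-correspondences. -/
structure RepEquiv (B C : Type u) [NonUnitalCStarAlgebra B] [NonUnitalCStarAlgebra C] where
  T : ∀ (D F : Type u) [NonUnitalCStarAlgebra D] [NormedAddCommGroup F] [NormedSpace ℂ F]
    [HilbertModule D F], NondegRep C D F ≃ NondegRep B D F
  intertwiner : ∀ (D F₁ F₂ : Type u) [NonUnitalCStarAlgebra D]
    [NormedAddCommGroup F₁] [NormedSpace ℂ F₁] [HilbertModule D F₁]
    [NormedAddCommGroup F₂] [NormedSpace ℂ F₂] [HilbertModule D F₂]
    (L₁ : NondegRep C D F₁) (L₂ : NondegRep C D F₂) (V : F₁ →ₗ[ℂ] F₂)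
    (_ : ∀ x y, (inn (V x) (V y) : D) = inn x y),
    L₁.Intertwines L₂ V ↔ (T D F₁ L₁).Intertwines (T D F₂ L₂) V
  tensor : ∀ (D D' F E : Type u) [NonUnitalCStarAlgebra D] [NonUnitalCStarAlgebra D']
    [NormedAddCommGroup F] [NormedSpace ℂ F] [HilbertModule D F]
    [NormedAddCommGroup E] [NormedSpace ℂ E] [HilbertModule D' E]
    (ψ : NondegRep D D' E) (L : NondegRep C D F) (L' : NondegRep C D' (ψ.toLeftAction.Tensor F)),
    NondegRep.IsInduced ψ L L' →
      NondegRep.IsInduced ψ (T D F L) (T D' (ψ.toLeftAction.Tensor F) L')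

/-- The induced representation `L ⊗ 1`. -/
def NondegRep.induced {D D' F E : Type u} [NonUnitalCStarAlgebra D] [NonUnitalCStarAlgebra D']
    [NormedAddCommGroup F] [NormedSpace ℂ F] [HilbertModule D F]
    [NormedAddCommGroup E] [NormedSpace ℂ E] [HilbertModule D' E]
    (ψ : NondegRep D D' E) (L : NondegRep C D F) : NondegRep C D' (ψ.toLeftAction.Tensor F) where
  toLeftAction := ψ.toLeftAction.leftTensor L.toLeftAction
  nondeg := LeftAction.leftTensor_nondegenerate _ _ L.nondeg

theorem NondegRep.isInduced_induced {D D' F E : Type u} [NonUnitalCStarAlgebra D]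
    [NonUnitalCStarAlgebra D'] [NormedAddCommGroup F] [NormedSpace ℂ F] [HilbertModule D F]
    [NormedAddCommGroup E] [NormedSpace ℂ E] [HilbertModule D' E]
    (ψ : NondegRep D D' E) (L : NondegRep C D F) : IsInduced ψ L (induced ψ L) := rfl

theorem NondegRep.IsInduced.unique {D D' F E : Type u} [NonUnitalCStarAlgebra D]
    [NonUnitalCStarAlgebra D'] [NormedAddCommGroup F] [NormedSpace ℂ F] [HilbertModule D F]
    [NormedAddCommGroup E] [NormedSpace ℂ E] [HilbertModule D' E]
    {ψ : NondegRep D D' E} {L : NondegRep C D F} {L₁ L₂ : NondegRep C D' (ψ.toLeftAction.Tensor F)}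
    (h₁ : IsInduced ψ L L₁) (h₂ : IsInduced ψ L L₂) : L₁ = L₂ := by
  cases L₁; cases L₂
  cases h₁; cases h₂
  rfl

namespace RepEquiv

variable (T : RepEquiv B C)

/-- The inverse family of bijections. -/
def symm : RepEquiv C B where
  T D F := (T.T D F).symm
  intertwiner D F₁ F₂ _ _ _ _ _ _ _ L₁ L₂ V hV := by
    rw [T.intertwiner D F₁ F₂ _ _ V hV, Equiv.apply_symm_apply, Equiv.apply_symm_apply]
  tensor D D' F E _ _ _ _ _ _ _ _ ψ L L' h := by
    have h1 := T.tensor D D' F E ψ _ _ (NondegRep.isInduced_induced ψ ((T.T D F).symm L))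
    rw [Equiv.apply_symm_apply] at h1
    rw [h.unique h1, Equiv.symm_apply_apply]
    exact NondegRep.isInduced_induced _ _

/-- The representation of `C` on `B`. -/
def onSelf : NondegRep C B B := (T.T B B).symm (leftReg B)

variable {D F : Type u} [NonUnitalCStarAlgebra D] [NormedAddCommGroup F] [NormedSpace ℂ F]
    [HilbertModule D F]

theorem act_act (ρ : NondegRep C D F) (c : C) (b : B) (v : F) :
    ρ.act c ((T.T D F ρ).act b v) = (T.T D F ρ).act (T.onSelf.act c b) v := by
  let L := T.T D F ρ
  have h1 : ∀ p q : B × F, (inn (L.tens p.1 p.2) (L.tens q.1 q.2) : D)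
      = inn (L.act p.1 p.2) (L.act q.1 q.2) := fun p q => by
    rw [L.inn_tens, L.adj, ← L.act_mul]; rfl
  obtain ⟨V, hV⟩ := Unitary.exists_of_gram h1 L.isTotal_tens
    (L.isNondegenerate_iff.1 L.nondeg)
  have h2 := T.tensor B D B F L _ _ (NondegRep.isInduced_induced L T.onSelf)
  rw [onSelf, Equiv.apply_symm_apply] at h2
  have h3 := h2.unique (NondegRep.isInduced_induced L (leftReg B))
  have h4 : (NondegRep.induced L (leftReg B)).Intertwines L V.toEquiv.toLinearMap := by
    intro b t
    have h5 := L.isTotal_tens.clm_ext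
      (S := (V.toIso : L.Tensor B →L[ℂ] F).comp ((L.leftTensor (leftReg B).toLeftAction).op b))
      (T := (L.op b).comp (V.toIso : L.Tensor B →L[ℂ] F)) fun p => by
        change V.toEquiv ((L.leftTensor (leftReg B).toLeftAction).act b (L.tens p.1 p.2))
          = L.act b (V.toEquiv (L.tens p.1 p.2))
        rw [L.leftTensor_tens, hV p, hV (_, p.2), leftReg_act, L.act_mul]
    exact congrArg (fun S : L.Tensor B →L[ℂ] F => S t) h5
  rw [← h3] at h4
  have h5 := (T.intertwiner D _ F _ ρ V.toEquiv.toLinearMap V.inn_map).2 h4 c (L.tens b v)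
  change V.toEquiv ((L.leftTensor T.onSelf.toLeftAction).act c (L.tens b v))
    = ρ.act c (V.toEquiv (L.tens b v)) at h5
  rw [L.leftTensor_tens, hV (b, v), hV (_, v)] at h5
  exact h5.symm

theorem act_act' (ρ : NondegRep C D F) (c : C) (b : B) (v : F) :
    (T.T D F ρ).act b (ρ.act c v) = ρ.act (T.symm.onSelf.act b c) v := by
  have := T.symm.act_act (T.T D F ρ) b c v
  simp only [symm, Equiv.symm_apply_apply] at this
  exact this

theorem norm_le_of_act_eq {L : NondegRep B C C} {b : B} {d : C} (h : ∀ c, L.act b c = d * c) :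
    ‖d‖ ≤ ‖b‖ := by
  have h1 := L.norm_act_le b (star d)
  rw [h, CStarRing.norm_self_mul_star, norm_star] at h1
  rcases (norm_nonneg d).eq_or_lt with h0 | h0
  · rw [← h0]; exact norm_nonneg _
  · exact le_of_mul_le_mul_right h1 h0

theorem exists_mul (b : B) : ∃ d : C, ∀ c, T.symm.onSelf.act b c = d * c := by
  set L : NondegRep B C C := T.symm.onSelf with hL
  have hTL : T.T C C (leftReg C) = L := rfl
  let S : Submodule ℂ B :=
    { carrier := {b | ∃ d : C, ∀ c, L.act b c = d * c}
      add_mem' := by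
        rintro a b ⟨d, hd⟩ ⟨e, he⟩
        exact ⟨d + e, fun c => by rw [map_add, LinearMap.add_apply, hd, he, add_mul]⟩
      zero_mem' := ⟨0, fun c => by rw [map_zero, LinearMap.zero_apply, zero_mul]⟩
      smul_mem' := by
        rintro t a ⟨d, hd⟩
        exact ⟨t • d, fun c => by rw [map_smul, LinearMap.smul_apply, hd, smul_mul_assoc]⟩ }
  have hS : IsClosed (S : Set B) := by
    rw [← isSeqClosed_iff_isClosed]
    intro x b hx hb
    choose d hd using hx
    have hc : CauchySeq d := by
      refine Metric.cauchySeq_iff.2 fun ε hε => ?_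
      obtain ⟨N, hN⟩ := Metric.cauchySeq_iff.1 hb.cauchySeq ε hε
      refine ⟨N, fun m hm n hn => lt_of_le_of_lt ?_ (hN m hm n hn)⟩
      rw [dist_eq_norm, dist_eq_norm]
      refine norm_le_of_act_eq (L := L) fun c => ?_
      rw [map_sub, LinearMap.sub_apply, hd, hd, sub_mul]
    obtain ⟨e, he⟩ := cauchySeq_tendsto_of_complete hc
    refine ⟨e, fun c => ?_⟩
    have h1 : Tendsto (fun n => L.act (x n) c) atTop (𝓝 (L.act b c)) :=
      (L.continuous_act.comp (continuous_id.prodMk continuous_const)).continuousAt.tendsto.comp hb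
    refine tendsto_nhds_unique h1 ?_
    simp only [hd]
    exact he.mul_const c
  refine (T.onSelf.isNondegenerate_iff.1 T.onSelf.nondeg).mem_of_isClosed hS (fun p => ?_) b
  refine ⟨star (L.act (star p.2) (star p.1)), fun c => ?_⟩
  have h1 := T.act_act (leftReg C) p.1 p.2 c
  rw [hTL, leftReg_act] at h1
  have h2 := L.adj (star p.2) (star p.1) c
  rw [inn_self_def, inn_self_def, star_star, star_star] at h2
  rw [h2, h1]

/-- The `*`-homomorphism that implements the bijections. -/
def hom (b : B) : C := (T.exists_mul b).choose

theorem hom_mul (b : B) (c : C) : T.hom b * c = T.symm.onSelf.act b c :=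
  ((T.exists_mul b).choose_spec c).symm

theorem act_hom (ρ : NondegRep C D F) (b : B) (v : F) : ρ.act (T.hom b) v = (T.T D F ρ).act b v := by
  have := (ρ.isNondegenerate_iff.1 ρ.nondeg).clm_ext (S := ρ.op (T.hom b))
    (T := (T.T D F ρ).op b) fun p => by
      rw [LeftAction.op_apply, LeftAction.op_apply, ← ρ.act_mul, hom_mul, T.act_act']
  exact congrArg (fun S : F →L[ℂ] F => S v) this

theorem hom_hom (c : C) : T.hom (T.symm.hom c) = c := by
  refine eq_of_mul_eq fun d => ?_
  rw [hom_mul]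
  exact T.symm.act_hom T.symm.onSelf c d |>.trans (by
    simp only [onSelf, symm, Equiv.symm_symm, Equiv.symm_apply_apply]; rfl)

/-- The isomorphism that implements the bijections. -/
def iso : B ≃⋆ₐ[ℂ] C where
  toFun := T.hom
  invFun := T.symm.hom
  left_inv b := T.symm.hom_hom b
  right_inv c := T.hom_hom c
  map_mul' a b := eq_of_mul_eq fun c => by
    rw [mul_assoc, hom_mul, hom_mul, hom_mul, LeftAction.act_mul]
  map_add' a b := eq_of_mul_eq fun c => by
    rw [add_mul, hom_mul, hom_mul, hom_mul, map_add, LinearMap.add_apply]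
  map_star' a := eq_of_mul_eq fun c => by
    have h : ∀ d : C, d * (T.hom (star a) * c) = d * (star (T.hom a) * c) := fun d => by
      have := T.symm.onSelf.adj a (star d) c
      rw [inn_self_def, inn_self_def, ← hom_mul, ← hom_mul, star_mul, star_star, mul_assoc] at this
      exact this.symm
    have h2 := h (star (T.hom (star a) * c - star (T.hom a) * c))
    rw [← sub_eq_zero, ← mul_sub, CStarRing.star_mul_self_eq_zero_iff, sub_eq_zero] at h2
    exact h2
  map_smul' t a := eq_of_mul_eq fun c => by
    rw [smul_mul_assoc, hom_mul, hom_mul, map_smul, LinearMap.smul_apply]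

theorem existsUnique_iso : ∃! θ : B ≃⋆ₐ[ℂ] C, ∀ (D F : Type u) [NonUnitalCStarAlgebra D]
    [NormedAddCommGroup F] [NormedSpace ℂ F] [HilbertModule D F] (ρ : NondegRep C D F),
    T.T D F ρ = ρ.comp θ := by
  refine ⟨T.iso, fun D F _ _ _ _ ρ => ?_, fun θ hθ => ?_⟩
  · refine NondegRep.ext (LinearMap.ext fun b => LinearMap.ext fun v => ?_)
    exact (T.act_hom ρ b v).symm
  · refine StarAlgEquiv.ext fun b => eq_of_mul_eq fun c => ?_
    have h1 := congrArg (fun L : NondegRep B C C => L.act b c) (hθ C C (leftReg C))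
    exact h1.symm.trans (T.hom_mul b c).symm

end RepEquiv

end SelfModule

section Measures

theorem regular_map_of_isClosedEmbedding {X Y : Type*} [TopologicalSpace X] [MeasurableSpace X]
    [BorelSpace X] [TopologicalSpace Y] [MeasurableSpace Y] [BorelSpace Y] {e : X → Y}
    (he : Topology.IsClosedEmbedding e) (μ : Measure X) [μ.Regular] : (μ.map e).Regular where
  lt_top_of_isCompact K hK := by
    rw [he.measurableEmbedding.map_apply]
    exact (he.isCompact_preimage hK).measure_lt_top
  outerRegular A hA r hr := by
    rw [he.measurableEmbedding.map_apply] at hr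
    obtain ⟨V, hAV, hV, hVr⟩ := Set.exists_isOpen_lt_of_lt _ r hr
    obtain ⟨O, hO, rfl⟩ := he.isInducing.isOpen_iff.1 hV
    refine ⟨O ∪ (Set.range e)ᶜ, fun a ha => ?_, hO.union he.isClosed_range.isOpen_compl, ?_⟩
    · by_cases h : a ∈ Set.range e
      · obtain ⟨x, rfl⟩ := h
        exact Or.inl (hAV ha)
      · exact Or.inr h
    · rw [he.measurableEmbedding.map_apply]
      convert hVr using 2
      ext x; simp
  innerRegular U hU r hr := by
    rw [he.measurableEmbedding.map_apply] at hr
    obtain ⟨K, hKU, hK, hKr⟩ := (hU.preimage he.continuous).exists_lt_isCompact hr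
    refine ⟨e '' K, Set.image_subset_iff.2 hKU, hK.image he.continuous, ?_⟩
    rwa [he.measurableEmbedding.map_apply, Set.preimage_image_eq _ he.injective]

variable {G : LCGroupoid.{u}}

namespace MeasFam

variable {v : C(G.Arr, G.Obj)} (ν : MeasFam G v)

theorem isClosed_fibre (v : C(G.Arr, G.Obj)) (x : G.Obj) : IsClosed {g | v g = x} :=
  isClosed_eq v.continuous continuous_const

theorem ae_mem (x : G.Obj) : ∀ᵐ g ∂ν.m x, g ∈ {g | v g = x} := ν.supp x

/-- The measure on the fibre over `x`. -/
def fib (x : G.Obj) : Measure {g | v g = x} := (ν.m x).comap Subtype.val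

theorem map_fib (x : G.Obj) : (ν.fib x).map Subtype.val = ν.m x := by
  rw [fib, map_comap_subtype_coe (isClosed_fibre v x).measurableSet,
    Measure.restrict_eq_self_of_ae_mem (ν.ae_mem x)]

theorem fib_preimage (x : G.Obj) (A : Set G.Arr) :
    ν.fib x (Subtype.val ⁻¹' A) = ν.m x A := by
  conv_rhs => rw [← ν.map_fib x]
  rw [(isClosed_fibre v x).isClosedEmbedding_subtypeVal.measurableEmbedding.map_apply]

instance (x : G.Obj) : (ν.fib x).Regular where
  lt_top_of_isCompact K hK := by
    rw [fib, (isClosed_fibre v x).isClosedEmbedding_subtypeVal.measurableEmbedding.comap_apply]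
    exact (hK.image continuous_subtype_val).measure_lt_top
  toOuterRegular := Measure.OuterRegular.comap' _ continuous_subtype_val
    (isClosed_fibre v x).isClosedEmbedding_subtypeVal.measurableEmbedding
  innerRegular U hU r hr := by
    obtain ⟨O, hO, rfl⟩ := isOpen_induced_iff.1 hU
    rw [fib_preimage] at hr
    obtain ⟨K, hKO, hK, hKr⟩ := hO.exists_lt_isCompact hr
    refine ⟨Subtype.val ⁻¹' K, Set.preimage_mono hKO,
      (isClosed_fibre v x).isClosedEmbedding_subtypeVal.isCompact_preimage hK, ?_⟩
    rwa [fib_preimage]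

theorem integral_fib {E : Type*} [NormedAddCommGroup E] [NormedSpace ℝ E] (x : G.Obj)
    (f : G.Arr → E) : ∫ g : {g | v g = x}, f g ∂ν.fib x = ∫ g, f g ∂ν.m x := by
  rw [fib, integral_subtype_comap (isClosed_fibre v x).measurableSet,
    Measure.restrict_eq_self_of_ae_mem (ν.ae_mem x)]

theorem integral_eq_of_forall {E : Type*} [NormedAddCommGroup E] [NormedSpace ℝ E] {x : G.Obj}
    {f : G.Arr → E} {φ : {g | v g = x} → E} (h : ∀ g, f g.1 = φ g) :
    ∫ g, f g ∂ν.m x = ∫ g, φ g ∂ν.fib x := by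
  rw [← integral_fib]; exact integral_congr_ae (Eventually.of_forall h)

/-- The measures of a compact set are bounded. -/
theorem exists_bound {M : Set G.Arr} (hM : IsCompact M) :
    ∃ C : ℝ, 0 ≤ C ∧ ∀ x, (ν.m x).real M ≤ C := by
  obtain ⟨χ, -, hχ1, hχ01, hχc⟩ := exists_continuous_sum_one_of_isOpen_isCompact
    (n := 1) (s := fun _ => Set.univ) (fun _ => isOpen_univ) hM
    (fun g _ => Set.mem_iUnion.2 ⟨0, trivial⟩)
  have hχK : ∀ g ∈ M, χ 0 g = 1 := fun g hg => by simpa using hχ1 hg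
  have hI : HasCompactSupport fun x => ∫ g, χ 0 g ∂ν.m x := by
    refine HasCompactSupport.intro ((hχc 0).isCompact.image v.continuous) fun x hx => ?_
    have : ∀ᵐ g ∂ν.m x, χ 0 g = 0 := by
      filter_upwards [(ν.supp x : ∀ᵐ g ∂ν.m x, v g = x)] with g hg
      exact image_eq_zero_of_notMem_tsupport fun h => hx ⟨g, h, hg⟩
    rw [integral_congr_ae this, integral_zero]
  obtain ⟨B, hB⟩ := hI.exists_bound_of_continuous (ν.cont _ (χ 0).continuous (hχc 0))
  refine ⟨max B 0, le_max_right _ _, fun x => ?_⟩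
  have h1 : (ν.m x).real M = ∫ g, M.indicator 1 g ∂ν.m x :=
    (integral_indicator_one hM.measurableSet).symm
  rw [h1]
  refine le_trans (integral_mono_of_nonneg (Eventually.of_forall fun g =>
    Set.indicator_nonneg (fun _ _ => zero_le_one) g)
    ((χ 0).continuous.integrable_of_hasCompactSupport (hχc 0)) (Eventually.of_forall fun g => ?_))
    (((le_abs_self _).trans (hB x)).trans (le_max_left _ _))
  by_cases hg : g ∈ M
  · simp [hg, hχK g hg]
  · simpa [hg] using (hχ01 0 g).1

end MeasFam

namespace HaarSystem

variable (α : HaarSystem G)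

theorem integral_tilde {E : Type*} [NormedAddCommGroup E] [NormedSpace ℝ E] (x : G.Obj)
    (f : G.Arr → E) : ∫ g, f g ∂α.tilde.m x = ∫ g, f (G.inv g) ∂α.m x :=
  integral_map_equiv G.invHomeo.toMeasurableEquiv f

/-- Left translation by `g`, as a map between fibres of the range map. -/
def leftMul (g : G.Arr) {x y : G.Obj} (hx : G.r g = x) (hy : G.s g = y) :
    {h | G.r h = y} ≃ₜ {h | G.r h = x} where
  toFun h := ⟨G.mul g h, by
    have := G.r_mul g h (hy.trans h.2.symm); exact this.trans hx⟩
  invFun k := ⟨G.mul (G.inv g) k, by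
    have := G.r_mul (G.inv g) k ((G.s_inv g).trans (hx.trans k.2.symm))
    exact this.trans ((G.r_inv g).trans hy)⟩
  left_inv h := Subtype.ext (LCGroupoid.IsMul.inv_mul_left ⟨hy.trans h.2.symm, rfl⟩).2
  right_inv k := Subtype.ext (by
    have m : G.IsMul (G.inv g) k (G.mul (G.inv g) k) := ⟨(G.s_inv g).trans (hx.trans k.2.symm), rfl⟩
    have := m.inv_mul_left
    rw [LCGroupoid.inv_inv] at this
    exact this.2)
  continuous_toFun := by
    refine Continuous.subtype_mk ?_ _
    exact G.continuous_mul.comp (f := fun h : {h | G.r h = y} =>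
      (⟨(g, h.1), hy.trans h.2.symm⟩ : G.Sq)) (by fun_prop)
  continuous_invFun := by
    refine Continuous.subtype_mk ?_ _
    exact G.continuous_mul.comp (f := fun k : {h | G.r h = x} =>
      (⟨(G.inv g, k.1), (G.s_inv g).trans (hx.trans k.2.symm)⟩ : G.Sq)) (by fun_prop)

theorem leftMul_coe (g : G.Arr) {x y : G.Obj} (hx : G.r g = x) (hy : G.s g = y)
    (h : {h | G.r h = y}) : (leftMul g hx hy h : G.Arr) = G.mul g h := rfl

theorem map_leftMul (g : G.Arr) {x y : G.Obj} (hx : G.r g = x) (hy : G.s g = y) :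
    (α.fib y).map (leftMul g hx hy) = α.fib x := by
  have hcl := (MeasFam.isClosed_fibre G.r x).isClosedEmbedding_subtypeVal
  have hreg : ((α.fib y).map (leftMul g hx hy)).Regular := Measure.Regular.map _
  have h1 : ((α.fib y).map (leftMul g hx hy)).map Subtype.val = (α.fib x).map Subtype.val := by
    have := regular_map_of_isClosedEmbedding hcl ((α.fib y).map (leftMul g hx hy))
    have := regular_map_of_isClosedEmbedding hcl (α.fib x)
    refine Measure.ext_of_integral_eq_on_compactlySupported fun f => ?_
    rw [α.map_fib, hcl.integral_map]
    rw [(leftMul g hx hy).isClosedEmbedding.integral_map]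
    have h2 := α.inv g f f.continuous f.hasCompactSupport
    rw [hx, hy] at h2
    rw [← h2, ← MeasFam.integral_fib]
    rfl
  ext A hA
  have h2 := congrArg (fun μ : Measure G.Arr => μ (Subtype.val '' A)) h1
  simp only [hcl.measurableEmbedding.map_apply, Set.preimage_image_eq _ hcl.injective] at h2
  exact h2

theorem integral_leftMul {E : Type*} [NormedAddCommGroup E] [NormedSpace ℝ E] (g : G.Arr)
    {x y : G.Obj} (hx : G.r g = x) (hy : G.s g = y) (φ : {h | G.r h = x} → E) :
    ∫ h, φ (leftMul g hx hy h) ∂α.fib y = ∫ k, φ k ∂α.fib x := by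
  rw [← α.map_leftMul g hx hy]
  exact (integral_map_equiv (leftMul g hx hy).toMeasurableEquiv φ).symm

end HaarSystem

end Measures

section FibreIntegrals

theorem Tot.vec_eq {X : Type u} {fib : X → Type u} {x : X} {a b : fib x}
    (h : (⟨x, a⟩ : Tot fib) = ⟨x, b⟩) : a = b := by
  injection h

theorem BanachBundle.IsCont.continuous {X : Type u} [TopologicalSpace X] {A : BanachBundle.{u} X}
    {Z : Type*} [TopologicalSpace Z] {x : X} {f : Z → A.fib x} (hf : A.IsCont (fun _ => x) f) :
    Continuous f := by
  refine continuous_iff_continuousAt.2 fun z₀ => ?_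
  rw [ContinuousAt, Metric.tendsto_nhds]
  intro ε hε
  obtain ⟨β, hβ, hβ0⟩ := A.exists_section ⟨x, f z₀⟩
  have hβ' : A.IsCont (fun _ : Z => x) (fun _ => β x) :=
    hβ.comp (continuous_const (y := x) (X := Z))
  have hb : β x = f z₀ := hβ0
  rw [hb] at hβ'
  filter_upwards [(hf.sub hβ').eventually_lt (z₀ := z₀) (c := ε) (by simpa using hε)] with z hz
  rwa [dist_eq_norm]

variable {G : LCGroupoid.{u}} {Z Z' W : Type u} [TopologicalSpace Z] [TopologicalSpace Z']
  [TopologicalSpace W] {A : FellBundle.{u} G}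

namespace FibreProduct

variable {π : C(Z, W)} {ℓ : C(W, G.Arr)}

theorem integral_mk {v : C(G.Arr, G.Obj)} (P : FibreProduct π v) (ν : MeasFam G v)
    {f : ∀ z, A.fib (ℓ (π z))} {w : W} {x : G.Obj} {k : G.Arr} (hx : P.c w = x) (hk : ℓ w = k)
    (φ : {g | v g = x} → A.fib k)
    (h : ∀ z, π z = w → ∀ g : {g | v g = x}, g.1 = P.b z →
      (⟨ℓ (π z), f z⟩ : Tot A.fib) = ⟨k, φ g⟩) :
    (⟨ℓ w, P.integral ν f w⟩ : Tot A.fib) = ⟨k, ∫ g, φ g ∂ν.fib x⟩ := by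
  subst hx hk
  congr 1
  refine ν.integral_eq_of_forall fun g => ?_
  obtain ⟨z, rfl, hz⟩ := P.surj w g.1 g.2
  rw [← hz, P.ext_apply]
  exact Tot.vec_eq (h z rfl g hz.symm)

theorem integral_tilde_mk (P : FibreProduct π G.s) (α : HaarSystem G)
    {f : ∀ z, A.fib (ℓ (π z))} {w : W} {x : G.Obj} {k : G.Arr} (hx : P.c w = x) (hk : ℓ w = k)
    (φ : {g | G.r g = x} → A.fib k)
    (h : ∀ z, π z = w → ∀ g : {g | G.r g = x}, G.inv g.1 = P.b z →
      (⟨ℓ (π z), f z⟩ : Tot A.fib) = ⟨k, φ g⟩) :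
    (⟨ℓ w, P.integral α.tilde f w⟩ : Tot A.fib) = ⟨k, ∫ g, φ g ∂α.fib x⟩ := by
  subst hx hk
  congr 1
  rw [integral, α.integral_tilde]
  refine MeasFam.integral_eq_of_forall _ fun g => ?_
  obtain ⟨z, rfl, hz⟩ := P.surj w (G.inv g.1) ((G.s_inv _).trans g.2)
  rw [← hz, P.ext_apply]
  exact Tot.vec_eq (h z rfl g hz.symm)

end FibreProduct

/-- Two integration operators agree, up to the identification `e` of the spaces. -/
def IntegralOp.Same {π : C(Z, W)} {π' : C(Z', W)} (J : IntegralOp A π) (J' : IntegralOp A π')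
    (e : Z → Z') : Prop :=
  ∀ (ℓ : C(W, G.Arr)) (f : A.CcTop (ℓ.comp π)) (f' : A.CcTop (ℓ.comp π')),
    (∀ z, (⟨ℓ (π z), f.1 z⟩ : Tot A.fib) = ⟨ℓ (π' (e z)), f'.1 (e z)⟩) →
      ∀ w, (J.int ℓ f).1 w = (J'.int ℓ f').1 w

variable (A) (α : HaarSystem G)

theorem hasCompactSupport_of_prod {X Y E : Type*} [TopologicalSpace X] [TopologicalSpace Y]
    [T2Space X] [T2Space Y]
    [Zero E] {f : X → Y → E} {K : Set X} {L : Set Y} (hK : IsCompact K) (hL : IsCompact L)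
    (h : ∀ x y, f x y ≠ 0 → x ∈ K ∧ y ∈ L) : HasCompactSupport f.uncurry :=
  HasCompactSupport.intro (hK.prod hL) fun p hp => by
    by_contra hne
    exact hp (h p.1 p.2 hne)

theorem isCompact_fibre {v : C(G.Arr, G.Obj)} {x : G.Obj} {K : Set G.Arr} (hK : IsCompact K) :
    IsCompact (Subtype.val ⁻¹' K : Set {g | v g = x}) :=
  (MeasFam.isClosed_fibre v x).isClosedEmbedding_subtypeVal.isCompact_preimage hK

section
variable {A}

theorem intR_mk {ℓ : C(G.Obj, G.Arr)} (f : A.CcTop (ℓ.comp G.r)) {x : G.Obj} {k : G.Arr}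
    (hk : ℓ x = k) (φ : {g | G.r g = x} → A.fib k)
    (h : ∀ g, G.r g = x → ∀ l : {g | G.r g = x}, l.1 = g →
      (⟨ℓ (G.r g), f.1 g⟩ : Tot A.fib) = ⟨k, φ l⟩) :
    (⟨ℓ x, ((intR A α).int ℓ f).1 x⟩ : Tot A.fib) = ⟨k, ∫ g, φ g ∂α.fib x⟩ :=
  FibreProduct.integral_mk _ α.toMeasFam (x := x) rfl hk φ h

theorem intS_mk {ℓ : C(G.Obj, G.Arr)} (f : A.CcTop (ℓ.comp G.s)) {x : G.Obj} {k : G.Arr}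
    (hk : ℓ x = k) (φ : {g | G.r g = x} → A.fib k)
    (h : ∀ g, G.s g = x → ∀ l : {g | G.r g = x}, G.inv l.1 = g →
      (⟨ℓ (G.s g), f.1 g⟩ : Tot A.fib) = ⟨k, φ l⟩) :
    (⟨ℓ x, ((intS A α).int ℓ f).1 x⟩ : Tot A.fib) = ⟨k, ∫ g, φ g ∂α.fib x⟩ :=
  FibreProduct.integral_tilde_mk _ α (x := x) rfl hk φ h

variable {ℓ : C(G.Arr, G.Arr)} {w : G.Arr} {x : G.Obj} {k : G.Arr}

theorem lam0_mk (f : A.CcTop (ℓ.comp G.d0)) (hx : G.r w = x) (hk : ℓ w = k)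
    (φ : {g | G.r g = x} → A.fib k)
    (h : ∀ z, G.d0 z = w → ∀ l : {g | G.r g = x}, G.inv l.1 = G.d2 z →
      (⟨ℓ (G.d0 z), f.1 z⟩ : Tot A.fib) = ⟨k, φ l⟩) :
    (⟨ℓ w, ((lam0 A α).int ℓ f).1 w⟩ : Tot A.fib) = ⟨k, ∫ g, φ g ∂α.fib x⟩ :=
  FibreProduct.integral_tilde_mk _ α hx hk φ h

theorem lam1_mk (f : A.CcTop (ℓ.comp G.d1)) (hx : G.r w = x) (hk : ℓ w = k)
    (φ : {g | G.r g = x} → A.fib k)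
    (h : ∀ z, G.d1 z = w → ∀ l : {g | G.r g = x}, l.1 = G.d2 z →
      (⟨ℓ (G.d1 z), f.1 z⟩ : Tot A.fib) = ⟨k, φ l⟩) :
    (⟨ℓ w, ((lam1 A α).int ℓ f).1 w⟩ : Tot A.fib) = ⟨k, ∫ g, φ g ∂α.fib x⟩ :=
  FibreProduct.integral_mk _ α.toMeasFam hx hk φ h

theorem lam2_mk (f : A.CcTop (ℓ.comp G.d2)) (hx : G.s w = x) (hk : ℓ w = k)
    (φ : {g | G.r g = x} → A.fib k)
    (h : ∀ z, G.d2 z = w → ∀ l : {g | G.r g = x}, l.1 = G.d0 z →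
      (⟨ℓ (G.d2 z), f.1 z⟩ : Tot A.fib) = ⟨k, φ l⟩) :
    (⟨ℓ w, ((lam2 A α).int ℓ f).1 w⟩ : Tot A.fib) = ⟨k, ∫ g, φ g ∂α.fib x⟩ :=
  FibreProduct.integral_mk _ α.toMeasFam hx hk φ h

end

/-- Fubini's theorem for a section over `G²` that is pulled back to the product of two fibres. -/
theorem exists_fubini {x : G.Obj} {ℓ : C(G.Sq, G.Arr)} (f : A.CcTop ℓ) {k : G.Arr}
    (e : {g | G.r g = x} × {g | G.r g = x} → G.Sq) (he : Continuous e) (hk : ∀ p, ℓ (e p) = k)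
    (h : ∀ K : Set G.Sq, IsCompact K → ∃ M N : Set G.Arr, IsCompact M ∧ IsCompact N ∧
      ∀ p, e p ∈ K → p.1.1 ∈ M ∧ p.2.1 ∈ N) :
    ∃ φ : {g | G.r g = x} → {g | G.r g = x} → A.fib k,
      (∀ p, (⟨ℓ (e p), f.1 (e p)⟩ : Tot A.fib) = ⟨k, φ p.1 p.2⟩) ∧
      ∫ l, ∫ m, φ l m ∂α.fib x ∂α.fib x = ∫ m, ∫ l, φ l m ∂α.fib x ∂α.fib x := by
  obtain ⟨K, hK, hfK⟩ := f.2.2.1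
  obtain ⟨M, N, hM, hN, hMN⟩ := h K hK
  refine ⟨fun l m => A.cast (hk (l, m)) (f.1 (e (l, m))), fun p => (A.mk_cast (hk p) _).symm,
    integral_integral_swap_of_hasCompactSupport ?_
      (hasCompactSupport_of_prod (isCompact_fibre hM) (isCompact_fibre hN) fun l m hne => ?_)⟩
  · refine BanachBundle.IsCont.continuous (A := A.toBanachBundle) (x := k) ?_
    have := f.2.1.comp he
    unfold BanachBundle.IsCont at this ⊢
    convert this using 2 with p
    exact A.mk_cast (hk p) _
  · by_contra hp
    refine hne ?_
    rw [hfK (e (l, m)) fun hm => hp (hMN _ hm), map_zero]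

theorem intS_lam2 : ((intS A α).comp (lam2 A α)).Same ((intR A α).comp (lam0 A α)) id := by
  intro ℓ f f' hf x
  obtain ⟨φ, hφ, hF⟩ := exists_fubini A α f' (x := x) (k := ℓ x)
    (fun p => ⟨(G.inv p.1.1, p.2.1), by rw [G.s_inv]; exact p.1.2.trans p.2.2.symm⟩)
    (by fun_prop) (fun p => congrArg ℓ p.2.2) (fun K hK => ⟨G.inv '' (G.d2 '' K), G.d0 '' K,
      (hK.image G.d2.continuous).image G.inv.continuous, hK.image G.d0.continuous, fun p hp =>
        ⟨⟨_, ⟨_, hp, rfl⟩, LCGroupoid.inv_inv _⟩, ⟨_, hp, rfl⟩⟩⟩)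
  refine Tot.vec_eq (x := ℓ x) ((intS_mk α _ (k := ℓ x) rfl
    (fun l => ∫ m, φ l m ∂α.fib x) fun g hg l hl => ?_).trans ?_)
  · refine lam2_mk (ℓ := ℓ.comp G.s) α f hg (congrArg ℓ hg) (φ l) fun z hz m hm => ?_
    refine (hf z).trans ((hφ (l, m)).symm ▸ ?_)
    have : z = (⟨(G.inv l.1, m.1), by rw [G.s_inv]; exact l.2.trans m.2.symm⟩ : G.Sq) :=
      Subtype.ext (Prod.ext (hz.trans hl.symm) hm.symm)
    subst this
    rfl
  · rw [hF]
    refine (intR_mk α _ (k := ℓ x) rfl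
      (fun m => ∫ l, φ l m ∂α.fib x) fun h hh m hm => ?_).symm
    refine lam0_mk (ℓ := ℓ.comp G.r) α f' hh (congrArg ℓ hh) (fun l => φ l m) fun z hz l hl => ?_
    rw [← hφ (l, m)]
    have : z = (⟨(G.inv l.1, m.1), by rw [G.s_inv]; exact l.2.trans m.2.symm⟩ : G.Sq) :=
      Subtype.ext (Prod.ext hl.symm (hz.trans hm.symm))
    subst this
    rfl

theorem lam0_same (e : G.Sq → G.Sq) (he0 : ∀ z, G.d1 (e z) = G.d0 z)
    (he2 : ∀ z, G.d2 (e z) = G.inv (G.d2 z)) : (lam0 A α).Same (lam1 A α) e := by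
  intro ℓ f f' hf k
  have hk : ∀ g : {g | G.r g = G.r k}, G.s (G.inv g.1) = G.r k := fun g => (G.s_inv _).trans g.2
  let φ : {g | G.r g = G.r k} → A.fib (ℓ k) := fun g => f.1 ⟨(G.inv g.1, k), hk g⟩
  refine Tot.vec_eq (x := ℓ k) ((lam0_mk α f (k := ℓ k) rfl rfl
    φ fun z hz g hg => ?_).trans (lam1_mk α f' (k := ℓ k) rfl rfl
    φ fun z hz g hg => ?_).symm)
  · have : z = (⟨(G.inv g.1, k), hk g⟩ : G.Sq) := Subtype.ext (Prod.ext hg.symm hz)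
    subst this
    rfl
  · have h1 := hf ⟨(G.inv g.1, k), hk g⟩
    have : z = e ⟨(G.inv g.1, k), hk g⟩ := by
      have h2 : G.d2 z = G.d2 (e ⟨(G.inv g.1, k), hk g⟩) := by
        rw [he2]; exact hg.symm.trans (LCGroupoid.inv_inv _).symm
      have h3 : G.d1 z = G.d1 (e ⟨(G.inv g.1, k), hk g⟩) := by rw [he0]; exact hz
      have h4 := (LCGroupoid.isMul_sq z).inv_mul_left
      have h5 := (LCGroupoid.isMul_sq (e ⟨(G.inv g.1, k), hk g⟩)).inv_mul_left
      rw [← h2, ← h3] at h5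
      exact Subtype.ext (Prod.ext h2 (h4.2.symm.trans h5.2))
    subst this
    exact h1.symm

theorem isMul_leftMul {x y : G.Obj} {g : G.Arr} (hx : G.r g = x) (hy : G.s g = y)
    (h : {h | G.r h = y}) : G.IsMul g h (HaarSystem.leftMul g hx hy h) := ⟨hy.trans h.2.symm, rfl⟩

theorem intS_lam1 : ((intS A α).comp (lam1 A α)).Same ((intS A α).comp (lam0 A α)) id := by
  intro ℓ f f' hf x
  have hm : ∀ p : {g | G.r g = x} × {g | G.r g = x}, G.IsMul (G.inv p.2.1) p.1.1
    (G.mul (G.inv p.2.1) p.1.1) := fun p => ⟨(G.s_inv _).trans (p.2.2.trans p.1.2.symm), rfl⟩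
  have hm' : ∀ p : {g | G.r g = x} × {g | G.r g = x},
      G.s (G.mul (G.inv p.2.1) p.1.1) = G.r (G.inv p.1.1) := fun p => by
    rw [(hm p).s_eq, G.r_inv]
  have hd1 : ∀ p : {g | G.r g = x} × {g | G.r g = x},
      G.mul (G.mul (G.inv p.2.1) p.1.1) (G.inv p.1.1) = G.inv p.2.1 := fun p => by
    have := (hm p).inv.inv_mul_left.inv
    rw [LCGroupoid.inv_inv, LCGroupoid.inv_inv, LCGroupoid.inv_inv] at this
    exact this.2
  let e : {g | G.r g = x} × {g | G.r g = x} → G.Sq := fun p =>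
    ⟨(G.mul (G.inv p.2.1) p.1.1, G.inv p.1.1), hm' p⟩
  have he : Continuous e := by
    refine Continuous.subtype_mk (Continuous.prodMk ?_ (by fun_prop)) _
    exact G.continuous_mul.comp (f := fun p : {g | G.r g = x} × {g | G.r g = x} =>
      (⟨(G.inv p.2.1, p.1.1), (hm p).1⟩ : G.Sq)) (by fun_prop)
  have hes : ∀ p, G.s (G.d0 (e p)) = x := fun p => (G.s_inv _).trans p.1.2
  obtain ⟨φ, hφ, hF⟩ := exists_fubini A α f' (x := x) (k := ℓ x) e he
    (fun p => congrArg ℓ (hes p)) (fun K hK => ⟨G.inv '' (G.d0 '' K), G.inv '' (G.d1 '' K),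
      (hK.image G.d0.continuous).image G.inv.continuous,
      (hK.image G.d1.continuous).image G.inv.continuous, fun p hp =>
        ⟨⟨_, ⟨_, hp, rfl⟩, LCGroupoid.inv_inv _⟩, ⟨_, ⟨_, hp, rfl⟩, by
          change G.inv (G.mul (G.mul (G.inv p.2.1) p.1.1) (G.inv p.1.1)) = _
          rw [hd1, LCGroupoid.inv_inv]⟩⟩⟩)
  refine Tot.vec_eq (x := ℓ x) ((intS_mk α _ (k := ℓ x) rfl
    (fun m => ∫ l, φ l m ∂α.fib x) fun k hk m hmk => ?_).trans ?_)
  · have hs : G.s m.1 = G.r k := by rw [← hmk]; exact (G.r_inv _).symm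
    rw [← α.integral_leftMul m.1 m.2 hs.symm.symm]
    refine lam1_mk (ℓ := ℓ.comp G.s) α f rfl (congrArg ℓ hk)
      (fun g => φ (HaarSystem.leftMul m.1 m.2 hs g) m) fun z hz g hg => ?_
    refine (hf z).trans ((hφ (HaarSystem.leftMul m.1 m.2 hs g, m)).symm ▸ ?_)
    have h1 : G.d2 z = G.d2 (e (HaarSystem.leftMul m.1 m.2 hs g, m)) :=
      hg.symm.trans (isMul_leftMul m.2 hs g).inv_mul_left.2.symm
    have h2 : G.d1 z = G.d1 (e (HaarSystem.leftMul m.1 m.2 hs g, m)) :=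
      (hz.trans hmk.symm).trans (hd1 (HaarSystem.leftMul m.1 m.2 hs g, m)).symm
    have h4 := (LCGroupoid.isMul_sq z).inv_mul_left
    have h5 := (LCGroupoid.isMul_sq (e (HaarSystem.leftMul m.1 m.2 hs g, m))).inv_mul_left
    rw [← h1, ← h2] at h5
    have : z = e (HaarSystem.leftMul m.1 m.2 hs g, m) :=
      Subtype.ext (Prod.ext h1 (h4.2.symm.trans h5.2))
    subst this
    rfl
  · rw [← hF]
    refine (intS_mk α _ (k := ℓ x) rfl
      (fun l => ∫ m, φ l m ∂α.fib x) fun k hk l hlk => ?_).symm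
    have hs : G.s l.1 = G.r k := by rw [← hlk]; exact (G.r_inv _).symm
    rw [← α.integral_leftMul l.1 l.2 hs.symm.symm]
    refine lam0_mk (ℓ := ℓ.comp G.s) α f' rfl (congrArg ℓ hk)
      (fun g => φ l (HaarSystem.leftMul l.1 l.2 hs g)) fun z hz g hg => ?_
    rw [← hφ (l, HaarSystem.leftMul l.1 l.2 hs g)]
    have h1 : G.d2 z = G.d2 (e (l, HaarSystem.leftMul l.1 l.2 hs g)) := by
      refine hg.symm.trans ?_
      have := (isMul_leftMul l.2 hs g).inv_mul_left.inv
      rw [LCGroupoid.inv_inv] at this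
      exact this.2.symm
    have : z = e (l, HaarSystem.leftMul l.1 l.2 hs g) :=
      Subtype.ext (Prod.ext h1 (hz.trans hlk.symm))
    subst this
    rfl

theorem intR_lam1 : ((intR A α).comp (lam1 A α)).Same ((intR A α).comp (lam2 A α)) id := by
  intro ℓ f f' hf x
  have hm : ∀ p : {g | G.r g = x} × {g | G.r g = x}, G.IsMul (G.inv p.1.1) p.2.1
    (G.mul (G.inv p.1.1) p.2.1) := fun p => ⟨(G.s_inv _).trans (p.1.2.trans p.2.2.symm), rfl⟩
  have hm' : ∀ p : {g | G.r g = x} × {g | G.r g = x},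
      G.IsMul p.1.1 (G.mul (G.inv p.1.1) p.2.1) p.2.1 := fun p => by
    have := (hm p).inv_mul_left
    rwa [LCGroupoid.inv_inv] at this
  let e : {g | G.r g = x} × {g | G.r g = x} → G.Sq := fun p =>
    ⟨(p.1.1, G.mul (G.inv p.1.1) p.2.1), (hm' p).1⟩
  have he : Continuous e := by
    refine Continuous.subtype_mk (Continuous.prodMk (by fun_prop) ?_) _
    exact G.continuous_mul.comp (f := fun p : {g | G.r g = x} × {g | G.r g = x} =>
      (⟨(G.inv p.1.1, p.2.1), (hm p).1⟩ : G.Sq)) (by fun_prop)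
  obtain ⟨φ, hφ, hF⟩ := exists_fubini A α f' (x := x) (k := ℓ x) e he
    (fun p => congrArg ℓ p.1.2) (fun K hK => ⟨G.d2 '' K, G.d1 '' K,
      hK.image G.d2.continuous, hK.image G.d1.continuous, fun p hp =>
        ⟨⟨_, hp, rfl⟩, ⟨_, hp, (hm' p).2⟩⟩⟩)
  have key : ∀ (z : G.Sq) (p : {g | G.r g = x} × {g | G.r g = x}), G.d2 z = p.1.1 →
      G.d1 z = p.2.1 → z = e p := fun z p h1 h2 => by
    have h4 := (LCGroupoid.isMul_sq z).inv_mul_left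
    rw [h1, h2] at h4
    exact Subtype.ext (Prod.ext h1 h4.2.symm)
  refine Tot.vec_eq (x := ℓ x) ((intR_mk α _ (k := ℓ x) rfl
    (fun m => ∫ l, φ l m ∂α.fib x) fun k hk m hmk => ?_).trans ?_)
  · refine lam1_mk (ℓ := ℓ.comp G.r) α f hk (congrArg ℓ hk)
      (fun g => φ g m) fun z hz g hg => ?_
    refine (hf z).trans ((hφ (g, m)).symm ▸ ?_)
    have := key z (g, m) hg.symm (hz.trans hmk.symm)
    subst this
    rfl
  · rw [← hF]
    refine (intR_mk α _ (k := ℓ x) rfl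
      (fun l => ∫ m, φ l m ∂α.fib x) fun g hg l hlg => ?_).symm
    have hlg' : l.1 = g := hlg
    subst hlg'
    rw [← α.integral_leftMul l.1 l.2 rfl]
    refine lam2_mk (ℓ := ℓ.comp G.r) α f' rfl (congrArg ℓ hg)
      (fun h => φ l (HaarSystem.leftMul l.1 l.2 rfl h)) fun z hz h hh => ?_
    rw [← hφ (l, HaarSystem.leftMul l.1 l.2 rfl h)]
    have h1 : G.d1 z = (HaarSystem.leftMul l.1 l.2 rfl h).1 := by
      have h2 := (LCGroupoid.isMul_sq z).2
      have hz' : G.d2 z = l.1 := hz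
      have hh' : h.1 = G.d0 z := hh
      rw [HaarSystem.leftMul_coe, ← h2, hz', hh']
    have := key z (l, HaarSystem.leftMul l.1 l.2 rfl h) hz h1
    subst this
    rfl

end FibreIntegrals

section Bounds

variable {G : LCGroupoid.{u}} {Z W V : Type u} [TopologicalSpace Z]
  [TopologicalSpace W] [TopologicalSpace V] {A : FellBundle.{u} G} {π : C(Z, W)}

namespace IntegralOp

theorem int_eq_zero (J : IntegralOp A π) {ℓ : C(W, G.Arr)} (f : A.CcTop (ℓ.comp π)) (w : W)
    (h : ∀ z, π z = w → f.1 z = 0) : (J.int ℓ f).1 w = 0 := by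
  classical
  have := J.mem ℓ (fun w' => {a | w' = w → a = 0}) (fun w' => ?_) (fun w' => ?_)
    (fun w' _ => rfl) (fun w' c a _ ha hw => ?_) f (fun z hz => h z hz) w
  · exact this rfl
  · intro a ha b hb s t _ _ _ hw
    rw [ha hw, hb hw, smul_zero, smul_zero, add_zero]
  · by_cases hw : w' = w
    · simp [hw]
    · simp [hw]
  · rw [ha hw, smul_zero]

/-- An integration operator is bounded if the masses of compact sets are bounded. -/
def IsBdd (J : IntegralOp A π) : Prop :=
  ∀ K : Set Z, IsCompact K → ∃ C : ℝ, 0 ≤ C ∧ ∀ (ℓ : C(W, G.Arr)) (f : A.CcTop (ℓ.comp π)) (B : ℝ),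
    0 ≤ B → (∀ z ∉ K, f.1 z = 0) → (∀ z, ‖f.1 z‖ ≤ B) → ∀ w, ‖(J.int ℓ f).1 w‖ ≤ C * B

theorem IsBdd.comp {ρ : C(W, V)} {J : IntegralOp A ρ} {I : IntegralOp A π} (hJ : J.IsBdd)
    (hI : I.IsBdd) : (J.comp I).IsBdd := by
  intro K hK
  obtain ⟨C, hC, h⟩ := hI K hK
  obtain ⟨C', hC', h'⟩ := hJ (π '' K) (hK.image π.continuous)
  refine ⟨C' * C, mul_nonneg hC' hC, fun ℓ f B hB hf hfB w => ?_⟩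
  rw [mul_assoc]
  exact h' ℓ (I.int (ℓ.comp ρ) f) (C * B) (mul_nonneg hC hB)
    (fun w hw => I.int_eq_zero (ℓ := ℓ.comp ρ) f w fun z hz => hf z fun hzK => hw ⟨z, hzK, hz⟩)
    (h (ℓ.comp ρ) f B hB hf hfB) w

end IntegralOp

theorem FibreProduct.isBdd_integralOp [T2Space W] {v : C(G.Arr, G.Obj)} (P : FibreProduct π v)
    (ν : MeasFam G v) : (P.integralOp (A := A) ν).IsBdd := by
  intro K hK
  have hM := hK.image P.b.continuous
  obtain ⟨C, hC, h⟩ := ν.exists_bound hM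
  refine ⟨C, hC, fun ℓ f B hB hf hfB w => ?_⟩
  change ‖∫ g, P.ext f.1 w g ∂ν.m (P.c w)‖ ≤ _
  have h0 : ∀ g ∉ P.b '' K, P.ext f.1 w g = 0 := fun g =>
    P.ext_cases (p := fun _ g a => g ∉ P.b '' K → a = 0) f.1
      (fun z hz => hf z fun hz' => hz ⟨z, hz', rfl⟩) (fun _ _ _ _ => rfl) w g
  have h1 : ∀ g, ‖P.ext f.1 w g‖ ≤ B :=
    P.ext_cases (p := fun _ _ a => ‖a‖ ≤ B) f.1 hfB (fun _ _ _ => by simpa using hB) w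
  rw [← setIntegral_eq_integral_of_forall_compl_eq_zero h0, mul_comm]
  refine (norm_setIntegral_le_of_norm_le_const hM.measure_lt_top fun g _ => h1 g).trans ?_
  exact mul_le_mul_of_nonneg_left (h _) hB

variable (A) (α : HaarSystem G)

theorem isBdd_intR : (intR A α).IsBdd := FibreProduct.isBdd_integralOp _ _
theorem isBdd_intS : (intS A α).IsBdd := FibreProduct.isBdd_integralOp _ _
theorem isBdd_lam0 : (lam0 A α).IsBdd := FibreProduct.isBdd_integralOp _ _
theorem isBdd_lam1 : (lam1 A α).IsBdd := FibreProduct.isBdd_integralOp _ _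
theorem isBdd_lam2 : (lam2 A α).IsBdd := FibreProduct.isBdd_integralOp _ _

variable {A}

theorem FibreProduct.enorm_integral_le {v : C(G.Arr, G.Obj)} (P : FibreProduct π v)
    (ν : MeasFam G v) {ℓ : C(W, G.Arr)} (f : ∀ z, A.fib (ℓ (π z))) (w : W) (B : G.Arr → ENNReal)
    (h : ∀ z, ‖f z‖ₑ ≤ B (P.b z)) : ‖P.integral ν f w‖ₑ ≤ ∫⁻ g, B g ∂ν.m (P.c w) := by
  refine (enorm_integral_le_lintegral_enorm _).trans (lintegral_mono fun g => ?_)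
  refine P.ext_cases (p := fun _ g a => ‖a‖ₑ ≤ B g) f h (fun _ _ _ => by simp) w g

theorem enorm_intR_le {ℓ : C(G.Obj, G.Arr)} (f : A.CcTop (ℓ.comp G.r)) (x : G.Obj)
    (B : G.Arr → ENNReal) (h : ∀ g, ‖f.1 g‖ₑ ≤ B g) :
    ‖((intR A α).int ℓ f).1 x‖ₑ ≤ ∫⁻ g, B g ∂α.m x :=
  FibreProduct.enorm_integral_le _ _ f.1 x B h

theorem enorm_intS_le {ℓ : C(G.Obj, G.Arr)} (f : A.CcTop (ℓ.comp G.s)) (x : G.Obj)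
    (B : G.Arr → ENNReal) (h : ∀ g, ‖f.1 g‖ₑ ≤ B g) :
    ‖((intS A α).int ℓ f).1 x‖ₑ ≤ ∫⁻ g, B g ∂α.tilde.m x :=
  FibreProduct.enorm_integral_le _ _ f.1 x B h

/-- The `I`-norm is bounded by a multiple of the supremum norm for sections supported in a given
compact set. -/
theorem exists_normI_le {K : Set G.Arr} (hK : IsCompact K) : ∃ C : ℝ, 0 ≤ C ∧
    ∀ (ξ : A.Sec) (B : ℝ), 0 ≤ B → (∀ g ∉ K, FellBundle.ev ξ g = 0) →
      (∀ g, ‖FellBundle.ev ξ g‖ ≤ B) → FellBundle.normI α ξ ≤ ENNReal.ofReal (C * B) := by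
  have key : ∀ {v : C(G.Arr, G.Obj)} (ν : MeasFam G v), ∃ C : ℝ, 0 ≤ C ∧
      ∀ (ξ : A.Sec) (B : ℝ), 0 ≤ B → (∀ g ∉ K, FellBundle.ev ξ g = 0) →
      (∀ g, ‖FellBundle.ev ξ g‖ ≤ B) →
        (⨆ x, ∫⁻ g, ‖FellBundle.ev ξ g‖ₑ ∂ν.m x) ≤ ENNReal.ofReal (C * B) := fun ν => by
    obtain ⟨C, hC, h⟩ := ν.exists_bound hK
    refine ⟨C, hC, fun ξ B hB h0 hb => iSup_le fun x => ?_⟩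
    calc ∫⁻ g, ‖FellBundle.ev ξ g‖ₑ ∂ν.m x
        ≤ ∫⁻ g, K.indicator (fun _ => ENNReal.ofReal B) g ∂ν.m x := by
          refine lintegral_mono fun g => ?_
          by_cases hg : g ∈ K
          · rw [Set.indicator_of_mem hg, ← ofReal_norm]
            exact ENNReal.ofReal_le_ofReal (hb g)
          · simp [h0 g hg]
      _ = ENNReal.ofReal B * ν.m x K := lintegral_indicator_const hK.measurableSet _
      _ = ENNReal.ofReal ((ν.m x).real K * B) := by
          rw [mul_comm, ENNReal.ofReal_mul measureReal_nonneg, measureReal_def,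
            ENNReal.ofReal_toReal hK.measure_lt_top.ne]
      _ ≤ _ := ENNReal.ofReal_le_ofReal (mul_le_mul_of_nonneg_right (h x) hB)
  obtain ⟨C, hC, h⟩ := key α.toMeasFam
  obtain ⟨C', hC', h'⟩ := key α.tilde
  refine ⟨max C C', hC.trans (le_max_left _ _), fun ξ B hB h0 hb => max_le ?_ ?_⟩
  · exact (h ξ B hB h0 hb).trans (ENNReal.ofReal_le_ofReal
      (mul_le_mul_of_nonneg_right (le_max_left _ _) hB))
  · exact (h' ξ B hB h0 hb).trans (ENNReal.ofReal_le_ofReal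
      (mul_le_mul_of_nonneg_right (le_max_right _ _) hB))

end Bounds

section Approximation

instance (G : LCGroupoid.{u}) : LocallyCompactSpace G.Obj :=
  have h : Topology.IsClosedEmbedding G.u :=
    { Topology.IsEmbedding.of_leftInverse (f := G.r) G.r_u G.r.continuous G.u.continuous with
      isClosed_range := by
        have : Set.range G.u = {g | G.u (G.r g) = g} := by
          ext g
          exact ⟨by rintro ⟨x, rfl⟩; exact congrArg G.u (G.r_u x), fun h => ⟨_, h⟩⟩
        rw [this]
        exact isClosed_eq (by fun_prop) continuous_id }
  h.locallyCompactSpace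

theorem isClosed_sq (G : LCGroupoid.{u}) : IsClosed {p : G.Arr × G.Arr | G.s p.1 = G.r p.2} :=
  isClosed_eq (by fun_prop) (by fun_prop)

instance (G : LCGroupoid.{u}) : LocallyCompactSpace G.Sq :=
  (isClosed_sq G).isClosedEmbedding_subtypeVal.locallyCompactSpace

/-- Urysohn functions on locally compact spaces. -/
theorem exists_bump {Z : Type*} [TopologicalSpace Z] [T2Space Z] [LocallyCompactSpace Z]
    {K N : Set Z} (hK : IsCompact K) (hN : IsOpen N) (hKN : K ⊆ N) :
    ∃ χ : Z → ℝ, Continuous χ ∧ (∀ y, 0 ≤ χ y ∧ χ y ≤ 1) ∧ (∀ y ∈ K, χ y = 1) ∧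
      (∀ y ∉ N, χ y = 0) ∧ HasCompactSupport χ := by
  obtain ⟨f, hs, h1, h01, hc⟩ := exists_continuous_sum_one_of_isOpen_isCompact
    (n := 1) (s := fun _ => N) (fun _ => hN) hK (fun z hz => Set.mem_iUnion.2 ⟨0, hKN hz⟩)
  exact ⟨f 0, (f 0).continuous, h01 0, fun y hy => by simpa using h1 hy,
    fun y hy => image_eq_zero_of_notMem_tsupport fun h => hy (hs 0 h), hc 0⟩

theorem exists_bump_nhds {Z : Type*} [TopologicalSpace Z] [T2Space Z] [LocallyCompactSpace Z]
    {z : Z} {N : Set Z} (hN : N ∈ 𝓝 z) :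
    ∃ χ : Z → ℝ, Continuous χ ∧ (∀ y, 0 ≤ χ y ∧ χ y ≤ 1) ∧ (∀ᶠ y in 𝓝 z, χ y = 1) ∧
      (∀ y ∉ N, χ y = 0) ∧ HasCompactSupport χ := by
  obtain ⟨K, hK, hKN, hKc⟩ := local_compact_nhds (interior_mem_nhds.2 hN)
  obtain ⟨χ, h1, h2, h3, h4, h5⟩ := exists_bump hKc isOpen_interior hKN
  exact ⟨χ, h1, h2, Filter.mem_of_superset hK h3, fun y hy => h4 y fun h => hy (interior_subset h),
    h5⟩

/-- Urysohn functions of product form. -/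
theorem exists_bump_prod {Z X Y : Type*} [TopologicalSpace Z] [TopologicalSpace X] [T2Space X]
    [LocallyCompactSpace X] [TopologicalSpace Y] [T2Space Y] [LocallyCompactSpace Y]
    {a : Z → X} {b : Z → Y} (h : Topology.IsInducing fun z => (a z, b z)) {z : Z} {N : Set Z}
    (hN : N ∈ 𝓝 z) : ∃ (χ : X → ℝ) (ψ : Y → ℝ), Continuous χ ∧ Continuous ψ ∧
      (∀ z, 0 ≤ χ (a z) * ψ (b z) ∧ χ (a z) * ψ (b z) ≤ 1) ∧
      (∀ᶠ y in 𝓝 z, χ (a y) * ψ (b y) = 1) ∧ (∀ y ∉ N, χ (a y) * ψ (b y) = 0) := by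
  rw [h.nhds_eq_comap, nhds_prod_eq] at hN
  obtain ⟨T, hT, hTN⟩ := mem_comap.1 hN
  obtain ⟨M, hM, M', hM', hMM⟩ := mem_prod_iff.1 hT
  obtain ⟨χ, h1, h2, h3, h4, h5⟩ := exists_bump_nhds hM
  obtain ⟨ψ, k1, k2, k3, k4, k5⟩ := exists_bump_nhds hM'
  have hab : Continuous fun z => (a z, b z) := h.continuous
  refine ⟨χ, ψ, h1, k1, fun z => ⟨mul_nonneg (h2 _).1 (k2 _).1,
    mul_le_one₀ (h2 _).2 (k2 _).1 (k2 _).2⟩, ?_, fun y hy => ?_⟩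
  · filter_upwards [(continuous_fst.comp hab).continuousAt.eventually h3,
      (continuous_snd.comp hab).continuousAt.eventually k3] with y hy hy'
    have hy : χ (a y) = 1 := hy
    have hy' : ψ (b y) = 1 := hy'
    rw [hy, hy', mul_one]
  · by_cases hM : a y ∈ M
    · rw [k4 (b y) fun hM' => hy (hTN (hMM ⟨hM, hM'⟩)), mul_zero]
    · rw [h4 _ hM, zero_mul]

namespace BanachBundle

variable {X : Type u} [TopologicalSpace X] {A : BanachBundle.{u} X} {Z : Type*} [TopologicalSpace Z]

/-- A subspace of sections contains the multiples of its elements by sufficiently many continuous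
functions. -/
def HasBumps {ℓ : Z → X} (V : Submodule ℂ (∀ z, A.fib (ℓ z))) : Prop :=
  ∀ z, ∀ N ∈ 𝓝 z, ∃ χ : Z → ℝ, (∀ y, 0 ≤ χ y ∧ χ y ≤ 1) ∧ (∀ᶠ y in 𝓝 z, χ y = 1) ∧
    (∀ y ∉ N, χ y = 0) ∧ ∀ v ∈ V, (fun y => (χ y : ℂ) • v y) ∈ V

/-- Stone–Weierstraß theorem for sections: a space of sections that is fibrewise dense and has
enough bump functions is uniformly dense. -/
theorem exists_uniform_approx {ℓ : Z → X} {V : Submodule ℂ (∀ z, A.fib (ℓ z))}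
    (hV : ∀ v ∈ V, A.IsCont ℓ v) (hχ : HasBumps V) {f : ∀ z, A.fib (ℓ z)} (hf : A.IsCont ℓ f)
    {K O : Set Z} (hK : IsCompact K) (hfK : ∀ z ∉ K, f z = 0) (hO : IsOpen O) (hKO : K ⊆ O)
    (hd : ∀ z ∈ K, ∀ ε > 0, ∃ v ∈ V, ‖v z - f z‖ < ε) {ε : ℝ} (hε : 0 < ε) :
    ∃ v ∈ V, (∀ z, ‖v z - f z‖ ≤ ε) ∧ ∀ z ∉ O, v z = 0 := by
  have key : ∃ (ψ : Z → ℝ) (v : ∀ z, A.fib (ℓ z)), v ∈ V ∧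
      (∀ v ∈ V, (fun y => (ψ y : ℂ) • v y) ∈ V) ∧ (∀ y, 0 ≤ ψ y ∧ ψ y ≤ 1) ∧
      (∀ y, ‖v y - (ψ y : ℂ) • f y‖ ≤ ψ y * ε) ∧ (∀ y ∉ O, ψ y = 0) ∧ ∀ y ∈ K, ψ y = 1 := by
    refine hK.induction_on (p := fun s => ∃ (ψ : Z → ℝ) (v : ∀ z, A.fib (ℓ z)), v ∈ V ∧
      (∀ v ∈ V, (fun y => (ψ y : ℂ) • v y) ∈ V) ∧ (∀ y, 0 ≤ ψ y ∧ ψ y ≤ 1) ∧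
      (∀ y, ‖v y - (ψ y : ℂ) • f y‖ ≤ ψ y * ε) ∧ (∀ y ∉ O, ψ y = 0) ∧ ∀ y ∈ s, ψ y = 1) ?_ ?_ ?_ ?_
    · refine ⟨0, 0, V.zero_mem, fun v _ => ?_, by simp, by simp, by simp, by simp⟩
      convert V.zero_mem using 1
      ext y; simp
    · rintro s t hst ⟨ψ, v, h1, h2, h3, h4, h5, h6⟩
      exact ⟨ψ, v, h1, h2, h3, h4, h5, fun y hy => h6 y (hst hy)⟩
    · rintro s t ⟨ψ, v, h1, h2, h3, h4, h5, h6⟩ ⟨ψ', v', h1', h2', h3', h4', h5', h6'⟩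
      refine ⟨fun y => ψ y + ψ' y - ψ y * ψ' y, fun y => v y + v' y - (ψ y : ℂ) • v' y,
        V.sub_mem (V.add_mem h1 h1') (h2 _ h1'), fun w hw => ?_, fun y => ?_, fun y => ?_,
        fun y hy => ?_, fun y hy => ?_⟩
      · have := V.sub_mem (V.add_mem (h2 _ hw) (h2' _ hw)) (h2 _ (h2' _ hw))
        convert this using 1
        ext y
        simp only [Pi.add_apply, Pi.sub_apply, smul_smul, Complex.ofReal_sub, Complex.ofReal_add,
          Complex.ofReal_mul, sub_smul, add_smul]
      · have := h3 y; have := h3' y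
        constructor <;> nlinarith
      · have e : v y + v' y - (ψ y : ℂ) • v' y - ((ψ y + ψ' y - ψ y * ψ' y : ℝ) : ℂ) • f y
            = (v y - (ψ y : ℂ) • f y) + ((1 - ψ y : ℝ) : ℂ) • (v' y - (ψ' y : ℂ) • f y) := by
          simp only [Complex.ofReal_sub, Complex.ofReal_add,
            Complex.ofReal_mul, sub_smul, add_smul, smul_sub, smul_smul, Complex.ofReal_one, one_smul,
            sub_mul, one_mul]
          abel
        rw [e]
        refine (norm_add_le _ _).trans ?_
        rw [norm_smul, Complex.norm_real, Real.norm_of_nonneg (sub_nonneg.2 (h3 y).2)]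
        have := h4 y
        have := mul_le_mul_of_nonneg_left (h4' y) (sub_nonneg.2 (h3 y).2)
        linarith
      · simp [h5 y hy, h5' y hy]
      · rcases hy with hy | hy
        · simp [h6 y hy]
        · simp [h6' y hy]
    · intro z hz
      obtain ⟨v, hv, hvz⟩ := hd z hz ε hε
      obtain ⟨χ, h1, h2, h3, h4⟩ := hχ z _ (Filter.inter_mem (hO.mem_nhds (hKO hz))
        (((hV v hv).sub hf).eventually_lt hvz))
      refine ⟨_, mem_nhdsWithin_of_mem_nhds h2, χ, _, h4 v hv, h4, h1, fun y => ?_, fun y hy => ?_,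
        fun y hy => hy⟩
      · rw [← smul_sub, norm_smul, Complex.norm_real, Real.norm_of_nonneg (h1 y).1]
        by_cases hy : y ∈ O ∩ {y | ‖v y - f y‖ < ε}
        · exact mul_le_mul_of_nonneg_left hy.2.le (h1 y).1
        · rw [h3 y hy, zero_mul, zero_mul]
      · exact h3 y fun h => hy h.1
  obtain ⟨ψ, v, h1, h2, h3, h4, h5, h6⟩ := key
  refine ⟨v, h1, fun z => ?_, fun z hz => ?_⟩
  · by_cases hz : z ∈ K
    · simpa [h6 z hz] using h4 z
    · have := h4 z
      rw [hfK z hz, smul_zero, sub_zero] at this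
      rw [hfK z hz, sub_zero]
      exact this.trans (mul_le_of_le_one_left hε.le (h3 z).2)
  · simpa [h5 z hz] using h4 z

/-- Continuous sections with compact support. -/
def IsCc (A : BanachBundle.{u} X) (ℓ : Z → X) (f : ∀ z, A.fib (ℓ z)) : Prop :=
  A.IsCont ℓ f ∧ ∃ K : Set Z, IsCompact K ∧ ∀ z ∉ K, f z = 0

theorem IsCont.bump {ℓ : Z → X} {f : ∀ z, A.fib (ℓ z)} (hf : A.IsCont ℓ f) {χ : Z → ℝ}
    (hχ : Continuous χ) (hc : HasCompactSupport χ) : A.IsCc ℓ fun z => (χ z : ℂ) • f z :=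
  ⟨hf.smul (Complex.continuous_ofReal.comp hχ), tsupport χ, hc, fun z hz => by
    beta_reduce; rw [image_eq_zero_of_notMem_tsupport hz, Complex.ofReal_zero, zero_smul]⟩

/-- A field of subspaces has sufficiently many sections. -/
def HasSections (A : BanachBundle.{u} X) (ℓ : Z → X) (E : ∀ z, Submodule ℂ (A.fib (ℓ z))) : Prop :=
  ∀ z, ∀ a ∈ E z, ∀ ε > 0, ∃ f : ∀ z, A.fib (ℓ z), A.IsCc ℓ f ∧ (∀ z, f z ∈ E z) ∧ ‖f z - a‖ < ε

theorem hasSections_top [T2Space Z] [LocallyCompactSpace Z] {ℓ : Z → X} (hℓ : Continuous ℓ) :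
    A.HasSections ℓ fun _ => ⊤ := by
  intro z a _ ε hε
  obtain ⟨σ, hσ, hσa⟩ := A.exists_section ⟨ℓ z, a⟩
  have hσa : σ (ℓ z) = a := hσa
  obtain ⟨χ, h1, h2, h3, h4, h5⟩ := exists_bump_nhds (Filter.univ_mem (f := 𝓝 z))
  refine ⟨_, IsCont.bump (f := fun z => σ (ℓ z)) (Continuous.comp hσ hℓ) h1 h5,
    fun _ => trivial, ?_⟩
  rw [h3.self_of_nhds, hσa]
  simpa using hε

end BanachBundle

namespace FellBundle

variable {G : LCGroupoid.{u}} {A : FellBundle.{u} G} {Z : Type*} [TopologicalSpace Z]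
  {ℓ₁ ℓ₂ ℓ₃ : Z → G.Arr} {f : ∀ z, A.fib (ℓ₁ z)} {g : ∀ z, A.fib (ℓ₂ z)}

theorem isCc_mul_left (hf : A.IsCc ℓ₁ f) (hg : A.IsCont ℓ₂ g)
    (m : ∀ z, G.IsMul (ℓ₁ z) (ℓ₂ z) (ℓ₃ z)) : A.IsCc ℓ₃ (fun z => A.mul (m z) (f z) (g z)) := by
  obtain ⟨K, hK, hfK⟩ := hf.2
  exact ⟨isCont_mul hf.1 hg m, K, hK, fun z hz => by
    beta_reduce; rw [hfK z hz, map_zero, LinearMap.zero_apply]⟩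

theorem hasSections_prodSpan {P : ∀ z, Submodule ℂ (A.fib (ℓ₁ z))}
    {Q : ∀ z, Submodule ℂ (A.fib (ℓ₂ z))} (hP : A.HasSections ℓ₁ P) (hQ : A.HasSections ℓ₂ Q)
    (m : ∀ z, G.IsMul (ℓ₁ z) (ℓ₂ z) (ℓ₃ z)) (h3 : Continuous ℓ₃) :
    A.HasSections ℓ₃ fun z => A.prodSpan (m z) (P z) (Q z) := by
  intro z a ha ε hε
  let T : Submodule ℂ (A.fib (ℓ₃ z)) :=
    { carrier := {a | ∃ f : ∀ z, A.fib (ℓ₃ z), A.IsCc ℓ₃ f ∧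
        (∀ z, f z ∈ A.prodSpan (m z) (P z) (Q z)) ∧ f z = a}
      add_mem' := by
        rintro _ _ ⟨f, hf, hfE, rfl⟩ ⟨g, hg, hgE, rfl⟩
        obtain ⟨K, hK, hfK⟩ := hf.2
        obtain ⟨L, hL, hgL⟩ := hg.2
        refine ⟨fun z => f z + g z, ⟨hf.1.add hg.1, K ∪ L, hK.union hL, fun z hz => ?_⟩,
          fun z => Submodule.add_mem _ (hfE z) (hgE z), rfl⟩
        beta_reduce
        rw [hfK z fun h => hz (Or.inl h), hgL z fun h => hz (Or.inr h), add_zero]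
      zero_mem' := ⟨fun _ => 0, ⟨BanachBundle.isCont_zero h3, ∅, isCompact_empty, fun _ _ => rfl⟩,
        fun z => Submodule.zero_mem _, rfl⟩
      smul_mem' := by
        rintro c _ ⟨f, hf, hfE, rfl⟩
        obtain ⟨K, hK, hfK⟩ := hf.2
        exact ⟨fun z => c • f z, ⟨hf.1.smul continuous_const, K, hK, fun z hz => by
          beta_reduce; rw [hfK z hz, smul_zero]⟩, fun z => Submodule.smul_mem _ c (hfE z), rfl⟩ }
  have hT : A.prodSpan (m z) (P z) (Q z) ≤ T.topologicalClosure := by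
    refine prodSpan_le T.isClosed_topologicalClosure fun p hp q hq => ?_
    rw [← SetLike.mem_coe, Submodule.topologicalClosure_coe, Metric.mem_closure_iff]
    intro ε hε
    have hc : Continuous fun x : A.fib (ℓ₁ z) × A.fib (ℓ₂ z) => A.mul (m z) x.1 x.2 :=
      (A.mulL (m z)).continuous₂
    obtain ⟨δ, hδ, h⟩ := Metric.continuous_iff.1 hc (p, q) ε hε
    obtain ⟨f, hf, hfP, hfp⟩ := hP z p hp δ hδ
    obtain ⟨g, hg, hgQ, hgq⟩ := hQ z q hq δ hδ
    refine ⟨A.mul (m z) (f z) (g z), ⟨_, isCc_mul_left hf hg.1 m,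
      fun z => mul_mem_prodSpan (m z) (hfP z) (hgQ z), rfl⟩, ?_⟩
    rw [dist_comm]
    refine h (f z, g z) ?_
    rw [Prod.dist_eq, max_lt_iff, dist_eq_norm, dist_eq_norm]
    exact ⟨hfp, hgq⟩
  have := hT ha
  rw [← SetLike.mem_coe, Submodule.topologicalClosure_coe, Metric.mem_closure_iff] at this
  obtain ⟨_, ⟨f, hf, hfE, rfl⟩, hfa⟩ := this ε hε
  exact ⟨f, hf, hfE, by rwa [dist_comm, dist_eq_norm] at hfa⟩

variable (A)

theorem hasSections_rangeIdeal {q : Z → G.Obj} {ℓ : Z → G.Arr} (hℓ : Continuous ℓ)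
    (hq : Continuous q) [T2Space Z] [LocallyCompactSpace Z] (h : ∀ z, G.r (ℓ z) = q z) :
    A.HasSections (fun z => G.u (q z)) fun z => A.rangeIdeal (ℓ z) (h z) :=
  hasSections_prodSpan (BanachBundle.hasSections_top hℓ)
    (BanachBundle.hasSections_top (G.inv.continuous.comp hℓ)) _ (G.u.continuous.comp hq)

theorem hasSections_idealI {q : G.Sq → G.Obj} (hq : Continuous q)
    (h : ∀ z, G.r (G.d1 z) = q z) :
    A.HasSections (fun z => G.u (q z)) fun z => A.idealI z (h z) :=
  hasSections_prodSpan
    (hasSections_prodSpan (BanachBundle.hasSections_top G.d2.continuous)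
      (BanachBundle.hasSections_top G.d0.continuous) _ G.d1.continuous)
    (hasSections_prodSpan (BanachBundle.hasSections_top (G.inv.continuous.comp G.d0.continuous))
      (BanachBundle.hasSections_top (G.inv.continuous.comp G.d2.continuous)) _
      (G.inv.continuous.comp G.d1.continuous)) _ (G.u.continuous.comp hq)

theorem hasSections_ideal1 : A.HasSections G.d2 (ideal1 A) :=
  hasSections_prodSpan (hasSections_idealI A (G.r.continuous.comp G.d2.continuous) LCGroupoid.r_d1)
    (BanachBundle.hasSections_top G.d2.continuous) _ G.d2.continuous

end FellBundle

end Approximation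

section Factorization

attribute [local instance] CStarAlgebra.spectralOrder CStarAlgebra.spectralOrderedRing

variable {G : LCGroupoid.{u}} {A : FellBundle.{u} G}

namespace FellBundle

theorem adj_mul_self_nonneg {g g' : G.Arr} {x : G.Obj} (i : G.inv g = g') (m : G.IsMul g' g (G.u x))
    (a : A.fib g) : (0 : A.fib (G.u x)) ≤ A.mul m (A.adj i a) a := by
  subst i
  have hx : G.s g = x := by
    have := m.s_eq
    rw [G.s_u] at this; exact this.symm
  subst hx
  obtain ⟨b, hb⟩ := A.exists_adj_mul_self g a
  rw [hb]
  exact star_mul_self_nonneg b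

variable {g : G.Arr} {x : G.Obj} (hx : G.r g = x)

/-- The element `a a^*` of the C*-algebra over the unit `r(g)`. -/
def sqr (a : A.fib g) : A.fib (G.u x) := A.mul (LCGroupoid.isMul_self_inv hx) a (A.adj rfl a)

theorem sqr_nonneg (a : A.fib g) : 0 ≤ sqr hx a := by
  have := adj_mul_self_nonneg (x := x) (LCGroupoid.inv_inv g) (LCGroupoid.isMul_self_inv hx)
    (A.adj rfl a)
  rwa [A.adj_adj] at this

theorem norm_sqr (a : A.fib g) : ‖sqr hx a‖ = ‖a‖ * ‖a‖ := by
  have := A.norm_adj_mul_self (LCGroupoid.inv_inv g) (LCGroupoid.isMul_self_inv hx) (A.adj rfl a)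
  rwa [A.adj_adj, A.norm_adj] at this

/-- The action of the C*-algebra over `r(g)` on the fibre over `g`. -/
def lsmul (b : A.fib (G.u x)) (a : A.fib g) : A.fib g := A.mul (LCGroupoid.isMul_u_left hx) b a

theorem lsmul_mul (b c : A.fib (G.u x)) (a : A.fib g) :
    lsmul hx (b * c) a = lsmul hx b (lsmul hx c a) :=
  A.mul_assoc _ _ _ _ b c a

theorem lsmul_sub (b c : A.fib (G.u x)) (a : A.fib g) :
    lsmul hx (b - c) a = lsmul hx b a - lsmul hx c a := by
  simp only [lsmul, map_sub, LinearMap.sub_apply]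

theorem mul_adj_lsmul (b : A.fib (G.u x)) (a c : A.fib g) :
    A.mul (LCGroupoid.isMul_self_inv hx) c (A.adj rfl (lsmul hx b a))
      = A.mul (LCGroupoid.isMul_self_inv hx) c (A.adj rfl a) * star b := by
  have m : G.IsMul (G.inv g) (G.u x) (G.inv g) := LCGroupoid.isMul_u_right (by rw [G.s_inv, hx])
  rw [lsmul, A.adj_mul (LCGroupoid.isMul_u_left hx) m (LCGroupoid.inv_u x) rfl rfl,
    ← A.mul_assoc (LCGroupoid.isMul_self_inv hx) (LCGroupoid.isMul_u x) m
      (LCGroupoid.isMul_self_inv hx)]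
  rfl

theorem lsmul_mul_adj (b : A.fib (G.u x)) (a c : A.fib g) :
    A.mul (LCGroupoid.isMul_self_inv hx) (lsmul hx b a) (A.adj rfl c)
      = b * A.mul (LCGroupoid.isMul_self_inv hx) a (A.adj rfl c) :=
  A.mul_assoc _ _ (LCGroupoid.isMul_self_inv hx) (LCGroupoid.isMul_u x) b a _

theorem sqr_lsmul (b : A.fib (G.u x)) (a : A.fib g) :
    sqr hx (lsmul hx b a) = b * sqr hx a * star b := by
  rw [sqr, mul_adj_lsmul, lsmul_mul_adj]; rfl

theorem sqr_sub_lsmul (b : A.fib (G.u x)) (a : A.fib g) :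
    sqr hx (a - lsmul hx b a) = sqr hx a - b * sqr hx a - (sqr hx a * star b
      - b * sqr hx a * star b) := by
  rw [sqr, map_sub, map_sub, map_sub, LinearMap.sub_apply, LinearMap.sub_apply, mul_adj_lsmul,
    mul_adj_lsmul, lsmul_mul_adj]; rfl

theorem quasispectrum_sqr {a : A.fib g} {r : ℝ} (hr : r ∈ quasispectrum ℝ (sqr hx a)) :
    0 ≤ r ∧ r ≤ ‖a‖ * ‖a‖ := by
  have h0 := sqr_nonneg hx a
  refine ⟨quasispectrum_nonneg_of_nonneg _ h0 r hr, ?_⟩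
  rw [← norm_sqr hx]
  exact (le_abs_self r).trans (NonUnitalIsometricContinuousFunctionalCalculus.norm_quasispectrum_le
    _ hr (IsSelfAdjoint.of_nonneg h0))

theorem norm_cfc_lsmul_le {a : A.fib g} {h : ℝ → ℝ} (hc : Continuous h) (h0 : h 0 = 0) {c : ℝ}
    (hc0 : 0 ≤ c) (H : ∀ r, 0 ≤ r → r ≤ ‖a‖ * ‖a‖ → |h r * r * h r| ≤ c ^ 2) :
    ‖lsmul hx (cfcₙ h (sqr hx a)) a‖ ≤ c := by
  have hsa : IsSelfAdjoint (sqr hx a) := .of_nonneg (sqr_nonneg hx a)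
  have h1 : sqr hx (lsmul hx (cfcₙ h (sqr hx a)) a)
      = cfcₙ (fun r => h r * r * h r) (sqr hx a) := by
    have hb : star (cfcₙ h (sqr hx a)) = cfcₙ h (sqr hx a) := cfcₙ_predicate (R := ℝ) h (sqr hx a)
    rw [sqr_lsmul, hb, cfcₙ_mul _ _ _ (by fun_prop) (by simp) (by fun_prop) h0,
      cfcₙ_mul _ _ _ (by fun_prop) h0 (by fun_prop) rfl]
    congr 2
    exact (cfcₙ_id' ℝ (sqr hx a)).symm
  have h2 : ‖lsmul hx (cfcₙ h (sqr hx a)) a‖ ^ 2 ≤ c ^ 2 := by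
    rw [sq, ← norm_sqr hx, h1]
    exact norm_cfcₙ_le fun r hr => H r (quasispectrum_sqr hx hr).1 (quasispectrum_sqr hx hr).2
  exact (abs_le_of_sq_le_sq h2 hc0).trans' (le_abs_self _)

end FellBundle

/-- The function `s(r) = r^{1/4}`. -/
def qroot (r : ℝ) : ℝ := √√r

/-- The function `s / (s² + ε²)`, where `s(r) = r^{1/4}`. -/
def qinv (ε r : ℝ) : ℝ := qroot r / (qroot r ^ 2 + ε ^ 2)

theorem continuous_qroot : Continuous qroot := by unfold qroot; fun_prop
theorem qroot_zero : qroot 0 = 0 := by simp [qroot]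
theorem qroot_nonneg (r : ℝ) : 0 ≤ qroot r := Real.sqrt_nonneg _
theorem qroot_pow {r : ℝ} (hr : 0 ≤ r) : qroot r ^ 4 = r := by
  rw [show qroot r ^ 4 = (qroot r ^ 2) ^ 2 by ring, qroot, Real.sq_sqrt (Real.sqrt_nonneg _),
    Real.sq_sqrt hr]
theorem qinv_zero (ε : ℝ) : qinv ε 0 = 0 := by simp [qinv, qroot_zero]

variable {ε : ℝ}

theorem continuous_qinv (hε : 0 < ε) : Continuous (qinv ε) := by
  unfold qinv
  exact continuous_qroot.div ((continuous_qroot.pow 2).add continuous_const)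
    fun r => by positivity

theorem abs_qinv_sub (hε : 0 < ε) (r : ℝ) :
    |qroot r - qinv ε r * qroot r ^ 2| ≤ ε := by
  have hs := qroot_nonneg r
  set s := qroot r
  have h : s - s / (s ^ 2 + ε ^ 2) * s ^ 2 = s * ε ^ 2 / (s ^ 2 + ε ^ 2) := by field_simp; ring
  change |s - s / (s ^ 2 + ε ^ 2) * s ^ 2| ≤ ε
  rw [h, abs_of_nonneg (by positivity), div_le_iff₀ (by positivity)]
  nlinarith [sq_nonneg (s - ε), mul_nonneg hs hε.le, sq_nonneg s]

theorem abs_one_sub_qinv (hε : 0 < ε) (r : ℝ) :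
    |(1 - qroot r * qinv ε r) * qroot r ^ 2| ≤ ε ^ 2 := by
  have hs := qroot_nonneg r
  set s := qroot r
  have h : (1 - s * (s / (s ^ 2 + ε ^ 2))) * s ^ 2 = s ^ 2 * ε ^ 2 / (s ^ 2 + ε ^ 2) := by
    field_simp; ring
  change |(1 - s * (s / (s ^ 2 + ε ^ 2))) * s ^ 2| ≤ ε ^ 2
  rw [h, abs_of_nonneg (by positivity), div_le_iff₀ (by positivity)]
  nlinarith [sq_nonneg ε, sq_nonneg (ε ^ 2), sq_nonneg (s * ε)]

theorem abs_qinv_le (hε : 0 < ε) (r : ℝ) : |qinv ε r * qroot r ^ 2| ≤ qroot r := by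
  have hs := qroot_nonneg r
  set s := qroot r
  change |s / (s ^ 2 + ε ^ 2) * s ^ 2| ≤ s
  rw [abs_of_nonneg (by positivity), div_mul_eq_mul_div, div_le_iff₀ (by positivity)]
  nlinarith [mul_nonneg hs (sq_nonneg ε)]

theorem mul_mul_eq_sq {h r : ℝ} (hr : 0 ≤ r) : h * r * h = (h * qroot r ^ 2) ^ 2 := by
  nth_rw 1 [← qroot_pow hr]; ring

namespace FellBundle

variable {g : G.Arr} {x : G.Obj} (hx : G.r g = x)

/-- Factorization in a single fibre. -/
theorem exists_fibre_factorization (a : A.fib g) : ∃ b : A.fib g,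
    (∀ ε > 0, ‖b - lsmul hx (cfcₙ (qinv ε) (sqr hx a)) a‖ ≤ 2 * ε) ∧
      lsmul hx (cfcₙ qroot (sqr hx a)) b = a ∧ ‖b‖ ^ 2 ≤ ‖a‖ := by
  let y : ℝ → A.fib g := fun ε => lsmul hx (cfcₙ (qinv ε) (sqr hx a)) a
  have hy : ∀ ε > 0, ∀ δ > 0, ‖y ε - y δ‖ ≤ ε + δ := fun ε hε δ hδ => by
    have hc := continuous_qinv hε
    have hc' := continuous_qinv hδ
    have h1 : y ε - y δ = lsmul hx (cfcₙ (fun r => qinv ε r - qinv δ r) (sqr hx a)) a := by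
      rw [cfcₙ_sub _ _ _ (by fun_prop) (qinv_zero _) (by fun_prop) (qinv_zero _), lsmul_sub]
    rw [h1]
    refine norm_cfc_lsmul_le hx (hc.sub hc') (by simp [qinv_zero]) (by positivity) fun r hr _ => ?_
    rw [mul_mul_eq_sq hr, abs_of_nonneg (sq_nonneg _)]
    refine sq_le_sq' ?_ ?_ <;>
    · have h2 := abs_le.1 (abs_qinv_sub hε r)
      have h3 := abs_le.1 (abs_qinv_sub hδ r)
      rw [Pi.sub_apply, sub_mul]
      linarith
  have hy0 : ∀ ε > 0, ‖y ε‖ ≤ √‖a‖ := fun ε hε => by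
    refine norm_cfc_lsmul_le hx (continuous_qinv hε) (qinv_zero _) (Real.sqrt_nonneg _)
      fun r hr hra => ?_
    rw [mul_mul_eq_sq hr, abs_of_nonneg (sq_nonneg _), ← sq_abs]
    refine pow_le_pow_left₀ (abs_nonneg _) ((abs_qinv_le hε r).trans ?_) 2
    refine Real.sqrt_le_sqrt ?_
    rw [Real.sqrt_le_left (norm_nonneg _), sq]
    exact hra
  have hy1 : ∀ ε > 0, ‖a - lsmul hx (cfcₙ qroot (sqr hx a)) (y ε)‖ ≤ ε ^ 2 := fun ε hε => by
    have hc := continuous_qinv hε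
    have hq := continuous_qroot
    let k : ℝ → ℝ := fun r => qroot r * qinv ε r
    have hk : Continuous k := hq.mul hc
    have hk0 : k 0 = 0 := by simp [k, qroot_zero]
    have h1 : lsmul hx (cfcₙ qroot (sqr hx a)) (y ε) = lsmul hx (cfcₙ k (sqr hx a)) a := by
      rw [cfcₙ_mul _ _ _ (by fun_prop) qroot_zero (by fun_prop) (qinv_zero _), lsmul_mul]
    have hb : star (cfcₙ k (sqr hx a)) = cfcₙ k (sqr hx a) := cfcₙ_predicate (R := ℝ) k (sqr hx a)
    have hsa : IsSelfAdjoint (sqr hx a) := .of_nonneg (sqr_nonneg hx a)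
    have h2 : sqr hx (a - lsmul hx (cfcₙ k (sqr hx a)) a)
        = cfcₙ (fun r => r - k r * r - (r * k r - k r * r * k r)) (sqr hx a) := by
      rw [cfcₙ_sub _ _ _ (by fun_prop) (by simp) (by fun_prop) (by simp),
        cfcₙ_sub _ _ _ (by fun_prop) (by simp) (by fun_prop) (by simp),
        cfcₙ_sub _ _ _ (by fun_prop) (by simp) (by fun_prop) (by simp),
        cfcₙ_mul (fun r => k r * r) _ _ (by fun_prop) (by simp) (by fun_prop) hk0,
        cfcₙ_mul _ _ _ (by fun_prop) hk0 (by fun_prop) rfl,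
        cfcₙ_mul _ _ _ (by fun_prop) rfl (by fun_prop) hk0, cfcₙ_id' ℝ (sqr hx a),
        sqr_sub_lsmul, hb]
    have h3 : ‖a - lsmul hx (cfcₙ k (sqr hx a)) a‖ ^ 2 ≤ (ε ^ 2) ^ 2 := by
      rw [sq, ← norm_sqr hx, h2]
      refine norm_cfcₙ_le fun r hr => ?_
      have hr0 := (quasispectrum_sqr hx hr).1
      have e : r - k r * r - (r * k r - k r * r * k r) = ((1 - k r) * qroot r ^ 2) ^ 2 := by
        have h4 : r - k r * r - (r * k r - k r * r * k r) = r * (1 - k r) ^ 2 := by ring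
        rw [h4]
        nth_rw 1 [← qroot_pow hr0]
        ring
      rw [e, Real.norm_of_nonneg (sq_nonneg _), ← sq_abs]
      exact pow_le_pow_left₀ (abs_nonneg _) (abs_one_sub_qinv hε r) 2
    rw [h1]
    exact (abs_le_of_sq_le_sq h3 (by positivity)).trans' (le_abs_self _)
  have hcomplete := A.complete g
  have hcs : CauchySeq fun n : ℕ => y (1 / (n + 1)) := by
    rw [Metric.cauchySeq_iff]
    intro ε hε
    obtain ⟨N, hN⟩ := exists_nat_one_div_lt (half_pos hε)
    refine ⟨N, fun m hm n hn => ?_⟩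
    have h1 : ∀ m ≥ N, (1 : ℝ) / (m + 1) < ε / 2 := fun m hm =>
      (one_div_le_one_div_of_le (by positivity) (by gcongr)).trans_lt hN
    rw [dist_eq_norm]
    have := hy (1 / (m + 1)) (by positivity) (1 / (n + 1)) (by positivity)
    linarith [h1 m hm, h1 n hn]
  obtain ⟨b, hb⟩ := cauchySeq_tendsto_of_complete hcs
  have ht := tendsto_one_div_add_atTop_nhds_zero_nat (𝕜 := ℝ)
  refine ⟨b, fun ε hε => ?_, ?_, ?_⟩
  · refine le_trans (le_of_tendsto_of_tendsto' (hb.sub_const (y ε)).norm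
      (ht.add_const ε) fun n => hy _ (by positivity) ε hε) ?_
    linarith
  · have hcont : Continuous fun c => lsmul hx (cfcₙ qroot (sqr hx a)) c :=
      (A.mulL (LCGroupoid.isMul_u_left hx) _).continuous
    have h1 := ((hcont.tendsto b).comp hb).const_sub a |>.norm
    have h2 := le_of_tendsto_of_tendsto' h1 (ht.pow 2) fun n => hy1 _ (by positivity)
    rw [zero_pow two_ne_zero] at h2
    exact (sub_eq_zero.1 (norm_le_zero_iff.1 h2)).symm
  · have := le_of_tendsto' hb.norm fun n => hy0 _ (by positivity)
    rw [← Real.sq_sqrt (norm_nonneg a)]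
    exact pow_le_pow_left₀ (norm_nonneg _) this 2

end FellBundle

namespace SubAlgFamily

variable {Y : Type u} [TopologicalSpace Y] (S : SubAlgFamily A Y)

/-- Evaluation at a point. -/
def evalHom (y : Y) : S.C0 →⋆ₙₐ[ℂ] A.fib (G.u (S.q y)) where
  toFun f := f.1 y
  map_smul' _ _ := rfl
  map_zero' := rfl
  map_add' _ _ := rfl
  map_mul' _ _ := rfl
  map_star' _ := rfl

variable {S}

theorem C0.norm_apply_le (f : S.C0) (y : Y) : ‖f.1 y‖ ≤ ‖f‖ :=
  lp.norm_apply_le_norm (by simp) f.1 y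

theorem C0.norm_le {f : S.C0} {c : ℝ} (hc : 0 ≤ c) (h : ∀ y, ‖f.1 y‖ ≤ c) : ‖f‖ ≤ c :=
  lp.norm_le_of_forall_le hc h

theorem continuous_evalHom (y : Y) : Continuous (S.evalHom y) :=
  AddMonoidHomClass.continuous_of_bound (S.evalHom y) 1 fun f => by
    rw [one_mul]; exact C0.norm_apply_le f y

theorem cfcₙ_apply_eq {T : S.C0} (hT : IsSelfAdjoint T) {h : ℝ → ℝ} (hc : Continuous h)
    (h0 : h 0 = 0) (y : Y) : (cfcₙ h T : S.C0).1 y = cfcₙ h (T.1 y) :=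
  (S.evalHom y).map_cfcₙ h T hc.continuousOn h0 (continuous_evalHom y) hT (hT.map (S.evalHom y))

open FellBundle in
/-- Factorization of compactly supported sections. -/
theorem exists_factorization {ℓ : Y → G.Arr} (hr : ∀ z, G.r (ℓ z) = S.q z) {f : ∀ z, A.fib (ℓ z)}
    (hf : A.IsCc ℓ f) (hS : ∀ z, sqr (hr z) (f z) ∈ S.S z) :
    ∃ (x : A.Cc S.label S.S) (y : ∀ z, A.fib (ℓ z)), A.IsCc ℓ y ∧
      (∀ z, ∀ ε > 0, ∃ c ∈ S.S z, ‖y z - lsmul (hr z) c (f z)‖ ≤ ε) ∧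
      (∀ z k (i : G.inv (S.label z) = k) (m : G.IsMul k (ℓ z) (ℓ z)),
        A.mul m (A.adj i (x.1 z)) (y z) = f z) ∧
      (∀ z, ‖x.1 z‖ ^ 2 ≤ ‖f z‖) ∧ ∀ z, ‖y z‖ ^ 2 ≤ ‖f z‖ := by
  obtain ⟨K, hK, hfK⟩ := hf.2
  have hsq : A.IsCc (fun z => G.u (S.q z)) (fun z => sqr (hr z) (f z)) :=
    isCc_mul_left hf (isCont_adj hf.1 fun _ => rfl) _
  let T : S.C0 := S.ofCc ⟨fun z => sqr (hr z) (f z), hsq.1, hsq.2, hS⟩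
  have hT : IsSelfAdjoint T := C0.ext fun z => IsSelfAdjoint.of_nonneg (sqr_nonneg (hr z) (f z))
  have hcq := continuous_qroot
  have hTz : ∀ z ∉ K, T.1 z = 0 := fun z hz => by
    change sqr (hr z) (f z) = 0
    rw [← norm_eq_zero, norm_sqr, hfK z hz, norm_zero, zero_mul]
  have happ : ∀ h : ℝ → ℝ, Continuous h → h 0 = 0 → ∀ z,
      (cfcₙ h T : S.C0).1 z = cfcₙ h (sqr (hr z) (f z)) := fun h hc h0 z => cfcₙ_apply_eq hT hc h0 z
  choose y hy1 hy2 hy3 using fun z => exists_fibre_factorization (hr z) (f z)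
  refine ⟨⟨fun z => (cfcₙ qroot T : S.C0).1 z, (cfcₙ qroot T : S.C0).2.1, ⟨K, hK, fun z hz => ?_⟩,
    (cfcₙ qroot T : S.C0).2.2.2⟩, y, ⟨?_, K, hK, fun z hz => ?_⟩, fun z ε hε => ?_,
    fun z k i m => ?_, fun z => ?_, hy3⟩
  · refine (cfcₙ_apply_eq hT hcq qroot_zero z).trans ?_
    rw [hTz z hz]
    exact cfcₙ_apply_zero
  · refine BanachBundle.isCont_of_approx hf.1.continuous_label fun z₀ ε hε => ?_
    have hc := continuous_qinv (show 0 < ε / 4 by positivity)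
    refine ⟨fun z => lsmul (hr z) ((cfcₙ (qinv (ε / 4)) T : S.C0).1 z) (f z),
      isCont_mul (cfcₙ (qinv (ε / 4)) T : S.C0).2.1 hf.1 _, Eventually.of_forall fun z => ?_⟩
    beta_reduce
    rw [happ _ hc (qinv_zero _)]
    refine (hy1 z (ε / 4) (by positivity)).trans_lt (by linarith)
  · have := hy3 z
    rw [hfK z hz, norm_zero] at this
    exact norm_eq_zero.1 (pow_eq_zero_iff two_ne_zero |>.1 (le_antisymm this (sq_nonneg _)))
  · have hc := continuous_qinv (show 0 < ε / 2 by positivity)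
    refine ⟨(cfcₙ (qinv (ε / 2)) T : S.C0).1 z, (cfcₙ (qinv (ε / 2)) T : S.C0).2.2.2 z, ?_⟩
    rw [happ _ hc (qinv_zero _)]
    exact (hy1 z (ε / 2) (by positivity)).trans (by linarith)
  · have hk : k = G.u (S.q z) := i.symm.trans (LCGroupoid.inv_u _)
    subst hk
    have h1 : star ((cfcₙ qroot T : S.C0).1 z) = (cfcₙ qroot T : S.C0).1 z := by
      rw [happ _ hcq qroot_zero]
      exact cfcₙ_predicate (R := ℝ) qroot (sqr (hr z) (f z))
    refine Eq.trans ?_ (hy2 z)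
    rw [← happ _ hcq qroot_zero]
    exact congrArg (fun b => A.mul m b (y z)) h1
  · change ‖(cfcₙ qroot T : S.C0).1 z‖ ^ 2 ≤ _
    rw [happ _ hcq qroot_zero]
    have : ‖cfcₙ qroot (sqr (hr z) (f z))‖ ≤ √‖f z‖ := norm_cfcₙ_le fun r hr' => by
      rw [Real.norm_of_nonneg (qroot_nonneg r)]
      refine Real.sqrt_le_sqrt ?_
      rw [Real.sqrt_le_left (norm_nonneg _), sq]
      exact (quasispectrum_sqr (hr z) hr').2
    rw [← Real.sq_sqrt (norm_nonneg (f z))]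
    exact pow_le_pow_left₀ (norm_nonneg _) this 2

end SubAlgFamily

end Factorization

section Adjointable

variable (D F : Type u) [NonUnitalCStarAlgebra D] [NormedAddCommGroup F] [NormedSpace ℂ F]
  [HilbertModule D F]

variable {F} in
/-- `S` is an adjoint of `T`. -/
def IsAdj (T S : F →L[ℂ] F) : Prop := ∀ v w, (inn (T v) w : D) = inn v (S w)

variable {D F} in
theorem IsAdj.symm {T S : F →L[ℂ] F} (h : IsAdj D T S) : IsAdj D S T := fun v w => by
  rw [← star_inn, ← h, star_inn]

variable {D F} in
theorem IsAdj.norm_le {T S : F →L[ℂ] F} (h : IsAdj D T S) : ‖S‖ ≤ ‖T‖ :=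
  S.opNorm_le_bound (norm_nonneg _) (HilbertModule.norm_le_of_inn h (norm_nonneg _) T.le_opNorm)

variable {D F} in
theorem IsAdj.unique {T S S' : F →L[ℂ] F} (h : IsAdj D T S) (h' : IsAdj D T S') : S = S' :=
  ContinuousLinearMap.ext fun v => HilbertModule.ext_inn (D := D) fun z => by rw [← h, ← h']

/-- The C*-algebra of adjointable operators on a Hilbert module. -/
def adjAlg : Subalgebra ℂ (F →L[ℂ] F) where
  carrier := {T | ∃ S, IsAdj D T S}
  mul_mem' := by
    rintro T T' ⟨S, hS⟩ ⟨S', hS'⟩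
    exact ⟨S' * S, fun v w => (hS _ _).trans (hS' _ _)⟩
  add_mem' := by
    rintro T T' ⟨S, hS⟩ ⟨S', hS'⟩
    exact ⟨S + S', fun v w => by
      rw [add_apply, add_apply, inn_add_left, inn_add_right,
        hS, hS']⟩
  algebraMap_mem' c := ⟨star c • 1, fun v w => by
    change (inn (c • v) w : D) = inn v (star c • w)
    rw [inn_smul_left, inn_smul_right]⟩

theorem isClosed_adjAlg : IsClosed (adjAlg D F : Set (F →L[ℂ] F)) := by
  have := HilbertModule.complete (D := D) (F := F)
  rw [← isSeqClosed_iff_isClosed]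
  intro T T₀ hT hTT
  choose S hS using hT
  have hd : ∀ m n, ‖S m - S n‖ ≤ ‖T m - T n‖ := fun m n =>
    IsAdj.norm_le (D := D) fun v w => by
      rw [sub_apply, sub_apply, inn_sub_left,
        inn_sub_right, hS, hS]
  have hc : CauchySeq S := by
    have := hTT.cauchySeq
    rw [Metric.cauchySeq_iff] at this ⊢
    intro ε hε
    obtain ⟨N, hN⟩ := this ε hε
    refine ⟨N, fun m hm n hn => ?_⟩
    have := hN m hm n hn
    rw [dist_eq_norm] at this ⊢
    exact (hd m n).trans_lt this
  obtain ⟨S₀, hS₀⟩ := cauchySeq_tendsto_of_complete hc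
  refine ⟨S₀, fun v w => ?_⟩
  have hi := HilbertModule.continuous_inn D F
  have h1 : Tendsto (fun n => (inn (T n v) w : D)) atTop (𝓝 (inn (T₀ v) w)) :=
    (hi.tendsto (T₀ v, w)).comp
      ((((ContinuousLinearMap.apply ℂ F v).continuous.tendsto T₀).comp hTT).prodMk_nhds
        tendsto_const_nhds)
  have h2 : Tendsto (fun n => (inn v (S n w) : D)) atTop (𝓝 (inn v (S₀ w))) :=
    (hi.tendsto (v, S₀ w)).comp (tendsto_const_nhds.prodMk_nhds
      (((ContinuousLinearMap.apply ℂ F w).continuous.tendsto S₀).comp hS₀))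
  exact tendsto_nhds_unique h1 (h2.congr fun n => (hS n v w).symm)

variable {D F}

theorem isAdj_choose (T : adjAlg D F) : IsAdj D T.1 T.2.choose := T.2.choose_spec

/-- The adjoint of an adjointable operator. -/
def adjAlg.dag (T : adjAlg D F) : adjAlg D F := ⟨T.2.choose, T.1, (isAdj_choose T).symm⟩

theorem adjAlg.isAdj (T : adjAlg D F) : IsAdj D T.1 (adjAlg.dag T).1 := isAdj_choose T

theorem adjAlg.dag_eq {T S : adjAlg D F} (h : IsAdj D T.1 S.1) : adjAlg.dag T = S :=
  Subtype.ext ((adjAlg.isAdj T).unique h)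

theorem adjAlg.norm_dag_mul_self (T : adjAlg D F) : ‖T‖ * ‖T‖ ≤ ‖adjAlg.dag T * T‖ := by
  have h : ∀ v, ‖T.1 v‖ ≤ √‖adjAlg.dag T * T‖ * ‖v‖ := fun v => by
    refine (le_abs_self _).trans (abs_le_of_sq_le_sq ?_ (by positivity))
    rw [mul_pow, Real.sq_sqrt (norm_nonneg (adjAlg.dag T * T)), HilbertModule.norm_sq_eq (D := D), adjAlg.isAdj T]
    refine (HilbertModule.norm_inn_le _ _).trans ?_
    have := (adjAlg.dag T * T).1.le_opNorm v
    calc ‖v‖ * ‖(adjAlg.dag T).1 (T.1 v)‖ ≤ ‖v‖ * (‖adjAlg.dag T * T‖ * ‖v‖) := by gcongr; exact this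
      _ = _ := by ring
  have h2 : ‖T‖ ≤ √‖adjAlg.dag T * T‖ := T.1.opNorm_le_bound (Real.sqrt_nonneg _) h
  calc ‖T‖ * ‖T‖ ≤ √‖adjAlg.dag T * T‖ * √‖adjAlg.dag T * T‖ := by gcongr
    _ = _ := Real.mul_self_sqrt (norm_nonneg (adjAlg.dag T * T))

variable (D F) in
/-- The adjointable operators form a C*-algebra. -/
@[reducible] def adjAlg.cstar : NonUnitalCStarAlgebra (adjAlg D F) :=
  have := HilbertModule.complete (D := D) (F := F)
  { (inferInstance : NormedRing (adjAlg D F)), (inferInstance : NormedSpace ℂ (adjAlg D F)) with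
    complete := ((isClosed_adjAlg D F).completeSpace_coe).complete
    star := adjAlg.dag
    star_involutive := fun T => adjAlg.dag_eq (adjAlg.isAdj T).symm
    star_mul := fun S T => adjAlg.dag_eq (T := S * T) (S := adjAlg.dag T * adjAlg.dag S) fun v w =>
      ((adjAlg.isAdj S) _ _).trans ((adjAlg.isAdj T) _ _)
    star_add := fun S T => adjAlg.dag_eq (T := S + T) (S := adjAlg.dag S + adjAlg.dag T)
      fun v w => by
        change (inn (S.1 v + T.1 v) w : D) = inn v ((adjAlg.dag S).1 w + (adjAlg.dag T).1 w)
        rw [inn_add_left, inn_add_right, adjAlg.isAdj S, adjAlg.isAdj T]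
    norm_mul_self_le := adjAlg.norm_dag_mul_self
    smul_assoc := fun c S T => smul_mul_assoc c S T
    smul_comm := fun c S T => (mul_smul_comm c S T).symm
    star_smul := fun c T => adjAlg.dag_eq (T := c • T) (S := star c • adjAlg.dag T) fun v w => by
      change (inn (c • T.1 v) w : D) = inn v (star c • (adjAlg.dag T).1 w)
      rw [inn_smul_left, inn_smul_right, adjAlg.isAdj T] }

variable (D F) in
/-- The type of adjointable operators. -/
def Adj : Type u := adjAlg D F

instance : NonUnitalCStarAlgebra (Adj D F) := adjAlg.cstar D F

namespace Adj

/-- The underlying operator. -/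
def app (T : Adj D F) : F →L[ℂ] F := Subtype.val (p := (· ∈ adjAlg D F)) T

theorem app_ext {S T : Adj D F} (h : ∀ v, S.app v = T.app v) : S = T :=
  Subtype.ext (ContinuousLinearMap.ext h)

theorem mul_app (S T : Adj D F) (v : F) : (S * T).app v = S.app (T.app v) := rfl
theorem norm_app (T : Adj D F) : ‖T‖ = ‖T.app‖ := rfl
theorem inn_app (T : Adj D F) (v w : F) : (inn (T.app v) w : D) = inn v ((star T).app w) :=
  adjAlg.isAdj T v w
theorem star_eq {S T : Adj D F} (h : IsAdj D T.app S.app) : star T = S := adjAlg.dag_eq h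

end Adj

end Adjointable

section SectionRepresentations

open FellBundle

variable {G : LCGroupoid.{u}} (A : FellBundle.{u} G) (α : HaarSystem G)

/-- A nondegenerate `*`-representation of the convolution algebra `C_c(G, A)` that is bounded by
the `I`-norm. -/
@[ext]
structure SecRep (D F : Type u) [NonUnitalCStarAlgebra D] [NormedAddCommGroup F]
    [NormedSpace ℂ F] [HilbertModule D F] where
  L : A.Sec →ₗ[ℂ] F →ₗ[ℂ] F
  map_conv : ∀ ξ η v, L (conv α ξ η) v = L ξ (L η v)
  adj : ∀ ξ v w, (inn (L ξ v) w : D) = inn v (L (starSec ξ) w)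
  bound : ∀ ξ v, ‖L ξ v‖ ≤ (normI α ξ).toReal * ‖v‖
  nondeg : IsTotal fun p : A.Sec × F => L p.1 p.2

variable {A α} {D F : Type u} [NonUnitalCStarAlgebra D] [NormedAddCommGroup F]
  [NormedSpace ℂ F] [HilbertModule D F]

theorem univHom_mem (ξ : A.Sec) : univHom α ξ ∈ (univRange A α).topologicalClosure :=
  NonUnitalStarSubalgebra.le_topologicalClosure _ ⟨ξ, rfl⟩

variable (A α) in
/-- The canonical map from `C_c(G, A)` to the C*-algebra of the Fell bundle. -/
def univ : A.Sec →ₗ[ℂ] CStar A α where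
  toFun ξ := ⟨univHom α ξ, univHom_mem ξ⟩
  map_add' ξ η := Subtype.ext (lp.ext (funext fun p => map_add p.hom.toFun ξ η))
  map_smul' c ξ := Subtype.ext (lp.ext (funext fun p => map_smul p.hom.toFun c ξ))

theorem univ_conv (ξ η : A.Sec) : univ A α (conv α ξ η) = univ A α ξ * univ A α η :=
  Subtype.ext (lp.ext (funext fun p => p.hom.map_conv ξ η))

theorem univ_star (ξ : A.Sec) : univ A α (starSec ξ) = star (univ A α ξ) :=
  Subtype.ext (lp.ext (funext fun p => p.hom.map_star ξ))

theorem norm_univ_le (ξ : A.Sec) : ‖univ A α ξ‖ ≤ (normI α ξ).toReal := by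
  refine lp.norm_le_of_forall_le ENNReal.toReal_nonneg fun p => ?_
  have := ENNReal.toReal_mono (normI_lt_top α ξ).ne (p.hom.bound ξ)
  rwa [toReal_enorm] at this

theorem denseRange_univ : DenseRange (univ A α) := by
  refine fun c => Metric.mem_closure_iff.2 fun ε hε => ?_
  have hc : Subtype.val (p := (· ∈ (univRange A α).topologicalClosure)) c ∈
      closure (Set.range (univHom α (A := A))) :=
    Subtype.property (p := (· ∈ (univRange A α).topologicalClosure)) c
  obtain ⟨_, ⟨ξ, rfl⟩, h⟩ := Metric.mem_closure_iff.1 hc ε hε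
  exact ⟨_, ⟨ξ, rfl⟩, h⟩

theorem norm_hom_le_univ {C : Type u} [NonUnitalCStarAlgebra C] (ρ : SecHom A α C) (ξ : A.Sec) :
    ‖ρ.toFun ξ‖ ≤ ‖univ A α ξ‖ := by
  let p : SemiIdx A α := ⟨fun ξ => ‖ρ.toFun ξ‖, C, inferInstance, ρ, fun _ => rfl⟩
  have h := p.hom_spec α ξ
  change ‖ρ.toFun ξ‖ = _ at h
  rw [h]
  exact lp.norm_apply_le_norm (by simp) (univHom α ξ) p

/-- The restriction of a representation of the C*-algebra to the convolution algebra. -/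
def NondegRep.toSecRep (L : NondegRep (CStar A α) D F) : SecRep A α D F where
  L := L.act ∘ₗ univ A α
  map_conv ξ η v := by
    simp only [LinearMap.comp_apply, univ_conv, L.act_mul]
  adj ξ v w := by
    simp only [LinearMap.comp_apply, univ_star, L.adj]
  bound ξ v := (L.norm_act_le _ _).trans
    (mul_le_mul_of_nonneg_right (norm_univ_le ξ) (norm_nonneg _))
  nondeg := by
    refine ((LeftAction.isNondegenerate_iff _).1 L.nondeg).of_forall_mem_closure ?_
    rintro ⟨c, v⟩
    refine denseRange_univ.induction_on (p := fun c => L.act c v ∈ closure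
      (Submodule.span ℂ (Set.range fun p : A.Sec × F => (L.act ∘ₗ univ A α) p.1 p.2) : Set F)) c
      ?_ fun ξ => ?_
    · exact isClosed_closure.preimage (f := fun c => L.act c v)
        (L.continuous_act.comp (continuous_id.prodMk continuous_const))
    · exact subset_closure (Submodule.subset_span ⟨(ξ, v), rfl⟩)

theorem exists_extension {V B C : Type*} [AddCommGroup V] [Module ℂ V] [NormedAddCommGroup B]
    [NormedSpace ℂ B] [NormedAddCommGroup C] [NormedSpace ℂ C] [CompleteSpace C] (f : V →ₗ[ℂ] C)
    (e : V →ₗ[ℂ] B) (he : DenseRange e) (h : ∃ c, ∀ v, ‖f v‖ ≤ c * ‖e v‖) :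
    ∃ T : B →L[ℂ] C, ∀ v, T (e v) = f v :=
  ⟨f.extendOfNorm e, LinearMap.extendOfNorm_eq he h⟩

namespace SecRep

variable (R : SecRep A α D F)

/-- The operators of the representation as adjointable operators. -/
def toAdj : A.Sec →ₗ[ℂ] Adj D F where
  toFun ξ := ⟨(R.L ξ).mkContinuous _ (R.bound ξ), (R.L (starSec ξ)).mkContinuous _ (R.bound _),
    R.adj ξ⟩
  map_add' ξ η := Adj.app_ext fun v => congrFun (congrArg DFunLike.coe (map_add R.L ξ η)) v
  map_smul' c ξ := Adj.app_ext fun v => congrFun (congrArg DFunLike.coe (map_smul R.L c ξ)) v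

theorem toAdj_app (ξ : A.Sec) (v : F) : (R.toAdj ξ).app v = R.L ξ v := rfl

/-- The bounded `*`-homomorphism to the adjointable operators. -/
def toHom : SecHom A α (Adj D F) where
  toFun := R.toAdj
  map_conv ξ η := Adj.app_ext fun v => R.map_conv ξ η v
  map_star ξ := (Adj.star_eq (T := R.toAdj ξ) (S := R.toAdj (starSec ξ)) (R.adj ξ)).symm
  bound ξ := by
    rw [← ENNReal.ofReal_toReal (normI_lt_top α ξ).ne, ← ofReal_norm, Adj.norm_app]
    exact ENNReal.ofReal_le_ofReal
      ((R.toAdj ξ).app.opNorm_le_bound ENNReal.toReal_nonneg (R.bound ξ))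

theorem exists_norm_le : ∃ C, ∀ ξ, ‖R.toAdj ξ‖ ≤ C * ‖univ A α ξ‖ :=
  ⟨1, fun ξ => (norm_hom_le_univ R.toHom ξ).trans_eq (one_mul _).symm⟩

theorem exists_ext : ∃ T : CStar A α →L[ℂ] Adj D F, ∀ ξ, T (univ A α ξ) = R.toAdj ξ :=
  exists_extension R.toAdj (univ A α) denseRange_univ R.exists_norm_le

/-- The extension of the representation to the C*-algebra. -/
def ext₀ : CStar A α →L[ℂ] Adj D F := R.exists_ext.choose

theorem ext₀_univ (ξ : A.Sec) : R.ext₀ (univ A α ξ) = R.toAdj ξ := R.exists_ext.choose_spec ξ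

theorem ext₀_mul (c d : CStar A α) : R.ext₀ (c * d) = R.ext₀ c * R.ext₀ d := by
  refine denseRange_univ.induction_on₂ (p := fun c d => R.ext₀ (c * d) = R.ext₀ c * R.ext₀ d)
    ?_ (fun ξ η => ?_) c d
  · exact isClosed_eq (R.ext₀.continuous.comp continuous_mul)
      ((R.ext₀.continuous.comp continuous_fst).mul (R.ext₀.continuous.comp continuous_snd))
  · rw [← univ_conv, ext₀_univ, ext₀_univ, ext₀_univ]
    exact R.toHom.map_conv ξ η

theorem ext₀_star (c : CStar A α) : R.ext₀ (star c) = star (R.ext₀ c) := by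
  refine denseRange_univ.induction_on (p := fun c => R.ext₀ (star c) = star (R.ext₀ c)) c
    ?_ (fun ξ => ?_)
  · exact isClosed_eq (R.ext₀.continuous.comp continuous_star) R.ext₀.continuous.star
  · rw [← univ_star, ext₀_univ, ext₀_univ]
    exact R.toHom.map_star ξ

/-- The representation of the C*-algebra given by a bounded representation of the convolution
algebra. -/
def toNondegRep : NondegRep (CStar A α) D F where
  act :=
    { toFun := fun c => (R.ext₀ c).app.toLinearMap
      map_add' := fun c d => by rw [map_add]; rfl
      map_smul' := fun c d => by rw [map_smul]; rfl }
  act_mul c d v := by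
    change (R.ext₀ (c * d)).app v = (R.ext₀ c).app ((R.ext₀ d).app v)
    rw [ext₀_mul, Adj.mul_app]
  adj c v w := by
    change (inn ((R.ext₀ c).app v) w : D) = inn v ((R.ext₀ (star c)).app w)
    rw [ext₀_star, Adj.inn_app]
  nondeg := by
    rw [LeftAction.isNondegenerate_iff]
    exact R.nondeg.of_forall_exists fun p => ⟨(univ A α p.1, p.2), by
      change (R.ext₀ (univ A α p.1)).app p.2 = _
      rw [ext₀_univ, toAdj_app]⟩

theorem toNondegRep_act (ξ : A.Sec) (v : F) : R.toNondegRep.act (univ A α ξ) v = R.L ξ v := by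
  change (R.ext₀ (univ A α ξ)).app v = _
  rw [ext₀_univ, toAdj_app]

end SecRep

theorem NondegRep.ext_univ {L L' : NondegRep (CStar A α) D F}
    (h : ∀ ξ v, L.act (univ A α ξ) v = L'.act (univ A α ξ) v) : L = L' := by
  refine NondegRep.ext (LinearMap.ext fun c => LinearMap.ext fun v => ?_)
  refine denseRange_univ.induction_on (p := fun c => L.act c v = L'.act c v) c ?_ (h · v)
  exact isClosed_eq (L.continuous_act.comp (continuous_id.prodMk continuous_const))
    (L'.continuous_act.comp (continuous_id.prodMk continuous_const))

variable (A α D F) in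
/-- Representations of the C*-algebra correspond to bounded representations of the convolution
algebra. -/
def secRepEquiv : NondegRep (CStar A α) D F ≃ SecRep A α D F where
  toFun := NondegRep.toSecRep
  invFun := SecRep.toNondegRep
  left_inv L := NondegRep.ext_univ fun ξ v => L.toSecRep.toNondegRep_act ξ v
  right_inv R := SecRep.ext (LinearMap.ext fun ξ => LinearMap.ext fun v => R.toNondegRep_act ξ v)

theorem secRepEquiv_L (L : NondegRep (CStar A α) D F) (ξ : A.Sec) (v : F) :
    (secRepEquiv A α D F L).L ξ v = L.act (univ A α ξ) v := rfl

end SectionRepresentations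

section InductiveLimit

namespace BanachBundle

variable {X : Type u} [TopologicalSpace X] {A : BanachBundle.{u} X} {Z : Type*} [TopologicalSpace Z]
  {ℓ : C(Z, X)} {E : ∀ z, Submodule ℂ (A.fib (ℓ z))} {N : Type*} [NormedAddCommGroup N]

/-- Boundedness on the sections that are supported in a given compact set. -/
def IndCont (Φ : A.Cc ℓ E → N) : Prop :=
  ∀ K : Set Z, IsCompact K → ∃ C : ℝ, 0 ≤ C ∧ ∀ (f : A.Cc ℓ E) (B : ℝ), 0 ≤ B →
    (∀ z ∉ K, f.1 z = 0) → (∀ z, ‖f.1 z‖ ≤ B) → ‖Φ f‖ ≤ C * B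

/-- A family of sections that is closed under multiplication by bump functions and fibrewise
total. -/
structure Spanning {ι : Type*} (s : ι → A.Cc ℓ E) : Prop where
  bumps : ∀ z, ∀ N ∈ 𝓝 z, ∃ χ : Z → ℝ, (∀ y, 0 ≤ χ y ∧ χ y ≤ 1) ∧ (∀ᶠ y in 𝓝 z, χ y = 1) ∧
    (∀ y ∉ N, χ y = 0) ∧ ∀ i, ∃ j, ∀ y, (s j).1 y = (χ y : ℂ) • (s i).1 y
  dense : ∀ z, ∀ a ∈ E z, ∀ ε > 0, ∃ v ∈ Submodule.span ℂ (Set.range s), ‖v.1 z - a‖ < ε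

variable {ι : Type*} {s : ι → A.Cc ℓ E}

theorem Spanning.exists_approx [T2Space Z] [LocallyCompactSpace Z] (hs : Spanning s)
    {K : Set Z} (hK : IsCompact K) : ∃ K' : Set Z, IsCompact K' ∧ ∀ f : A.Cc ℓ E,
      (∀ z ∉ K, f.1 z = 0) → ∀ ε > 0, ∃ g ∈ Submodule.span ℂ (Set.range s),
        (∀ z ∉ K', (f - g).1 z = 0) ∧ ∀ z, ‖(f - g).1 z‖ ≤ ε := by
  obtain ⟨K', hK', hKK⟩ := exists_compact_superset hK
  let V : Submodule ℂ (∀ z, A.fib (ℓ z)) :=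
    (Submodule.span ℂ (Set.range s)).map (A.Cc ℓ E).subtype
  have hb : HasBumps V := by
    intro z N hN
    obtain ⟨χ, h1, h2, h3, h4⟩ := hs.bumps z N hN
    refine ⟨χ, h1, h2, h3, ?_⟩
    rintro _ ⟨v, hv, rfl⟩
    induction hv using Submodule.span_induction with
    | mem v hv =>
      obtain ⟨i, rfl⟩ := hv
      obtain ⟨j, hj⟩ := h4 i
      exact ⟨s j, Submodule.subset_span ⟨j, rfl⟩, funext hj⟩
    | zero =>
      convert V.zero_mem using 1
      ext y; exact smul_zero _
    | add v w _ _ hv hw =>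
      convert V.add_mem hv hw using 1
      ext y; exact smul_add _ _ _
    | smul c v _ hv =>
      convert V.smul_mem c hv using 1
      ext y; exact smul_comm _ _ _
  refine ⟨K', hK', fun f hfK ε hε => ?_⟩
  obtain ⟨_, ⟨g, hg, rfl⟩, h1, h2⟩ := exists_uniform_approx (V := V) (f := f.1)
    (by rintro _ ⟨v, -, rfl⟩; exact v.2.1) hb f.2.1 hK hfK isOpen_interior hKK
    (fun z _ ε hε => by
      obtain ⟨v, hv, hvz⟩ := hs.dense z (f.1 z) (f.2.2.2 z) ε hε
      exact ⟨_, ⟨v, hv, rfl⟩, hvz⟩) hε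
  refine ⟨g, hg, fun z hz => ?_, fun z => ?_⟩
  · have h3 : g.1 z = 0 := h2 z fun h => hz (interior_subset h)
    have h4 : f.1 z = 0 := hfK z fun h => hz (interior_subset (hKK h))
    change f.1 z - g.1 z = 0
    rw [h3, h4, sub_zero]
  · have := h1 z
    rw [norm_sub_rev] at this
    exact this

variable [NormedSpace ℂ N] {σ : ℂ →+* ℂ}

theorem IndCont.mem [T2Space Z] [LocallyCompactSpace Z] (hs : Spanning s)
    {Φ : A.Cc ℓ E →ₛₗ[σ] N} (hΦ : IndCont Φ) {S : Submodule ℂ N} (hS : IsClosed (S : Set N))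
    (h : ∀ i, Φ (s i) ∈ S) (f : A.Cc ℓ E) : Φ f ∈ S := by
  obtain ⟨K₀, hK₀, hf₀⟩ := f.2.2.1
  obtain ⟨K, hK, hf⟩ := hs.exists_approx hK₀
  obtain ⟨C, hC, hΦC⟩ := hΦ K hK
  rw [← SetLike.mem_coe, ← hS.closure_eq, Metric.mem_closure_iff]
  intro ε hε
  obtain ⟨g, hg, h1, h2⟩ := hf f hf₀ (ε / (C + 1)) (by positivity)
  have hgS : g ∈ S.comap Φ := Submodule.span_le.2 (by rintro _ ⟨i, rfl⟩; exact h i) hg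
  refine ⟨Φ g, hgS, ?_⟩
  rw [dist_eq_norm, ← map_sub]
  refine (hΦC (f - g) _ (by positivity) h1 h2).trans_lt ?_
  rw [mul_div_assoc', div_lt_iff₀ (by positivity)]
  nlinarith

theorem IndCont.ext [T2Space Z] [LocallyCompactSpace Z] (hs : Spanning s)
    {Φ Ψ : A.Cc ℓ E →ₛₗ[σ] N} (hΦ : IndCont Φ) (hΨ : IndCont Ψ)
    (h : ∀ i, Φ (s i) = Ψ (s i)) (f : A.Cc ℓ E) : Φ f = Ψ f := by
  have hd : IndCont (Φ - Ψ : A.Cc ℓ E →ₛₗ[σ] N) := fun K hK => by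
    obtain ⟨C, hC, h1⟩ := hΦ K hK
    obtain ⟨C', hC', h2⟩ := hΨ K hK
    refine ⟨C + C', by positivity, fun f B hB hf hfB => ?_⟩
    rw [add_mul]
    exact (norm_sub_le _ _).trans (add_le_add (h1 f B hB hf hfB) (h2 f B hB hf hfB))
  have := IndCont.mem hs hd (S := ⊥) isClosed_singleton
    (fun i => (Submodule.mem_bot _).2 (sub_eq_zero.2 (h i))) f
  exact sub_eq_zero.1 ((Submodule.mem_bot _).1 this)

theorem IndCont.clm_comp {N' : Type*} [NormedAddCommGroup N'] [NormedSpace ℂ N']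
    {Φ : A.Cc ℓ E → N} (hΦ : IndCont Φ) {τ : ℂ →+* ℂ} [RingHomIsometric τ] (T : N →SL[τ] N') :
    IndCont fun f => T (Φ f) := fun K hK => by
  obtain ⟨C, hC, h1⟩ := hΦ K hK
  refine ⟨‖T‖ * C, by positivity, fun f B hB hf hfB => ?_⟩
  rw [mul_assoc]
  exact T.le_opNorm_of_le (h1 f B hB hf hfB)

end BanachBundle

variable {G : LCGroupoid.{u}} {A : FellBundle.{u} G} {α : HaarSystem G} {Z W Y Y' : Type u}
  [TopologicalSpace Z] [TopologicalSpace W] [TopologicalSpace Y] [TopologicalSpace Y']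
  {N : Type*} [NormedAddCommGroup N]

open BanachBundle

theorem IntegralOp.IsBdd.indCont {π : C(Z, W)} {J : IntegralOp A π} (hJ : J.IsBdd)
    {ℓ : C(W, G.Arr)} {Φ : A.CcTop ℓ → N} (hΦ : IndCont Φ) : IndCont fun f => Φ (J.int ℓ f) := by
  intro K hK
  obtain ⟨C, hC, h⟩ := hJ K hK
  obtain ⟨C', hC', h'⟩ := hΦ (π '' K) (hK.image π.continuous)
  refine ⟨C' * C, mul_nonneg hC' hC, fun f B hB hf hfB => ?_⟩
  rw [mul_assoc]
  exact h' (J.int ℓ f) (C * B) (mul_nonneg hC hB)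
    (fun w hw => J.int_eq_zero f w fun z hz => hf z fun hzK => hw ⟨z, hzK, hz⟩)
    (h ℓ f B hB hf hfB)

namespace L2Data

variable {π : C(Z, Y)} {S : SubAlgFamily A Y} {X : L2Data A π S}

theorem norm_inn_le {K : Set Z} {C : ℝ} (hC : 0 ≤ C)
    (h : ∀ (ℓ : C(Y, G.Arr)) (f : A.CcTop (ℓ.comp π)) (B : ℝ),
    0 ≤ B → (∀ z ∉ K, f.1 z = 0) → (∀ z, ‖f.1 z‖ ≤ B) → ∀ w, ‖(X.J.int ℓ f).1 w‖ ≤ C * B)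
    (x y : X.Sec) (B B' : ℝ) (hB : 0 ≤ B) (hB' : 0 ≤ B') (hy : ∀ z ∉ K, ev y z = 0)
    (hx : ∀ z, ‖ev x z‖ ≤ B) (hyB : ∀ z, ‖ev y z‖ ≤ B') : ‖(inn x y : S.C0)‖ ≤ C * (B * B') := by
  refine SubAlgFamily.C0.norm_le (by positivity) fun w => ?_
  refine h S.label (ptInn x y) (B * B') (by positivity) (fun z hz => ?_) (fun z => ?_) w
  · change A.mul _ _ (ev y z) = 0
    rw [hy z hz]; exact map_zero _
  · refine (A.norm_mul_le _ _ _).trans ?_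
    rw [A.norm_adj]
    exact mul_le_mul (hx z) (hyB z) (norm_nonneg _) hB

variable {D F : Type u} [NonUnitalCStarAlgebra D] [NormedAddCommGroup F] [NormedSpace ℂ F]
  [HilbertModule D F] (φ : LeftAction S.C0 D F)

variable (X) in
/-- The map `x ↦ x ⊗ v`. -/
def tensL (v : F) : A.Cc X.p X.E →ₗ[ℂ] φ.Tensor X.Sec where
  toFun x := φ.tens (X := X.Sec) x v
  map_add' x y := φ.tens_add_left (X := X.Sec) x y v
  map_smul' c x := φ.tens_smul_left (X := X.Sec) c x v

theorem indCont_tensL (hJ : X.J.IsBdd) (v : F) : IndCont (X.tensL φ v) := by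
  intro K hK
  obtain ⟨C, hC, h⟩ := hJ K hK
  refine ⟨√C * ‖v‖, by positivity, fun x B hB hx hxB => ?_⟩
  have h1 : ‖(inn (V := X.Sec) x x : S.C0)‖ ≤ C * (B * B) :=
    norm_inn_le hC h x x B B hB hB hx hxB hxB
  calc _ ≤ √‖(inn (V := X.Sec) x x : S.C0)‖ * ‖v‖ := φ.norm_tens_le (X := X.Sec) x v
    _ ≤ √(C * (B * B)) * ‖v‖ := by gcongr
    _ = _ := by rw [Real.sqrt_mul hC, Real.sqrt_mul_self hB]; ring

theorem isTotal_tens_of_spanning [T2Space Z] [LocallyCompactSpace Z] (hJ : X.J.IsBdd) {ι : Type u}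
    {s : ι → X.Sec} (hs : Spanning (A := A.toBanachBundle) (E := X.E) s) :
    IsTotal fun p : ι × F => φ.tens (s p.1) p.2 := by
  refine φ.isTotal_tens.of_forall_mem_closure fun p => ?_
  refine IndCont.mem hs (indCont_tensL φ hJ p.2) (S := (Submodule.span ℂ (Set.range
    fun p : ι × F => φ.tens (s p.1) p.2)).topologicalClosure)
    (Submodule.isClosed_topologicalClosure _) (fun i => ?_) p.1
  exact Submodule.le_topologicalClosure _ (Submodule.subset_span ⟨(i, p.2), rfl⟩)

variable {π' : C(Z, Y')} {S' : SubAlgFamily A Y'} {X' : L2Data A π' S'}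

/-- The section `z ↦ x(z)^* y(z)`. -/
def pair {ℓ : C(Z, G.Arr)} (m : ∀ z, G.IsMul (G.inv (X'.p z)) (X.p z) (ℓ z)) (x : X'.Sec)
    (y : X.Sec) : A.CcTop ℓ :=
  ⟨fun z => A.mul (m z) (A.adj rfl (ev x z)) (ev y z),
    FellBundle.isCont_mul (FellBundle.isCont_adj (isCont_ev x) _) (isCont_ev y) _, by
      obtain ⟨K, hK, hK0⟩ := exists_compact_ev x
      refine ⟨K, hK, fun z hz => ?_⟩
      beta_reduce
      rw [hK0 z hz, map_zero, map_zero, LinearMap.zero_apply], fun _ => trivial⟩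

variable {ℓ : C(Z, G.Arr)} (m : ∀ z, G.IsMul (G.inv (X'.p z)) (X.p z) (ℓ z))

theorem pair_add_right (x : X'.Sec) (y y' : X.Sec) :
    pair m x (y + y') = pair m x y + pair m x y' := Subtype.ext (funext fun z =>
  map_add (A.mul (m z) (A.adj rfl (ev x z))) (ev y z) (ev y' z))

theorem pair_smul_right (c : ℂ) (x : X'.Sec) (y : X.Sec) :
    pair m x (c • y) = c • pair m x y := Subtype.ext (funext fun z =>
  map_smul (A.mul (m z) (A.adj rfl (ev x z))) c (ev y z))

theorem pair_add_left (x x' : X'.Sec) (y : X.Sec) :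
    pair m (x + x') y = pair m x y + pair m x' y := Subtype.ext (funext fun z => by
  change A.mul (m z) (A.adj rfl (ev x z + ev x' z)) (ev y z) = A.mul (m z) (A.adj rfl (ev x z)) (ev y z)
    + A.mul (m z) (A.adj rfl (ev x' z)) (ev y z)
  rw [map_add, map_add, LinearMap.add_apply])

theorem pair_smul_left (c : ℂ) (x : X'.Sec) (y : X.Sec) :
    pair m (c • x) y = star c • pair m x y := Subtype.ext (funext fun z => by
  change A.mul (m z) (A.adj rfl (c • ev x z)) (ev y z)
    = star c • A.mul (m z) (A.adj rfl (ev x z)) (ev y z)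
  rw [map_smulₛₗ, map_smul, LinearMap.smul_apply]; rfl)

theorem exists_bound_ev (x : X.Sec) : ∃ C : ℝ, 0 ≤ C ∧ ∀ z, ‖ev x z‖ ≤ C := by
  obtain ⟨C, hC⟩ := SubAlgFamily.exists_bound (A := A.toBanachBundle) (ℓ := X.p) (E := X.E) x
  exact ⟨max C 0, le_max_right _ _, fun z => (hC z).trans (le_max_left _ _)⟩

theorem indCont_pair_right {Φ : A.CcTop ℓ → N} (hΦ : IndCont Φ) (x : X'.Sec) :
    IndCont (A := A.toBanachBundle) (E := X.E) fun y : X.Sec => Φ (pair m x y) := by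
  obtain ⟨b, hb, hx⟩ := exists_bound_ev x
  intro K hK
  obtain ⟨C, hC, h⟩ := hΦ K hK
  refine ⟨C * b, by positivity, fun y B hB hy hyB => ?_⟩
  rw [mul_assoc]
  refine h _ (b * B) (by positivity) (fun z hz => ?_) fun z => ?_
  · change A.mul _ _ (ev (X := X) y z) = 0
    have : ev (X := X) y z = 0 := hy z hz
    rw [this, map_zero]
  · refine (A.norm_mul_le _ _ _).trans ?_
    rw [A.norm_adj]
    exact mul_le_mul (hx z) (hyB z) (norm_nonneg _) hb

theorem indCont_pair_left {Φ : A.CcTop ℓ → N} (hΦ : IndCont Φ) (y : X.Sec) :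
    IndCont (A := A.toBanachBundle) (E := X'.E) fun x : X'.Sec => Φ (pair m x y) := by
  obtain ⟨b, hb, hx⟩ := exists_bound_ev y
  intro K hK
  obtain ⟨C, hC, h⟩ := hΦ K hK
  refine ⟨C * b, by positivity, fun x B hB hy hyB => ?_⟩
  rw [mul_assoc]
  refine h _ (b * B) (by positivity) (fun z hz => ?_) fun z => ?_
  · change A.mul _ (A.adj rfl (ev (X := X') x z)) _ = 0
    have : ev (X := X') x z = 0 := hy z hz
    rw [this, map_zero, map_zero, LinearMap.zero_apply]
  · refine (A.norm_mul_le _ _ _).trans ?_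
    rw [A.norm_adj, mul_comm]
    exact mul_le_mul (hx z) (hyB z) (norm_nonneg _) hb

end L2Data

end InductiveLimit

section Canonical

variable {G : LCGroupoid.{u}} {A : FellBundle.{u} G}

/-- Evaluation of sections at a point. -/
def BanachBundle.evL {X : Type u} [TopologicalSpace X] {A : BanachBundle.{u} X} {Z : Type*}
    [TopologicalSpace Z] {ℓ : C(Z, X)} {E : ∀ z, Submodule ℂ (A.fib (ℓ z))} (z : Z) :
    A.Cc ℓ E →ₗ[ℂ] A.fib (ℓ z) where
  toFun f := f.1 z
  map_add' _ _ := rfl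
  map_smul' _ _ := rfl

namespace FellBundle

theorem adj_mem_prodSpan' {g h k g' h' k' : G.Arr} (m : G.IsMul g h k) (m' : G.IsMul h' g' k')
    (ig : G.inv g = g') (ih : G.inv h = h') (ik : G.inv k = k') {P : Submodule ℂ (A.fib g)}
    {Q : Submodule ℂ (A.fib h)} {P' : Submodule ℂ (A.fib g')} {Q' : Submodule ℂ (A.fib h')}
    (hP : ∀ a ∈ P, A.adj ig a ∈ P') (hQ : ∀ b ∈ Q, A.adj ih b ∈ Q') {t : A.fib k}
    (ht : t ∈ A.prodSpan m P Q) : A.adj ik t ∈ A.prodSpan m' Q' P' := by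
  refine prodSpan_le (R := (A.prodSpan m' Q' P').comap (A.adj ik)) ?_ (fun a ha b hb => ?_) ht
  · refine (isClosed_prodSpan m' Q' P').preimage (f := fun a => A.adj ik a) ?_
    exact (AddMonoidHomClass.isometry_of_norm (A.adj ik) fun a => A.norm_adj ik a).continuous
  · change A.adj ik (A.mul m a b) ∈ A.prodSpan m' Q' P'
    rw [A.adj_mul m m' ig ih ik]
    exact mul_mem_prodSpan m' (hQ b hb) (hP a ha)

theorem idealI_star (z : G.Sq) {x : G.Obj} (hx : G.r (G.d1 z) = x) {t : A.fib (G.u x)}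
    (ht : t ∈ A.idealI z hx) : star t ∈ A.idealI z hx :=
  adj_mem_prodSpan' (P' := A.prodSpan (LCGroupoid.isMul_sq z).inv ⊤ ⊤)
    (Q' := A.prodSpan (LCGroupoid.isMul_sq z) ⊤ ⊤) _ (LCGroupoid.isMul_self_inv hx) rfl
    (LCGroupoid.inv_inv _) _
    (fun _ ha => adj_mem_prodSpan' (P' := ⊤) (Q' := ⊤) _ _ rfl rfl rfl (fun _ _ => trivial)
      (fun _ _ => trivial) ha)
    (fun _ hb => adj_mem_prodSpan' (P' := ⊤) (Q' := ⊤) _ _ (LCGroupoid.inv_inv _)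
      (LCGroupoid.inv_inv _) _ (fun _ _ => trivial) (fun _ _ => trivial) hb) ht

variable (A) in
/-- The C*-algebra of sections of the field of ideals `A_g A_h A_h^* A_g^*`. -/
def idealFam : SubAlgFamily A G.Sq where
  q := G.r.comp G.d2
  S z := A.idealI z (LCGroupoid.r_d1 z)
  isClosed _ := isClosed_prodSpan _ _ _
  mul_mem z _ b ha _ := idealI_mul z _ ha b
  star_mem z _ ha := idealI_star z _ ha

/-- A closed `*`-subalgebra is spanned by its products. -/
theorem le_prodSpan_self {x : G.Obj} {I : Submodule ℂ (A.fib (G.u x))}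
    (hI : IsClosed (I : Set (A.fib (G.u x)))) (hm : ∀ a ∈ I, ∀ b ∈ I, a * b ∈ I)
    (hs : ∀ a ∈ I, star a ∈ I) : I ≤ A.prodSpan (LCGroupoid.isMul_u x) I I := by
  let B : NonUnitalStarSubalgebra ℂ (A.fib (G.u x)) :=
    { I with
      mul_mem' := fun ha hb => hm _ ha _ hb
      star_mem' := fun ha => hs _ ha }
  let _ : NonUnitalCStarAlgebra B := NonUnitalStarSubalgebra.nonUnitalCStarAlgebra B (h_closed := hI)
  have h := IsTotal.mem_of_isClosed (isTotal_mul B)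
    (S := (A.prodSpan (LCGroupoid.isMul_u x) I I).comap (B.subtype : B →ₗ[ℂ] A.fib (G.u x)))
    ((isClosed_prodSpan _ _ _).preimage continuous_subtype_val)
    (fun p => mul_mem_prodSpan _ p.1.2 p.2.2)
  exact fun a ha => h ⟨a, ha⟩

theorem idealI_le (z : G.Sq) {x : G.Obj} (hx : G.r (G.d1 z) = x) :
    A.idealI z hx ≤ A.prodSpan (LCGroupoid.isMul_u x) (A.idealI z hx) (A.idealI z hx) :=
  le_prodSpan_self (isClosed_prodSpan _ _ _) (fun _ ha b _ => idealI_mul z hx ha b)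
    fun _ ha => idealI_star z hx ha

theorem ideal1_mul_mem (z : G.Sq) {a : A.fib (G.d2 z)} (ha : a ∈ ideal1 A z) (b : A.fib (G.d0 z)) :
    A.mul (LCGroupoid.isMul_sq z) a b ∈ ideal2 A z := by
  have hx : G.r (G.d1 z) = G.r (G.d2 z) := LCGroupoid.r_d1 z
  have key : ∀ {x : G.Obj} (hx : G.r (G.d2 z) = x) (hx' : G.r (G.d1 z) = x),
      a ∈ A.prodSpan (LCGroupoid.isMul_u_left hx) (A.idealI z hx') ⊤ →
      A.mul (LCGroupoid.isMul_sq z) a b ∈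
        A.prodSpan (LCGroupoid.isMul_u_left hx') (A.idealI z hx') ⊤ := fun hx hx' ha =>
    prodSpan_mul _ (LCGroupoid.isMul_sq z) (LCGroupoid.isMul_sq z) _ ha b fun _ _ => trivial
  have h1 := key rfl hx ha
  have h2 : ∀ {x : G.Obj} (hx : G.r (G.d1 z) = x) {c : A.fib (G.d1 z)},
      c ∈ A.prodSpan (LCGroupoid.isMul_u_left hx) (A.idealI z hx) ⊤ → c ∈ ideal2 A z := by
    rintro _ rfl c hc; exact hc
  exact h2 hx h1

theorem ideal2_le (z : G.Sq) : ideal2 A z ≤ A.prodSpan (LCGroupoid.isMul_sq z) (ideal1 A z) ⊤ := by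
  have key : ∀ {x : G.Obj} (hx : G.r (G.d2 z) = x) (hx' : G.r (G.d1 z) = x),
      A.prodSpan (LCGroupoid.isMul_u_left hx') (A.idealI z hx') ⊤ ≤
      A.prodSpan (LCGroupoid.isMul_sq z)
        (A.prodSpan (LCGroupoid.isMul_u_left hx) (A.idealI z hx') ⊤) ⊤ := by
    intro x hx hx'
    refine prodSpan_le (isClosed_prodSpan _ _ _) fun t ht c _ => ?_
    refine mul_right_mem (isClosed_prodSpan _ _ _) _ _ (idealI_le z hx' ht) c fun t₁ h₁ t₂ h₂ => ?_
    rw [A.mul_assoc _ _ (LCGroupoid.isMul_u_left hx') (LCGroupoid.isMul_u_left hx')]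
    have ms : G.IsMul (G.inv (G.d1 z)) (G.d1 z) (G.u (G.s (G.d1 z))) :=
      LCGroupoid.isMul_inv_self rfl
    have mq : G.IsMul (G.d1 z) (G.u (G.s (G.d1 z))) (G.d1 z) := LCGroupoid.isMul_u_right rfl
    have m0 : G.IsMul (G.d0 z) (G.u (G.s (G.d1 z))) (G.d0 z) :=
      LCGroupoid.isMul_u_right (LCGroupoid.s_d1 z).symm
    have h3 : A.mul (LCGroupoid.isMul_u_left hx') t₂ c ∈ A.prodSpan (LCGroupoid.isMul_sq z) ⊤ ⊤ := by
      refine mul_right_mem (isClosed_prodSpan _ _ _) _ _ h₂ c fun a ha b _ => ?_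
      rw [A.mul_assoc _ _ ms mq]
      exact prodSpan_mul _ mq m0 _ ha _ fun _ _ => trivial
    refine mul_left_mem (isClosed_prodSpan _ _ _) _ _ h3 t₁ fun a _ b _ => ?_
    rw [← A.mul_assoc (LCGroupoid.isMul_u_left hx) (LCGroupoid.isMul_sq z)]
    exact mul_mem_prodSpan _ (mul_mem_prodSpan _ h₁ trivial) trivial
  have h2 : ∀ {x : G.Obj} (hx : G.r (G.d1 z) = x), ideal2 A z ≤
      A.prodSpan (LCGroupoid.isMul_u_left hx) (A.idealI z hx) ⊤ := by
    rintro _ rfl; exact le_rfl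
  exact (h2 (LCGroupoid.r_d1 z)).trans (key rfl (LCGroupoid.r_d1 z))

theorem ideal1_le (z : G.Sq) : ideal1 A z ≤ A.prodSpan
    (LCGroupoid.isMul_u_right (LCGroupoid.s_d2 z)) (ideal1 A z) (A.rangeIdeal (G.d0 z) rfl) := by
  refine prodSpan_le (isClosed_prodSpan _ _ _) fun t ht c _ => ?_
  refine mul_right_mem (isClosed_prodSpan _ _ _) _ _ (idealI_le z _ ht) c fun t₁ h₁ t₂ h₂ => ?_
  have ml : G.IsMul (G.u (G.r (G.d2 z))) (G.d2 z) (G.d2 z) := LCGroupoid.isMul_u_left rfl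
  rw [A.mul_assoc _ _ ml ml]
  have mi : G.IsMul (G.inv (G.d1 z)) (G.d2 z) (G.inv (G.d0 z)) := by
    have := (LCGroupoid.isMul_sq z).inv_mul_left.inv
    rwa [LCGroupoid.inv_inv] at this
  have m10 : G.IsMul (G.d1 z) (G.inv (G.d0 z)) (G.d2 z) := by
    have := (LCGroupoid.isMul_sq z).inv.inv_mul_left.inv
    rwa [LCGroupoid.inv_inv, LCGroupoid.inv_inv, LCGroupoid.inv_inv] at this
  have mu : G.IsMul (G.d2 z) (G.u (G.r (G.d0 z))) (G.d2 z) :=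
    LCGroupoid.isMul_u_right (LCGroupoid.s_d2 z)
  have h3 : A.mul ml t₂ c ∈ A.prodSpan mu ⊤ (A.rangeIdeal (G.d0 z) rfl) := by
    refine mul_right_mem (isClosed_prodSpan _ _ _) _ _ h₂ c fun a ha b _ => ?_
    rw [A.mul_assoc _ _ mi m10]
    refine mul_right_mem (isClosed_prodSpan _ _ _) _ _ ha _ fun a₁ _ a₂ _ => ?_
    rw [A.mul_assoc _ _ (LCGroupoid.isMul_self_inv rfl) mu]
    exact mul_mem_prodSpan _ trivial (mul_mem_prodSpan _ trivial trivial)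
  refine mul_left_mem (isClosed_prodSpan _ _ _) _ _ h3 t₁ fun a _ b hb => ?_
  rw [← A.mul_assoc ml mu]
  exact mul_mem_prodSpan _ (mul_mem_prodSpan _ h₁ trivial) hb

theorem adj_mul_mul {p q q' w w' d : G.Arr} (mq : G.IsMul p q w) (mq' : G.IsMul p q' w')
    (mD : G.IsMul (G.inv w') w d) (mX : G.IsMul (G.inv q') q d) {y : G.Obj} (hp : G.s p = y)
    (hq : G.r q = y) (a a' : A.fib p) (b : A.fib q) (b' : A.fib q') :
    A.mul mD (A.adj rfl (A.mul mq' a' b')) (A.mul mq a b)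
      = A.mul mX (A.adj rfl b') (A.mul (LCGroupoid.isMul_u_left hq)
        (A.mul (LCGroupoid.isMul_inv_self hp) (A.adj rfl a') a) b) := by
  rw [A.adj_mul mq' mq'.inv rfl rfl rfl, A.mul_assoc mq'.inv mD mq.inv_mul_left mX,
    A.mul_assoc (LCGroupoid.isMul_inv_self hp) (LCGroupoid.isMul_u_left hq) mq mq.inv_mul_left]

theorem adj_mul_mul_tot {p q q' w w' d d' : G.Arr} (mq : G.IsMul p q w) (mq' : G.IsMul p q' w')
    (mD : G.IsMul (G.inv w') w d) (mX : G.IsMul (G.inv q') q d') {y : G.Obj} (hp : G.s p = y)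
    (hq : G.r q = y) (a a' : A.fib p) (b : A.fib q) (b' : A.fib q') :
    (⟨d', A.mul mX (A.adj rfl b') (A.mul (LCGroupoid.isMul_u_left hq)
        (A.mul (LCGroupoid.isMul_inv_self hp) (A.adj rfl a') a) b)⟩ : Tot A.fib)
      = ⟨d, A.mul mD (A.adj rfl (A.mul mq' a' b')) (A.mul mq a b)⟩ := by
  have hd : d = d' := by
    have h1 : G.IsMul (G.inv q') q d := by
      have m3 := mq.inv_mul_left
      have hs : G.s (G.inv q') = G.r (G.inv p) := mq'.inv.1
      refine ⟨?_, ?_⟩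
      · rw [G.s_inv, ← mq'.1, mq.1]
      · rw [← mD.2, ← mq'.inv.2, G.mul_assoc _ _ _ hs m3.1, m3.2]
    exact h1.2.symm.trans mX.2
  subst hd
  rw [adj_mul_mul mq mq' mD mX hp hq]

end FellBundle

namespace L2Data

open BanachBundle FellBundle

variable {α : HaarSystem G} {π : C(G.Arr, G.Obj)} {d : C(G.Sq, G.Arr)} {ρ : C(G.Sq, G.Obj)}
    (X : L2Data A π (FellBundle.unitFam A)) (Y : L2Data A d (FellBundle.rangeFam A))
    (W : L2Data A ρ (FellBundle.unitFam A))

/-- The products of sections of `Y` with sections of `X` span the sections of `W`. -/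
structure IsProd (m : ∀ z, G.IsMul (Y.p z) (X.p (d z)) (W.p z)) : Prop where
  mem : ∀ z, ∀ a ∈ Y.E z, ∀ b ∈ X.E (d z), A.mul (m z) a b ∈ W.E z
  le : ∀ z, W.E z ≤ A.prodSpan (m z) (Y.E z) (X.E (d z))
  secY : A.HasSections Y.p Y.E
  secX : A.HasSections X.p X.E
  bdd : W.J.IsBdd

variable {X Y W} {m : ∀ z, G.IsMul (Y.p z) (X.p (d z)) (W.p z)} (h : IsProd X Y W m)

/-- The product section. -/
def prodSec (y : Y.Sec) (x : X.Sec) : W.Sec :=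
  W.mkSec (fun z => A.mul (m z) (ev y z) (ev x (d z)))
    (isCont_mul (isCont_ev y) ((isCont_ev x).comp d.continuous) _) (by
      obtain ⟨K, hK, hK0⟩ := exists_compact_ev y
      exact ⟨K, hK, fun z hz => by rw [hK0 z hz, map_zero, LinearMap.zero_apply]⟩)
    fun z => h.mem z _ (ev_mem y z) _ (ev_mem x (d z))

/-- Multiplication of a section by a continuous function. -/
def cutoff {Z V : Type u} [TopologicalSpace Z] [TopologicalSpace V] {π : C(Z, V)}
    {S : SubAlgFamily A V} {X : L2Data A π S} (χ : C(Z, ℝ)) (x : X.Sec) : X.Sec :=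
  X.mkSec (fun z => (χ z : ℂ) • ev x z)
    ((isCont_ev x).smul (Complex.continuous_ofReal.comp χ.continuous)) (by
      obtain ⟨K, hK, hK0⟩ := exists_compact_ev x
      exact ⟨K, hK, fun z hz => by rw [hK0 z hz, smul_zero]⟩)
    fun z => (X.E z).smul_mem _ (ev_mem x z)

theorem exists_sec_near {Z V : Type u} [TopologicalSpace Z] [TopologicalSpace V] {π : C(Z, V)}
    {S : SubAlgFamily A V} {X : L2Data A π S} (hX : A.HasSections X.p X.E) (z : Z) {a : A.fib (X.p z)}
    (ha : a ∈ X.E z) {ε : ℝ} (hε : 0 < ε) : ∃ x : X.Sec, ‖ev x z - a‖ < ε := by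
  obtain ⟨f, hf, hfE, hfa⟩ := hX z a ha ε hε
  exact ⟨X.mkSec f hf.1 hf.2 hfE, hfa⟩

theorem IsProd.spanning : Spanning (A := A.toBanachBundle) (E := W.E)
    fun p : Y.Sec × X.Sec => prodSec h p.1 p.2 where
  bumps z N hN := by
    obtain ⟨χ, h1, h2, h3, h4, -⟩ := exists_bump_nhds hN
    refine ⟨χ, h2, h3, h4, fun p => ⟨(cutoff ⟨χ, h1⟩ p.1, p.2), fun y => ?_⟩⟩
    change A.mul (m y) ((χ y : ℂ) • ev p.1 y) (ev p.2 (d y)) = (χ y : ℂ) • A.mul (m y) _ _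
    rw [map_smul, LinearMap.smul_apply]
  dense z a ha ε hε := by
    let V : Submodule ℂ (A.toBanachBundle.Cc W.p W.E) := Submodule.span ℂ (Set.range fun p :
      Y.Sec × X.Sec => (prodSec h p.1 p.2 : A.toBanachBundle.Cc W.p W.E))
    let T : Submodule ℂ (A.fib (W.p z)) := V.map (BanachBundle.evL z)
    have hT : A.prodSpan (m z) (Y.E z) (X.E (d z)) ≤ T.topologicalClosure := by
      refine prodSpan_le T.isClosed_topologicalClosure fun p hp q hq => ?_
      rw [← SetLike.mem_coe, Submodule.topologicalClosure_coe, Metric.mem_closure_iff]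
      intro ε hε
      have hc : Continuous fun x : A.fib (Y.p z) × A.fib (X.p (d z)) => A.mul (m z) x.1 x.2 :=
        (A.mulL (m z)).continuous₂
      obtain ⟨δ, hδ, hcδ⟩ := Metric.continuous_iff.1 hc (p, q) ε hε
      obtain ⟨y, hy⟩ := exists_sec_near h.secY z hp hδ
      obtain ⟨x, hx⟩ := exists_sec_near h.secX (d z) hq hδ
      refine ⟨A.mul (m z) (ev y z) (ev x (d z)), ⟨prodSec h y x, Submodule.subset_span ⟨(y, x), rfl⟩,
        rfl⟩, ?_⟩
      rw [dist_comm]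
      refine hcδ (ev y z, ev x (d z)) ?_
      rw [Prod.dist_eq, max_lt_iff, dist_eq_norm, dist_eq_norm]
      exact ⟨hy, hx⟩
    have := hT (h.le z ha)
    rw [← SetLike.mem_coe, Submodule.topologicalClosure_coe, Metric.mem_closure_iff] at this
    obtain ⟨_, ⟨v, hv, rfl⟩, hva⟩ := this ε hε
    exact ⟨v, hv, by rwa [dist_comm, dist_eq_norm] at hva⟩

variable {D F : Type u} [NonUnitalCStarAlgebra D] [NormedAddCommGroup F] [NormedSpace ℂ F]
  [HilbertModule D F] (φ : LeftAction (FellBundle.unitFam A).C0 D F)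

theorem inn_prodSec {hr : ∀ g, G.r (X.p g) = (rangeFam A).q g}
    {hE : ∀ g, ∀ c ∈ (rangeFam A).S g, ∀ a ∈ X.E g,
      A.mul (LCGroupoid.isMul_u_left (hr g)) c a ∈ X.E g}
    (hJ : (X.J.comp Y.J).Same W.J id) (y y' : Y.Sec) (x x' : X.Sec) :
    (inn x ((leftAction (rangeFam A) hr hE).act (inn y y') x') : (unitFam A).C0)
      = inn (prodSec h y x) (prodSec h y' x') := by
  refine SubAlgFamily.C0.ext fun w => ?_
  let T : ∀ g, A.fib (G.u (G.r g)) →L[ℝ] A.fib (G.u (π g)) := fun g =>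
    ((A.mulL (LCGroupoid.isMul_inv_self (X.s_eq g)) (A.adj rfl (ev x g))).comp
      ((A.mulL (LCGroupoid.isMul_u_left (hr g))).flip (ev x' g))).restrictScalars ℝ
  let f : A.CcTop (((unitFam A).label.comp π).comp d) :=
    ⟨fun z => T (d z) ((ptInn y y').1 z), isCont_mul
      (isCont_adj ((isCont_ev x).comp d.continuous) _) (isCont_mul (ptInn y y').2.1
        ((isCont_ev x').comp d.continuous) _) _, by
      obtain ⟨K, hK, hK0⟩ := (ptInn y y').2.2.1
      exact ⟨K, hK, fun z hz => by 
        beta_reduce; rw [hK0 z hz]; exact map_zero (T (d z))⟩, fun _ => trivial⟩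
  have h1 : Y.J.int ((unitFam A).label.comp π) f
      = ptInn x ((leftAction (rangeFam A) hr hE).act (inn y y') x') := Subtype.ext (funext fun g =>
    Y.J.map (rangeFam A).label ((unitFam A).label.comp π) T (ptInn y y') f (fun z => rfl) g)
  change (X.J.int _ (ptInn x _)).1 w = _
  rw [← h1]
  refine hJ (unitFam A).label f (ptInn (prodSec h y x) (prodSec h y' x')) (fun z => ?_) w
  exact adj_mul_mul_tot (m z) (m z) (LCGroupoid.isMul_inv_self (W.s_eq z))
    (LCGroupoid.isMul_inv_self (X.s_eq (d z))) (Y.s_eq z) (hr (d z)) (ev y' z) (ev y z)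
    (ev x' (d z)) (ev x (d z))

theorem IsProd.isTotal_tens (h : IsProd X Y W m) :
    IsTotal fun p : Y.Sec × (X.Sec × F) => φ.tens (prodSec h p.1 p.2.1) p.2.2 := by
  have ht : IsTotal fun p : (Y.Sec × X.Sec) × F => φ.tens (prodSec h p.1.1 p.1.2) p.2 :=
    isTotal_tens_of_spanning (X := W) φ (ι := Y.Sec × X.Sec) h.bdd
      (s := fun p => prodSec h p.1 p.2) (IsProd.spanning h)
  exact ht.of_forall_exists fun p => ⟨(p.1.1, p.1.2, p.2), rfl⟩

theorem inn_tens_prodSec {act : LeftAction (rangeFam A).C0 (unitFam A).C0 X.Sec}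
    (hg : ∀ (y y' : Y.Sec) (x x' : X.Sec), (inn x (act.act (inn y y') x') : (unitFam A).C0)
      = inn (prodSec h y x) (prodSec h y' x')) (y y' : Y.Sec) (x x' : X.Sec) (v v' : F) :
    (inn ((φ.leftTensor act).tens y (φ.tens x v)) ((φ.leftTensor act).tens y' (φ.tens x' v')) : D)
      = inn (φ.tens (prodSec h y x) v) (φ.tens (prodSec h y' x') v') := by
  rw [LeftAction.inn_tens, LeftAction.leftTensor_tens, LeftAction.inn_tens, LeftAction.inn_tens, hg]

/-- Existence of the canonical unitaries. -/
theorem IsProd.exists_canonical (h : IsProd X Y W m)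
    (act : LeftAction (rangeFam A).C0 (unitFam A).C0 X.Sec)
    (hg : ∀ (y y' : Y.Sec) (x x' : X.Sec), (inn x (act.act (inn y y') x') : (unitFam A).C0)
      = inn (prodSec h y x) (prodSec h y' x')) :
    ∃ γ : Unitary D ((φ.leftTensor act).Tensor Y.Sec) (φ.Tensor W.Sec),
      IsCanonical φ X act Y W m γ := by
  have he : IsTotal fun p : Y.Sec × (X.Sec × F) => (φ.leftTensor act).tens p.1 (φ.tens p.2.1 p.2.2) :=
    (φ.leftTensor act).isTotal_tens_of_total (X := Y.Sec)
      (e := fun p : X.Sec × F => φ.tens p.1 p.2) φ.isTotal_tens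
  obtain ⟨γ, hγ⟩ := Unitary.exists_of_gram (D := D) (ι := Y.Sec × (X.Sec × F))
    (fun p q => inn_tens_prodSec h φ hg p.1 q.1 p.2.1 q.2.1 p.2.2 q.2.2) he (h.isTotal_tens φ)
  refine ⟨γ, fun y x w hw ξ => ?_⟩
  have hw' : prodSec h y x = w := sec_ext fun z => (hw z).symm
  rw [← hw']
  exact hγ (y, x, ξ)

end L2Data

end Canonical

section PullBack

variable {G : LCGroupoid.{u}} {A : FellBundle.{u} G} {α : HaarSystem G}

open BanachBundle FellBundle L2Data

theorem IntegralOp.Same.symm {Z W : Type u} [TopologicalSpace Z] [TopologicalSpace W]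
    {π π' : C(Z, W)} {J : IntegralOp A π} {J' : IntegralOp A π'} (h : J.Same J' id) :
    J'.Same J id := fun ℓ f f' hf w => (h ℓ f' f (fun z => (hf z).symm) w).symm

variable (A α) in
theorem isProd_Y0Xs : IsProd (Xs A α) (Y0 A α) (W2 A α) (isMul_Y0Xs A α) where
  mem z _ ha b _ := ideal1_mul_mem z ha b
  le z := ideal2_le z
  secY := hasSections_ideal1 A
  secX := hasSections_top continuous_id
  bdd := (isBdd_intS A α).comp (isBdd_lam0 A α)

variable (A α) in
theorem isProd_Y0Xr : IsProd (Xr A α) (Y0 A α) (W1 A α) (isMul_Y0Xr A α) where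
  mem z _ ha b _ := prodSpan_mul _ _ (LCGroupoid.isMul_u_right (LCGroupoid.s_d2 z)) _ ha b fun _ _ => trivial
  le z := ideal1_le z
  secY := hasSections_ideal1 A
  secX := hasSections_rangeIdeal A continuous_id G.r.continuous fun _ => rfl
  bdd := (isBdd_intS A α).comp (isBdd_lam2 A α)

variable (A α) in
theorem isProd_Y1Xs : IsProd (Xs A α) (Y1 A α) (W2 A α) (isMul_Y1Xs A α) where
  mem _ _ ha _ _ := mul_mem_prodSpan _ ha trivial
  le _ := le_rfl
  secY := hasSections_idealI A (G.r.continuous.comp G.d1.continuous) fun _ => rfl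
  secX := hasSections_top continuous_id
  bdd := (isBdd_intS A α).comp (isBdd_lam0 A α)

theorem idealI_mul_cast (z : G.Sq) {x x' : G.Obj} (hx : G.r (G.d1 z) = x) (hx' : G.r (G.d1 z) = x')
    (m : G.IsMul (G.u x) (G.u x) (G.u x')) :
    (∀ a ∈ A.idealI z hx, ∀ b, A.mul m a b ∈ A.idealI z hx') ∧
      A.idealI z hx' ≤ A.prodSpan m (A.idealI z hx) (A.rangeIdeal (G.d1 z) hx) := by
  obtain rfl : x = x' := hx.symm.trans hx'
  exact ⟨fun a ha b => idealI_mul z hx ha b, (idealI_le z hx).trans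
    (prodSpan_mono _ le_rfl (idealI_le_rangeIdeal_d1 z hx))⟩

variable (A α) in
theorem isProd_Y1Xr : IsProd (Xr A α) (Y1 A α) (W0 A α) (isMul_Y1Xr A α) where
  mem z _ ha b _ := (idealI_mul_cast z rfl (LCGroupoid.r_d1 z) _).1 _ ha b
  le z := (idealI_mul_cast z rfl (LCGroupoid.r_d1 z) _).2
  secY := hasSections_idealI A (G.r.continuous.comp G.d1.continuous) fun _ => rfl
  secX := hasSections_rangeIdeal A continuous_id G.r.continuous fun _ => rfl
  bdd := (isBdd_intR A α).comp (isBdd_lam2 A α)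

variable (A α) in
theorem isProd_Y2Xs : IsProd (Xs A α) (Y2 A α) (W1 A α) (isMul_Y2Xs A α) where
  mem _ _ ha _ _ := mul_mem_prodSpan _ ha trivial
  le _ := le_rfl
  secY := hasSections_idealI A (G.r.continuous.comp G.d2.continuous) LCGroupoid.r_d1
  secX := hasSections_top continuous_id
  bdd := (isBdd_intS A α).comp (isBdd_lam2 A α)

variable (A α) in
theorem isProd_Y2Xr : IsProd (Xr A α) (Y2 A α) (W0 A α) (isMul_Y2Xr A α) where
  mem z _ ha b _ := idealI_mul z (LCGroupoid.r_d1 z) ha b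
  le z := (idealI_le z (LCGroupoid.r_d1 z)).trans
    (prodSpan_mono _ le_rfl (idealI_le_rangeIdeal_d2 z (LCGroupoid.r_d1 z) rfl))
  secY := hasSections_idealI A (G.r.continuous.comp G.d2.continuous) LCGroupoid.r_d1
  secX := hasSections_rangeIdeal A continuous_id G.r.continuous fun _ => rfl
  bdd := (isBdd_intR A α).comp (isBdd_lam2 A α)

section Pairing

variable {D F : Type u} [NonUnitalCStarAlgebra D] [NormedAddCommGroup F] [NormedSpace ℂ F]
  [HilbertModule D F] {φ : LeftAction (FellBundle.unitFam A).C0 D F} (U : FellUnitary α φ)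

theorem isMul_XrXs (g : G.Arr) : G.IsMul (G.inv ((Xr A α).p g)) ((Xs A α).p g) g := by
  change G.IsMul (G.inv (G.u (G.r g))) g g
  rw [G.inv_u]
  exact LCGroupoid.isMul_u_left rfl

theorem oneU_tens {d : C(G.Sq, G.Arr)} (Y : L2Data A d (rangeFam A)) (y : Y.Sec)
    (t : φ.Tensor (Xs A α).Sec) :
    U.oneU Y ((leftS α φ).tens y t) = (leftR α φ).tens y (U.toEquiv t) :=
  LeftAction.mapRight_tens _ _ _ _ _ y t

variable {d : C(G.Sq, G.Arr)} {Y : L2Data A d (rangeFam A)} {ρ ρ' : C(G.Sq, G.Obj)}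
  {Ws : L2Data A ρ (unitFam A)} {Wr : L2Data A ρ' (unitFam A)}
  {ms : ∀ z, G.IsMul (Y.p z) ((Xs A α).p (d z)) (Ws.p z)}
  {mr : ∀ z, G.IsMul (Y.p z) ((Xr A α).p (d z)) (Wr.p z)}
  (hs : IsProd (Xs A α) Y Ws ms) (hr : IsProd (Xr A α) Y Wr mr)
  (mD : ∀ z, G.IsMul (G.inv (Wr.p z)) (Ws.p z) (d z))

theorem int_pair_prodSec (x' : (Xr A α).Sec) (x : (Xs A α).Sec) (y' y : Y.Sec) :
    (Y.J.int (.id _) (pair mD (prodSec hr y' x') (prodSec hs y x)) : A.Sec)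
      = pair (isMul_XrXs (α := α)) x' ((actS A α).act (inn y' y) x) := by
  let T : ∀ g, A.fib (G.u (G.r g)) →L[ℝ] A.fib g := fun g =>
    ((A.mulL (isMul_XrXs (α := α) g) (A.adj rfl (L2Data.ev x' g))).comp
      ((A.mulL (LCGroupoid.isMul_u_left rfl)).flip (L2Data.ev x g))).restrictScalars ℝ
  refine Subtype.ext (funext fun g => ?_)
  refine Y.J.map (rangeFam A).label (.id _) T (ptInn y' y)
    (pair mD (prodSec hr y' x') (prodSec hs y x)) (fun z => ?_) g
  exact adj_mul_mul (ms z) (mr z) (mD z) (isMul_XrXs (α := α) (d z)) (Y.s_eq z) rfl (L2Data.ev y z) (L2Data.ev y' z)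
    (L2Data.ev x (d z)) (L2Data.ev x' (d z))

variable {L : A.Sec →ₗ[ℂ] F →ₗ[ℂ] F}
  (hL : ∀ (x : (Xr A α).Sec) (y : (Xs A α).Sec) (v : F),
    φ.ann x (U.toEquiv (φ.tens y v)) = L (pair (isMul_XrXs (α := α)) x y) v)
  {γs : Unitary D ((leftS α φ).Tensor Y.Sec) (φ.Tensor Ws.Sec)}
  {γr : Unitary D ((leftR α φ).Tensor Y.Sec) (φ.Tensor Wr.Sec)}
  (hγs : IsCanonical φ (Xs A α) (actS A α) Y Ws ms γs)
  (hγr : IsCanonical φ (Xr A α) (actR A α) Y Wr mr γr)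

include hγs hγr hL in
theorem ann_pullU_prodSec (x' : (Xr A α).Sec) (x : (Xs A α).Sec) (y' y : Y.Sec) (v : F) :
    φ.ann (prodSec hr y' x') (U.pullU γs γr (φ.tens (prodSec hs y x) v))
      = L (Y.J.int (.id _) (pair mD (prodSec hr y' x') (prodSec hs y x))) v := by
  have h1 : γs.toEquiv.symm (φ.tens (prodSec hs y x) v) = (leftS α φ).tens y (φ.tens x v) := by
    rw [LinearEquiv.symm_apply_eq]
    exact (hγs y x (prodSec hs y x) (fun _ => rfl) v).symm
  rw [int_pair_prodSec, ← hL]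
  refine HilbertModule.ext_inn (D := D) fun v' => ?_
  rw [← LeftAction.inn_tens_left, ← LeftAction.inn_tens_left,
    ← hγr y' x' (prodSec hr y' x') (fun _ => rfl) v', FellUnitary.pullU, h1, γr.inn_map,
    oneU_tens, LeftAction.inn_tens]
  have h2 := U.intertwines (inn y' y) (φ.tens x v)
  rw [LeftAction.leftTensor_tens] at h2
  exact congrArg (fun t => (inn (φ.tens x' v') t : D)) h2.symm

variable (γs γr) in
/-- The operator `d^*(U)` as a continuous linear map. -/
def pullL : φ.Tensor Ws.Sec →L[ℂ] φ.Tensor Wr.Sec :=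
  (γr.toIso : (leftR α φ).Tensor Y.Sec →L[ℂ] φ.Tensor Wr.Sec) ∘L U.oneU Y ∘L
    (γs.toIso.symm : φ.Tensor Ws.Sec →L[ℂ] (leftS α φ).Tensor Y.Sec)

include hγs hγr hL hs hr in
theorem ann_pullU (hY : Y.J.IsBdd) (hLc : ∀ v, IndCont fun ξ : A.Sec => L ξ v) (w' : Wr.Sec)
    (w : Ws.Sec) (v : F) :
    φ.ann w' (U.pullU γs γr (φ.tens w v)) = L (Y.J.int (.id _) (pair mD w' w)) v := by
  have hI : IndCont fun f : A.CcTop d => L (Y.J.int (.id _) f) v := hY.indCont (hLc v)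
  have h1 : ∀ x' y', φ.ann (prodSec hr y' x') (U.pullU γs γr (φ.tens w v))
      = L (Y.J.int (.id _) (pair mD (prodSec hr y' x') w)) v := fun x' y' => by
    let Φ : A.toBanachBundle.Cc Ws.p Ws.E →ₗ[ℂ] F :=
      (φ.ann (prodSec hr y' x') ∘L pullL U γs γr).toLinearMap ∘ₗ Ws.tensL φ v
    let Ψ : A.toBanachBundle.Cc Ws.p Ws.E →ₗ[ℂ] F :=
      { toFun := fun w => L (Y.J.int (.id _) (pair mD (prodSec hr y' x') (w : Ws.Sec))) v
        map_add' := fun a b => by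
          rw [← LinearMap.add_apply, ← map_add, ← map_add]
          exact congrArg (fun f => L (Y.J.int (.id _) f) v) (pair_add_right mD _ a b)
        map_smul' := fun c a => by
          rw [RingHom.id_apply, ← LinearMap.smul_apply, ← map_smul, ← map_smul]
          exact congrArg (fun f => L (Y.J.int (.id _) f) v) (pair_smul_right mD c _ a) }
    exact IndCont.ext (Φ := Φ) (Ψ := Ψ) hs.spanning
      ((indCont_tensL φ hs.bdd v).clm_comp (φ.ann (prodSec hr y' x') ∘L pullL U γs γr))
      (indCont_pair_right mD hI _)
      (fun p => ann_pullU_prodSec U hs hr mD hL hγs hγr x' p.2 y' p.1 v) w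
  refine HilbertModule.ext_inn (D := D) fun v' => ?_
  rw [← star_inn, ← LeftAction.inn_tens_right, ← star_inn (L _ v)]
  congr 1
  let Φ : A.toBanachBundle.Cc Wr.p Wr.E →ₗ[ℂ] D :=
    (HilbertModule.innL D (φ.Tensor Wr.Sec) (U.pullU γs γr (φ.tens w v))).toLinearMap ∘ₗ Wr.tensL φ v'
  let T : F →L⋆[ℂ] D := (HilbertModule.innL D F).flip v'
  have hsm : ∀ (c : ℂ) (f : A.CcTop ((ContinuousMap.id G.Arr).comp d)),
      T (L (Y.J.int (.id _) (star c • f)) v) = c • T (L (Y.J.int (.id _) f) v) := fun c f => by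
    rw [map_smul, map_smul, LinearMap.smul_apply, map_smulₛₗ]
    exact congrArg (· • _) (star_star c)
  let Ψ : A.toBanachBundle.Cc Wr.p Wr.E →ₗ[ℂ] D :=
    { toFun := fun x => T (L (Y.J.int (.id _) (pair mD (x : Wr.Sec) w)) v)
      map_add' := fun a b => by
        rw [← map_add, ← LinearMap.add_apply, ← map_add, ← map_add]
        exact congrArg (fun f => T (L (Y.J.int (.id _) f) v)) (pair_add_left mD a b w)
      map_smul' := fun c a => by
        refine (congrArg (fun f => T (L (Y.J.int (.id _) f) v)) (pair_smul_left mD c a w)).trans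
          (hsm c _) }
  refine IndCont.ext (Φ := Φ) (Ψ := Ψ) hr.spanning
    ((indCont_tensL φ hr.bdd v').clm_comp (HilbertModule.innL D (φ.Tensor Wr.Sec) (U.pullU γs γr (φ.tens w v))))
    ((indCont_pair_left mD hI w).clm_comp T) (fun p => ?_) w'
  change (inn (U.pullU γs γr (φ.tens w v)) (φ.tens (prodSec hr p.1 p.2) v') : D)
    = inn (L (Y.J.int (.id _) (pair mD (prodSec hr p.1 p.2) w)) v) v'
  rw [LeftAction.inn_tens_right, h1]

end Pairing

end PullBack

section Integration

variable {G : LCGroupoid.{u}} {A : FellBundle.{u} G} {α : HaarSystem G}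

open BanachBundle FellBundle L2Data

section
attribute [local instance] CStarAlgebra.spectralOrder CStarAlgebra.spectralOrderedRing

theorem exists_approximate_unit (C : Type*) [NonUnitalCStarAlgebra C] :
    ∃ l : Filter C, l.NeBot ∧ ∀ c : C, Tendsto (fun e => c * e) l (𝓝 c) :=
  ⟨CStarAlgebra.approximateUnit C, inferInstance,
    (CStarAlgebra.increasingApproximateUnit C).tendsto_mul_left⟩
end

theorem FellBundle.mul_adj_congr {h k k' l p : G.Arr} (i : G.inv h = k) (i' : G.inv h = k')
    (m : G.IsMul k l p) (m' : G.IsMul k' l p) (a : A.fib h) (b : A.fib l) :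
    A.mul m (A.adj i a) b = A.mul m' (A.adj i' a) b := by
  subst i i'; rfl

/-- A section of `A A^*` with compact support, as an element of `C₀(G, A A^*)`. -/
def secC0 (x : (Xr A α).Sec) : (rangeFam A).C0 := (rangeFam A).ofCc x

variable (α) in
/-- Cutting off an element of `C₀(G, A A^*)`. -/
def C0cut (χ : G.Arr → ℝ) (hχ : Continuous χ) (hc : HasCompactSupport χ) (c : (rangeFam A).C0) :
    (Xr A α).Sec :=
  (Xr A α).mkSec (fun g => (χ g : ℂ) • c.1 g)
    ((show A.IsCont (Xr A α).p fun g => c.1 g from c.2.1).smul (Complex.continuous_ofReal.comp hχ))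
    ⟨tsupport χ, hc, fun g hg => by rw [image_eq_zero_of_notMem_tsupport hg]; exact zero_smul _ _⟩
    fun g => ((rangeFam A).S g).smul_mem _ (c.2.2.2 g)

/-- The section `g ↦ x(g)^* y(g)`. -/
abbrev pairS (x : (Xr A α).Sec) (y : (Xs A α).Sec) : A.Sec :=
  pair (ℓ := .id G.Arr) (isMul_XrXs (α := α)) x y

theorem act_star_secC0 (x : (Xr A α).Sec) (y : (Xs A α).Sec) :
    (actS A α).act (star (secC0 x)) y = pairS x y :=
  sec_ext fun _ => mul_adj_congr _ _ _ _ _ _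

variable {D F : Type u} [NonUnitalCStarAlgebra D] [NormedAddCommGroup F] [NormedSpace ℂ F]
  [HilbertModule D F] {φ : LeftAction (FellBundle.unitFam A).C0 D F} (U : FellUnitary α φ)

theorem ann_act_right (c : (rangeFam A).C0) (x : (Xr A α).Sec) (y : (Xs A α).Sec) (v : F) :
    φ.ann ((actR A α).act c x) (U.toEquiv (φ.tens y v))
      = φ.ann x (U.toEquiv (φ.tens ((actS A α).act (star c) y) v)) := by
  have h := U.intertwines (star c) (φ.tens y v)
  rw [LeftAction.leftTensor_tens] at h
  rw [LeftAction.ann_act]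
  exact congrArg (φ.ann x) h.symm

theorem tendsto_ann {χ : G.Arr → ℝ} (hχ : Continuous χ) (hc : HasCompactSupport χ)
    {x : (Xr A α).Sec} (hx : ∀ g, L2Data.ev x g ≠ 0 → χ g = 1) {l : Filter (rangeFam A).C0}
    (hl : ∀ c : (rangeFam A).C0, Tendsto (fun e => c * e) l (𝓝 c)) (y : (Xs A α).Sec) (v : F) :
    Tendsto (fun e => φ.ann (C0cut α χ hχ hc e)
      (U.toEquiv (φ.tens (X := (Xs A α).Sec) (pairS x y) v))) l
      (𝓝 (φ.ann x (U.toEquiv (φ.tens y v)))) := by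
  set t := U.toEquiv (φ.tens y v)
  obtain ⟨K, hK, hxK⟩ := exists_compact_ev x
  obtain ⟨C, hC, h⟩ := isBdd_intR A α K hK
  rw [tendsto_iff_norm_sub_tendsto_zero]
  have h0 : Tendsto (fun e => √C * ‖secC0 x * e - secC0 x‖ * ‖t‖) l (𝓝 0) := by
    have := tendsto_iff_norm_sub_tendsto_zero.1 (hl (secC0 x))
    simpa using (this.const_mul (√C)).mul_const ‖t‖
  refine squeeze_zero (fun _ => norm_nonneg _) (fun e => ?_) h0
  have h1 : φ.ann (C0cut α χ hχ hc e)
      (U.toEquiv (φ.tens (X := (Xs A α).Sec) (pairS x y) v))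
      = φ.ann ((actR A α).act (secC0 x) (C0cut α χ hχ hc e)) t := by
    rw [ann_act_right, act_star_secC0]
  rw [h1, ← LeftAction.ann_sub]
  set d : (Xr A α).Sec := (actR A α).act (secC0 x) (C0cut α χ hχ hc e) - x
  have hd : ∀ g, L2Data.ev d g = (secC0 x * e - secC0 x).1 g := fun g => by
    change (secC0 x).1 g * ((χ g : ℂ) • e.1 g) - (secC0 x).1 g
      = (secC0 x).1 g * e.1 g - (secC0 x).1 g
    congr 1
    by_cases hg : L2Data.ev x g = 0
    · have : (secC0 x).1 g = 0 := hg
      rw [this, zero_mul, zero_mul]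
    · rw [hx g hg, Complex.ofReal_one, one_smul]
  have hdn : ‖(inn d d : (unitFam A).C0)‖ ≤ C * (‖secC0 x * e - secC0 x‖ * ‖secC0 x * e - secC0 x‖) := by
    refine L2Data.norm_inn_le hC h d d _ _ (norm_nonneg _) (norm_nonneg _) (fun g hg => ?_)
      (fun g => ?_) fun g => ?_
    · rw [hd]
      have : (secC0 x).1 g = 0 := hxK g hg
      change (secC0 x).1 g * e.1 g - (secC0 x).1 g = 0
      rw [this, zero_mul, sub_zero]
    all_goals rw [hd]; exact SubAlgFamily.C0.norm_apply_le _ g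
  refine (φ.norm_ann_le d t).trans ?_
  gcongr
  refine (Real.sqrt_le_sqrt hdn).trans_eq ?_
  rw [Real.sqrt_mul hC, Real.sqrt_mul_self (norm_nonneg _)]

/-- Exact factorization of sections. -/
theorem exists_pair_eq (ξ : A.Sec) : ∃ (x : (Xr A α).Sec) (y : (Xs A α).Sec),
    pairS x y = ξ ∧ (∀ g, ‖L2Data.ev x g‖ ^ 2 ≤ ‖ξ.1 g‖) ∧
      ∀ g, ‖L2Data.ev y g‖ ^ 2 ≤ ‖ξ.1 g‖ := by
  obtain ⟨x, y, hy, -, hxy, hx, hy'⟩ := (rangeFam A).exists_factorization (ℓ := id) (fun _ => rfl)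
    (f := ξ.1) ⟨ξ.2.1, ξ.2.2.1⟩ (fun g => mul_mem_prodSpan _ trivial trivial)
  exact ⟨x, (Xs A α).mkSec y hy.1 hy.2 fun _ => trivial,
    Subtype.ext (funext fun g => hxy g _ _ (isMul_XrXs (α := α) g)), hx, hy'⟩

theorem norm_inn_le_normI {π : C(G.Arr, G.Obj)} {X : L2Data A π (unitFam A)} (ξ : A.Sec)
    (hX : ∀ (f : A.CcTop ((unitFam A).label.comp π)) (w : G.Obj) (B : G.Arr → ENNReal),
      (∀ g, ‖f.1 g‖ₑ ≤ B g) → (∀ g, B g = ‖FellBundle.ev ξ g‖ₑ) →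
        ‖(X.J.int (unitFam A).label f).1 w‖ₑ ≤ normI α ξ)
    (x : X.Sec) (hx : ∀ g, ‖L2Data.ev x g‖ ^ 2 ≤ ‖ξ.1 g‖) :
    ‖(inn x x : (unitFam A).C0)‖ ≤ (normI α ξ).toReal := by
  refine SubAlgFamily.C0.norm_le ENNReal.toReal_nonneg fun w => ?_
  rw [← toReal_enorm]
  refine ENNReal.toReal_mono (normI_lt_top α ξ).ne ?_
  refine hX (ptInn x x) w (fun g => ‖FellBundle.ev ξ g‖ₑ) (fun g => ?_) fun _ => rfl
  rw [enorm_le_iff_norm_le]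
  refine ((A.norm_mul_le _ _ _).trans_eq ?_).trans (hx g)
  rw [A.norm_adj, sq]

theorem norm_inn_le_normI_Xr (ξ : A.Sec) (x : (Xr A α).Sec)
    (hx : ∀ g, ‖L2Data.ev x g‖ ^ 2 ≤ ‖ξ.1 g‖) :
    ‖(inn x x : (unitFam A).C0)‖ ≤ (normI α ξ).toReal :=
  norm_inn_le_normI ξ (fun f w B h hB => (enorm_intR_le α f w B h).trans (by
    rw [funext hB]; exact (le_iSup (fun x => ∫⁻ g, ‖FellBundle.ev ξ g‖ₑ ∂α.m x) w).trans
      le_sup_left)) x hx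

theorem norm_inn_le_normI_Xs (ξ : A.Sec) (y : (Xs A α).Sec)
    (hy : ∀ g, ‖L2Data.ev y g‖ ^ 2 ≤ ‖ξ.1 g‖) :
    ‖(inn y y : (unitFam A).C0)‖ ≤ (normI α ξ).toReal :=
  norm_inn_le_normI ξ (fun f w B h hB => (enorm_intS_le α f w B h).trans (by
    rw [funext hB]; exact (le_iSup (fun x => ∫⁻ g, ‖FellBundle.ev ξ g‖ₑ ∂α.tilde.m x) w).trans
      le_sup_right)) y hy

/-- The operators `T_x^* U T_y` only depend on `x^* y`. -/
theorem ann_eq_of_pair {ι : Type*} (s : Finset ι) (c : ι → ℂ) (x : ι → (Xr A α).Sec)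
    (y : ι → (Xs A α).Sec) (v : F) (h : ∑ i ∈ s, c i • pairS (x i) (y i) = 0) :
    ∑ i ∈ s, c i • φ.ann (x i) (U.toEquiv (φ.tens (y i) v)) = 0 := by
  obtain ⟨l, hl, hle⟩ := exists_approximate_unit (rangeFam A).C0
  choose K hK hxK using fun i => exists_compact_ev (x i)
  obtain ⟨χ, h1, -, h2, -, h3⟩ := exists_bump (s.isCompact_biUnion fun i _ => hK i) isOpen_univ
    (Set.subset_univ _)
  have ht := tendsto_finsetSum s fun i hi => (tendsto_ann U h1 h3 (x := x i) (fun g hg => h2 g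
    (Set.mem_biUnion hi (by by_contra hgK; exact hg (hxK i g hgK)))) hle (y i) v).const_smul (c i)
  refine tendsto_nhds_unique ht ?_
  refine tendsto_const_nhds.congr fun e => ?_
  let Φ : A.Sec →ₗ[ℂ] F := (φ.ann (C0cut α χ h1 h3 e)).toLinearMap ∘ₗ U.toEquiv.toLinearMap ∘ₗ
    (Xs A α).tensL φ v
  have hΦ := congrArg Φ h
  rw [map_sum, map_zero] at hΦ
  rw [← hΦ]
  exact Finset.sum_congr rfl fun i _ => (map_smul Φ _ _)

theorem one_smul_add_neg_smul {V : Type*} [AddCommGroup V] [Module ℂ V] (c : ℂ) (a b : V)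
    (h : c • b = a) : (1 : ℂ) • a + (-c) • b = 0 := by
  rw [← h]; module

theorem one_smul_add_neg_smul_add {V : Type*} [AddCommGroup V] [Module ℂ V] (a b : V) :
    (1 : ℂ) • (a + b) + (-1 : ℂ) • a + (-1 : ℂ) • b = 0 := by module

theorem exists_integrated : ∃ L : A.Sec →ₗ[ℂ] F →ₗ[ℂ] F,
    (∀ x y v, φ.ann x (U.toEquiv (φ.tens y v)) = L (pairS x y) v) ∧
      ∀ ξ v, ‖L ξ v‖ ≤ (normI α ξ).toReal * ‖v‖ := by
  choose x y hxy hx hy using exists_pair_eq (A := A) (α := α)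
  have key : ∀ (ξ : A.Sec) (x' : (Xr A α).Sec) (y' : (Xs A α).Sec), pairS x' y' = ξ → ∀ v,
      φ.ann x' (U.toEquiv (φ.tens y' v)) = φ.ann (x ξ) (U.toEquiv (φ.tens (y ξ) v)) := by
    intro ξ x' y' h v
    have := ann_eq_of_pair U (Finset.univ : Finset (Fin 2)) ![1, -1] ![x', x ξ] ![y', y ξ] v (by
      rw [Fin.sum_univ_two]
      change (1 : ℂ) • pairS x' y' + (-1 : ℂ) • pairS (x ξ) (y ξ) = 0
      rw [h, hxy]; exact one_smul_add_neg_smul 1 ξ ξ (one_smul ℂ ξ))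
    rw [Fin.sum_univ_two] at this
    change (1 : ℂ) • φ.ann x' (U.toEquiv (φ.tens y' v))
      + (-1 : ℂ) • φ.ann (x ξ) (U.toEquiv (φ.tens (y ξ) v)) = 0 at this
    rwa [one_smul, neg_one_smul, ← sub_eq_add_neg, sub_eq_zero] at this
  refine ⟨LinearMap.mk₂ ℂ (fun ξ v => φ.ann (x ξ) (U.toEquiv (φ.tens (y ξ) v))) (fun ξ η v => ?_)
    (fun c ξ v => ?_) (fun ξ v w => ?_) (fun c ξ v => ?_), fun x' y' v => key _ x' y' rfl v,
    fun ξ v => ?_⟩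
  · have := ann_eq_of_pair U (Finset.univ : Finset (Fin 3)) ![1, -1, -1] ![x (ξ + η), x ξ, x η]
      ![y (ξ + η), y ξ, y η] v (by
        rw [Fin.sum_univ_three]
        change (1 : ℂ) • pairS (x (ξ + η)) (y (ξ + η)) + (-1 : ℂ) • pairS (x ξ) (y ξ)
          + (-1 : ℂ) • pairS (x η) (y η) = 0
        rw [hxy, hxy, hxy]; exact one_smul_add_neg_smul_add ξ η)
    rw [Fin.sum_univ_three] at this
    change (1 : ℂ) • φ.ann (x (ξ + η)) (U.toEquiv (φ.tens (y (ξ + η)) v))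
      + (-1 : ℂ) • φ.ann (x ξ) (U.toEquiv (φ.tens (y ξ) v))
      + (-1 : ℂ) • φ.ann (x η) (U.toEquiv (φ.tens (y η) v)) = 0 at this
    rw [one_smul, neg_one_smul, neg_one_smul] at this
    rw [← sub_eq_zero, ← this]; abel
  · have := ann_eq_of_pair U (Finset.univ : Finset (Fin 2)) ![1, -c] ![x (c • ξ), x ξ]
      ![y (c • ξ), y ξ] v (by
        rw [Fin.sum_univ_two]
        change (1 : ℂ) • pairS (x (c • ξ)) (y (c • ξ)) + (-c) • pairS (x ξ) (y ξ) = 0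
        rw [hxy, hxy]; exact one_smul_add_neg_smul c _ _ rfl)
    rw [Fin.sum_univ_two] at this
    change (1 : ℂ) • φ.ann (x (c • ξ)) (U.toEquiv (φ.tens (y (c • ξ)) v))
      + (-c) • φ.ann (x ξ) (U.toEquiv (φ.tens (y ξ) v)) = 0 at this
    rwa [one_smul, neg_smul, ← sub_eq_add_neg, sub_eq_zero] at this
  · rw [LeftAction.tens_add, map_add, map_add]
  · rw [LeftAction.tens_smul, map_smul, map_smul]
  · calc _ ≤ √‖(inn (x ξ) (x ξ) : (unitFam A).C0)‖ * ‖U.toEquiv (φ.tens (y ξ) v)‖ :=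
          φ.norm_ann_le _ _
      _ ≤ √(normI α ξ).toReal * (√(normI α ξ).toReal * ‖v‖) := by
          rw [U.norm_map]
          gcongr
          · exact norm_inn_le_normI_Xr ξ _ (hx ξ)
          · refine (φ.norm_tens_le _ _).trans ?_
            gcongr
            exact norm_inn_le_normI_Xs ξ _ (hy ξ)
      _ = _ := by rw [← _root_.mul_assoc, Real.mul_self_sqrt ENNReal.toReal_nonneg]

end Integration

section Fullness

variable {G : LCGroupoid.{u}} {A : FellBundle.{u} G} {α : HaarSystem G}

open BanachBundle FellBundle L2Data

theorem norm_integral_smul_sub_le {X E : Type*} [MeasurableSpace X] [NormedAddCommGroup E]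
    [NormedSpace ℝ E] [CompleteSpace E] {μ : Measure X} {ψ : X → ℝ} {f : X → E} {a : E} {ε : ℝ}
    (hψ : Integrable ψ μ) (h0 : ∀ x, 0 ≤ ψ x) (hf : Integrable (fun x => ψ x • f x) μ)
    (h : ∀ x, ψ x ≠ 0 → ‖f x - a‖ ≤ ε) :
    ‖(∫ x, ψ x • f x ∂μ) - (∫ x, ψ x ∂μ) • a‖ ≤ (∫ x, ψ x ∂μ) * ε := by
  rw [← integral_smul_const, ← integral_sub hf (hψ.smul_const a), ← integral_mul_const]
  refine norm_integral_le_of_norm_le (hψ.mul_const ε) (Eventually.of_forall fun x => ?_)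
  rw [← smul_sub, norm_smul, Real.norm_of_nonneg (h0 x)]
  by_cases hx : ψ x = 0
  · rw [hx, zero_mul, zero_mul]
  · exact mul_le_mul_of_nonneg_left (h x hx) (h0 x)

variable (α) in
/-- Averages of a section over small neighbourhoods of a point of a fibre. -/
theorem exists_average {ℓ : C(G.Obj, G.Arr)} (f : A.CcTop (ℓ.comp G.r)) (g₀ : G.Arr)
    {a : A.fib (ℓ (G.r g₀))} (ha : a = f.1 g₀) {ε : ℝ} (hε : 0 < ε) : ∃ (χ : C(G.Arr, ℝ)) (c : ℝ), ∀ f' : A.CcTop (ℓ.comp G.r),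
      (∀ g, f'.1 g = (χ g : ℂ) • f.1 g) →
        ‖(c : ℂ) • ((intR A α).int ℓ f').1 (G.r g₀) - a‖ ≤ ε := by
  let w := G.r g₀
  let F : {g | G.r g = w} → A.fib (ℓ w) := fun l => A.cast (congrArg ℓ l.2) (f.1 l.1)
  have hF : Continuous F := by
    refine BanachBundle.IsCont.continuous (A := A.toBanachBundle) (x := ℓ w) ?_
    have h1 : A.IsCont (fun l : {g | G.r g = w} => ℓ (G.r l.1)) (fun l => f.1 l.1) :=
      f.2.1.comp continuous_subtype_val
    have h2 : (fun l : {g | G.r g = w} => (⟨ℓ w, F l⟩ : Tot A.fib)) = fun l => ⟨ℓ (G.r l.1), f.1 l.1⟩ :=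
      funext fun l => A.mk_cast _ _
    rw [BanachBundle.IsCont, h2]; exact h1
  let l₀ : {g | G.r g = w} := ⟨g₀, rfl⟩
  have hN : {l | ‖F l - F l₀‖ < ε} ∈ 𝓝 l₀ := by
    have : ContinuousAt (fun l => ‖F l - F l₀‖) l₀ := by fun_prop
    refine this.preimage_mem_nhds (Iio_mem_nhds ?_)
    simpa using hε
  obtain ⟨N, hN, hNF⟩ := mem_nhds_subtype _ _ _ |>.1 hN
  obtain ⟨χ, h1, h2, h3, h4, h5⟩ := exists_bump_nhds hN
  let ψ : {g | G.r g = w} → ℝ := fun l => χ l.1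
  have hψc : Continuous ψ := h1.comp continuous_subtype_val
  have hψs : HasCompactSupport ψ :=
    h5.comp_isClosedEmbedding (MeasFam.isClosed_fibre G.r w).isClosedEmbedding_subtypeVal
  have hi : Integrable ψ (α.fib w) := hψc.integrable_of_hasCompactSupport hψs
  have hpos : 0 < ∫ l, ψ l ∂α.fib w := by
    refine (integral_pos_iff_support_of_nonneg (f := ψ) (fun l => (h2 l.1).1) hi).2
      (pos_iff_ne_zero.2 ?_)
    obtain ⟨O, hO, hOo, hgO⟩ := mem_nhds_iff.1 h3
    have := α.full w O hOo ⟨g₀, hgO, rfl⟩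
    rw [← α.fib_preimage] at this
    refine fun h => this (measure_mono_null (fun l hl => ?_) h)
    have hl1 : χ l.1 = 1 := hO hl
    change χ l.1 ≠ 0
    rw [hl1]; exact one_ne_zero
  refine ⟨⟨χ, h1⟩, (∫ l, ψ l ∂α.fib w)⁻¹, fun f' hf' => ?_⟩
  have hint : ((intR A α).int ℓ f').1 w = ∫ l, ψ l • F l ∂α.fib w := by
    refine Tot.vec_eq (intR_mk α f' rfl (fun l => ψ l • F l) fun g hg l hl => ?_)
    subst hl
    rw [hf']
    have : ψ l • F l = A.cast (congrArg ℓ l.2) ((χ l.1 : ℂ) • f.1 l.1) := by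
      rw [map_smul]; exact (Complex.coe_smul _ _).symm
    rw [this]
    exact (A.mk_cast _ _).symm
  have hest := norm_integral_smul_sub_le (ε := ε) (a := F l₀) hi (fun l => (h2 l.1).1)
    ((hψc.smul hF).integrable_of_hasCompactSupport hψs.smul_right) (fun l hl => by
      have : l.1 ∈ N := by by_contra h; exact hl (h4 _ h)
      exact le_of_lt (hNF this))
  have hF0 : F l₀ = a := ha.symm
  rw [hint, ← hF0]
  have hne := hpos.ne'
  calc _ = ‖(∫ l, ψ l ∂α.fib w)⁻¹ • ((∫ l, ψ l • F l ∂α.fib w) - (∫ l, ψ l ∂α.fib w) • F l₀)‖ := by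
        rw [smul_sub, inv_smul_smul₀ hne]; congr 2
    _ ≤ (∫ l, ψ l ∂α.fib w)⁻¹ * ((∫ l, ψ l ∂α.fib w) * ε) := by
        rw [norm_smul, Real.norm_of_nonneg (inv_nonneg.2 hpos.le)]
        gcongr
    _ = ε := by field_simp

theorem FellBundle.top_le_prodSpan {x : G.Obj} {k : G.Arr} (hk : k = G.u x)
    (m : G.IsMul (G.u x) k (G.u x)) : ⊤ ≤ A.prodSpan m ⊤ ⊤ := by
  subst hk
  exact le_prodSpan_self isClosed_univ (fun _ _ _ _ => trivial) fun _ _ => trivial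

theorem FellBundle.top_le_rangeIdeal {g : G.Arr} {x : G.Obj} (hx : G.r g = x) (hg : g = G.u x) :
    ⊤ ≤ A.rangeIdeal g hx := by
  subst hg
  exact top_le_prodSpan (G.inv_u x) _

variable (A α) in
/-- The section `⟨x, x'⟩` of `A⁰`. -/
def innS (p : (Xr A α).Sec × (Xr A α).Sec) : A.CcTop (unitFam A).label :=
  (intR A α).int (unitFam A).label (ptInn p.1 p.2)

/-- A section of `A⁰` with compact support as an element of `C₀(G⁰, A⁰)`. -/
def ofTop (f : A.CcTop (unitFam A).label) : (unitFam A).C0 :=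
  (unitFam A).ofCc ⟨f.1, f.2.1, f.2.2.1, fun _ => trivial⟩

theorem dist_lt_of_dist_le {E : Type*} [PseudoMetricSpace E] {a b c : E} {ε : ℝ}
    (h : dist a b ≤ ε / 2) (h' : dist b c < ε / 2) : dist c a < ε := by
  rw [dist_comm c]
  linarith [dist_triangle a b c]

theorem int_cutoff (χ : G.Obj → ℝ) {ℓ : C(G.Obj, G.Arr)} (f f' : A.CcTop (ℓ.comp G.r))
    (h : ∀ g, f'.1 g = (χ (G.r g) : ℂ) • f.1 g) (w : G.Obj) :
    ((intR A α).int ℓ f').1 w = (χ w : ℂ) • ((intR A α).int ℓ f).1 w :=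
  (intR A α).map ℓ ℓ (fun w => ((χ w : ℂ) • ContinuousLinearMap.id ℂ (A.fib (ℓ w))).restrictScalars ℝ)
    f f' h w

theorem spanning_innS : Spanning (innS A α) where
  bumps w N hN := by
    obtain ⟨χ, h1, h2, h3, h4, -⟩ := exists_bump_nhds hN
    refine ⟨χ, h2, h3, h4, fun p => ⟨(p.1, cutoff ⟨fun g => χ (G.r g), h1.comp G.r.continuous⟩ p.2),
      fun w => int_cutoff χ (ptInn p.1 p.2) _ (fun g => ?_) w⟩⟩
    exact map_smul (A.mul (LCGroupoid.isMul_inv_self ((Xr A α).s_eq g))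
      (A.adj rfl (L2Data.ev p.1 g))) (χ (G.r g) : ℂ) (L2Data.ev p.2 g)
  dense := by
    intro w a _ ε hε
    have key : ∀ (g₀ : G.Arr) (hw : G.r g₀ = w) (_ : g₀ = G.u w), ∃ v ∈ Submodule.span ℂ
        (Set.range (innS A α)), ‖v.1 w - a‖ < ε := by
      rintro g₀ rfl hg₀
      let T : Submodule ℂ (A.fib (G.u (G.r g₀))) := (Submodule.span ℂ (Set.range (innS A α))).map
        (BanachBundle.evL (A := A.toBanachBundle) (G.r g₀))
      have hT : ∀ b c : A.fib (G.u (G.r g₀)), A.mul (LCGroupoid.isMul_inv_self (G.s_u _))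
          (A.adj rfl b) c ∈ T.topologicalClosure := by
        intro b c
        rw [← SetLike.mem_coe, Submodule.topologicalClosure_coe, Metric.mem_closure_iff]
        intro ε hε
        have hc : Continuous fun x : A.fib (G.u (G.r g₀)) × A.fib (G.u (G.r g₀)) =>
            A.mul (LCGroupoid.isMul_inv_self (G.s_u (G.r g₀))) (A.adj rfl x.1) x.2 :=
          (A.mulL _).continuous₂.comp (((AddMonoidHomClass.isometry_of_norm (A.adj rfl)
            fun a => A.norm_adj rfl a).continuous.comp continuous_fst).prodMk continuous_snd)
        obtain ⟨δ, hδ, hcδ⟩ := Metric.continuous_iff.1 hc (b, c) (ε / 2) (half_pos hε)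
        have hX : A.HasSections (Xr A α).p (Xr A α).E :=
          hasSections_rangeIdeal A continuous_id G.r.continuous fun _ => rfl
        obtain ⟨x, hx⟩ := exists_sec_near hX g₀ (a := b) (top_le_rangeIdeal rfl hg₀ trivial) hδ
        obtain ⟨y, hy⟩ := exists_sec_near hX g₀ (a := c) (top_le_rangeIdeal rfl hg₀ trivial) hδ
        obtain ⟨χ, t, hχ⟩ := exists_average α (ptInn x y) g₀ (a := A.mul
          (LCGroupoid.isMul_inv_self (G.s_u (G.r g₀))) (A.adj rfl (L2Data.ev x g₀)) (L2Data.ev y g₀))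
          rfl (half_pos hε)
        have h1 := hχ (ptInn x (cutoff χ y)) fun g => map_smul (A.mul (LCGroupoid.isMul_inv_self
          ((Xr A α).s_eq g)) (A.adj rfl (L2Data.ev x g))) (χ g : ℂ) (L2Data.ev y g)
        have h2 := hcδ (L2Data.ev x g₀, L2Data.ev y g₀) (by
          rw [Prod.dist_eq, max_lt_iff, dist_eq_norm, dist_eq_norm]
          exact ⟨hx, hy⟩)
        have hT1 : (innS A α (x, cutoff χ y)).1 (G.r g₀) ∈ T := Submodule.mem_map_of_mem
          (f := BanachBundle.evL (A := A.toBanachBundle) (G.r g₀))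
          (Submodule.subset_span (Set.mem_range_self (x, cutoff χ y)))
        refine ⟨_, T.smul_mem (t : ℂ) hT1, ?_⟩
        exact dist_lt_of_dist_le ((dist_eq_norm _ _).trans_le h1) h2
      have hT2 : ∀ b c : A.fib (G.u (G.r g₀)), b * c ∈ T.topologicalClosure := fun b c => by
        have := hT (star b) c
        rw [mul_adj_congr rfl (G.inv_u _) _ (LCGroupoid.isMul_u _)] at this
        have hs : A.adj (G.inv_u (G.r g₀)) (star b) = b := star_star b
        rw [hs] at this
        exact this
      have hT3 := IsTotal.mem_of_isClosed (isTotal_mul (A.fib (G.u (G.r g₀))))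
        T.isClosed_topologicalClosure (fun p => hT2 p.1 p.2) a
      obtain ⟨_, ⟨v, hv, rfl⟩, hva⟩ := Metric.mem_closure_iff.1
        (show a ∈ closure (T : Set (A.fib (G.u (G.r g₀)))) from hT3) ε hε
      exact ⟨v, hv, (norm_sub_rev _ _).trans_lt ((dist_eq_norm _ _).symm.trans_lt hva)⟩
    exact key (G.u w) (G.r_u w) rfl

theorem denseRange_ofCc : DenseRange (ofTop (A := A)) := by
  intro b
  rw [Metric.mem_closure_iff]
  intro ε hε
  obtain ⟨K, hK, hbK⟩ := b.2.2.1 (ε / 2) (half_pos hε)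
  obtain ⟨χ, h1, h2, h3, -, h4⟩ := exists_bump hK isOpen_univ (Set.subset_univ _)
  refine ⟨_, ⟨⟨fun w => (χ w : ℂ) • b.1 w, (show A.IsCont (unitFam A).label fun w => b.1 w from
    b.2.1).smul (Complex.continuous_ofReal.comp h1), ⟨tsupport χ, h4, fun w hw => by
      beta_reduce
      have h0 : (χ w : ℂ) = 0 := by rw [image_eq_zero_of_notMem_tsupport hw, Complex.ofReal_zero]
      rw [h0]; exact zero_smul _ _⟩, fun _ => trivial⟩, rfl⟩, ?_⟩
  rw [dist_eq_norm]
  refine (SubAlgFamily.C0.norm_le (half_pos hε).le fun w => ?_).trans_lt (half_lt_self hε)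
  change ‖b.1 w - (χ w : ℂ) • b.1 w‖ ≤ ε / 2
  by_cases hw : w ∈ K
  · rw [h3 w hw, Complex.ofReal_one, one_smul, sub_self, norm_zero]; exact (half_pos hε).le
  · have : b.1 w - (χ w : ℂ) • b.1 w = ((1 - χ w : ℝ) : ℂ) • b.1 w := by
      rw [Complex.ofReal_sub, Complex.ofReal_one, sub_smul, one_smul]
    rw [this, norm_smul, Complex.norm_real, Real.norm_of_nonneg (sub_nonneg.2 (h2 w).2)]
    calc _ ≤ 1 * ‖b.1 w‖ := by gcongr; linarith [(h2 w).1]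
      _ ≤ _ := by rw [one_mul]; exact (hbK w hw).le

variable {D F : Type u} [NonUnitalCStarAlgebra D] [NormedAddCommGroup F] [NormedSpace ℂ F]
  [HilbertModule D F] {φ : LeftAction (FellBundle.unitFam A).C0 D F}

variable (α) in
/-- The Hilbert module `L²(G, A A^*, r, α)` is full. -/
theorem isTotal_act_inn (hφ : φ.IsNondegenerate) :
    IsTotal fun p : ((Xr A α).Sec × (Xr A α).Sec) × F => φ.act (inn p.1.1 p.1.2) p.2 := by
  refine (φ.isNondegenerate_iff.1 hφ).of_forall_mem_closure fun p => ?_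
  set S := (Submodule.span ℂ (Set.range fun p : ((Xr A α).Sec × (Xr A α).Sec) × F =>
    φ.act (inn p.1.1 p.1.2) p.2)).topologicalClosure
  have hS : IsClosed (S : Set F) := Submodule.isClosed_topologicalClosure _
  have h1 : ∀ b, φ.act (ofTop (A := A) b) p.2 ∈ S := by
    let Φ : A.CcTop (unitFam A).label →ₗ[ℂ] F :=
      { toFun := fun b => φ.act (ofTop b) p.2
        map_add' := fun a b => LinearMap.congr_fun (map_add φ.act (ofTop a) (ofTop b)) p.2
        map_smul' := fun c b => LinearMap.congr_fun (map_smul φ.act c (ofTop b)) p.2 }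
    refine IndCont.mem (Φ := Φ) (spanning_innS (α := α)) (fun K _ => ⟨‖p.2‖, norm_nonneg _,
      fun f B hB _ hfB => ?_⟩) hS fun i => Submodule.le_topologicalClosure _
        (Submodule.subset_span ⟨(i, p.2), rfl⟩)
    rw [mul_comm]
    refine (φ.norm_act_le _ _).trans ?_
    gcongr
    exact SubAlgFamily.C0.norm_le hB hfB
  have h2 : IsClosed {b : (unitFam A).C0 | φ.act b p.2 ∈ S} := hS.preimage
    (φ.continuous_act.comp (continuous_id.prodMk continuous_const))
  exact denseRange_ofCc.induction_on p.1 h2 h1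

end Fullness

section Factors

variable {G : LCGroupoid.{u}} {A : FellBundle.{u} G} {α : HaarSystem G}

open BanachBundle FellBundle L2Data

theorem integral_clm_intR {ℓ₀ : C(G.Obj, G.Arr)} (f : A.CcTop (ℓ₀.comp G.r)) (x : G.Obj)
    {k : G.Arr} (T : A.fib (ℓ₀ x) →L[ℝ] A.fib k) :
    ∫ l : {g | G.r g = x}, T (A.cast (congrArg ℓ₀ l.2) (f.1 l.1)) ∂α.fib x
      = T (((intR A α).int ℓ₀ f).1 x) := by
  let F : {g | G.r g = x} → A.fib (ℓ₀ x) := fun l => A.cast (congrArg ℓ₀ l.2) (f.1 l.1)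
  have hF : Continuous F := by
    refine BanachBundle.IsCont.continuous (A := A.toBanachBundle) (x := ℓ₀ x) ?_
    have h1 : A.IsCont (fun l : {g | G.r g = x} => ℓ₀ (G.r l.1)) (fun l => f.1 l.1) :=
      f.2.1.comp continuous_subtype_val
    have h2 : (fun l : {g | G.r g = x} => (⟨ℓ₀ x, F l⟩ : Tot A.fib))
        = fun l => ⟨ℓ₀ (G.r l.1), f.1 l.1⟩ := funext fun l => A.mk_cast _ _
    rw [BanachBundle.IsCont, h2]; exact h1
  have hFs : HasCompactSupport F := by
    obtain ⟨K, hK, hfK⟩ := f.2.2.1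
    refine HasCompactSupport.intro ((MeasFam.isClosed_fibre G.r x).isClosedEmbedding_subtypeVal
      |>.isCompact_preimage hK) fun l hl => ?_
    change A.cast _ (f.1 l.1) = 0
    rw [hfK l.1 hl]; exact map_zero _
  have h1 : ((intR A α).int ℓ₀ f).1 x = ∫ l, F l ∂α.fib x :=
    Tot.vec_eq (intR_mk α f rfl F fun g hg l hl => by subst hl; exact (A.mk_cast _ _).symm)
  rw [h1, ← ContinuousLinearMap.integral_comp_comm _ (hF.integrable_of_hasCompactSupport hFs)]

theorem FellBundle.mul_eq_zero_left {g h k : G.Arr} {m : G.IsMul g h k} {a : A.fib g} {b : A.fib h}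
    (ha : a = 0) : A.mul m a b = 0 := by rw [ha, map_zero, LinearMap.zero_apply]

theorem FellBundle.mul_adj_eq_zero {g h h' k : G.Arr} {m : G.IsMul g h k} {i : G.inv h' = h}
    {a : A.fib g} {b : A.fib h'} (hb : b = 0) : A.mul m a (A.adj i b) = 0 := by
  rw [hb, map_zero, map_zero]

theorem FellBundle.mul_cast {g h h' k : G.Arr} (e : h = h') (m : G.IsMul g h' k) (m' : G.IsMul g h k)
    (a : A.fib g) (b : A.fib h) : A.mul m a (A.cast e b) = A.mul m' a b := by
  subst e; rfl

theorem isCompact_sq {K L : Set G.Arr} (hK : IsCompact K) (hL : IsCompact L) :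
    IsCompact {z : G.Sq | G.d2 z ∈ K ∧ G.d0 z ∈ L} :=
  (isClosed_sq G).isClosedEmbedding_subtypeVal.isCompact_preimage (hK.prod hL)

/-- The map `(g, h) ↦ (g⁻¹, g h)`. -/
def sqFlip : C(G.Sq, G.Sq) where
  toFun z := ⟨(G.inv (G.d2 z), G.d1 z), by rw [G.s_inv, LCGroupoid.r_d1]⟩
  continuous_toFun := by
    exact Continuous.subtype_mk ((G.inv.continuous.comp G.d2.continuous).prodMk G.d1.continuous) _

theorem sqFlip_sqFlip (z : G.Sq) : sqFlip (sqFlip z) = z :=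
  Subtype.ext (Prod.ext (LCGroupoid.inv_inv _) (LCGroupoid.isMul_sq z).inv_mul_left.2)

theorem isCompact_sq' {K L : Set G.Arr} (hK : IsCompact K) (hL : IsCompact L) :
    IsCompact {z : G.Sq | G.d2 z ∈ K ∧ G.d1 z ∈ L} := by
  convert (isCompact_sq (hK.image G.inv.continuous) hL).image sqFlip.continuous using 1
  ext z
  constructor
  · rintro ⟨h, h'⟩
    exact ⟨sqFlip z, ⟨⟨_, h, rfl⟩, h'⟩, sqFlip_sqFlip z⟩
  · rintro ⟨y, ⟨⟨k, hk, hky⟩, h'⟩, rfl⟩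
    refine ⟨?_, ?_⟩
    · change G.inv (G.d2 y) ∈ K
      rw [← hky, LCGroupoid.inv_inv]; exact hk
    · have : G.d1 (sqFlip y) = G.d0 y := (LCGroupoid.isMul_sq y).inv_mul_left.2
      rw [this]; exact h'

theorem isMul_d2_u (z : G.Sq) : G.IsMul (G.d2 z) (G.inv (G.u (G.r (G.d0 z)))) (G.d2 z) := by
  rw [G.inv_u]; exact LCGroupoid.isMul_u_right (LCGroupoid.s_d2 z)

theorem isMul_d1_inv_d0 (z : G.Sq) : G.IsMul (G.d1 z) (G.inv (G.d0 z)) (G.d2 z) := by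
  have := (LCGroupoid.isMul_sq z).inv.inv_mul_left.inv
  rwa [LCGroupoid.inv_inv, LCGroupoid.inv_inv, LCGroupoid.inv_inv] at this

theorem FellBundle.mul_adj_mem (z : G.Sq) (a : A.fib (G.d2 z)) {b : A.fib (G.u (G.r (G.d0 z)))}
    (hb : b ∈ A.rangeIdeal (G.d0 z) rfl) : A.mul (isMul_d2_u z) a (A.adj rfl b) ∈
      A.prodSpan (isMul_d1_inv_d0 z) (A.prodSpan (LCGroupoid.isMul_sq z) ⊤ ⊤) ⊤ := by
  have mi : G.IsMul (G.d0 z) (G.inv (G.d0 z)) (G.inv (G.u (G.r (G.d0 z)))) := by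
    rw [G.inv_u]; exact LCGroupoid.isMul_self_inv rfl
  have h1 : A.adj rfl b ∈ A.prodSpan mi ⊤ ⊤ :=
    adj_mem_prodSpan' (P' := ⊤) (Q' := ⊤) _ mi rfl (LCGroupoid.inv_inv _) rfl
      (fun _ _ => trivial) (fun _ _ => trivial) hb
  refine mul_left_mem (isClosed_prodSpan _ _ _) _ _ h1 a fun c _ d _ => ?_
  rw [← A.mul_assoc (LCGroupoid.isMul_sq z) (isMul_d1_inv_d0 z)]
  exact mul_mem_prodSpan _ (mul_mem_prodSpan _ trivial trivial) trivial

theorem FellBundle.sqr_mem_idealI (z : G.Sq) {a : A.fib (G.d2 z)} (ha : a ∈ A.prodSpan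
    (isMul_d1_inv_d0 z) (A.prodSpan (LCGroupoid.isMul_sq z) ⊤ ⊤) ⊤) :
    sqr rfl a ∈ A.idealI z (LCGroupoid.r_d1 z) := by
  refine mul_right_mem (isClosed_prodSpan _ _ _) _ _ ha _ fun b hb c _ => ?_
  rw [A.mul_assoc _ _ (LCGroupoid.isMul_sq z).inv (LCGroupoid.isMul_self_inv (LCGroupoid.r_d1 z))]
  exact mul_mem_prodSpan _ hb (mul_mem_prodSpan _ trivial trivial)

variable (A) in
/-- The family with fibres `A_g A_h A_h^*`. -/
def mulAdjFam (z : G.Sq) : Submodule ℂ (A.fib (G.d2 z)) :=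
  A.prodSpan (isMul_d1_inv_d0 z) (A.prodSpan (LCGroupoid.isMul_sq z) ⊤ ⊤) ⊤

/-- The section `(g, h) ↦ p(g) q(h)^*`. -/
def mulAdjSec (p : (Xs A α).Sec) (q : (Xr A α).Sec) : A.Cc G.d2 (mulAdjFam A) :=
  ⟨fun z => A.mul (isMul_d2_u z) (L2Data.ev p (G.d2 z)) (A.adj rfl (L2Data.ev q (G.d0 z))),
    isCont_mul ((L2Data.isCont_ev p).comp G.d2.continuous)
      (isCont_adj ((L2Data.isCont_ev q).comp G.d0.continuous) _) _, by
      obtain ⟨K, hK, hpK⟩ := L2Data.exists_compact_ev p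
      obtain ⟨L, hL, hqL⟩ := L2Data.exists_compact_ev q
      refine ⟨_, isCompact_sq hK hL, fun z hz => ?_⟩
      by_cases hzK : G.d2 z ∈ K
      · exact mul_adj_eq_zero (hqL _ fun h => hz ⟨hzK, h⟩)
      · exact mul_eq_zero_left (hpK _ hzK),
    fun z => mul_adj_mem z _ (L2Data.ev_mem q (G.d0 z))⟩

/-- Sections with values in `A_g A_h A_h^*` factor through sections of `E₀` and `E₁`. -/
theorem exists_factor_mulAdj (M : A.Cc G.d2 (mulAdjFam A)) :
    ∃ (y₂ : (Y2 A α).Sec) (y₀ : (Y0 A α).Sec), (∀ z k (i : G.inv (G.u (G.r (G.d2 z))) = k)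
      (m : G.IsMul k (G.d2 z) (G.d2 z)), A.mul m (A.adj i (L2Data.ev y₂ z)) (L2Data.ev y₀ z)
        = M.1 z) ∧ (∀ z, ‖L2Data.ev y₂ z‖ ^ 2 ≤ ‖M.1 z‖) ∧ ∀ z, ‖L2Data.ev y₀ z‖ ^ 2 ≤ ‖M.1 z‖ := by
  obtain ⟨x, y, hy, hyc, hxy, hx, hy'⟩ := (idealFam A).exists_factorization (ℓ := G.d2) (fun _ => rfl)
    ⟨M.2.1, M.2.2.1⟩ fun z => sqr_mem_idealI z (M.2.2.2 z)
  refine ⟨x, (Y0 A α).mkSec y hy.1 hy.2 fun z => ?_, hxy, hx, hy'⟩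
  have hcl : IsClosed (ideal1 A z : Set (A.fib (G.d2 z))) := isClosed_prodSpan _ _ _
  change y z ∈ (ideal1 A z : Set (A.fib (G.d2 z)))
  rw [← hcl.closure_eq, Metric.mem_closure_iff]
  intro ε hε
  obtain ⟨c, hc, hyc⟩ := hyc z (ε / 2) (half_pos hε)
  exact ⟨_, mul_mem_prodSpan _ hc trivial, by
    rw [dist_eq_norm]; exact hyc.trans_lt (half_lt_self hε)⟩

theorem FellBundle.idealI_mul_cast' (z : G.Sq) {x x' : G.Obj} (hx : G.r (G.d1 z) = x)
    (hx' : G.r (G.d1 z) = x') (m : G.IsMul (G.u x) (G.u x') (G.u x')) (a : A.fib (G.u x))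
    (ha : a ∈ A.idealI z hx) (b : A.fib (G.u x')) : A.mul m a b ∈ A.idealI z hx' := by
  obtain rfl : x = x' := hx.symm.trans hx'
  exact idealI_mul z hx ha b

theorem isMul_d1_u (z : G.Sq) : G.IsMul (G.u (G.r (G.d2 z))) (G.inv (G.u (G.r (G.d1 z))))
    (G.u (G.r (G.d1 z))) := by
  rw [G.inv_u, LCGroupoid.r_d1]; exact LCGroupoid.isMul_u _

theorem isMul_u_d1 (z : G.Sq) : G.IsMul (G.u (G.r (G.d2 z))) (G.d1 z) (G.d1 z) := by
  rw [← LCGroupoid.r_d1]; exact LCGroupoid.isMul_u_left rfl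

theorem FellBundle.mul_adj_mem' (z : G.Sq) {a : A.fib (G.u (G.r (G.d2 z)))}
    {b : A.fib (G.u (G.r (G.d1 z)))} (ha : a ∈ A.rangeIdeal (G.d2 z) rfl)
    (hb : b ∈ A.rangeIdeal (G.d1 z) rfl) : A.mul (isMul_d1_u z) a (A.adj rfl b) ∈
      A.prodSpan (LCGroupoid.isMul_self_inv rfl) (A.prodSpan (LCGroupoid.isMul_sq z) ⊤ ⊤) ⊤ := by
  have mi : G.IsMul (G.d1 z) (G.inv (G.d1 z)) (G.inv (G.u (G.r (G.d1 z)))) := by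
    rw [G.inv_u]; exact LCGroupoid.isMul_self_inv rfl
  have h1 : A.adj rfl b ∈ A.prodSpan mi ⊤ ⊤ :=
    adj_mem_prodSpan' (P' := ⊤) (Q' := ⊤) _ mi rfl (LCGroupoid.inv_inv _) rfl
      (fun _ _ => trivial) (fun _ _ => trivial) hb
  refine mul_left_mem (isClosed_prodSpan _ _ _) _ _ h1 a fun c _ d _ => ?_
  rw [← A.mul_assoc (isMul_u_d1 z) (LCGroupoid.isMul_self_inv rfl)]
  refine mul_mem_prodSpan _ ?_ trivial
  refine mul_right_mem (isClosed_prodSpan _ _ _) _ _ ha c fun e _ f _ => ?_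
  rw [A.mul_assoc _ _ (LCGroupoid.isMul_sq z).inv_mul_left (LCGroupoid.isMul_sq z)]
  exact mul_mem_prodSpan _ trivial trivial

theorem FellBundle.sqr_mem_idealI' (z : G.Sq) {a : A.fib (G.u (G.r (G.d1 z)))} (ha : a ∈ A.prodSpan
    (LCGroupoid.isMul_self_inv rfl) (A.prodSpan (LCGroupoid.isMul_sq z) ⊤ ⊤)
      (⊤ : Submodule ℂ (A.fib (G.inv (G.d1 z))))) {x : G.Obj}
    (hx : G.r (G.u (G.r (G.d1 z))) = x) (hx' : G.r (G.d1 z) = x) :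
    sqr hx a ∈ A.idealI z hx' := by
  subst hx'
  have mu : G.IsMul (G.inv (G.d1 z)) (G.inv (G.u (G.r (G.d1 z)))) (G.inv (G.d1 z)) := by
    rw [G.inv_u]; exact LCGroupoid.isMul_u_right (G.s_inv _)
  have mi : G.IsMul (G.d1 z) (G.inv (G.d1 z)) (G.inv (G.u (G.r (G.d1 z)))) := by
    rw [G.inv_u]; exact LCGroupoid.isMul_self_inv rfl
  have h1 : A.adj rfl a ∈ A.prodSpan mi ⊤ (A.prodSpan (LCGroupoid.isMul_sq z).inv ⊤ ⊤) :=
    adj_mem_prodSpan' (P' := A.prodSpan (LCGroupoid.isMul_sq z).inv ⊤ ⊤) (Q' := ⊤) _ mi rfl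
      (LCGroupoid.inv_inv _) rfl (fun _ h => adj_mem_prodSpan' (P' := ⊤) (Q' := ⊤) _ _ rfl rfl rfl (fun _ _ => trivial)
        (fun _ _ => trivial) h) (fun _ _ => trivial) ha
  refine mul_right_mem (isClosed_prodSpan _ _ _) _ _ ha _ fun b hb c _ => ?_
  rw [A.mul_assoc _ _ mu (LCGroupoid.isMul_self_inv rfl)]
  refine mul_mem_prodSpan _ hb ?_
  refine mul_left_mem (isClosed_prodSpan _ _ _) _ _ h1 c fun d _ e he => ?_
  have ms : G.IsMul (G.inv (G.d1 z)) (G.d1 z) (G.u (G.s (G.d1 z))) := LCGroupoid.isMul_inv_self rfl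
  have mt : G.IsMul (G.u (G.s (G.d1 z))) (G.inv (G.d1 z)) (G.inv (G.d1 z)) :=
    LCGroupoid.isMul_u_left (G.r_inv _)
  have ml : G.IsMul (G.u (G.s (G.d1 z))) (G.inv (G.d0 z)) (G.inv (G.d0 z)) :=
    LCGroupoid.isMul_u_left (by rw [G.r_inv, LCGroupoid.s_d1])
  rw [← A.mul_assoc ms mt]
  refine mul_left_mem (isClosed_prodSpan _ _ _) _ _ he _ fun f _ k _ => ?_
  rw [← A.mul_assoc ml (LCGroupoid.isMul_sq z).inv]
  exact mul_mem_prodSpan _ trivial trivial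

/-- The section `p(g) q(gh)^*` over `G²` factors through sections of `E₀`. -/
theorem exists_factor₁ (p q : (Xr A α).Sec) :
    ∃ (y₂ : (Y2 A α).Sec) (y₁ : (Y1 A α).Sec), ∀ z k (i : G.inv (G.u (G.r (G.d2 z))) = k)
      (m : G.IsMul k (G.u (G.r (G.d1 z))) (G.u (G.r (G.d1 z)))),
      A.mul m (A.adj i (L2Data.ev y₂ z)) (L2Data.ev y₁ z)
        = A.mul (isMul_d1_u z) (L2Data.ev p (G.d2 z)) (A.adj rfl (L2Data.ev q (G.d1 z))) := by
  obtain ⟨K, hK, hpK⟩ := L2Data.exists_compact_ev p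
  obtain ⟨L, hL, hqL⟩ := L2Data.exists_compact_ev q
  have hc : A.IsCc (fun z => G.u (G.r (G.d1 z))) fun z => A.mul (isMul_d1_u z)
      (L2Data.ev p (G.d2 z)) (A.adj rfl (L2Data.ev q (G.d1 z))) := by
    refine ⟨isCont_mul ((L2Data.isCont_ev p).comp G.d2.continuous)
      (isCont_adj ((L2Data.isCont_ev q).comp G.d1.continuous) _) _, _, isCompact_sq' hK hL,
      fun z hz => ?_⟩
    by_cases hzK : G.d2 z ∈ K
    · exact mul_adj_eq_zero (hqL _ fun h => hz ⟨hzK, h⟩)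
    · exact mul_eq_zero_left (hpK _ hzK)
  have hr : ∀ z : G.Sq, G.r (G.u (G.r (G.d1 z))) = G.r (G.d2 z) := fun z => by
    rw [G.r_u, LCGroupoid.r_d1]
  obtain ⟨x, y, hy, hyc, hxy, -, -⟩ := (idealFam A).exists_factorization
    (ℓ := fun z => G.u (G.r (G.d1 z))) hr hc fun z => sqr_mem_idealI' z
      (mul_adj_mem' z (L2Data.ev_mem p (G.d2 z)) (L2Data.ev_mem q (G.d1 z))) _ (LCGroupoid.r_d1 z)
  refine ⟨x, (Y1 A α).mkSec y hy.1 hy.2 fun z => ?_, hxy⟩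
  have hcl : IsClosed (A.idealI z rfl : Set (A.fib (G.u (G.r (G.d1 z))))) := isClosed_prodSpan _ _ _
  change y z ∈ (A.idealI z rfl : Set (A.fib (G.u (G.r (G.d1 z)))))
  rw [← hcl.closure_eq, Metric.mem_closure_iff]
  intro ε hε
  obtain ⟨c, hc, hyc⟩ := hyc z (ε / 2) (half_pos hε)
  refine ⟨_, idealI_mul_cast' z (LCGroupoid.r_d1 z) rfl (LCGroupoid.isMul_u_left (hr z)) c hc _, by
    rw [dist_eq_norm]; exact hyc.trans_lt (half_lt_self hε)⟩

end Factors

section Multiplicativity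

variable {G : LCGroupoid.{u}} {A : FellBundle.{u} G} {α : HaarSystem G}

open BanachBundle FellBundle L2Data

theorem lam2_pull {ℓ₀ : C(G.Obj, G.Arr)} {ℓ : C(G.Arr, G.Arr)} (f : A.CcTop (ℓ₀.comp G.r))
    (f' : A.CcTop (ℓ.comp G.d2)) (g : G.Arr) (T : A.fib (ℓ₀ (G.s g)) →L[ℝ] A.fib (ℓ g))
    (h : ∀ z (hz : G.d2 z = g), (⟨ℓ (G.d2 z), f'.1 z⟩ : Tot A.fib) = ⟨ℓ g, T (A.cast
      (congrArg ℓ₀ ((LCGroupoid.s_d2 z).symm.trans (congrArg G.s hz))) (f.1 (G.d0 z)))⟩) :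
    ((lam2 A α).int ℓ f').1 g = T (((intR A α).int ℓ₀ f).1 (G.s g)) := by
  rw [← integral_clm_intR]
  refine Tot.vec_eq (lam2_mk α f' rfl rfl _ fun z hz l hl => ?_)
  rw [h z hz]
  obtain ⟨l, hl'⟩ := l
  subst hl
  rfl

theorem lam1_pull {ℓ₀ : C(G.Obj, G.Arr)} {ℓ : C(G.Arr, G.Arr)} (f : A.CcTop (ℓ₀.comp G.r))
    (f' : A.CcTop (ℓ.comp G.d1)) (k : G.Arr) (T : A.fib (ℓ₀ (G.r k)) →L[ℝ] A.fib (ℓ k))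
    (h : ∀ z (hz : G.d1 z = k), (⟨ℓ (G.d1 z), f'.1 z⟩ : Tot A.fib) = ⟨ℓ k, T (A.cast
      (congrArg ℓ₀ ((LCGroupoid.r_d1 z).symm.trans (congrArg G.r hz))) (f.1 (G.d2 z)))⟩) :
    ((lam1 A α).int ℓ f').1 k = T (((intR A α).int ℓ₀ f).1 (G.r k)) := by
  rw [← integral_clm_intR]
  refine Tot.vec_eq (lam1_mk α f' rfl rfl _ fun z hz l hl => ?_)
  rw [h z hz]
  obtain ⟨l, hl'⟩ := l
  subst hl
  rfl

theorem FellBundle.cast_mul {g g' h k : G.Arr} (e : g = g') (m : G.IsMul g' h k) (m' : G.IsMul g h k)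
    (a : A.fib g) (b : A.fib h) : A.mul m (A.cast e a) b = A.mul m' a b := by
  subst e; rfl

theorem FellBundle.mul_tot {g h k k' : G.Arr} (m : G.IsMul g h k) (m' : G.IsMul g h k')
    (a : A.fib g) (b : A.fib h) : (⟨k, A.mul m a b⟩ : Tot A.fib) = ⟨k', A.mul m' a b⟩ := by
  obtain rfl := m.2.symm.trans m'.2; rfl

/-- `(s y)^* (t x) = (y^* p) (q^* x)` if `s^* t = p q^*`. -/
theorem FellBundle.adj_mul_mul_of_factor {x y s t n s' p q' : G.Arr}
    {a : A.fib s} {b : A.fib t} {c : A.fib p} {d : A.fib q'}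
    {is : G.inv s = s'} {mst : G.IsMul s' t n} {mpq : G.IsMul p q' n}
    (hf : A.mul mst (A.adj is a) b = A.mul mpq c d)
    {sy : G.Arr} (msy : G.IsMul s y sy) {tx : G.Arr} (mtx : G.IsMul t x tx)
    {k : G.Arr} (mk : G.IsMul (G.inv sy) tx k) {y' : G.Arr} (iy : G.inv y = y')
    {yp qx : G.Arr} (myp : G.IsMul y' p yp) (mqx : G.IsMul q' x qx) (mk' : G.IsMul yp qx k)
    (u : A.fib y) (v : A.fib x) :
    A.mul mk (A.adj rfl (A.mul msy a u)) (A.mul mtx b v)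
      = A.mul mk' (A.mul myp (A.adj iy u) c) (A.mul mqx d v) := by
  subst is iy
  have m1 : G.IsMul (G.inv s) tx (G.mul (G.inv s) tx) :=
    ⟨by rw [G.s_inv, mtx.r_eq, ← mst.1, G.s_inv], rfl⟩
  have m2 : G.IsMul n x (G.mul (G.inv s) tx) := by
    refine ⟨by rw [mst.s_eq, mtx.1], ?_⟩
    rw [← mst.2, G.mul_assoc _ _ _ mst.1 mtx.1, mtx.2]
  have m3 : G.IsMul (G.inv y) (G.mul (G.inv s) tx) k := by
    refine ⟨by rw [m1.r_eq]; exact msy.inv.1, ?_⟩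
    rw [← mk.2, ← msy.inv.2, G.mul_assoc _ _ _ msy.inv.1 m1.1]
  have m4 : G.IsMul p qx (G.mul (G.inv s) tx) := by
    refine ⟨by rw [mqx.r_eq, mpq.1], ?_⟩
    rw [← m2.2, ← mpq.2, G.mul_assoc _ _ _ mpq.1 mqx.1, mqx.2]
  rw [A.adj_mul msy msy.inv rfl rfl rfl, A.mul_assoc msy.inv mk m1 m3,
    ← A.mul_assoc mst m2 mtx m1, hf, A.mul_assoc mpq m2 mqx m4, A.mul_assoc myp mk' m4 m3]

theorem inn_prodSec₀ {p : (Xs A α).Sec} {q : (Xr A α).Sec} {y₂ : (Y2 A α).Sec} {y₀ : (Y0 A α).Sec}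
    (hf : ∀ z k (i : G.inv (G.u (G.r (G.d2 z))) = k)
      (m : G.IsMul k (G.d2 z) (G.d2 z)), A.mul m (A.adj i (L2Data.ev y₂ z)) (L2Data.ev y₀ z)
        = A.mul (isMul_d2_u z) (L2Data.ev p (G.d2 z)) (A.adj rfl (L2Data.ev q (G.d0 z))))
    (y : (Xs A α).Sec) (x : (Xr A α).Sec) :
    (inn (prodSec (isProd_Y2Xs A α) y₂ y) (prodSec (isProd_Y0Xr A α) y₀ x) : (unitFam A).C0)
      = inn y p * inn q x := by
  refine SubAlgFamily.C0.ext fun w => ?_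
  refine (intS A α).map (unitFam A).label (unitFam A).label
    (fun w => mulRightL (LCGroupoid.isMul_u w) ((inn q x : (unitFam A).C0).1 w)) (ptInn y p)
    ((lam2 A α).int ((unitFam A).label.comp G.s) (ptInn (prodSec (isProd_Y2Xs A α) y₂ y)
      (prodSec (isProd_Y0Xr A α) y₀ x))) (fun g => ?_) w
  refine lam2_pull (ℓ := (unitFam A).label.comp G.s) (ptInn q x) (ptInn (prodSec (isProd_Y2Xs A α) y₂ y)
      (prodSec (isProd_Y0Xr A α) y₀ x)) g
    ((A.mulL (LCGroupoid.isMul_u (G.s g)) ((ptInn y p).1 g)).restrictScalars ℝ) ?_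
  rintro z rfl
  congr 1
  refine Eq.trans ?_ (mul_cast (congrArg G.u (LCGroupoid.s_d2 z).symm) (LCGroupoid.isMul_u _)
    (by rw [← LCGroupoid.s_d2]; exact LCGroupoid.isMul_u _) ((ptInn y p).1 (G.d2 z))
    ((ptInn q x).1 (G.d0 z))).symm
  exact adj_mul_mul_of_factor (hf z _ rfl (by rw [G.inv_u]; exact LCGroupoid.isMul_u_left rfl))
    (isMul_Y2Xs A α z) (isMul_Y0Xr A α z) _ rfl _ _ _ _ _

end Multiplicativity

section Multiplicativity

variable {G : LCGroupoid.{u}} {A : FellBundle.{u} G} {α : HaarSystem G}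

open BanachBundle FellBundle L2Data

theorem inn_prodSec₁ {p q : (Xr A α).Sec} {y₂ : (Y2 A α).Sec} {y₁ : (Y1 A α).Sec}
    (hf : ∀ z k (i : G.inv (G.u (G.r (G.d2 z))) = k)
      (m : G.IsMul k (G.u (G.r (G.d1 z))) (G.u (G.r (G.d1 z)))),
      A.mul m (A.adj i (L2Data.ev y₂ z)) (L2Data.ev y₁ z)
        = A.mul (isMul_d1_u z) (L2Data.ev p (G.d2 z)) (A.adj rfl (L2Data.ev q (G.d1 z))))
    (x x' : (Xr A α).Sec) :
    (inn (prodSec (isProd_Y2Xr A α) y₂ x) (prodSec (isProd_Y1Xr A α) y₁ x') : (unitFam A).C0)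
      = inn x p * inn q x' := by
  have m : ∀ z : G.Sq, G.IsMul (G.inv ((W0 A α).p z)) ((W0 A α).p z) (G.u (G.r (G.d1 z))) :=
    fun z => by rw [LCGroupoid.r_d1]; exact LCGroupoid.isMul_inv_self (G.s_u _)
  let f : A.CcTop (((unitFam A).label.comp G.r).comp G.d1) :=
    pair m (prodSec (isProd_Y2Xr A α) y₂ x) (prodSec (isProd_Y1Xr A α) y₁ x')
  refine SubAlgFamily.C0.ext fun w => ?_
  refine (intR_lam1 A α (unitFam A).label f (ptInn (prodSec (isProd_Y2Xr A α) y₂ x)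
    (prodSec (isProd_Y1Xr A α) y₁ x')) (fun z => mul_tot _ _ _ _) w).symm.trans ?_
  refine (intR A α).map (unitFam A).label (unitFam A).label
    (fun w => (A.mulL (LCGroupoid.isMul_u w) ((inn x p : (unitFam A).C0).1 w)).restrictScalars ℝ)
    (ptInn q x') ((lam1 A α).int ((unitFam A).label.comp G.r) f) (fun k => ?_) w
  refine lam1_pull (ℓ := (unitFam A).label.comp G.r) (ptInn x p) f k
    (mulRightL (LCGroupoid.isMul_u (G.r k)) ((ptInn q x').1 k)) ?_
  rintro z rfl
  congr 1
  refine Eq.trans ?_ (cast_mul (congrArg G.u (LCGroupoid.r_d1 z).symm)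
    (LCGroupoid.isMul_u _) (by rw [← LCGroupoid.r_d1]; exact LCGroupoid.isMul_u _)
    ((ptInn x p).1 (G.d2 z)) ((ptInn q x').1 (G.d1 z))).symm
  exact adj_mul_mul_of_factor (hf z _ rfl (by
      rw [G.inv_u, ← LCGroupoid.r_d1]; exact LCGroupoid.isMul_u_left (G.r_u _)))
    (isMul_Y2Xr A α z) (isMul_Y1Xr A α z) _ rfl _ _ _ _ _

section Operators

variable {D F : Type u} [NonUnitalCStarAlgebra D] [NormedAddCommGroup F] [NormedSpace ℂ F]
  [HilbertModule D F] {φ : LeftAction (FellBundle.unitFam A).C0 D F}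

section General

variable {π₁ π₂ : C(G.Arr, G.Obj)} {d₁ d₂ : C(G.Sq, G.Arr)} {ρ : C(G.Sq, G.Obj)}
  {X₁ : L2Data A π₁ (unitFam A)} {X₂ : L2Data A π₂ (unitFam A)}
  {Y₁ : L2Data A d₁ (rangeFam A)} {Y₂ : L2Data A d₂ (rangeFam A)} {W : L2Data A ρ (unitFam A)}
  {act₁ : LeftAction (rangeFam A).C0 (unitFam A).C0 X₁.Sec}
  {act₂ : LeftAction (rangeFam A).C0 (unitFam A).C0 X₂.Sec}
  {m₁ : ∀ z, G.IsMul (Y₁.p z) (X₁.p (d₁ z)) (W.p z)} {m₂ : ∀ z, G.IsMul (Y₂.p z) (X₂.p (d₂ z)) (W.p z)}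
  {γ₁ : Unitary D ((φ.leftTensor act₁).Tensor Y₁.Sec) (φ.Tensor W.Sec)}
  {γ₂ : Unitary D ((φ.leftTensor act₂).Tensor Y₂.Sec) (φ.Tensor W.Sec)}

theorem IsCanonical.symm_tens (h₁ : IsProd X₁ Y₁ W m₁) (hγ₁ : IsCanonical φ X₁ act₁ Y₁ W m₁ γ₁)
    (y : Y₁.Sec) (x : X₁.Sec) (v : F) :
    γ₁.toEquiv.symm (φ.tens (prodSec h₁ y x) v) = (φ.leftTensor act₁).tens y (φ.tens x v) := by
  rw [LinearEquiv.symm_apply_eq]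
  exact (hγ₁ y x (prodSec h₁ y x) (fun _ => rfl) v).symm

theorem IsCanonical.ann_ann (h₁ : IsProd X₁ Y₁ W m₁) (hγ₁ : IsCanonical φ X₁ act₁ Y₁ W m₁ γ₁)
    (y : Y₁.Sec) (x : X₁.Sec) (t : (φ.leftTensor act₁).Tensor Y₁.Sec) :
    φ.ann x ((φ.leftTensor act₁).ann y t) = φ.ann (prodSec h₁ y x) (γ₁.toEquiv t) := by
  refine HilbertModule.ext_inn (D := D) fun v => ?_
  rw [← LeftAction.inn_tens_left, ← LeftAction.inn_tens_left, ← LeftAction.inn_tens_left,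
    ← hγ₁ y x (prodSec h₁ y x) (fun _ => rfl) v, γ₁.inn_map]

/-- If `y₁^* y₂ = p q^*`, then `T_{y₁}^* T_{y₂} = T_p T_q^*`. -/
theorem IsCanonical.ann_tens (h₁ : IsProd X₁ Y₁ W m₁) (hγ₁ : IsCanonical φ X₁ act₁ Y₁ W m₁ γ₁)
    (h₂ : IsProd X₂ Y₂ W m₂) (hγ₂ : IsCanonical φ X₂ act₂ Y₂ W m₂ γ₂) {y₁ : Y₁.Sec} {y₂ : Y₂.Sec}
    {p : X₁.Sec} {q : X₂.Sec} (h : ∀ a b, (inn (prodSec h₁ y₁ a) (prodSec h₂ y₂ b) :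
      (unitFam A).C0) = inn a p * inn q b) (t : φ.Tensor X₂.Sec) :
    (φ.leftTensor act₁).ann y₁ (γ₁.toEquiv.symm (γ₂.toEquiv ((φ.leftTensor act₂).tens y₂ t)))
      = φ.tens p (φ.ann q t) := by
  have := φ.isTotal_tens.clm_ext
    (S := (φ.leftTensor act₁).ann y₁ ∘L (γ₁.toIso.symm : φ.Tensor W.Sec →L[ℂ] _) ∘L
      (γ₂.toIso : _ →L[ℂ] φ.Tensor W.Sec) ∘L (φ.leftTensor act₂).cre y₂)
    (T := φ.cre p ∘L φ.ann q) (fun i => ?_)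
  · exact congrArg (fun T : φ.Tensor X₂.Sec →L[ℂ] φ.Tensor X₁.Sec => T t) this
  change (φ.leftTensor act₁).ann y₁ (γ₁.toEquiv.symm (γ₂.toEquiv ((φ.leftTensor act₂).tens y₂
    (φ.tens i.1 i.2)))) = φ.tens p (φ.ann q (φ.tens i.1 i.2))
  refine HilbertModule.ext_total (D := D) φ.isTotal_tens fun j => ?_
  rw [← LeftAction.inn_tens_left, γ₁.inn_symm_right, hγ₁ y₁ j.1 (prodSec h₁ y₁ j.1) (fun _ => rfl),
    hγ₂ y₂ i.1 (prodSec h₂ y₂ i.1) (fun _ => rfl), LeftAction.inn_tens, h, φ.act_mul,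
    LeftAction.ann_tens, LeftAction.inn_tens]

end General

variable (U : FellUnitary α φ)

theorem ann_oneU {d : C(G.Sq, G.Arr)} (Y : L2Data A d (rangeFam A)) (y : Y.Sec)
    (t : (leftS α φ).Tensor Y.Sec) :
    (leftR α φ).ann y (U.oneU Y t) = U.toEquiv ((leftS α φ).ann y t) :=
  LeftAction.ann_mapRight _ _ _ _ _ y t

theorem inn_oneU {d : C(G.Sq, G.Arr)} (Y : L2Data A d (rangeFam A))
    (s t : (leftS α φ).Tensor Y.Sec) : (inn (U.oneU Y s) (U.oneU Y t) : D) = inn s t := by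
  have h := ((leftS α φ).isTotal_tens (X := Y.Sec)).clm_ext
    (S := (HilbertModule.innL D _ (U.oneU Y s)) ∘L U.oneU Y) (T := HilbertModule.innL D _ s)
    fun p => by
      change (inn (U.oneU Y s) (U.oneU Y ((leftS α φ).tens p.1 p.2)) : D)
        = inn s ((leftS α φ).tens p.1 p.2)
      rw [oneU_tens, LeftAction.inn_tens_right, LeftAction.inn_tens_right, ann_oneU]
      exact U.inn_map _ _
  exact congrArg (fun T : (leftS α φ).Tensor Y.Sec →L[ℂ] D => T t) h

theorem inn_pullU {d : C(G.Sq, G.Arr)} {Y : L2Data A d (rangeFam A)} {ρ ρ' : C(G.Sq, G.Obj)}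
    {Ws : L2Data A ρ (unitFam A)} {Wr : L2Data A ρ' (unitFam A)}
    (γs : Unitary D ((leftS α φ).Tensor Y.Sec) (φ.Tensor Ws.Sec))
    (γr : Unitary D ((leftR α φ).Tensor Y.Sec) (φ.Tensor Wr.Sec)) (s t : φ.Tensor Ws.Sec) :
    (inn (U.pullU γs γr s) (U.pullU γs γr t) : D) = inn s t := by
  rw [FellUnitary.pullU, FellUnitary.pullU, γr.inn_map, inn_oneU, γs.inn_symm,
    LinearEquiv.apply_symm_apply]

theorem pullU_prodSec {d : C(G.Sq, G.Arr)} {Y : L2Data A d (rangeFam A)} {ρ ρ' : C(G.Sq, G.Obj)}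
    {Ws : L2Data A ρ (unitFam A)} {Wr : L2Data A ρ' (unitFam A)}
    {ms : ∀ z, G.IsMul (Y.p z) ((Xs A α).p (d z)) (Ws.p z)} (hs : IsProd (Xs A α) Y Ws ms)
    {γs : Unitary D ((leftS α φ).Tensor Y.Sec) (φ.Tensor Ws.Sec)}
    {γr : Unitary D ((leftR α φ).Tensor Y.Sec) (φ.Tensor Wr.Sec)}
    (hγs : IsCanonical φ (Xs A α) (actS A α) Y Ws ms γs) (y : Y.Sec) (x : (Xs A α).Sec) (v : F) :
    U.pullU γs γr (φ.tens (prodSec hs y x) v)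
      = γr.toEquiv ((leftR α φ).tens y (U.toEquiv (φ.tens x v))) := by
  rw [FellUnitary.pullU, hγs.symm_tens hs]
  exact congrArg _ (oneU_tens U Y y _)

variable {U} {L : A.Sec →ₗ[ℂ] F →ₗ[ℂ] F}

theorem indCont_of_bound (hb : ∀ ξ v, ‖L ξ v‖ ≤ (normI α ξ).toReal * ‖v‖) (v : F) :
    IndCont fun ξ : A.Sec => L ξ v := by
  intro K hK
  obtain ⟨C, hC, h⟩ := exists_normI_le (A := A) α hK
  refine ⟨C * ‖v‖, by positivity, fun ξ B hB hξ hξB => (hb ξ v).trans ?_⟩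
  rw [mul_right_comm]
  gcongr
  exact ENNReal.toReal_le_of_le_ofReal (by positivity) (h ξ B hB hξ hξB)

theorem isMul_inv_d2_d1 (z : G.Sq) : G.IsMul (G.inv (G.d2 z)) (G.d1 z) (G.d0 z) :=
  (LCGroupoid.isMul_sq z).inv_mul_left

theorem isMul_W0W2 (z : G.Sq) : G.IsMul (G.inv ((W0 A α).p z)) ((W2 A α).p z) (G.d1 z) := by
  change G.IsMul (G.inv (G.u (G.r (G.d2 z)))) (G.d1 z) (G.d1 z)
  rw [G.inv_u]
  exact isMul_u_d1 z

/-- The section `(g, h) ↦ ξ(g)^* η(g h)`. -/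
def starMul (ξ η : A.Sec) : A.CcTop ((ContinuousMap.id G.Arr).comp G.d0) :=
  ⟨fun z => A.mul (isMul_inv_d2_d1 z) (A.adj rfl (FellBundle.ev ξ (G.d2 z)))
      (FellBundle.ev η (G.d1 z)),
    isCont_mul (isCont_adj ((FellBundle.isCont_ev ξ).comp G.d2.continuous) _)
      ((FellBundle.isCont_ev η).comp G.d1.continuous) _, by
      obtain ⟨K, hK, hK0⟩ := FellBundle.exists_compact_ev ξ
      obtain ⟨K', hK', hK0'⟩ := FellBundle.exists_compact_ev η
      refine ⟨_, isCompact_sq' hK hK', fun z hz => ?_⟩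
      by_cases h : G.d2 z ∈ K
      · beta_reduce
        rw [hK0' _ fun h' => hz ⟨h, h'⟩, map_zero]; rfl
      · beta_reduce
        rw [hK0 _ h, map_zero, map_zero, LinearMap.zero_apply]; rfl, fun _ => trivial⟩

theorem lam0_starMul (ξ η : A.Sec) :
    ((lam0 A α).int (.id G.Arr) (starMul ξ η) : A.Sec) = conv α (starSec ξ) η := by
  refine Subtype.ext (funext fun k => ?_)
  refine lam0_same A α sqFlip (fun z => (isMul_inv_d2_d1 z).2) (fun _ => rfl) (.id G.Arr)
    (starMul ξ η) (extMul (starSec ξ) η) (fun z => ?_) k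
  have key : ∀ {g g' : G.Arr} (e : g' = g) (k : G.Arr) (m : G.IsMul (G.inv g) (G.d1 z) k)
      (i : G.inv g' = G.inv g), A.mul m (A.adj rfl (FellBundle.ev ξ g)) (FellBundle.ev η (G.d1 z))
        = A.mul m (A.adj i (FellBundle.ev ξ g')) (FellBundle.ev η (G.d1 z)) := by
    rintro g _ rfl k m i; rfl
  refine (mul_tot _ (LCGroupoid.isMul_sq (sqFlip z)) _ _).trans ?_
  exact congrArg (fun t => (⟨_, t⟩ : Tot A.fib)) (key (LCGroupoid.inv_inv _) _ _ _)

variable (hL : ∀ (x : (Xr A α).Sec) (y : (Xs A α).Sec) (v : F),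
  φ.ann x (U.toEquiv (φ.tens y v)) = L (pairS x y) v)
  (hb : ∀ ξ v, ‖L ξ v‖ ≤ (normI α ξ).toReal * ‖v‖) (hU : U.IsCoherent)

include hL hb hU

theorem integrated_conv (ξ η : A.Sec) (v : F) : L (conv α ξ η) v = L ξ (L η v) := by
  obtain ⟨x, p, rfl, -⟩ := exists_pair_eq (α := α) ξ
  obtain ⟨q, y, rfl, -⟩ := exists_pair_eq (α := α) η
  obtain ⟨y₂, y₀, hf, -⟩ := exists_factor_mulAdj (mulAdjSec p q)
  obtain ⟨γ₀s, γ₀r, γ₁s, γ₁r, γ₂s, γ₂r, c0s, c0r, c1s, c1r, c2s, c2r, h⟩ := hU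
  have h1 := c2s.ann_tens (isProd_Y2Xs A α) (isProd_Y0Xr A α) c0r (inn_prodSec₀ hf)
    (U.toEquiv (φ.tens y v))
  rw [← hL x p, ← hL q y, ← h1, ← ann_oneU, c2r.ann_ann (isProd_Y2Xr A α)]
  have h2 := pullU_prodSec U (isProd_Y0Xs A α) (γr := γ₀r) c0s y₀ y v
  rw [← h2]
  refine Eq.trans ?_ (congrArg (φ.ann (prodSec (isProd_Y2Xr A α) y₂ x))
    (h (φ.tens (prodSec (isProd_Y0Xs A α) y₀ y) v))).symm
  rw [ann_pullU U (isProd_Y1Xs A α) (isProd_Y1Xr A α) isMul_W0W2 hL c1s c1r (isBdd_lam1 A α)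
    (indCont_of_bound hb)]
  refine congrArg (fun f => L ((lam1 A α).int (.id G.Arr) f) v) (Subtype.ext (funext fun z => ?_))
  symm
  exact adj_mul_mul_of_factor (hf z _ rfl (by rw [G.inv_u]; exact LCGroupoid.isMul_u_left rfl))
    (isMul_Y2Xr A α z) (isMul_Y0Xs A α z) _ rfl _ _ _ _ _

theorem inn_integrated (ξ η : A.Sec) (v w : F) :
    (inn (L ξ v) (L η w) : D) = inn v (L (conv α (starSec ξ) η) w) := by
  obtain ⟨p, x, rfl, -⟩ := exists_pair_eq (α := α) ξ
  obtain ⟨q, y, rfl, -⟩ := exists_pair_eq (α := α) η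
  obtain ⟨y₂, y₁, hf⟩ := exists_factor₁ p q
  obtain ⟨γ₀s, γ₀r, γ₁s, γ₁r, γ₂s, γ₂r, c0s, c0r, c1s, c1r, c2s, c2r, h⟩ := hU
  have h1 := c2r.ann_tens (isProd_Y2Xr A α) (isProd_Y1Xr A α) c1r (inn_prodSec₁ hf)
    (U.toEquiv (φ.tens y w))
  rw [← hL p x, ← hL q y, ← LeftAction.inn_tens_right, ← h1, ← LeftAction.inn_tens_left,
    γ₂r.inn_symm_right, ← pullU_prodSec U (isProd_Y1Xs A α) (γr := γ₁r) c1s y₁ y w,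
    ← pullU_prodSec U (isProd_Y2Xs A α) (γr := γ₂r) c2s y₂ x v, ← h, inn_pullU,
    LeftAction.inn_tens_left]
  refine congrArg (fun t => (inn v t : D)) ?_
  rw [ann_pullU U (isProd_Y0Xs A α) (isProd_Y0Xr A α) isMul_inv_d2_d1 hL c0s c0r (isBdd_lam0 A α)
    (indCont_of_bound hb), ← lam0_starMul]
  refine congrArg (fun f => L ((lam0 A α).int (.id G.Arr) f) w) (Subtype.ext (funext fun z => ?_))
  have mp : G.IsMul (G.inv (G.d2 z)) (G.u (G.r (G.d2 z))) (G.inv (G.d2 z)) :=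
    LCGroupoid.isMul_u_right (G.s_inv _)
  refine (adj_mul_mul_of_factor (hf z _ rfl (by
      rw [G.inv_u, ← LCGroupoid.r_d1]; exact LCGroupoid.isMul_u_left (G.r_u _)))
    (isMul_Y2Xs A α z) (isMul_Y1Xs A α z) _ rfl mp (isMul_XrXs (α := α) (G.d1 z)) (isMul_inv_d2_d1 z)
    (L2Data.ev x (G.d2 z)) (L2Data.ev y (G.d1 z))).trans ?_
  have h2 := A.adj_mul (isMul_XrXs (α := α) (G.d2 z)) mp (LCGroupoid.inv_inv _) rfl rfl
    (A.adj rfl (L2Data.ev p (G.d2 z))) (L2Data.ev x (G.d2 z))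
  have h3 := h2.trans (congrArg (A.mul mp (A.adj rfl (L2Data.ev x (G.d2 z))))
    (A.adj_adj rfl (LCGroupoid.inv_inv _) (L2Data.ev p (G.d2 z))))
  exact congrArg (fun t => A.mul (isMul_inv_d2_d1 z) t (FellBundle.ev (pairS q y : A.Sec) (G.d1 z))) h3.symm

omit hU hb in
theorem isTotal_integrated (hφ : φ.IsNondegenerate) : IsTotal fun p : A.Sec × F => L p.1 p.2 := by
  refine (isTotal_act_inn α hφ).of_forall_mem_closure fun p => ?_
  rw [← LeftAction.ann_tens, ← U.toEquiv.apply_symm_apply (φ.tens p.1.2 p.2)]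
  exact φ.isTotal_tens.mem_of_isClosed (S := Submodule.comap (φ.ann p.1.1 ∘L
      (U.toIso : φ.Tensor (Xs A α).Sec →L[ℂ] φ.Tensor (Xr A α).Sec)).toLinearMap
      (Submodule.span ℂ (Set.range fun p : A.Sec × F => L p.1 p.2)).topologicalClosure)
    ((Submodule.isClosed_topologicalClosure _).preimage (φ.ann p.1.1 ∘L
      (U.toIso : φ.Tensor (Xs A α).Sec →L[ℂ] φ.Tensor (Xr A α).Sec)).continuous)
    (fun i => Submodule.le_topologicalClosure _ (Submodule.subset_span
      ⟨(pairS p.1.1 i.1, i.2), (hL _ _ _).symm⟩)) _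

theorem integrated_adj (hφ : φ.IsNondegenerate) (ξ : A.Sec) (v w : F) :
    (inn (L ξ v) w : D) = inn v (L (starSec ξ) w) := by
  have h := (isTotal_integrated hL hφ).clm_ext (S := HilbertModule.innL D F (L ξ v))
    (T := (HilbertModule.innL D F v) ∘L ((L (starSec ξ)).mkContinuous _ (hb _))) fun p => by
      change (inn (L ξ v) (L p.1 p.2) : D) = inn v (L (starSec ξ) (L p.1 p.2))
      rw [inn_integrated hL hb hU, integrated_conv hL hb hU]
  exact congrArg (fun T : F →L[ℂ] D => T w) h

end Operators

end Multiplicativity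

section Disintegration

variable {G : LCGroupoid.{u}} {A : FellBundle.{u} G} {α : HaarSystem G}

open BanachBundle FellBundle L2Data

/-- The section `g ↦ b(r(g)) ξ(g)`. -/
def unitMul : (unitFam A).C0 →ₗ[ℂ] A.Sec →ₗ[ℂ] A.Sec :=
  LinearMap.mk₂ ℂ
    (fun b ξ => ⟨fun g => A.mul (LCGroupoid.isMul_u_left rfl) (b.1 (G.r g)) (FellBundle.ev ξ g),
      isCont_mul (b.2.1.comp G.r.continuous) (FellBundle.isCont_ev ξ) _, by
      obtain ⟨K, hK, hK0⟩ := FellBundle.exists_compact_ev ξ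
      exact ⟨K, hK, fun g hg => by beta_reduce; rw [hK0 g hg, map_zero]; rfl⟩, fun _ => trivial⟩)
    (fun b c ξ => Subtype.ext (funext fun g => (congrFun (congrArg DFunLike.coe
      (map_add (A.mul (LCGroupoid.isMul_u_left rfl)) (b.1 (G.r g)) (c.1 (G.r g)))) (FellBundle.ev ξ g))))
    (fun t b ξ => Subtype.ext (funext fun g => (congrFun (congrArg DFunLike.coe
      (map_smul (A.mul (LCGroupoid.isMul_u_left rfl)) t (b.1 (G.r g)))) (FellBundle.ev ξ g))))
    (fun b ξ η => Subtype.ext (funext fun g => map_add (A.mul (LCGroupoid.isMul_u_left rfl)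
      (b.1 (G.r g))) (FellBundle.ev ξ g) (FellBundle.ev η g)))
    (fun t b ξ => Subtype.ext (funext fun g => map_smul (A.mul (LCGroupoid.isMul_u_left rfl)
      (b.1 (G.r g))) t (FellBundle.ev ξ g)))

theorem unitMul_mul (b c : (unitFam A).C0) (ξ : A.Sec) :
    unitMul (b * c) ξ = unitMul b (unitMul c ξ) := Subtype.ext (funext fun g =>
  A.mul_assoc (LCGroupoid.isMul_u _) _ _ (LCGroupoid.isMul_u_left rfl) (b.1 (G.r g)) (c.1 (G.r g))
    (FellBundle.ev ξ g))

theorem starMul_unitMul (b : (unitFam A).C0) (ξ η : A.Sec) :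
    starMul (unitMul b ξ) η = starMul ξ (unitMul (star b) η) := by
  refine Subtype.ext (funext fun z => ?_)
  have m : G.IsMul (G.inv (G.d2 z)) (G.u (G.r (G.d2 z))) (G.inv (G.d2 z)) :=
    LCGroupoid.isMul_u_right (G.s_inv _)
  have key : ∀ {x : G.Obj} (hx : G.r (G.d1 z) = x), A.mul (LCGroupoid.isMul_u_left rfl)
      (star (b.1 (G.r (G.d1 z)))) (FellBundle.ev η (G.d1 z))
      = A.mul (LCGroupoid.isMul_u_left hx) (star (b.1 x)) (FellBundle.ev η (G.d1 z)) := by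
    rintro _ rfl; rfl
  refine (congrArg (fun t => A.mul (isMul_inv_d2_d1 z) t (FellBundle.ev η (G.d1 z)))
    (A.adj_mul (LCGroupoid.isMul_u_left rfl) m (LCGroupoid.inv_u _) rfl rfl (b.1 (G.r (G.d2 z)))
      (FellBundle.ev ξ (G.d2 z)))).trans ?_
  refine (A.mul_assoc m _ (LCGroupoid.isMul_u_left (LCGroupoid.r_d1 z)) (isMul_inv_d2_d1 z) _ _ _).trans ?_
  exact congrArg (fun t => A.mul (isMul_inv_d2_d1 z) (A.adj rfl (FellBundle.ev ξ (G.d2 z))) t)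
    (key (LCGroupoid.r_d1 z)).symm

theorem conv_unitMul (b : (unitFam A).C0) (ξ η : A.Sec) :
    conv α (starSec (unitMul b ξ)) η = conv α (starSec ξ) (unitMul (star b) η) := by
  rw [← lam0_starMul, ← lam0_starMul, starMul_unitMul]

theorem FellBundle.norm_mul_sub_lt {g : G.Arr} {a f e : A.fib g} {b c : A.fib (G.u (G.r g))} {ε : ℝ}
    (hf : A.mul (LCGroupoid.isMul_u_left rfl) c e = f) (hfa : ‖f - a‖ < ε / 2)
    (hb : ‖b - c‖ < ε / 2 / (‖e‖ + 1)) :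
    ‖A.mul (LCGroupoid.isMul_u_left rfl) b e - a‖ < ε := by
  have h1 : A.mul (LCGroupoid.isMul_u_left rfl) b e - a
      = A.mul (LCGroupoid.isMul_u_left rfl) (b - c) e + (f - a) := by
    rw [← hf, map_sub, LinearMap.sub_apply]; abel
  have h2 : ‖A.mul (LCGroupoid.isMul_u_left rfl) (b - c) e‖ ≤ ε / 2 := by
    refine (A.norm_mul_le _ _ _).trans ?_
    rw [lt_div_iff₀ (by positivity)] at hb
    nlinarith [norm_nonneg (b - c), norm_nonneg e]
  rw [h1]
  exact (norm_add_le _ _).trans_lt (by linarith)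

theorem spanning_unitMul (α : HaarSystem G) : Spanning (A := A.toBanachBundle) (E := fun _ => ⊤)
    fun p : (unitFam A).C0 × A.Sec => unitMul p.1 p.2 where
  bumps g N hN := by
    obtain ⟨χ, h1, h2, h3, h4, -⟩ := exists_bump_nhds hN
    refine ⟨χ, h2, h3, h4, fun p => ⟨(p.1, ⟨fun g => (χ g : ℂ) • p.2.1 g,
      (p.2.2.1.smul (Complex.continuous_ofReal.comp h1)), by
        obtain ⟨K, hK, hK0⟩ := p.2.2.2.1
        exact ⟨K, hK, fun g hg => by beta_reduce; rw [hK0 g hg, smul_zero]⟩, fun _ => trivial⟩),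
      fun g => ?_⟩⟩
    exact map_smul (A.mul (LCGroupoid.isMul_u_left rfl) (p.1.1 (G.r g))) (χ g : ℂ) (p.2.1 g)
  dense := by
    intro g (a : A.fib g) _ ε hε
    obtain ⟨f, hf, -, hfa⟩ := hasSections_top (A := A.toBanachBundle) (ℓ := fun g => g) continuous_id g a trivial
      (ε / 2) (half_pos hε)
    obtain ⟨x, y, hxy, -⟩ := exists_pair_eq (α := α) (⟨f, hf.1, hf.2, fun _ => trivial⟩ : A.Sec)
    have hfg : A.mul (LCGroupoid.isMul_u_left rfl) (A.adj (G.inv_u _) (L2Data.ev x g))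
        (L2Data.ev y g) = f g := (mul_adj_congr _ _ _ _ _ _).trans (congrArg (fun ξ : A.Sec => ξ.1 g) hxy)
    set c : A.fib (G.u (G.r g)) := A.adj (G.inv_u _) (L2Data.ev x g)
    obtain ⟨b, hb, -, hbc⟩ := hasSections_top (A := A.toBanachBundle) G.u.continuous (G.r g) c trivial
      (ε / 2 / (‖L2Data.ev y g‖ + 1)) (by positivity)
    refine ⟨_, Submodule.subset_span ⟨(ofTop ⟨b, hb.1, hb.2, fun _ => trivial⟩, y), rfl⟩, ?_⟩
    exact norm_mul_sub_lt hfg hfa hbc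

namespace SecRep

variable {D F : Type u} [NonUnitalCStarAlgebra D] [NormedAddCommGroup F] [NormedSpace ℂ F]
  [HilbertModule D F] (S : SecRep A α D F)

theorem inn_L (ξ η : A.Sec) (v w : F) :
    (inn (S.L ξ v) (S.L η w) : D) = inn v (S.L (conv α (starSec ξ) η) w) := by
  rw [S.adj, S.map_conv]

theorem indCont (v : F) : IndCont fun ξ : A.Sec => S.L ξ v := indCont_of_bound S.bound v

theorem inn_L_right (ξ : A.Sec) (v w : F) : (inn w (S.L ξ v) : D) = inn (S.L (starSec ξ) w) v := by
  rw [← star_inn, S.adj, star_inn]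

theorem L_rsmul (ξ : A.Sec) (v : F) (d : D) : S.L ξ (rsmul v d) = rsmul (S.L ξ v) d := by
  refine HilbertModule.ext_inn (D := D) fun w => ?_
  rw [inn_rsmul_right, inn_L_right, inn_rsmul_right, inn_L_right]

/-- The map `ξ ⊗ v ↦ L(ξ) v`. -/
def algL : A.Sec ⊗[ℂ] F →ₗ[ℂ] F := TensorProduct.lift S.L

theorem algL_tmul (ξ : A.Sec) (v : F) : S.algL (ξ ⊗ₜ[ℂ] v) = S.L ξ v := TensorProduct.lift.tmul _ _

theorem exists_rsmul (t : A.Sec ⊗[ℂ] F) (d : D) :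
    ∃ t', ∀ w, (inn w (S.algL t') : D) = inn w (S.algL t) * d := by
  induction t with
  | zero => exact ⟨0, fun w => by rw [map_zero, inn_zero_right, zero_mul]⟩
  | tmul ξ v => exact ⟨ξ ⊗ₜ rsmul v d, fun w => by
      rw [algL_tmul, algL_tmul, L_rsmul, inn_rsmul_right]⟩
  | add s t hs ht =>
    obtain ⟨s', hs'⟩ := hs
    obtain ⟨t', ht'⟩ := ht
    exact ⟨s' + t', fun w => by
      rw [map_add, map_add, inn_add_right, inn_add_right, hs', ht', add_mul]⟩

/-- The semi-inner product on `C_c(G, A) ⊗ F`. -/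
@[reducible]
def preHilbert : PreHilbertModule D (A.Sec ⊗[ℂ] F) where
  inn s t := inn (S.algL s) (S.algL t)
  rsmul t d := (S.exists_rsmul t d).choose
  inn_add_right s t t' := by rw [map_add, inn_add_right]
  inn_smul_right c s t := by rw [map_smul, inn_smul_right]
  star_inn s t := star_inn _ _
  inn_rsmul_right s t d := (S.exists_rsmul t d).choose_spec _
  inn_self_pos t := inn_self_pos _

theorem exists_unitRep : ∃ φ : LeftAction (unitFam A).C0 D F,
    (∀ b ξ v, φ.act b (S.L ξ v) = S.L (unitMul b ξ) v) ∧ φ.IsNondegenerate := by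
  let _ := S.preHilbert
  let a : (unitFam A).C0 →ₗ[ℂ] (A.Sec ⊗[ℂ] F) →ₗ[ℂ] (A.Sec ⊗[ℂ] F) :=
    (LinearMap.rTensorHom F).comp unitMul
  have ha : ∀ b ξ v, a b (ξ ⊗ₜ v) = unitMul b ξ ⊗ₜ v := fun b ξ v => rfl
  let ψ : LeftAction (unitFam A).C0 D (A.Sec ⊗[ℂ] F) :=
    { act := a
      act_mul := fun b c t => by
        induction t with
        | zero => simp only [map_zero]
        | tmul ξ v => rw [ha, ha, ha, unitMul_mul]
        | add s t hs ht => rw [map_add, map_add, map_add, hs, ht]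
      adj := fun b s t => by
        induction s with
        | zero => simp only [map_zero, inn_zero_left]
        | add s s' hs hs' => rw [map_add, inn_add_left, inn_add_left, hs, hs']
        | tmul ξ v =>
          induction t with
          | zero => simp only [map_zero, inn_zero_right]
          | add t t' ht ht' => rw [map_add, inn_add_right, inn_add_right, ht, ht']
          | tmul η w =>
            rw [ha, ha]
            change (inn (S.algL (unitMul b ξ ⊗ₜ v)) (S.algL (η ⊗ₜ w)) : D)
              = inn (S.algL (ξ ⊗ₜ v)) (S.algL (unitMul (star b) η ⊗ₜ w))
            rw [algL_tmul, algL_tmul, algL_tmul, algL_tmul, inn_L, inn_L, conv_unitMul] }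
  have hd : DenseRange S.algL := by
    refine Dense.mono ?_ S.nondeg
    rw [← LinearMap.coe_range]
    refine Submodule.span_le.2 ?_
    rintro _ ⟨p, rfl⟩
    exact ⟨p.1 ⊗ₜ p.2, S.algL_tmul _ _⟩
  obtain ⟨φ, hφ⟩ := ψ.exists_transport S.algL (fun s t => rfl) hd
  have h1 : ∀ b ξ v, φ.act b (S.L ξ v) = S.L (unitMul b ξ) v := fun b ξ v => by
    rw [← algL_tmul, hφ, ← algL_tmul]; rfl
  refine ⟨φ, h1, φ.isNondegenerate_iff.2 (S.nondeg.of_forall_mem_closure fun p => ?_)⟩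
  refine IndCont.mem (Φ := S.L.flip p.2) (spanning_unitMul α) (S.indCont p.2)
    (S := (Submodule.span ℂ (Set.range fun p : (unitFam A).C0 × F =>
      φ.act p.1 p.2)).topologicalClosure) (Submodule.isClosed_topologicalClosure _) (fun i => ?_) p.1
  exact Submodule.le_topologicalClosure _ (Submodule.subset_span ⟨(i.1, S.L i.2 p.2), h1 _ _ _⟩)

end SecRep

end Disintegration

section Extension

namespace BanachBundle

variable {X : Type u} [TopologicalSpace X] {A : BanachBundle.{u} X} {Z : Type*} [TopologicalSpace Z]
  {ℓ : C(Z, X)} {E : ∀ z, Submodule ℂ (A.fib (ℓ z))}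

/-- The section `f` is supported in `K` and bounded by `B`. -/
def SuppLE (K : Set Z) (B : ℝ) (f : A.Cc ℓ E) : Prop := (∀ z ∉ K, f.1 z = 0) ∧ ∀ z, ‖f.1 z‖ ≤ B

namespace SuppLE

variable {K K' : Set Z} {B B' : ℝ} {f g : A.Cc ℓ E}

theorem add (hf : SuppLE K B f) (hg : SuppLE K' B' g) : SuppLE (K ∪ K') (B + B') (f + g) :=
  ⟨fun z hz => by
    change f.1 z + g.1 z = 0
    rw [hf.1 z fun h => hz (.inl h), hg.1 z fun h => hz (.inr h), add_zero],
    fun z => (norm_add_le _ _).trans (add_le_add (hf.2 z) (hg.2 z))⟩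

theorem smul (hf : SuppLE K B f) (c : ℂ) : SuppLE K (‖c‖ * B) (c • f) :=
  ⟨fun z hz => by
    change c • f.1 z = 0
    rw [hf.1 z hz, smul_zero],
    fun z => (norm_smul_le c (f.1 z)).trans (mul_le_mul_of_nonneg_left (hf.2 z) (norm_nonneg _))⟩

theorem neg (hf : SuppLE K B f) : SuppLE K B (-f) :=
  ⟨fun z hz => by
    change -f.1 z = 0
    rw [hf.1 z hz, neg_zero], fun z => (norm_neg (f.1 z)).trans_le (hf.2 z)⟩

theorem sub (hf : SuppLE K B f) (hg : SuppLE K' B' g) : SuppLE (K ∪ K') (B + B') (f - g) := by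
  rw [sub_eq_add_neg]; exact hf.add hg.neg

end SuppLE

variable {N : Type*} [NormedAddCommGroup N] [NormedSpace ℂ N] {V : Type*} [AddCommGroup V]
  [Module ℂ V]

/-- `t` is a limit of `q c` while `p c` approximates `f` in the inductive limit topology. -/
def LimRel (p : V →ₗ[ℂ] A.Cc ℓ E) (q : V →ₗ[ℂ] N) (K : Set Z) (f : A.Cc ℓ E) (t : N) : Prop :=
  ∀ ε > 0, ∃ c, SuppLE K ε (f - p c) ∧ ‖t - q c‖ ≤ ε

variable {p : V →ₗ[ℂ] A.Cc ℓ E} {q : V →ₗ[ℂ] N}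

theorem LimRel.norm_le {K K' : Set Z} {C B : ℝ} (hC : 0 ≤ C) {f : A.Cc ℓ E} {t : N}
    (h : LimRel p q K' f t) (hB : 0 ≤ B) (hf : SuppLE K B f)
    (hb : ∀ c B, 0 ≤ B → SuppLE (K ∪ K') B (p c) → ‖q c‖ ≤ C * B) : ‖t‖ ≤ C * B := by
  refine le_of_forall_pos_le_add fun ε hε => ?_
  obtain ⟨c, h1, h2⟩ := h (ε / (C + 1)) (by positivity)
  have h3 := hb c (B + ε / (C + 1)) (by positivity) (by have := hf.sub h1; rwa [sub_sub_cancel] at this)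
  calc ‖t‖ ≤ ‖q c‖ + ‖t - q c‖ := by
        have := norm_add_le (q c) (t - q c); rwa [add_sub_cancel] at this
    _ ≤ C * (B + ε / (C + 1)) + ε / (C + 1) := add_le_add h3 h2
    _ = C * B + ε := by field_simp; ring

theorem LimRel.add {K K' : Set Z} {f f' : A.Cc ℓ E} {t t' : N} (h : LimRel p q K f t)
    (h' : LimRel p q K' f' t') : LimRel p q (K ∪ K') (f + f') (t + t') := by
  intro ε hε
  obtain ⟨c, h1, h2⟩ := h (ε / 2) (half_pos hε)
  obtain ⟨c', h1', h2'⟩ := h' (ε / 2) (half_pos hε)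
  refine ⟨c + c', ?_, ?_⟩
  · have := h1.add h1'
    rwa [add_halves, sub_add_sub_comm, ← map_add] at this
  · rw [map_add, ← sub_add_sub_comm]
    exact (norm_add_le _ _).trans ((add_le_add h2 h2').trans_eq (add_halves ε))

theorem LimRel.smul {K : Set Z} {f : A.Cc ℓ E} {t : N} (h : LimRel p q K f t) (a : ℂ) :
    LimRel p q K (a • f) (a • t) := by
  intro ε hε
  obtain ⟨c, h1, h2⟩ := h (ε / (‖a‖ + 1)) (by positivity)
  have h3 : ‖a‖ * (ε / (‖a‖ + 1)) ≤ ε := by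
    rw [mul_div_assoc', div_le_iff₀ (by positivity)]; nlinarith [norm_nonneg a]
  refine ⟨a • c, ?_, ?_⟩
  · have e : a • f - p (a • c) = a • (f - p c) := by rw [map_smul]; exact (smul_sub a f (p c)).symm
    rw [e]
    exact ⟨(h1.smul a).1, fun z => ((h1.smul a).2 z).trans h3⟩
  · rw [map_smul, ← smul_sub]
    exact (norm_smul_le _ _).trans ((mul_le_mul_of_nonneg_left h2 (norm_nonneg _)).trans h3)

/-- Bounded linear maps on the span of a spanning family extend to all sections. -/
theorem Spanning.exists_extension [T2Space Z] [LocallyCompactSpace Z] [CompleteSpace N]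
    {ι : Type*} {s : ι → A.Cc ℓ E} (hs : Spanning s) (τ : ι → N)
    (hτ : ∀ K, IsCompact K → ∃ C : ℝ, 0 ≤ C ∧ ∀ (c : ι →₀ ℂ) (B : ℝ), 0 ≤ B →
      SuppLE K B (Finsupp.linearCombination ℂ s c) → ‖Finsupp.linearCombination ℂ τ c‖ ≤ C * B) :
    ∃ T : A.Cc ℓ E →ₗ[ℂ] N, IndCont T ∧ ∀ i, T (s i) = τ i := by
  set p := Finsupp.linearCombination ℂ s
  set q := Finsupp.linearCombination ℂ τ
  have huniq : ∀ {K K' f t t'}, IsCompact K → IsCompact K' → LimRel p q K f t →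
      LimRel p q K' f t' → t = t' := by
    intro K K' f t t' hK hK' h h'
    have h1 := h.add (h'.smul (-1))
    obtain ⟨C, hC, hb⟩ := hτ (∅ ∪ (K ∪ K')) (isCompact_empty.union (hK.union hK'))
    have h2 := h1.norm_le (K := ∅) (B := 0) hC le_rfl
      ⟨fun z _ => by change f.1 z + (-1 : ℂ) • f.1 z = 0; module,
        fun z => by change ‖f.1 z + (-1 : ℂ) • f.1 z‖ ≤ 0; rw [neg_one_smul, add_neg_cancel, norm_zero]⟩ hb
    rw [mul_zero, norm_le_zero_iff, neg_one_smul, ← sub_eq_add_neg, sub_eq_zero] at h2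
    exact h2
  have hex : ∀ K, IsCompact K → ∃ K', IsCompact K' ∧ ∀ f : A.Cc ℓ E, (∀ z ∉ K, f.1 z = 0) →
      ∃ t, LimRel p q K' f t := by
    intro K hK
    obtain ⟨K', hK', h⟩ := hs.exists_approx hK
    refine ⟨K', hK', fun f hf => ?_⟩
    have h1 : ∀ n : ℕ, ∃ c, SuppLE K' (1 / ((n : ℝ) + 1)) (f - p c) := fun n => by
      obtain ⟨g, hg, h2⟩ := h f hf (1 / ((n : ℝ) + 1)) (by positivity)
      rw [← Finsupp.range_linearCombination] at hg
      obtain ⟨c, rfl⟩ := hg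
      exact ⟨c, h2⟩
    choose c hc using h1
    obtain ⟨C, hC, hb⟩ := hτ (K' ∪ K') (hK'.union hK')
    have h0 : ∀ m n, ‖q (c n) - q (c m)‖ ≤ C * (1 / ((m : ℝ) + 1) + 1 / ((n : ℝ) + 1)) := fun m n => by
      rw [← map_sub]
      refine hb _ _ (by positivity) ?_
      have := (hc m).sub (hc n)
      rwa [sub_sub_sub_cancel_left, ← map_sub] at this
    have hlim : Tendsto (fun n : ℕ => 1 / ((n : ℝ) + 1)) atTop (𝓝 0) :=
      tendsto_one_div_add_atTop_nhds_zero_nat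
    have hcau : CauchySeq fun n => q (c n) := by
      refine cauchySeq_of_le_tendsto_0 (fun n : ℕ => C * (1 / ((n : ℝ) + 1) + 1 / ((n : ℝ) + 1)))
        (fun n m k hn hm => ?_) (by simpa using (hlim.add hlim).const_mul C)
      rw [dist_eq_norm]
      refine (h0 m n).trans (mul_le_mul_of_nonneg_left (add_le_add ?_ ?_) hC)
      · exact one_div_le_one_div_of_le (by positivity) (by gcongr)
      · exact one_div_le_one_div_of_le (by positivity) (by gcongr)
    obtain ⟨t, ht⟩ := cauchySeq_tendsto_of_complete hcau
    refine ⟨t, fun ε hε => ?_⟩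
    have h3 := (hlim.eventually_le_const hε).and
      ((tendsto_iff_norm_sub_tendsto_zero.1 ht).eventually_le_const hε)
    obtain ⟨n, h4, h5⟩ := h3.exists
    exact ⟨c n, ⟨(hc n).1, fun z => ((hc n).2 z).trans h4⟩, by rwa [norm_sub_rev]⟩
  have hex' : ∀ f : A.Cc ℓ E, ∃ (t : N) (K : Set Z), IsCompact K ∧ LimRel p q K f t := fun f => by
    obtain ⟨K, hK, hf⟩ := f.2.2.1
    obtain ⟨K', hK', h⟩ := hex K hK
    obtain ⟨t, ht⟩ := h f hf
    exact ⟨t, K', hK', ht⟩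
  choose T K hK hT using hex'
  refine ⟨⟨⟨T, fun f g => ?_⟩, fun a f => ?_⟩, fun K₀ hK₀ => ?_, fun i => ?_⟩
  · exact huniq (hK _) ((hK f).union (hK g)) (hT _) ((hT f).add (hT g))
  · exact huniq (hK _) (hK f) (hT _) ((hT f).smul a)
  · obtain ⟨K', hK', h⟩ := hex K₀ hK₀
    obtain ⟨C, hC, hb⟩ := hτ (K₀ ∪ K') (hK₀.union hK')
    refine ⟨C, hC, fun f B hB hf hfB => ?_⟩
    obtain ⟨t, ht⟩ := h f hf
    have : T f = t := huniq (hK f) hK' (hT f) ht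
    exact (congrArg norm this).trans_le (ht.norm_le hC hB ⟨hf, hfB⟩ hb)
  · refine huniq (hK _) isCompact_empty (hT _) fun ε hε => ⟨Finsupp.single i 1, ?_, ?_⟩
    · have : p (Finsupp.single i 1) = s i := by simp [p]
      rw [this, sub_self]
      exact ⟨fun _ _ => rfl, fun z => (norm_zero (E := A.fib (ℓ z))).trans_le hε.le⟩
    · have : q (Finsupp.single i 1) = τ i := by simp [q]
      rw [this, sub_self, norm_zero]; exact hε.le

end BanachBundle

variable {G : LCGroupoid.{u}} {A : FellBundle.{u} G}

open BanachBundle FellBundle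

/-- Products of sections are spanning. -/
theorem spanning_mul {Z : Type*} [TopologicalSpace Z] {a b : Z → G.Arr}
    (hab : Topology.IsInducing fun z => (a z, b z)) {ℓ : C(Z, G.Arr)} {ℓ₁ ℓ₂ : G.Arr → G.Arr}
    (m : ∀ z, G.IsMul (ℓ₁ (a z)) (ℓ₂ (b z)) (ℓ z)) {E : ∀ z, Submodule ℂ (A.fib (ℓ z))}
    {E₁ : ∀ g, Submodule ℂ (A.fib (ℓ₁ g))} {E₂ : ∀ g, Submodule ℂ (A.fib (ℓ₂ g))}
    (hE : ∀ z, E z ≤ A.prodSpan (m z) (E₁ (a z)) (E₂ (b z))) {ι₁ ι₂ : Type*}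
    {s₁ : ι₁ → ∀ g, A.fib (ℓ₁ g)} {s₂ : ι₂ → ∀ g, A.fib (ℓ₂ g)}
    (h₁ : ∀ i (χ : G.Arr → ℝ), Continuous χ → ∃ j, ∀ g, s₁ j g = (χ g : ℂ) • s₁ i g)
    (h₂ : ∀ i (χ : G.Arr → ℝ), Continuous χ → ∃ j, ∀ g, s₂ j g = (χ g : ℂ) • s₂ i g)
    (hd₁ : ∀ g, ∀ e ∈ E₁ g, ∀ ε > 0, ∃ i, ‖s₁ i g - e‖ < ε)
    (hd₂ : ∀ g, ∀ e ∈ E₂ g, ∀ ε > 0, ∃ i, ‖s₂ i g - e‖ < ε)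
    {s : ι₁ × ι₂ → A.toBanachBundle.Cc ℓ E}
    (hs : ∀ i z, (s i).1 z = A.mul (m z) (s₁ i.1 (a z)) (s₂ i.2 (b z))) : Spanning s where
  bumps z N hN := by
    obtain ⟨χ, ψ, h1, h2, h3, h4, h5⟩ := exists_bump_prod hab hN
    refine ⟨fun z => χ (a z) * ψ (b z), h3, h4, h5, fun i => ?_⟩
    obtain ⟨j, hj⟩ := h₁ i.1 χ h1
    obtain ⟨k, hk⟩ := h₂ i.2 ψ h2
    refine ⟨(j, k), fun y => ?_⟩
    rw [hs, hs, hj, hk, map_smul, map_smul, LinearMap.smul_apply, smul_smul, Complex.ofReal_mul]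
    congr 1
    exact _root_.mul_comm _ _
  dense z e he ε hε := by
    let V : Submodule ℂ (A.toBanachBundle.Cc ℓ E) := Submodule.span ℂ (Set.range s)
    let T : Submodule ℂ (A.fib (ℓ z)) := V.map (BanachBundle.evL z)
    have hT : A.prodSpan (m z) (E₁ (a z)) (E₂ (b z)) ≤ T.topologicalClosure := by
      refine prodSpan_le T.isClosed_topologicalClosure fun p hp q hq => ?_
      rw [← SetLike.mem_coe, Submodule.topologicalClosure_coe, Metric.mem_closure_iff]
      intro ε hε
      have hc : Continuous fun x : A.fib (ℓ₁ (a z)) × A.fib (ℓ₂ (b z)) => A.mul (m z) x.1 x.2 :=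
        (A.mulL (m z)).continuous₂
      obtain ⟨δ, hδ, hcδ⟩ := Metric.continuous_iff.1 hc (p, q) ε hε
      obtain ⟨i, hi⟩ := hd₁ (a z) p hp δ hδ
      obtain ⟨j, hj⟩ := hd₂ (b z) q hq δ hδ
      refine ⟨(s (i, j)).1 z, ⟨s (i, j), Submodule.subset_span ⟨(i, j), rfl⟩, rfl⟩, ?_⟩
      rw [dist_comm, hs]
      refine hcδ (s₁ i (a z), s₂ j (b z)) ?_
      rw [Prod.dist_eq, max_lt_iff, dist_eq_norm, dist_eq_norm]
      exact ⟨hi, hj⟩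
    have := hT (hE z he)
    rw [← SetLike.mem_coe, Submodule.topologicalClosure_coe, Metric.mem_closure_iff] at this
    obtain ⟨_, ⟨v, hv, rfl⟩, hva⟩ := this ε hε
    exact ⟨v, hv, by rwa [dist_comm, dist_eq_norm] at hva⟩

end Extension

section ExtensionToUnitary

theorem FibreProduct.exists_norm_sum_le {G : LCGroupoid.{u}} {A : FellBundle.{u} G} {Z W : Type u}
    [TopologicalSpace Z] [TopologicalSpace W] [T2Space W] {π : C(Z, W)} {v : C(G.Arr, G.Obj)}
    (P : FibreProduct π v) (ν : MeasFam G v) {K : Set Z} (hK : IsCompact K) :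
    ∃ C : ℝ, 0 ≤ C ∧ ∀ {ι : Type*} (s : Finset ι) {ℓ : C(W, G.Arr)} (w : W) {k : G.Arr}
      (T : ι → A.fib (ℓ w) →L[ℝ] A.fib k) (f : ι → A.CcTop (ℓ.comp π)) (B : ℝ), 0 ≤ B →
      (∀ z (hz : π z = w), z ∉ K → ∑ i ∈ s, T i (A.cast (congrArg ℓ hz) ((f i).1 z)) = 0) →
      (∀ z (hz : π z = w), ‖∑ i ∈ s, T i (A.cast (congrArg ℓ hz) ((f i).1 z))‖ ≤ B) →
      ‖∑ i ∈ s, T i (((P.integralOp ν).int ℓ (f i)).1 w)‖ ≤ C * B := by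
  have hM := hK.image P.b.continuous
  obtain ⟨C, hC, h⟩ := ν.exists_bound hM
  refine ⟨C, hC, fun s ℓ w k T f B hB h0 h1 => ?_⟩
  have hi : ∀ i, T i (((P.integralOp ν).int ℓ (f i)).1 w) = ∫ g, T i (P.ext (f i).1 w g) ∂ν.m (P.c w) :=
    fun i => ((T i).integral_comp_comm (P.integrable_ext ν (f i) w)).symm
  rw [Finset.sum_congr rfl fun i _ => hi i, ← integral_finsetSum _ fun i _ =>
    (T i).integrable_comp (P.integrable_ext ν (f i) w)]
  have key : ∀ g, (g ∉ P.b '' K → ∑ i ∈ s, T i (P.ext (f i).1 w g) = 0) ∧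
      ‖∑ i ∈ s, T i (P.ext (f i).1 w g)‖ ≤ B := fun g => by
    by_cases hg : v g = P.c w
    · obtain ⟨z, rfl, rfl⟩ := P.surj w g hg
      have e : ∀ i, P.ext (f i).1 (π z) (P.b z) = (f i).1 z := fun i => P.ext_apply _ _
      simp only [e]
      exact ⟨fun hz => h0 z rfl fun hzK => hz ⟨z, hzK, rfl⟩, h1 z rfl⟩
    · have e : ∀ i, P.ext (f i).1 w g = 0 := fun i => P.ext_of_ne _ _ _ hg
      simp only [e, map_zero, Finset.sum_const_zero, norm_zero]
      exact ⟨fun _ => trivial, hB⟩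
  rw [← setIntegral_eq_integral_of_forall_compl_eq_zero fun g hg => (key g).1 hg, mul_comm]
  refine (norm_setIntegral_le_of_norm_le_const hM.measure_lt_top fun g _ => (key g).2).trans ?_
  exact mul_le_mul_of_nonneg_left (h _) hB

variable {G : LCGroupoid.{u}} {A : FellBundle.{u} G} {α : HaarSystem G}

open BanachBundle FellBundle L2Data

section AdjMul

variable {Z : Type u} [TopologicalSpace Z] {p q ℓ : C(Z, G.Arr)} {E : ∀ z, Submodule ℂ (A.fib (q z))}

/-- The map `Ω ↦ x^* Ω`. -/
def adjMul (m : ∀ z, G.IsMul (G.inv (p z)) (q z) (ℓ z)) (x : ∀ z, A.fib (p z)) (hx : A.IsCont p x) :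
    A.Cc q E →ₗ[ℂ] A.CcTop ℓ where
  toFun f := ⟨fun z => A.mul (m z) (A.adj rfl (x z)) (f.1 z),
    isCont_mul (isCont_adj hx _) f.2.1 _, by
      obtain ⟨K, hK, hK0⟩ := f.2.2.1
      exact ⟨K, hK, fun z hz => by beta_reduce; rw [hK0 z hz, map_zero]⟩, fun _ => trivial⟩
  map_add' f f' := Subtype.ext (funext fun z => map_add (A.mul (m z) (A.adj rfl (x z))) (f.1 z) (f'.1 z))
  map_smul' c f := Subtype.ext (funext fun z => map_smul (A.mul (m z) (A.adj rfl (x z))) c (f.1 z))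

theorem adjMul_apply (m : ∀ z, G.IsMul (G.inv (p z)) (q z) (ℓ z)) (x : ∀ z, A.fib (p z))
    (hx : A.IsCont p x) (f : A.Cc q E) (z : Z) :
    (adjMul m x hx f).1 z = A.mul (m z) (A.adj rfl (x z)) (f.1 z) := rfl

theorem indCont_adjMul (m : ∀ z, G.IsMul (G.inv (p z)) (q z) (ℓ z)) {x : ∀ z, A.fib (p z)}
    (hx : A.IsCont p x) {b : ℝ} (hb : 0 ≤ b) (hxb : ∀ z, ‖x z‖ ≤ b) {N : Type*}
    [NormedAddCommGroup N] {Φ : A.CcTop ℓ → N} (hΦ : IndCont Φ) :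
    IndCont fun f : A.Cc q E => Φ (adjMul m x hx f) := by
  intro K hK
  obtain ⟨C, hC, h⟩ := hΦ K hK
  refine ⟨C * b, by positivity, fun y B hB hy hyB => ?_⟩
  rw [_root_.mul_assoc]
  refine h _ (b * B) (by positivity) (fun z hz => ?_) fun z => ?_
  · rw [adjMul_apply, hy z hz, map_zero]
  · rw [adjMul_apply]
    refine (A.norm_mul_le _ _ _).trans ?_
    rw [A.norm_adj]
    exact mul_le_mul (hxb z) (hyB z) (norm_nonneg _) hb

end AdjMul

variable (A) in
/-- The family with fibres `A_g A_h`. -/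
def mulFam (z : G.Sq) : Submodule ℂ (A.fib (G.d1 z)) := A.prodSpan (LCGroupoid.isMul_sq z) ⊤ ⊤

theorem isMul_Xr_d1 (z : G.Sq) : G.IsMul (G.inv (G.u (G.r (G.d2 z)))) (G.d1 z) (G.d1 z) := by
  rw [G.inv_u]; exact isMul_u_d1 z

theorem FellBundle.rangeIdeal_mul_mem (z : G.Sq) {a : A.fib (G.u (G.r (G.d2 z)))}
    (ha : a ∈ A.rangeIdeal (G.d2 z) rfl) (b : A.fib (G.d1 z)) :
    A.mul (isMul_u_d1 z) a b ∈ mulFam A z := by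
  refine mul_right_mem (isClosed_prodSpan _ _ _) _ _ ha b fun c _ d _ => ?_
  rw [A.mul_assoc _ _ (isMul_inv_d2_d1 z) (LCGroupoid.isMul_sq z)]
  exact mul_mem_prodSpan _ trivial trivial

/-- The section `(g, h) ↦ x(g) η(g h)`. -/
def rangeMul (x : (Xr A α).Sec) (η : A.Sec) : A.Cc G.d1 (mulFam A) :=
  ⟨fun z => A.mul (isMul_u_d1 z) (L2Data.ev x (G.d2 z)) (FellBundle.ev η (G.d1 z)),
    isCont_mul ((L2Data.isCont_ev x).comp G.d2.continuous)
      ((FellBundle.isCont_ev η).comp G.d1.continuous) _, by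
      obtain ⟨K, hK, hK0⟩ := L2Data.exists_compact_ev x
      obtain ⟨K', hK', hK0'⟩ := FellBundle.exists_compact_ev η
      refine ⟨_, isCompact_sq' hK hK', fun z hz => ?_⟩
      by_cases h : G.d2 z ∈ K
      · beta_reduce
        rw [hK0' _ fun h' => hz ⟨h, h'⟩, map_zero]
      · exact mul_eq_zero_left (hK0 _ h),
    fun z => rangeIdeal_mul_mem z (L2Data.ev_mem x (G.d2 z)) _⟩

/-- The section `(g, h) ↦ y(g) η(h)`. -/
def sqMul (y : (Xs A α).Sec) (η : A.Sec) : A.Cc G.d1 (mulFam A) :=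
  ⟨fun z => A.mul (LCGroupoid.isMul_sq z) (L2Data.ev y (G.d2 z)) (FellBundle.ev η (G.d0 z)),
    isCont_mul ((L2Data.isCont_ev y).comp G.d2.continuous)
      ((FellBundle.isCont_ev η).comp G.d0.continuous) _, by
      obtain ⟨K, hK, hK0⟩ := L2Data.exists_compact_ev y
      obtain ⟨K', hK', hK0'⟩ := FellBundle.exists_compact_ev η
      refine ⟨_, isCompact_sq hK hK', fun z hz => ?_⟩
      by_cases h : G.d2 z ∈ K
      · beta_reduce
        rw [hK0' _ fun h' => hz ⟨h, h'⟩, map_zero]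
      · exact mul_eq_zero_left (hK0 _ h),
    fun z => mul_mem_prodSpan _ trivial trivial⟩

theorem isInducing_d2_d1 : Topology.IsInducing fun z : G.Sq => (G.d2 z, G.d1 z) := by
  let e : G.Sq ≃ₜ G.Sq := ⟨⟨sqFlip, sqFlip, sqFlip_sqFlip, sqFlip_sqFlip⟩, sqFlip.continuous, sqFlip.continuous⟩
  have h := ((G.invHomeo.prodCongr (Homeomorph.refl G.Arr)).isInducing.comp
    Topology.IsInducing.subtypeVal).comp e.isInducing
  refine (congrArg Topology.IsInducing (funext fun z => ?_)).mp h
  exact Prod.ext (LCGroupoid.inv_inv _) rfl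

theorem exists_cutoff_ev (η : A.Sec) (χ : G.Arr → ℝ) (hχ : Continuous χ) :
    ∃ η' : A.Sec, ∀ g, FellBundle.ev η' g = (χ g : ℂ) • FellBundle.ev η g :=
  ⟨⟨fun g => (χ g : ℂ) • η.1 g, (η.2.1.smul (Complex.continuous_ofReal.comp hχ)), by
    obtain ⟨K, hK, hK0⟩ := η.2.2.1
    exact ⟨K, hK, fun g hg => by beta_reduce; rw [hK0 g hg, smul_zero]⟩, fun _ => trivial⟩, fun _ => rfl⟩

theorem exists_ev_near (g : G.Arr) (a : A.fib g) {ε : ℝ} (hε : 0 < ε) :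
    ∃ η : A.Sec, ‖FellBundle.ev η g - a‖ < ε := by
  obtain ⟨f, hf, -, hfa⟩ := hasSections_top (A := A.toBanachBundle) (ℓ := fun g => g) continuous_id g a
    trivial ε hε
  exact ⟨⟨f, hf.1, hf.2, fun _ => trivial⟩, hfa⟩

theorem FellBundle.top_le_prodSpan_rangeIdeal (α : HaarSystem G) (g : G.Arr) :
    ⊤ ≤ A.prodSpan (LCGroupoid.isMul_u_left (rfl : G.r g = G.r g)) (A.rangeIdeal g rfl) ⊤ := by
  intro a _
  refine (isClosed_prodSpan _ _ _).closure_subset (Metric.mem_closure_iff.2 fun ε hε => ?_)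
  obtain ⟨η, hη⟩ := exists_ev_near g a hε
  obtain ⟨x, y, hxy, -⟩ := exists_pair_eq (α := α) η
  refine ⟨_, ?_, by rwa [dist_comm, dist_eq_norm]⟩
  rw [← hxy]
  have : (pairS x y).1 g = A.mul (LCGroupoid.isMul_u_left rfl) (A.adj (G.inv_u _) (L2Data.ev x g))
      (L2Data.ev y g) := (mul_adj_congr _ _ _ _ _ _).symm
  exact (congrArg (· ∈ A.prodSpan _ _ _) this).mpr
    (mul_mem_prodSpan _ (rangeIdeal_star rfl (L2Data.ev_mem x g)) trivial)

theorem mulFam_le (α : HaarSystem G) (z : G.Sq) :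
    mulFam A z ≤ A.prodSpan (isMul_u_d1 z) (A.rangeIdeal (G.d2 z) rfl) ⊤ := by
  refine prodSpan_le (isClosed_prodSpan _ _ _) fun a _ b _ => ?_
  exact prodSpan_mul _ (LCGroupoid.isMul_sq z) (LCGroupoid.isMul_sq z) _
    (top_le_prodSpan_rangeIdeal α (G.d2 z) trivial) b fun _ _ => trivial

theorem spanning_rangeMul : Spanning (A := A.toBanachBundle) (E := mulFam A)
    fun p : (Xr A α).Sec × A.Sec => rangeMul p.1 p.2 :=
  spanning_mul isInducing_d2_d1 (ℓ₁ := fun g => G.u (G.r g)) (ℓ₂ := fun g => g) isMul_u_d1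
    (E₁ := fun g => A.rangeIdeal g rfl) (E₂ := fun _ => ⊤) (mulFam_le α)
    (s₁ := fun (x : (Xr A α).Sec) g => L2Data.ev x g) (s₂ := fun (η : A.Sec) g => FellBundle.ev η g)
    (fun x χ hχ => ⟨cutoff ⟨χ, hχ⟩ x, fun _ => rfl⟩) exists_cutoff_ev
    (fun g _ he _ hε => exists_sec_near (X := Xr A α)
      (hasSections_rangeIdeal A continuous_id G.r.continuous fun _ => rfl) g he hε)
    (fun g e _ _ hε => exists_ev_near g e hε) fun _ _ => rfl

theorem spanning_sqMul : Spanning (A := A.toBanachBundle) (E := mulFam A)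
    fun p : (Xs A α).Sec × A.Sec => sqMul p.1 p.2 :=
  spanning_mul (a := G.d2) (b := G.d0) Topology.IsInducing.subtypeVal (ℓ₁ := fun g => g) (ℓ₂ := fun g => g)
    LCGroupoid.isMul_sq
    (E₁ := fun _ => ⊤) (E₂ := fun _ => ⊤) (fun _ => le_rfl)
    (s₁ := fun (x : (Xs A α).Sec) g => L2Data.ev x g) (s₂ := fun (η : A.Sec) g => FellBundle.ev η g)
    (fun x χ hχ => ⟨cutoff ⟨χ, hχ⟩ x, fun _ => rfl⟩) exists_cutoff_ev
    (fun g e _ _ hε => exists_ev_near g e hε)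
    (fun g e _ _ hε => exists_ev_near g e hε) fun _ _ => rfl

end ExtensionToUnitary

section SliceMaps

variable {G : LCGroupoid.{u}} {A : FellBundle.{u} G} {α : HaarSystem G}

open BanachBundle FellBundle L2Data

theorem integral_clm_intS {ℓ₀ : C(G.Obj, G.Arr)} (f : A.CcTop (ℓ₀.comp G.s)) (x : G.Obj)
    {k : G.Arr} (T : A.fib (ℓ₀ x) →L[ℝ] A.fib k) :
    ∫ l : {g | G.r g = x}, T (A.cast (congrArg ℓ₀ ((G.s_inv _).trans l.2)) (f.1 (G.inv l.1))) ∂α.fib x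
      = T (((intS A α).int ℓ₀ f).1 x) := by
  let F : {g | G.r g = x} → A.fib (ℓ₀ x) := fun l =>
    A.cast (congrArg ℓ₀ ((G.s_inv _).trans l.2)) (f.1 (G.inv l.1))
  have hi : Continuous fun l : {g | G.r g = x} => G.inv l.1 := G.inv.continuous.comp continuous_subtype_val
  have hF : Continuous F := by
    refine BanachBundle.IsCont.continuous (A := A.toBanachBundle) (x := ℓ₀ x) ?_
    have h1 : A.IsCont (fun l : {g | G.r g = x} => ℓ₀ (G.s (G.inv l.1))) (fun l => f.1 (G.inv l.1)) :=
      f.2.1.comp hi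
    have h2 : (fun l : {g | G.r g = x} => (⟨ℓ₀ x, F l⟩ : Tot A.fib))
        = fun l => ⟨ℓ₀ (G.s (G.inv l.1)), f.1 (G.inv l.1)⟩ := funext fun l => A.mk_cast _ _
    rw [BanachBundle.IsCont, h2]; exact h1
  have hFs : HasCompactSupport F := by
    obtain ⟨K, hK, hfK⟩ := f.2.2.1
    refine HasCompactSupport.intro ((MeasFam.isClosed_fibre G.r x).isClosedEmbedding_subtypeVal
      |>.isCompact_preimage (hK.image G.inv.continuous)) fun l hl => ?_
    change A.cast _ (f.1 (G.inv l.1)) = 0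
    rw [hfK (G.inv l.1) fun h => hl ⟨_, h, LCGroupoid.inv_inv _⟩]; exact map_zero _
  have h1 : ((intS A α).int ℓ₀ f).1 x = ∫ l, F l ∂α.fib x :=
    Tot.vec_eq (intS_mk α f rfl F fun g hg l hl => by subst hl; exact (A.mk_cast _ _).symm)
  rw [h1, ← ContinuousLinearMap.integral_comp_comm _ (hF.integrable_of_hasCompactSupport hFs)]

theorem lam0_pull {ℓ₀ : C(G.Obj, G.Arr)} {ℓ : C(G.Arr, G.Arr)} (f : A.CcTop (ℓ₀.comp G.s))
    (f' : A.CcTop (ℓ.comp G.d0)) (k : G.Arr) (T : A.fib (ℓ₀ (G.r k)) →L[ℝ] A.fib (ℓ k))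
    (h : ∀ z (hz : G.d0 z = k), (⟨ℓ (G.d0 z), f'.1 z⟩ : Tot A.fib) = ⟨ℓ k, T (A.cast
      (congrArg ℓ₀ ((LCGroupoid.s_d2 z).trans (congrArg G.r hz))) (f.1 (G.d2 z)))⟩) :
    ((lam0 A α).int ℓ f').1 k = T (((intS A α).int ℓ₀ f).1 (G.r k)) := by
  rw [← integral_clm_intS]
  refine Tot.vec_eq (lam0_mk α f' rfl rfl _ fun z hz l hl => ?_)
  rw [h z hz]
  have key : ∀ (g : G.Arr) (e : g = G.d2 z) (h1 : ℓ₀ (G.s g) = ℓ₀ (G.r k))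
      (h2 : ℓ₀ (G.s (G.d2 z)) = ℓ₀ (G.r k)), A.cast h2 (f.1 (G.d2 z)) = A.cast h1 (f.1 g) := by
    rintro _ rfl _ _; rfl
  exact congrArg (fun t => (⟨ℓ k, T t⟩ : Tot A.fib)) (key _ hl _ _)

/-- The section `k ↦ ∫ x(g)^* Ω(g, g⁻¹k) dα(g)`. -/
def rangeSlice (x : (Xr A α).Sec) : A.Cc G.d1 (mulFam A) →ₗ[ℂ] A.Sec :=
  (lam1 A α).int (.id G.Arr) ∘ₗ adjMul (p := G.u.comp (G.r.comp G.d2)) (ℓ := (ContinuousMap.id G.Arr).comp G.d1)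
    isMul_Xr_d1 (fun z => L2Data.ev x (G.d2 z)) ((L2Data.isCont_ev x).comp G.d2.continuous)

/-- The section `h ↦ ∫ y(g)^* Ω(g, h) dα̃(g)`. -/
def sourceSlice (y : (Xs A α).Sec) : A.Cc G.d1 (mulFam A) →ₗ[ℂ] A.Sec :=
  (lam0 A α).int (.id G.Arr) ∘ₗ adjMul (p := G.d2) (ℓ := (ContinuousMap.id G.Arr).comp G.d0)
    isMul_inv_d2_d1 (fun z => L2Data.ev y (G.d2 z)) ((L2Data.isCont_ev y).comp G.d2.continuous)

theorem indCont_rangeSlice (x : (Xr A α).Sec) {N : Type*} [NormedAddCommGroup N] {Φ : A.Sec → N}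
    (hΦ : IndCont Φ) : IndCont fun Ω => Φ (rangeSlice x Ω) := by
  obtain ⟨b, hb, hx⟩ := exists_bound_ev x
  exact indCont_adjMul _ _ hb (fun z => hx (G.d2 z)) ((isBdd_lam1 A α).indCont hΦ)

theorem indCont_sourceSlice (y : (Xs A α).Sec) {N : Type*} [NormedAddCommGroup N] {Φ : A.Sec → N}
    (hΦ : IndCont Φ) : IndCont fun Ω => Φ (sourceSlice y Ω) := by
  obtain ⟨b, hb, hy⟩ := exists_bound_ev y
  exact indCont_adjMul _ _ hb (fun z => hy (G.d2 z)) ((isBdd_lam0 A α).indCont hΦ)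

theorem rangeSlice_rangeMul (x x' : (Xr A α).Sec) (η : A.Sec) :
    rangeSlice x (rangeMul x' η) = unitMul (inn x x') η := by
  refine Subtype.ext (funext fun k => ?_)
  refine lam1_pull (ℓ₀ := (unitFam A).label) (ℓ := .id G.Arr) (ptInn x x') _ k
    (((A.mulL (LCGroupoid.isMul_u_left rfl)).flip (FellBundle.ev η k)).restrictScalars ℝ) ?_
  rintro z rfl
  refine congrArg (fun t => (⟨_, t⟩ : Tot A.fib)) ?_
  refine Eq.trans ?_ (cast_mul _ (LCGroupoid.isMul_u_left rfl) (isMul_u_d1 z) _ _).symm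
  exact (A.mul_assoc (LCGroupoid.isMul_inv_self (G.s_u _)) _ _ _ _ _ _).symm

theorem rangeSlice_sqMul (x : (Xr A α).Sec) (y : (Xs A α).Sec) (η : A.Sec) :
    rangeSlice x (sqMul y η) = conv α (pairS x y) η := by
  refine congrArg ((lam1 A α).int (.id G.Arr)) (Subtype.ext (funext fun z => ?_))
  exact (A.mul_assoc _ _ _ _ _ _ _).symm

theorem sourceSlice_rangeMul (y : (Xs A α).Sec) (x : (Xr A α).Sec) (η : A.Sec) :
    sourceSlice y (rangeMul x η) = conv α (starSec (pairS x y)) η := by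
  rw [← lam0_starMul]
  refine congrArg ((lam0 A α).int (.id G.Arr)) (Subtype.ext (funext fun z => ?_))
  refine (A.mul_assoc (LCGroupoid.isMul_u_right (G.s_inv _)) (isMul_inv_d2_d1 z) _ _ _ _ _).symm.trans ?_
  refine congrArg (fun t => A.mul (isMul_inv_d2_d1 z) t (FellBundle.ev η (G.d1 z))) ?_
  refine Eq.symm ((A.adj_mul _ (LCGroupoid.isMul_u_right (G.s_inv _)) (LCGroupoid.inv_inv _) rfl rfl _ _).trans ?_)
  exact congrArg (A.mul _ _) (A.adj_adj _ _ _)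

theorem sourceSlice_sqMul (y y' : (Xs A α).Sec) (η : A.Sec) :
    sourceSlice y (sqMul y' η) = unitMul (inn y y') η := by
  refine Subtype.ext (funext fun k => ?_)
  refine lam0_pull (ℓ₀ := (unitFam A).label) (ℓ := .id G.Arr) (ptInn y y') _ k
    (((A.mulL (LCGroupoid.isMul_u_left rfl)).flip (FellBundle.ev η k)).restrictScalars ℝ) ?_
  rintro z rfl
  refine congrArg (fun t => (⟨_, t⟩ : Tot A.fib)) ?_
  refine Eq.trans ?_ (cast_mul _ (LCGroupoid.isMul_u_left rfl)
    (LCGroupoid.isMul_u_left (LCGroupoid.s_d2 z).symm) _ _).symm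
  exact (A.mul_assoc (LCGroupoid.isMul_inv_self rfl) _ _ _ _ _ _).symm

theorem exists_sq {g k : G.Arr} (h : G.r g = G.r k) : ∃ z : G.Sq, G.d2 z = g ∧ G.d1 z = k :=
  ⟨sqFlip ⟨(G.inv g, k), by rw [G.s_inv, h]⟩, LCGroupoid.inv_inv g,
    (LCGroupoid.isMul_sq _).inv_mul_left.2⟩

theorem mul_adj_rangeSlice {z z' : G.Sq} {g k n : G.Arr} (hg : G.d1 z = g) (hk : G.d1 z' = k)
    (hd : G.d2 z = G.d2 z') (m : G.IsMul (G.inv g) k n) (x : (Xr A α).Sec) (η : A.Sec)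
    (b : A.fib (G.d1 z')) : A.mul m (A.adj rfl (FellBundle.ev η g)) (A.cast hk
      (A.mul (isMul_Xr_d1 z') (A.adj rfl (L2Data.ev x (G.d2 z'))) b))
      = A.mul m (A.adj rfl (A.cast hg ((rangeMul x η).1 z))) (A.cast hk b) := by
  subst hg hk
  have key : ∀ (g : G.Arr) (_ : g = G.d2 z') (m1 : G.IsMul (G.u (G.r g)) (G.d1 z) (G.d1 z)),
      A.mul m (A.adj rfl (FellBundle.ev η (G.d1 z)))
        (A.mul (isMul_Xr_d1 z') (A.adj rfl (L2Data.ev x (G.d2 z'))) b)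
      = A.mul m (A.adj rfl (A.mul m1 (L2Data.ev x g) (FellBundle.ev η (G.d1 z)))) b := by
    rintro _ rfl m1
    exact (A.mul_assoc _ _ _ _ _ _ _).symm.trans
      (congrArg (fun t => A.mul m t b) (A.adj_mul m1 m1.inv rfl rfl rfl _ _).symm)
  exact key _ hd (isMul_u_d1 z)

theorem exists_norm_sum_lam1_le (α : HaarSystem G) {K : Set G.Sq} (hK : IsCompact K) :
    ∃ C : ℝ, 0 ≤ C ∧ ∀ {ι : Type u} (s : Finset ι) {ℓ : C(G.Arr, G.Arr)} (w : G.Arr) {k : G.Arr}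
      (T : ι → A.fib (ℓ w) →L[ℝ] A.fib k) (f : ι → A.CcTop (ℓ.comp G.d1)) (B : ℝ), 0 ≤ B →
      (∀ z (hz : G.d1 z = w), z ∉ K → ∑ i ∈ s, T i (A.cast (congrArg ℓ hz) ((f i).1 z)) = 0) →
      (∀ z (hz : G.d1 z = w), ‖∑ i ∈ s, T i (A.cast (congrArg ℓ hz) ((f i).1 z))‖ ≤ B) →
      ‖∑ i ∈ s, T i (((lam1 A α).int ℓ (f i)).1 w)‖ ≤ C * B :=
  FibreProduct.exists_norm_sum_le _ α.toMeasFam hK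

/-- Bounds for the section whose integral gives the inner product of a sum of elementary tensors
with itself. -/
theorem exists_sum_starMul_bound (α : HaarSystem G) {K : Set G.Sq} (hK : IsCompact K) : ∃ C : ℝ, 0 ≤ C ∧
    ∀ {ι : Type u} (s : Finset ι) (c : ι → ℂ) (x : ι → (Xr A α).Sec) (η : ι → A.Sec)
      (Ω : A.Cc G.d1 (mulFam A)) (B : ℝ), 0 ≤ B →
      (∀ z, Ω.1 z = ∑ i ∈ s, c i • (rangeMul (x i) (η i)).1 z) →
      SuppLE (A := A.toBanachBundle) K B Ω →
      ∀ z, ‖∑ i ∈ s, star (c i) • (starMul (η i) (rangeSlice (x i) Ω)).1 z‖ ≤ C * (B * B) ∧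
        (z ∉ {z | G.d2 z ∈ G.d1 '' K ∧ G.d1 z ∈ G.d1 '' K} →
          ∑ i ∈ s, star (c i) • (starMul (η i) (rangeSlice (x i) Ω)).1 z = 0) := by
  obtain ⟨C, hC, h⟩ := exists_norm_sum_lam1_le (A := A) α hK
  refine ⟨C, hC, fun s c x η Ω B hB hΩ hΩK z => ?_⟩
  let m := isMul_inv_d2_d1 z
  let T : _ → A.fib (G.d1 z) →L[ℝ] A.fib (G.d0 z) := fun i =>
    (A.mulL m (star (c i) • A.adj rfl (FellBundle.ev (η i) (G.d2 z)))).restrictScalars ℝ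
  have hT : ∀ i (a : A.fib (G.d1 z)), T i a
      = star (c i) • A.mul m (A.adj rfl (FellBundle.ev (η i) (G.d2 z))) a := fun i a => by
    change A.mul m (star (c i) • A.adj rfl (FellBundle.ev (η i) (G.d2 z))) a = _
    rw [map_smul, LinearMap.smul_apply]
  have key : ∀ z' (hz : G.d1 z' = G.d1 z), ∃ z'' : G.Sq, ∃ hz'' : G.d1 z'' = G.d2 z,
      ∑ i ∈ s, T i (A.cast hz (A.mul (isMul_Xr_d1 z') (A.adj rfl (L2Data.ev (x i) (G.d2 z'))) (Ω.1 z')))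
        = A.mul m (A.adj rfl (A.cast hz'' (Ω.1 z''))) (A.cast hz (Ω.1 z')) := by
    intro z' hz
    obtain ⟨z'', h1, h2⟩ := exists_sq (g := G.d2 z') (k := G.d2 z)
      (by rw [← LCGroupoid.r_d1, hz, LCGroupoid.r_d1])
    refine ⟨z'', h2, ?_⟩
    rw [hΩ z'', Finset.sum_congr rfl fun i _ => (hT i _).trans
      (congrArg (star (c i) • ·) (mul_adj_rangeSlice h2 hz h1 m (x i) (η i) (Ω.1 z')))]
    simp only [map_sum, map_smul, map_smulₛₗ, LinearMap.sum_apply, LinearMap.smul_apply]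
    rfl
  have h' : ∀ B', 0 ≤ B' → (∀ (z' z'' : G.Sq) (hz : G.d1 z' = G.d1 z) (hz'' : G.d1 z'' = G.d2 z),
      ‖A.mul m (A.adj rfl (A.cast hz'' (Ω.1 z''))) (A.cast hz (Ω.1 z'))‖ ≤ B') →
      ‖∑ i ∈ s, star (c i) • (starMul (η i) (rangeSlice (x i) Ω)).1 z‖ ≤ C * B' := by
    intro B' hB' hb
    refine (congrArg norm (Finset.sum_congr rfl fun i _ => (hT i _).symm)).trans_le ?_
    refine h s (ℓ := .id G.Arr) (G.d1 z) T (fun i => adjMul (p := G.u.comp (G.r.comp G.d2))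
      (ℓ := (ContinuousMap.id G.Arr).comp G.d1) isMul_Xr_d1 (fun z => L2Data.ev (x i) (G.d2 z))
      ((L2Data.isCont_ev (x i)).comp G.d2.continuous) Ω) B' hB' (fun z' hz hzK => ?_) fun z' hz => ?_
    · obtain ⟨z'', hz'', e⟩ := key z' hz
      refine e.trans ?_
      rw [hΩK.1 z' hzK, map_zero, map_zero]
    · obtain ⟨z'', hz'', e⟩ := key z' hz
      exact (congrArg norm e).trans_le (hb z' z'' hz hz'')
  refine ⟨h' (B * B) (by positivity) fun z' z'' hz hz'' => ?_, fun hz => ?_⟩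
  · refine (A.norm_mul_le _ _ _).trans ?_
    rw [A.norm_adj, LinearIsometryEquiv.norm_map, LinearIsometryEquiv.norm_map]
    exact mul_le_mul (hΩK.2 _) (hΩK.2 _) (norm_nonneg _) hB
  · rw [← norm_le_zero_iff, ← mul_zero C]
    refine h' 0 le_rfl fun z' z'' hz' hz'' => ?_
    by_cases h1 : z'' ∈ K
    · have h2 : z' ∉ K := fun h2 => hz ⟨⟨z'', h1, hz''⟩, z', h2, hz'⟩
      rw [hΩK.1 z' h2, map_zero, map_zero, norm_zero]
    · rw [hΩK.1 z'' h1, map_zero, map_zero, map_zero, LinearMap.zero_apply, norm_zero]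

end SliceMaps

section UnitaryOfSecRep

variable {G : LCGroupoid.{u}} {A : FellBundle.{u} G} {α : HaarSystem G}

open BanachBundle FellBundle L2Data

theorem BanachBundle.coe_sum {X : Type u} [TopologicalSpace X] {A : BanachBundle.{u} X} {Z : Type*}
    [TopologicalSpace Z] {ℓ : C(Z, X)} {E : ∀ z, Submodule ℂ (A.fib (ℓ z))} {ι : Type*} (s : Finset ι)
    (f : ι → A.Cc ℓ E) (z : Z) : (∑ i ∈ s, f i).1 z = ∑ i ∈ s, (f i).1 z :=
  map_sum (BanachBundle.evL z) f s

theorem pairS_act (c : (rangeFam A).C0) (x : (Xr A α).Sec) (y : (Xs A α).Sec) :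
    pairS ((actR A α).act (star c) x) y = pairS x ((actS A α).act c y) := by
  refine Subtype.ext (funext fun g => ?_)
  have m1 : G.IsMul (G.u (G.r g)) (G.u (G.r g)) (G.u (G.r g)) := LCGroupoid.isMul_u _
  have m2 : G.IsMul (G.inv (G.u (G.r g))) (G.u (G.r g)) (G.inv (G.u (G.r g))) := by
    rw [G.inv_u]; exact m1
  refine (congrArg (fun t => A.mul (isMul_XrXs (A := A) (α := α) g) t (L2Data.ev y g))
    (A.adj_mul m1 m2 (G.inv_u _) rfl rfl (star (c.1 g)) (L2Data.ev x g))).trans ?_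
  refine (A.mul_assoc m2 _ (LCGroupoid.isMul_u_left rfl) (isMul_XrXs (A := A) (α := α) g) _ _ _).trans ?_
  refine congrArg (fun t => A.mul (isMul_XrXs (A := A) (α := α) g) (A.adj rfl (L2Data.ev x g))
    (A.mul (LCGroupoid.isMul_u_left rfl) t (L2Data.ev y g))) ?_
  exact star_star (c.1 g)

namespace SecRep

variable {D F : Type u} [NonUnitalCStarAlgebra D] [NormedAddCommGroup F] [NormedSpace ℂ F]
  [HilbertModule D F] (S : SecRep A α D F) {φ : LeftAction (unitFam A).C0 D F}
  (hφ : ∀ b ξ v, φ.act b (S.L ξ v) = S.L (unitMul b ξ) v)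

variable (φ) in
/-- The map `∑ cᵢ (xᵢ, ηᵢ) ↦ ∑ cᵢ xᵢ ⊗ L(ηᵢ) w`. -/
def tensSum (w : F) : ((Xr A α).Sec × A.Sec →₀ ℂ) →ₗ[ℂ] φ.Tensor (Xr A α).Sec :=
  Finsupp.linearCombination ℂ fun p => φ.tens p.1 (S.L p.2 w)

section

include hφ

theorem ann_tensSum (x : (Xr A α).Sec) (w : F) (c : (Xr A α).Sec × A.Sec →₀ ℂ) :
    φ.ann x (S.tensSum φ w c) = S.L (rangeSlice x (Finsupp.linearCombination ℂ
      (fun p : (Xr A α).Sec × A.Sec => rangeMul p.1 p.2) c)) w := by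
  have h : (φ.ann x : φ.Tensor (Xr A α).Sec →ₗ[ℂ] F) ∘ₗ S.tensSum φ w = S.L.flip w ∘ₗ rangeSlice x ∘ₗ
      Finsupp.linearCombination ℂ (fun p : (Xr A α).Sec × A.Sec => rangeMul p.1 p.2) := by
    refine Finsupp.lhom_ext fun p t => ?_
    simp only [LinearMap.comp_apply, tensSum, Finsupp.linearCombination_single, map_smul]
    congr 1
    refine (φ.ann_tens x p.1 (S.L p.2 w)).trans ?_
    rw [hφ, rangeSlice_rangeMul]; rfl
  exact LinearMap.congr_fun h c

theorem inn_tensSum (w : F) (c : (Xr A α).Sec × A.Sec →₀ ℂ) :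
    (inn (S.tensSum φ w c) (S.tensSum φ w c) : D) = inn w (S.L ((lam0 A α).int (.id G.Arr)
      (∑ p ∈ c.support, star (c p) • starMul p.2 (rangeSlice p.1 (Finsupp.linearCombination ℂ
      (fun p : (Xr A α).Sec × A.Sec => rangeMul p.1 p.2) c)))) w) := by
  set t := S.tensSum φ w c
  have ht : t = ∑ p ∈ c.support, c p • φ.tens p.1 (S.L p.2 w) := Finsupp.linearCombination_apply _ _
  conv_lhs => enter [1]; rw [ht]
  rw [inn_sum_left, map_sum, map_sum, LinearMap.sum_apply, inn_sum_right]
  refine Finset.sum_congr rfl fun p _ => ?_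
  rw [inn_smul_left, φ.inn_tens_left, S.ann_tensSum hφ, S.adj, ← S.map_conv, map_smul, map_smul,
    LinearMap.smul_apply, inn_smul_right]
  congr 4
  exact (lam0_starMul _ _).symm

theorem exists_norm_tensSum_le (w : F) {K : Set G.Sq} (hK : IsCompact K) : ∃ C : ℝ, 0 ≤ C ∧
    ∀ (c : (Xr A α).Sec × A.Sec →₀ ℂ) (B : ℝ), 0 ≤ B → SuppLE (A := A.toBanachBundle) K B
      (Finsupp.linearCombination ℂ (fun p : (Xr A α).Sec × A.Sec => rangeMul p.1 p.2) c) →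
      ‖S.tensSum φ w c‖ ≤ C * B := by
  obtain ⟨C, hC, h⟩ := exists_sum_starMul_bound (A := A) α hK
  have hK' := hK.image G.d1.continuous
  obtain ⟨C', hC', h'⟩ := (isBdd_lam0 A α).indCont (S.indCont w) _ (isCompact_sq' hK' hK')
  refine ⟨√(‖w‖ * (C' * C)), Real.sqrt_nonneg _, fun c B hB hc => ?_⟩
  have h1 := h c.support c (fun p => p.1) (fun p => p.2) _ B hB (fun z => ?_) hc
  · have h2 := h' (∑ p ∈ c.support, star (c p) • starMul p.2 (rangeSlice p.1
      (Finsupp.linearCombination ℂ (fun p : (Xr A α).Sec × A.Sec => rangeMul p.1 p.2) c)))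
      (C * (B * B)) (by positivity) (fun z hz => ?_) fun z => ?_
    · rw [HilbertModule.norm_eq D, Real.sqrt_le_left (by positivity), S.inn_tensSum hφ]
      refine (HilbertModule.norm_inn_le (D := D) _ _).trans ?_
      rw [mul_pow, Real.sq_sqrt (by positivity)]
      calc _ ≤ ‖w‖ * (C' * (C * (B * B))) := mul_le_mul_of_nonneg_left h2 (norm_nonneg _)
        _ = _ := by ring
    · rw [coe_sum]
      exact (h1 z).2 hz
    · rw [coe_sum]
      exact (h1 z).1
  · rw [Finsupp.linearCombination_apply, Finsupp.sum, coe_sum]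
    rfl

theorem exists_tensMap (w : F) : ∃ T : A.Cc G.d1 (mulFam A) →ₗ[ℂ] φ.Tensor (Xr A α).Sec, IndCont T ∧
    ∀ x η, T (rangeMul x η) = φ.tens x (S.L η w) := by
  have := HilbertModule.complete (D := D) (F := φ.Tensor (Xr A α).Sec)
  obtain ⟨T, hT, h⟩ := spanning_rangeMul.exists_extension
    (fun p : (Xr A α).Sec × A.Sec => φ.tens p.1 (S.L p.2 w))
    (fun K hK => S.exists_norm_tensSum_le hφ w hK)
  exact ⟨T, hT, fun x η => h (x, η)⟩

variable {T : F → A.Cc G.d1 (mulFam A) →ₗ[ℂ] φ.Tensor (Xr A α).Sec} (hT : ∀ w, IndCont (T w))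
  (hT' : ∀ w x η, T w (rangeMul x η) = φ.tens x (S.L η w))

include hT hT'

theorem ann_tensMap (x : (Xr A α).Sec) (w : F) (Ω : A.Cc G.d1 (mulFam A)) :
    φ.ann x (T w Ω) = S.L (rangeSlice x Ω) w :=
  IndCont.ext (Φ := (φ.ann x : φ.Tensor (Xr A α).Sec →ₗ[ℂ] F) ∘ₗ T w) (Ψ := S.L.flip w ∘ₗ rangeSlice x)
    spanning_rangeMul ((hT w).clm_comp (φ.ann x)) (indCont_rangeSlice x (S.indCont w)) (fun p => by
      refine (congrArg (φ.ann x) (hT' w p.1 p.2)).trans ?_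
      refine (φ.ann_tens x p.1 (S.L p.2 w)).trans ?_
      rw [hφ, ← rangeSlice_rangeMul]; rfl) Ω

theorem inn_tensMap (y : (Xs A α).Sec) (η : A.Sec) (w w' : F) (Ω : A.Cc G.d1 (mulFam A)) :
    (inn (T w (sqMul y η)) (T w' Ω) : D) = inn (S.L η w) (S.L (sourceSlice y Ω) w') := by
  refine IndCont.ext (Φ := (HilbertModule.innL D _ (T w (sqMul y η)) :
    φ.Tensor (Xr A α).Sec →ₗ[ℂ] D) ∘ₗ T w') (Ψ := (HilbertModule.innL D F (S.L η w) : F →ₗ[ℂ] D) ∘ₗ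
    S.L.flip w' ∘ₗ sourceSlice y) (spanning_rangeMul (α := α))
    ((hT w').clm_comp (HilbertModule.innL D _ (T w (sqMul y η))))
    ((indCont_sourceSlice y (S.indCont w')).clm_comp (HilbertModule.innL D F (S.L η w))) (fun p => ?_) Ω
  change (inn (T w (sqMul y η)) (T w' (rangeMul p.1 p.2)) : D)
    = inn (S.L η w) (S.L (sourceSlice y (rangeMul p.1 p.2)) w')
  rw [hT', φ.inn_tens_right, S.ann_tensMap hφ hT hT', rangeSlice_sqMul, S.map_conv,
    sourceSlice_rangeMul, S.inn_L]

omit hφ in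
theorem isTotal_tensMap : IsTotal fun p : (Xs A α).Sec × A.Sec × F => T p.2.2 (sqMul p.1 p.2.1) := by
  refine (φ.isTotal_tens_of_total (X := (Xr A α).Sec) S.nondeg).of_forall_mem_closure fun p => ?_
  rw [← hT']
  exact IndCont.mem spanning_sqMul (hT p.2.2) (S := (Submodule.span ℂ (Set.range
    fun p : (Xs A α).Sec × A.Sec × F => T p.2.2 (sqMul p.1 p.2.1))).topologicalClosure)
    (Submodule.isClosed_topologicalClosure _)
    (fun i => Submodule.le_topologicalClosure _ (Submodule.subset_span ⟨(i.1, i.2, p.2.2), rfl⟩)) _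

end

/-- The operator `L(ξ)` as a bounded operator. -/
def opL (ξ : A.Sec) : F →L[ℂ] F :=
  (S.L ξ).mkContinuous _ (S.bound ξ)

include hφ in
theorem exists_unitary : ∃ U : FellUnitary α φ, ∀ x y v,
    φ.ann x (U.toEquiv (φ.tens y v)) = S.L (pairS x y) v := by
  choose T hT hT' using S.exists_tensMap hφ
  have he := φ.isTotal_tens_of_total (X := (Xs A α).Sec) S.nondeg
  obtain ⟨U, hU⟩ := Unitary.exists_of_gram (D := D)
    (e := fun p : (Xs A α).Sec × A.Sec × F => φ.tens p.1 (S.L p.2.1 p.2.2))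
    (f := fun p => T p.2.2 (sqMul p.1 p.2.1)) (fun i j => by
      rw [φ.inn_tens, S.inn_tensMap hφ hT hT', sourceSlice_sqMul, hφ]) he (S.isTotal_tensMap hT hT')
  have h1 : ∀ x y v, φ.ann x (U.toEquiv (φ.tens y v)) = S.L (pairS x y) v := fun x y => by
    have : (φ.ann x).comp ((U.toIso : _ →L[ℂ] _).comp (φ.cre y)) = S.opL (pairS x y) :=
      S.nondeg.clm_ext fun p => by
        change φ.ann x (U.toEquiv (φ.tens y (S.L p.1 p.2))) = S.L (pairS x y) (S.L p.1 p.2)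
        refine (congrArg (φ.ann x) (hU (y, p))).trans ?_
        rw [S.ann_tensMap hφ hT hT', rangeSlice_sqMul, S.map_conv]
    exact fun v => DFunLike.congr_fun this v
  refine ⟨⟨U, fun c t => ?_⟩, h1⟩
  have : (U.toIso : _ →L[ℂ] φ.Tensor (Xr A α).Sec).comp ((leftS α φ).op c)
      = ((leftR α φ).op c).comp (U.toIso : _ →L[ℂ] φ.Tensor (Xr A α).Sec) :=
    φ.isTotal_tens.clm_ext fun p => φ.tensor_ext fun x => by
      change φ.ann x (U.toEquiv ((leftS α φ).act c (φ.tens p.1 p.2)))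
        = φ.ann x ((leftR α φ).act c (U.toEquiv (φ.tens p.1 p.2)))
      have h2 := φ.ann_act (actR A α) (star c) x (U.toEquiv (φ.tens p.1 p.2))
      rw [star_star, h1, pairS_act] at h2
      exact ((congrArg (fun t => φ.ann x (U.toEquiv t)) (φ.leftTensor_tens (actS A α) c p.1 p.2)).trans
        (h1 _ _ _)).trans h2
  exact DFunLike.congr_fun this t

end SecRep

end UnitaryOfSecRep

section FactorOperators

variable {G : LCGroupoid.{u}} {A : FellBundle.{u} G} {α : HaarSystem G}

open BanachBundle FellBundle L2Data

theorem FellBundle.adj_mul_mul_assoc {x y s t n s' : G.Arr} {a : A.fib s} {b : A.fib t}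
    {is : G.inv s = s'} (mst : G.IsMul s' t n) {sy : G.Arr} (msy : G.IsMul s y sy) {tx : G.Arr}
    (mtx : G.IsMul t x tx) {k : G.Arr} (mk : G.IsMul (G.inv sy) tx k) {nx : G.Arr}
    (mnx : G.IsMul n x nx) (mk' : G.IsMul (G.inv y) nx k) (u : A.fib y) (v : A.fib x) :
    A.mul mk (A.adj rfl (A.mul msy a u)) (A.mul mtx b v)
      = A.mul mk' (A.adj rfl u) (A.mul mnx (A.mul mst (A.adj is a) b) v) := by
  subst is
  have m1 : G.IsMul (G.inv s) tx nx :=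
    ⟨by rw [G.s_inv, mtx.r_eq, ← mst.1, G.s_inv], by
      rw [← mnx.2, ← mst.2, G.mul_assoc _ _ _ mst.1 mtx.1, mtx.2]⟩
  rw [A.adj_mul msy msy.inv rfl rfl rfl, A.mul_assoc msy.inv mk m1 mk', ← A.mul_assoc mst mnx mtx m1]

theorem isMul_Y2_d2 (z : G.Sq) : G.IsMul (G.inv (G.u (G.r (G.d2 z)))) (G.d2 z) (G.d2 z) := by
  rw [G.inv_u]; exact LCGroupoid.isMul_u_left rfl

theorem FellBundle.idealI_mul_mem_mulAdjFam (z : G.Sq) {c : A.fib (G.u (G.r (G.d2 z)))}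
    (hc : c ∈ A.idealI z (LCGroupoid.r_d1 z)) (a : A.fib (G.d2 z)) :
    A.mul (isMul_Y2_d2 z) (A.adj rfl c) a ∈ mulAdjFam A z := by
  have mi : G.IsMul (G.d1 z) (G.inv (G.d1 z)) (G.inv (G.u (G.r (G.d2 z)))) := by
    rw [G.inv_u]; exact LCGroupoid.isMul_self_inv (LCGroupoid.r_d1 z)
  have m2 : G.IsMul (G.inv (G.d1 z)) (G.d2 z) (G.inv (G.d0 z)) := by
    have := (LCGroupoid.isMul_sq z).inv_mul_left.inv
    rwa [LCGroupoid.inv_inv] at this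
  have h1 : A.adj rfl c ∈ A.prodSpan mi (A.prodSpan (LCGroupoid.isMul_sq z) ⊤ ⊤) ⊤ :=
    adj_mem_prodSpan' (P' := ⊤) (Q' := A.prodSpan (LCGroupoid.isMul_sq z) ⊤ ⊤) _ mi rfl
      (LCGroupoid.inv_inv _) rfl (fun _ _ => trivial) (fun _ hb =>
        adj_mem_prodSpan' (P' := ⊤) (Q' := ⊤) _ (LCGroupoid.isMul_sq z) (LCGroupoid.inv_inv _)
          (LCGroupoid.inv_inv _) (LCGroupoid.inv_inv _) (fun _ _ => trivial) (fun _ _ => trivial) hb) hc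
  refine mul_right_mem (isClosed_prodSpan _ _ _) _ _ h1 a fun b hb d _ => ?_
  rw [A.mul_assoc _ _ m2 (isMul_d1_inv_d0 z)]
  exact mul_mem_prodSpan _ hb trivial

section RightMul

variable {Z : Type u} [TopologicalSpace Z] {p q ℓ : C(Z, G.Arr)} {E : ∀ z, Submodule ℂ (A.fib (q z))}

/-- The map `Ω ↦ Ω x`. -/
def rightMul (m : ∀ z, G.IsMul (q z) (p z) (ℓ z)) (x : ∀ z, A.fib (p z)) (hx : A.IsCont p x) :
    A.Cc q E →ₗ[ℂ] A.CcTop ℓ where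
  toFun f := ⟨fun z => A.mul (m z) (f.1 z) (x z), isCont_mul f.2.1 hx _, by
    obtain ⟨K, hK, hK0⟩ := f.2.2.1
    exact ⟨K, hK, fun z hz => mul_eq_zero_left (hK0 z hz)⟩, fun _ => trivial⟩
  map_add' f f' := Subtype.ext (funext fun z =>
    congrFun (congrArg DFunLike.coe (map_add (A.mul (m z)) (f.1 z) (f'.1 z))) (x z))
  map_smul' c f := Subtype.ext (funext fun z =>
    congrFun (congrArg DFunLike.coe (map_smul (A.mul (m z)) c (f.1 z))) (x z))

theorem indCont_rightMul (m : ∀ z, G.IsMul (q z) (p z) (ℓ z)) {x : ∀ z, A.fib (p z)}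
    (hx : A.IsCont p x) {b : ℝ} (hb : 0 ≤ b) (hxb : ∀ z, ‖x z‖ ≤ b) {N : Type*}
    [NormedAddCommGroup N] {Φ : A.CcTop ℓ → N} (hΦ : IndCont Φ) :
    IndCont fun f : A.Cc q E => Φ (rightMul m x hx f) := by
  intro K hK
  obtain ⟨C, hC, h⟩ := hΦ K hK
  refine ⟨C * b, by positivity, fun y B hB hy hyB => ?_⟩
  rw [_root_.mul_assoc, _root_.mul_comm b]
  exact h _ (B * b) (by positivity) (fun z hz => mul_eq_zero_left (hy z hz)) fun z =>
    (A.norm_mul_le _ _ _).trans (mul_le_mul (hyB z) (hxb z) (norm_nonneg _) hB)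

end RightMul

/-- The section `y₂^* y₀`. -/
def factorMul (y₂ : (Y2 A α).Sec) (y₀ : (Y0 A α).Sec) : A.Cc G.d2 (mulAdjFam A) :=
  ⟨fun z => A.mul (isMul_Y2_d2 z) (A.adj rfl (L2Data.ev y₂ z)) (L2Data.ev y₀ z),
    isCont_mul (isCont_adj (L2Data.isCont_ev y₂) _) (L2Data.isCont_ev y₀) _, by
      obtain ⟨K, hK, hK0⟩ := L2Data.exists_compact_ev y₀
      exact ⟨K, hK, fun z hz => by beta_reduce; rw [hK0 z hz]; exact map_zero _⟩, fun z =>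
      idealI_mul_mem_mulAdjFam z (L2Data.ev_mem y₂ z) _⟩

/-- The section `(g, h) ↦ p(g)^* M(g, h) q(h)`. -/
def sandwich (p : (Xs A α).Sec) (q : (Xr A α).Sec) :
    A.Cc G.d2 (mulAdjFam A) →ₗ[ℂ] A.CcTop ((unitFam A).label.comp (G.s.comp G.d2)) :=
  adjMul (p := G.d2) (q := G.d2) (fun _ => LCGroupoid.isMul_inv_self rfl)
    (fun z => L2Data.ev p (G.d2 z)) ((L2Data.isCont_ev p).comp G.d2.continuous) ∘ₗ
  rightMul (p := G.u.comp (G.r.comp G.d0)) (ℓ := G.d2)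
    (fun z => LCGroupoid.isMul_u_right (LCGroupoid.s_d2 z)) (fun z => L2Data.ev q (G.d0 z))
    ((L2Data.isCont_ev q).comp G.d0.continuous)

/-- The section `(g, h) ↦ x(g)^* M(g, h) y(h)`. -/
def sandwichSec (x : (Xr A α).Sec) (y : (Xs A α).Sec) :
    A.Cc G.d2 (mulAdjFam A) →ₗ[ℂ] A.CcTop ((ContinuousMap.id G.Arr).comp G.d1) :=
  adjMul (p := G.u.comp (G.r.comp G.d2)) (q := G.d1) isMul_Xr_d1
    (fun z => L2Data.ev x (G.d2 z)) ((L2Data.isCont_ev x).comp G.d2.continuous) ∘ₗ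
  rightMul (p := G.d0) (ℓ := G.d1) LCGroupoid.isMul_sq (fun z => L2Data.ev y (G.d0 z))
    ((L2Data.isCont_ev y).comp G.d0.continuous)

theorem indCont_sandwichSec (x : (Xr A α).Sec) (y : (Xs A α).Sec) {N : Type*} [NormedAddCommGroup N]
    {Φ : A.CcTop ((ContinuousMap.id G.Arr).comp G.d1) → N} (hΦ : IndCont Φ) :
    IndCont fun M => Φ (sandwichSec x y M) := by
  obtain ⟨b, hb, hx⟩ := exists_bound_ev x
  obtain ⟨b', hb', hy⟩ := exists_bound_ev y
  exact indCont_rightMul (p := G.d0) (ℓ := G.d1) LCGroupoid.isMul_sq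
    (x := fun z => L2Data.ev y (G.d0 z)) ((L2Data.isCont_ev y).comp G.d0.continuous) hb'
    (fun z => hy (G.d0 z))
    (indCont_adjMul (p := G.u.comp (G.r.comp G.d2)) (q := G.d1) (E := fun _ => ⊤) isMul_Xr_d1
      (x := fun z => L2Data.ev x (G.d2 z)) ((L2Data.isCont_ev x).comp G.d2.continuous) hb
      (fun z => hx (G.d2 z)) hΦ)

variable (α) in
/-- The section `s ↦ ∬ p^* M q`. -/
def coef (p : (Xs A α).Sec) (M : A.Cc G.d2 (mulAdjFam A)) (q : (Xr A α).Sec) : (unitFam A).C0 :=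
  ofTop ((W1 A α).J.int (unitFam A).label (sandwich p q M))

theorem inn_prodSec_factorMul (y₂ : (Y2 A α).Sec) (y₀ : (Y0 A α).Sec) (p : (Xs A α).Sec)
    (q : (Xr A α).Sec) :
    (inn (prodSec (isProd_Y2Xs A α) y₂ p) (prodSec (isProd_Y0Xr A α) y₀ q) : (unitFam A).C0)
      = coef α p (factorMul y₂ y₀) q := by
  refine SubAlgFamily.C0.ext fun w => ?_
  refine congrArg (fun f => ((W1 A α).J.int (unitFam A).label f).1 w) (Subtype.ext (funext fun z => ?_))
  exact adj_mul_mul_assoc (isMul_Y2_d2 z) (isMul_Y2Xs A α z) (isMul_Y0Xr A α z) _ _ _ _ _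

theorem coef_add (p : (Xs A α).Sec) (M M' : A.Cc G.d2 (mulAdjFam A)) (q : (Xr A α).Sec) :
    coef α p (M + M') q = coef α p M q + coef α p M' q :=
  SubAlgFamily.C0.ext fun w => by rw [coef, map_add, map_add]; rfl

theorem coef_smul (c : ℂ) (p : (Xs A α).Sec) (M : A.Cc G.d2 (mulAdjFam A)) (q : (Xr A α).Sec) :
    coef α p (c • M) q = c • coef α p M q :=
  SubAlgFamily.C0.ext fun w => by rw [coef, map_smul, map_smul]; rfl

theorem FellBundle.norm_adj_sub {k k' : G.Arr} (i : G.inv k = k') (i' : G.inv k' = k) (a : A.fib k)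
    (e : A.fib k') : ‖A.adj i a - e‖ = ‖a - A.adj i' e‖ := by
  rw [← A.norm_adj i (a - A.adj i' e), map_sub, A.adj_adj]

theorem isMul_inv_Xr (h : G.Arr) : G.IsMul h (G.inv h) (G.inv (G.u (G.r h))) := by
  rw [G.inv_u]; exact LCGroupoid.isMul_self_inv rfl

theorem spanning_mulAdjSec : Spanning (A := A.toBanachBundle) (E := mulAdjFam A)
    fun p : (Xs A α).Sec × (Xr A α).Sec => mulAdjSec p.1 p.2 := by
  refine spanning_mul (a := G.d2) (b := G.d0) Topology.IsInducing.subtypeVal (ℓ₁ := fun g => g)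
    (ℓ₂ := fun h => G.inv (G.u (G.r h))) isMul_d2_u
    (E₁ := fun _ => ⊤) (E₂ := fun h => A.prodSpan (isMul_inv_Xr h) ⊤ ⊤) (fun z => ?_)
    (s₁ := fun (x : (Xs A α).Sec) g => L2Data.ev x g)
    (s₂ := fun (q : (Xr A α).Sec) h => A.adj rfl (L2Data.ev q h))
    (fun x χ hχ => ⟨cutoff ⟨χ, hχ⟩ x, fun _ => rfl⟩) (fun x χ hχ => ⟨cutoff ⟨χ, hχ⟩ x, fun g => ?_⟩)
    (fun g e _ _ hε => exists_ev_near g e hε)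
    (fun g e he ε hε => ?_) fun _ _ => rfl
  · refine prodSpan_le (isClosed_prodSpan _ _ _) fun t ht c _ => ?_
    exact mul_right_mem (isClosed_prodSpan _ _ _) _ _ ht c fun a _ b _ => by
      rw [A.mul_assoc _ _ (isMul_inv_Xr (G.d0 z)) (isMul_d2_u z)]
      exact mul_mem_prodSpan _ trivial (mul_mem_prodSpan _ trivial trivial)
  · refine (map_smulₛₗ (A.adj rfl) (χ g : ℂ) (L2Data.ev x g)).trans ?_
    rw [Complex.conj_ofReal]; rfl
  · have i : G.inv (G.inv (G.u (G.r g))) = G.u (G.r g) := LCGroupoid.inv_inv _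
    have h1 : A.adj i e ∈ A.rangeIdeal g rfl :=
      adj_mem_prodSpan' (P' := ⊤) (Q' := ⊤) _ (LCGroupoid.isMul_self_inv rfl) rfl
        (LCGroupoid.inv_inv _) i (fun _ _ => trivial) (fun _ _ => trivial) he
    obtain ⟨q, hq⟩ := exists_sec_near (X := Xr A α)
      (hasSections_rangeIdeal A continuous_id G.r.continuous fun _ => rfl) g h1 hε
    refine ⟨q, ?_⟩
    exact (norm_adj_sub rfl i (L2Data.ev q g) e).trans_lt hq

end FactorOperators

section Coherence

variable {G : LCGroupoid.{u}} {A : FellBundle.{u} G} {α : HaarSystem G}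

open BanachBundle FellBundle L2Data

theorem IntegralOp.Same.refl {A : FellBundle.{u} G} {Z W : Type u} [TopologicalSpace Z]
    [TopologicalSpace W] {π : C(Z, W)} (J : IntegralOp A π) : J.Same J id := by
  intro ℓ f f' h w
  have : f = f' := Subtype.ext (funext fun z => eq_of_heq (Tot.mk.inj (h z)).2)
  rw [this]

theorem factorMul_eq {M : A.Cc G.d2 (mulAdjFam A)} {y₂ : (Y2 A α).Sec} {y₀ : (Y0 A α).Sec}
    (hf : ∀ z k (i : G.inv (G.u (G.r (G.d2 z))) = k)
      (m : G.IsMul k (G.d2 z) (G.d2 z)), A.mul m (A.adj i (L2Data.ev y₂ z)) (L2Data.ev y₀ z)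
        = M.1 z) : factorMul y₂ y₀ = M :=
  Subtype.ext (funext fun z => hf z _ rfl (isMul_Y2_d2 z))

theorem coef_mulAdjSec (a : (Xs A α).Sec) (p : (Xs A α).Sec) (q b : (Xr A α).Sec) :
    coef α a (mulAdjSec p q) b = inn a p * inn q b := by
  obtain ⟨y₂, y₀, hf, -⟩ := exists_factor_mulAdj (α := α) (mulAdjSec p q)
  rw [← factorMul_eq hf, ← inn_prodSec_factorMul]
  exact inn_prodSec₀ hf a b

theorem FellBundle.mul_mul_mul_mul {a g b h k : G.Arr} (mag : G.IsMul a g g) (mbh : G.IsMul b h h)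
    (mgh : G.IsMul g h k) (mgb : G.IsMul g b g) (mak : G.IsMul a k k) (x : A.fib a) (p : A.fib g)
    (c : A.fib b) (y : A.fib h) : A.mul mak x (A.mul mgh (A.mul mgb p c) y)
      = A.mul mgh (A.mul mag x p) (A.mul mbh c y) := by
  rw [A.mul_assoc mag mgh mgh mak, A.mul_assoc mgb mgh mbh mgh]

theorem extMul_pairS (x q : (Xr A α).Sec) (p y : (Xs A α).Sec) :
    extMul (pairS x p : A.Sec) (pairS q y) = sandwichSec x y (mulAdjSec p q) :=
  Subtype.ext (funext fun z => (mul_mul_mul_mul (isMul_XrXs (G.d2 z)) (isMul_XrXs (G.d0 z))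
    (LCGroupoid.isMul_sq z) (isMul_d2_u z) (isMul_Xr_d1 z) _ _ _ _).symm)

variable {D F : Type u} [NonUnitalCStarAlgebra D] [NormedAddCommGroup F] [NormedSpace ℂ F]
  [HilbertModule D F] {φ : LeftAction (FellBundle.unitFam A).C0 D F}

theorem tensorMap_ext {B : Type u} [NonUnitalCStarAlgebra B]
    {φ : LeftAction B D F} {X X' : Type u} [AddCommGroup X] [Module ℂ X] [PreHilbertModule B X]
    [AddCommGroup X'] [Module ℂ X'] [PreHilbertModule B X'] {S T : φ.Tensor X →L[ℂ] φ.Tensor X'}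
    (h : ∀ a b v, φ.ann a (S (φ.tens b v)) = φ.ann a (T (φ.tens b v))) : S = T :=
  φ.isTotal_tens.clm_ext fun p => φ.tensor_ext fun a => h a p.1 p.2

variable (γ₂s : Unitary D ((leftS α φ).Tensor (Y2 A α).Sec) (φ.Tensor (W1 A α).Sec))
  (γ₀r : Unitary D ((leftR α φ).Tensor (Y0 A α).Sec) (φ.Tensor (W1 A α).Sec))

/-- The operator `T_{y₂}^* T_{y₀}`. -/
def factorOp (y₂ : (Y2 A α).Sec) (y₀ : (Y0 A α).Sec) :
    φ.Tensor (Xr A α).Sec →L[ℂ] φ.Tensor (Xs A α).Sec :=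
  (leftS α φ).ann y₂ ∘L (γ₂s.toIso.symm : φ.Tensor (W1 A α).Sec →L[ℂ] _) ∘L
    (γ₀r.toIso : _ →L[ℂ] φ.Tensor (W1 A α).Sec) ∘L (leftR α φ).cre y₀

theorem factorOp_apply (y₂ : (Y2 A α).Sec) (y₀ : (Y0 A α).Sec) (t : φ.Tensor (Xr A α).Sec) :
    factorOp γ₂s γ₀r y₂ y₀ t
      = (leftS α φ).ann y₂ (γ₂s.toEquiv.symm (γ₀r.toEquiv ((leftR α φ).tens y₀ t))) := rfl

theorem norm_factorOp_le (y₂ : (Y2 A α).Sec) (y₀ : (Y0 A α).Sec) :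
    ‖factorOp γ₂s γ₀r y₂ y₀‖ ≤ √‖(inn y₂ y₂ : (rangeFam A).C0)‖ * √‖(inn y₀ y₀ : (rangeFam A).C0)‖ := by
  refine ContinuousLinearMap.opNorm_le_bound _ (by positivity) fun t => ?_
  rw [_root_.mul_assoc]
  refine ((leftS α φ).norm_ann_le y₂ _).trans ?_
  refine mul_le_mul_of_nonneg_left ?_ (Real.sqrt_nonneg _)
  refine (γ₂s.toIso.symm.norm_map _).trans_le ((γ₀r.toIso.norm_map _).trans_le ?_)
  exact (leftR α φ).norm_tens_le y₀ t

variable {γ₂s γ₀r}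

theorem ann_factorOp_tens
    (c2s : IsCanonical φ (Xs A α) (actS A α) (Y2 A α) (W1 A α) (isMul_Y2Xs A α) γ₂s)
    (c0r : IsCanonical φ (Xr A α) (actR A α) (Y0 A α) (W1 A α) (isMul_Y0Xr A α) γ₀r)
    (y₂ : (Y2 A α).Sec) (y₀ : (Y0 A α).Sec) (a : (Xs A α).Sec) (b : (Xr A α).Sec) (v : F) :
    φ.ann a (factorOp γ₂s γ₀r y₂ y₀ (φ.tens b v)) = φ.act (coef α a (factorMul y₂ y₀) b) v := by
  rw [factorOp_apply, c2s.ann_ann (isProd_Y2Xs A α), LinearEquiv.apply_symm_apply,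
    c0r y₀ b (prodSec (isProd_Y0Xr A α) y₀ b) (fun _ => rfl), LeftAction.ann_tens,
    inn_prodSec_factorMul]

variable (α φ) in
theorem exists_mulOp : ∃ B : A.Cc G.d2 (mulAdjFam A) →ₗ[ℂ]
    (φ.Tensor (Xr A α).Sec →L[ℂ] φ.Tensor (Xs A α).Sec),
    (∀ M a b v, φ.ann a (B M (φ.tens b v)) = φ.act (coef α a M b) v) ∧ IndCont B := by
  obtain ⟨γ₂s, c2s⟩ := (isProd_Y2Xs A α).exists_canonical φ (actS A α)
    (inn_prodSec (isProd_Y2Xs A α) (.refl _))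
  obtain ⟨γ₀r, c0r⟩ := (isProd_Y0Xr A α).exists_canonical φ (actR A α)
    (inn_prodSec (isProd_Y0Xr A α) (intS_lam2 A α).symm)
  choose y₂ y₀ hf hn₂ hn₀ using exists_factor_mulAdj (A := A) (α := α)
  have key : ∀ M a b v, φ.ann a (factorOp γ₂s γ₀r (y₂ M) (y₀ M) (φ.tens b v))
      = φ.act (coef α a M b) v := fun M a b v => by
    rw [ann_factorOp_tens c2s c0r, factorMul_eq (hf M)]
  refine ⟨{ toFun := fun M => factorOp γ₂s γ₀r (y₂ M) (y₀ M)
            map_add' := fun M M' => tensorMap_ext (φ := φ) (X := (Xr A α).Sec) (X' := (Xs A α).Sec)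
              fun a b v => ?_
            map_smul' := fun c M => tensorMap_ext (φ := φ) (X := (Xr A α).Sec) (X' := (Xs A α).Sec)
              fun a b v => ?_ }, key, ?_⟩
  · rw [_root_.add_apply, map_add, key, key, key, coef_add, map_add]; rfl
  · rw [RingHom.id_apply, _root_.smul_apply, map_smul, key, key, coef_smul, map_smul]
    rfl
  · intro K hK
    obtain ⟨C₂, hC₂, h₂⟩ := isBdd_lam2 A α K hK
    obtain ⟨C₀, hC₀, h₀⟩ := isBdd_lam0 A α K hK
    refine ⟨√C₂ * √C₀, by positivity, fun M B hB hM hMB => ?_⟩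
    have e : ∀ {n m : ℝ}, n ^ 2 ≤ m → m ≤ B → n ≤ √B := fun h h' =>
      Real.le_sqrt_of_sq_le (h.trans h')
    have z : ∀ {n m : ℝ}, n ^ 2 ≤ m → m = 0 → n = 0 := fun h h' => by
      subst h'; exact pow_eq_zero_iff two_ne_zero |>.1 (le_antisymm h (sq_nonneg _))
    have b₂ : ‖(inn (y₂ M) (y₂ M) : (rangeFam A).C0)‖ ≤ C₂ * (√B * √B) :=
      norm_inn_le hC₂ h₂ _ _ _ _ (Real.sqrt_nonneg _) (Real.sqrt_nonneg _)
        (fun w hw => norm_eq_zero.1 (z (hn₂ M w) (norm_eq_zero.2 (hM w hw))))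
        (fun w => e (hn₂ M w) (hMB w)) (fun w => e (hn₂ M w) (hMB w))
    have b₀ : ‖(inn (y₀ M) (y₀ M) : (rangeFam A).C0)‖ ≤ C₀ * (√B * √B) :=
      norm_inn_le hC₀ h₀ _ _ _ _ (Real.sqrt_nonneg _) (Real.sqrt_nonneg _)
        (fun w hw => norm_eq_zero.1 (z (hn₀ M w) (norm_eq_zero.2 (hM w hw))))
        (fun w => e (hn₀ M w) (hMB w)) (fun w => e (hn₀ M w) (hMB w))
    rw [Real.mul_self_sqrt hB] at b₂ b₀
    calc _ ≤ √‖(inn (y₂ M) (y₂ M) : (rangeFam A).C0)‖ * √‖(inn (y₀ M) (y₀ M) : (rangeFam A).C0)‖ :=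
          norm_factorOp_le γ₂s γ₀r _ _
      _ ≤ √(C₂ * B) * √(C₀ * B) := by gcongr
      _ = _ := by
        rw [Real.sqrt_mul hC₂, Real.sqrt_mul hC₀, mul_mul_mul_comm, Real.mul_self_sqrt hB]

variable (S : SecRep A α D F) {U : FellUnitary α φ} (hL : ∀ (x : (Xr A α).Sec) (y : (Xs A α).Sec)
  (v : F), φ.ann x (U.toEquiv (φ.tens y v)) = S.L (pairS x y) v)

include hL

theorem SecRep.ann_mulOp {B : A.Cc G.d2 (mulAdjFam A) →ₗ[ℂ]
      (φ.Tensor (Xr A α).Sec →L[ℂ] φ.Tensor (Xs A α).Sec)}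
    (hB : ∀ M a b v, φ.ann a (B M (φ.tens b v)) = φ.act (coef α a M b) v) (hB' : IndCont B)
    (M : A.Cc G.d2 (mulAdjFam A)) (x : (Xr A α).Sec) (y : (Xs A α).Sec) (v : F) :
    φ.ann x (U.toEquiv (B M (U.toEquiv (φ.tens y v))))
      = S.L ((lam1 A α).int (.id _) (sandwichSec x y M)) v := by
  let T : (φ.Tensor (Xr A α).Sec →L[ℂ] φ.Tensor (Xs A α).Sec) →L[ℂ] F :=
    (φ.ann x ∘L (U.toIso : _ →L[ℂ] φ.Tensor (Xr A α).Sec)) ∘L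
      ContinuousLinearMap.apply ℂ _ (U.toEquiv (φ.tens y v))
  let Ψ : A.Cc G.d2 (mulAdjFam A) →ₗ[ℂ] F :=
    S.L.flip v ∘ₗ ((lam1 A α).int (.id _) : A.CcTop ((ContinuousMap.id G.Arr).comp G.d1) →ₗ[ℂ] A.Sec)
      ∘ₗ sandwichSec x y
  have hΨ : IndCont Ψ := indCont_sandwichSec x y ((isBdd_lam1 A α).indCont (S.indCont v))
  refine IndCont.ext (Φ := T.toLinearMap ∘ₗ B) (Ψ := Ψ) (spanning_mulAdjSec (α := α)) (hB'.clm_comp T) hΨ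
    (fun i => ?_) M
  obtain ⟨p, q⟩ := i
  have h1 : B (mulAdjSec p q) = φ.cre p ∘L φ.ann q :=
    tensorMap_ext (φ := φ) (X := (Xr A α).Sec) (X' := (Xs A α).Sec) fun a b w => by
      rw [hB, coef_mulAdjSec]
      change _ = φ.ann a (φ.tens p (φ.ann q (φ.tens b w)))
      rw [φ.ann_tens, φ.ann_tens, φ.act_mul]
  have h2 : φ.ann x (U.toEquiv (B (mulAdjSec p q) (U.toEquiv (φ.tens y v))))
      = S.L (conv α (pairS x p) (pairS q y)) v := by
    rw [h1]
    change φ.ann x (U.toEquiv (φ.tens p (φ.ann q (U.toEquiv (φ.tens y v))))) = _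
    rw [hL, hL, S.map_conv]
  exact h2.trans (congrArg (fun f => S.L ((lam1 A α).int (.id G.Arr) f) v) (extMul_pairS x q p y))

theorem SecRep.isCoherent : U.IsCoherent := by
  obtain ⟨γ₀s, c0s⟩ := (isProd_Y0Xs A α).exists_canonical φ (actS A α)
    (inn_prodSec (isProd_Y0Xs A α) (.refl _))
  obtain ⟨γ₀r, c0r⟩ := (isProd_Y0Xr A α).exists_canonical φ (actR A α)
    (inn_prodSec (isProd_Y0Xr A α) (intS_lam2 A α).symm)
  obtain ⟨γ₁s, c1s⟩ := (isProd_Y1Xs A α).exists_canonical φ (actS A α)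
    (inn_prodSec (isProd_Y1Xs A α) (intS_lam1 A α))
  obtain ⟨γ₁r, c1r⟩ := (isProd_Y1Xr A α).exists_canonical φ (actR A α)
    (inn_prodSec (isProd_Y1Xr A α) (intR_lam1 A α))
  obtain ⟨γ₂s, c2s⟩ := (isProd_Y2Xs A α).exists_canonical φ (actS A α)
    (inn_prodSec (isProd_Y2Xs A α) (.refl _))
  obtain ⟨γ₂r, c2r⟩ := (isProd_Y2Xr A α).exists_canonical φ (actR A α)
    (inn_prodSec (isProd_Y2Xr A α) (.refl _))
  refine ⟨γ₀s, γ₀r, γ₁s, γ₁r, γ₂s, γ₂r, c0s, c0r, c1s, c1r, c2s, c2r, fun t => ?_⟩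
  obtain ⟨B, hB, hB'⟩ := exists_mulOp (A := A) α φ
  have key : ∀ (y₂ : (Y2 A α).Sec) (y₀ : (Y0 A α).Sec) (x : (Xr A α).Sec) (y : (Xs A α).Sec) (v : F),
      φ.ann (prodSec (isProd_Y2Xr A α) y₂ x)
        (U.pullU γ₂s γ₂r (U.pullU γ₀s γ₀r (φ.tens (prodSec (isProd_Y0Xs A α) y₀ y) v)))
      = φ.ann (prodSec (isProd_Y2Xr A α) y₂ x)
        (U.pullU γ₁s γ₁r (φ.tens (prodSec (isProd_Y0Xs A α) y₀ y) v)) := fun y₂ y₀ x y v => by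
    have hT : factorOp γ₂s γ₀r y₂ y₀ = B (factorMul y₂ y₀) :=
      tensorMap_ext (φ := φ) (X := (Xr A α).Sec) (X' := (Xs A α).Sec) fun a b w => by
        rw [hB, ann_factorOp_tens c2s c0r]
    rw [pullU_prodSec U (isProd_Y0Xs A α) c0s,
      ann_pullU U (isProd_Y1Xs A α) (isProd_Y1Xr A α) isMul_W0W2 hL c1s c1r (isBdd_lam1 A α)
        S.indCont]
    refine (c2r.ann_ann (isProd_Y2Xr A α) y₂ x _).symm.trans ?_
    rw [ann_oneU]
    refine (congrArg (fun T : φ.Tensor (Xr A α).Sec →L[ℂ] φ.Tensor (Xs A α).Sec =>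
      φ.ann x (U.toEquiv (T (U.toEquiv (φ.tens y v))))) hT).trans ?_
    rw [S.ann_mulOp hL hB hB']
    refine congrArg (fun f => S.L ((lam1 A α).int (.id G.Arr) f) v) (Subtype.ext (funext fun z => ?_))
    exact (adj_mul_mul_assoc (isMul_Y2_d2 z) (isMul_Y2Xr A α z) (isMul_Y0Xs A α z) (isMul_W0W2 z)
      (LCGroupoid.isMul_sq z) (isMul_Xr_d1 z) _ _).symm
  have := ((isProd_Y0Xs A α).isTotal_tens φ).clm_ext
    (S := pullL U γ₂s γ₂r ∘L pullL U γ₀s γ₀r) (T := pullL U γ₁s γ₁r) fun p =>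
      HilbertModule.ext_total (D := D) ((isProd_Y2Xr A α).isTotal_tens φ) fun q => by
        rw [LeftAction.inn_tens_left, LeftAction.inn_tens_left]
        exact congrArg (fun t => (inn q.2.2 t : D)) (key q.1 p.1 q.2.1 p.2.1 p.2.2)
  exact congrArg (fun T : φ.Tensor (W2 A α).Sec →L[ℂ] φ.Tensor (W0 A α).Sec => T t) this

end Coherence

section Correspondence

variable {G : LCGroupoid.{u}} {A : FellBundle.{u} G} {α : HaarSystem G}

open BanachBundle FellBundle L2Data

theorem FellBundle.adj_mul_star_mul {g x : G.Arr} {u : G.Obj} (mg : G.IsMul (G.inv x) g g)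
    (mx : G.IsMul x (G.u u) x) (mu : G.IsMul (G.u u) g g) (a : A.fib x) (b : A.fib (G.u u))
    (c : A.fib g) : A.mul mg (A.adj rfl (A.mul mx a (star b))) c
      = A.mul mu b (A.mul mg (A.adj rfl a) c) := by
  have mx' : G.IsMul (G.u u) (G.inv x) (G.inv x) := by
    have := mx.inv; rwa [G.inv_u] at this
  have h := A.adj_mul mx mx' rfl (G.inv_u _) rfl a (star b)
  have h2 : A.adj (G.inv_u u) (star b) = b := A.adj_adj _ _ b
  rw [h, h2, A.mul_assoc mx' mg mg mu]

theorem pairS_rsmul_star (b : (unitFam A).C0) (x : (Xr A α).Sec) (y : (Xs A α).Sec) :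
    (pairS (PreHilbertModule.rsmul x (star b)) y : A.Sec) = unitMul b (pairS x y) :=
  Subtype.ext (funext fun g => adj_mul_star_mul (isMul_XrXs (A := A) (α := α) g)
    (LCGroupoid.isMul_u _) (LCGroupoid.isMul_u_left rfl) (L2Data.ev x g) (b.1 (G.r g)) (L2Data.ev y g))

variable {D F : Type u} [NonUnitalCStarAlgebra D] [NormedAddCommGroup F] [NormedSpace ℂ F]
  [HilbertModule D F]

/-- The representation `S` of the convolution algebra is the integrated form of `R`. -/
def SecRep.IsIntegrated (S : SecRep A α D F) (R : FellRep A α D F) : Prop :=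
  ∀ x y v, R.φ.ann x (R.U.toEquiv (R.φ.tens y v)) = S.L (pairS x y) v

theorem FellRep.exists_secRep (R : FellRep A α D F) : ∃ S : SecRep A α D F, S.IsIntegrated R := by
  obtain ⟨L, hL, hb⟩ := exists_integrated R.U
  exact ⟨⟨L, integrated_conv hL hb R.coherent, integrated_adj hL hb R.coherent R.nondeg, hb,
    isTotal_integrated hL R.nondeg⟩, hL⟩

namespace SecRep

theorem exists_fellRep (S : SecRep A α D F) : ∃ R : FellRep A α D F, S.IsIntegrated R := by
  obtain ⟨φ, hφ, hn⟩ := S.exists_unitRep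
  obtain ⟨U, hU⟩ := S.exists_unitary hφ
  exact ⟨⟨φ, hn, U, S.isCoherent hU⟩, hU⟩

namespace IsIntegrated

variable {S S' : SecRep A α D F} {R R' : FellRep A α D F}

theorem act (h : S.IsIntegrated R) (b : (unitFam A).C0) (ξ : A.Sec) (v : F) :
    R.φ.act b (S.L ξ v) = S.L (unitMul b ξ) v := by
  obtain ⟨x, y, rfl, -⟩ := exists_pair_eq (α := α) ξ
  have h1 := R.φ.ann_rsmul x (star b) (R.U.toEquiv (R.φ.tens y v))
  rw [star_star, h, h, pairS_rsmul_star] at h1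
  exact h1.symm

theorem unique_secRep (h : S.IsIntegrated R) (h' : S'.IsIntegrated R) : S = S' := by
  refine SecRep.ext (LinearMap.ext fun ξ => LinearMap.ext fun v => ?_)
  obtain ⟨x, y, rfl, -⟩ := exists_pair_eq (α := α) ξ
  rw [← h, ← h']

theorem unique_fellRep (h : S.IsIntegrated R) (h' : S.IsIntegrated R') : R = R' := by
  have e : R.φ = R'.φ := LeftAction.ext (LinearMap.ext fun b => by
    have := S.nondeg.clm_ext (S := R.φ.op b) (T := R'.φ.op b) fun p => by
      rw [LeftAction.op_apply, LeftAction.op_apply, h.act, h'.act]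
    exact LinearMap.ext fun v => congrArg (fun T : F →L[ℂ] F => T v) this)
  obtain ⟨φ, hφ, U, hU⟩ := R
  obtain ⟨φ', hφ', U', hU'⟩ := R'
  obtain rfl : φ = φ' := e
  have : U.toUnitary = U'.toUnitary := Unitary.ext_total φ.isTotal_tens fun p =>
    φ.tensor_ext fun x => (h x p.1 p.2).trans (h' x p.1 p.2).symm
  obtain ⟨U, _⟩ := U
  obtain ⟨U', _⟩ := U'
  obtain rfl : U = U' := this
  rfl

end IsIntegrated

variable (A α D F) in
/-- The bijection between representations of the Fell bundle and of its convolution algebra. -/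
def fellRepEquiv : SecRep A α D F ≃ FellRep A α D F where
  toFun S := S.exists_fellRep.choose
  invFun R := R.exists_secRep.choose
  left_inv S := (FellRep.exists_secRep _).choose_spec.unique_secRep S.exists_fellRep.choose_spec
  right_inv R := (SecRep.exists_fellRep _).choose_spec.unique_fellRep R.exists_secRep.choose_spec

theorem isIntegrated_fellRepEquiv (S : SecRep A α D F) :
    S.IsIntegrated (fellRepEquiv A α D F S) := S.exists_fellRep.choose_spec

end SecRep

section Intertwiners

variable {F₁ F₂ : Type u} [NormedAddCommGroup F₁] [NormedSpace ℂ F₁] [HilbertModule D F₁]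
  [NormedAddCommGroup F₂] [NormedSpace ℂ F₂] [HilbertModule D F₂]

/-- An isometry of Hilbert modules as a continuous linear map. -/
def isometryL (D : Type u) [NonUnitalCStarAlgebra D] [HilbertModule D F₁] [HilbertModule D F₂]
    (V : F₁ →ₗ[ℂ] F₂) (hV : ∀ x y, (inn (V x) (V y) : D) = inn x y) : F₁ →L[ℂ] F₂ :=
  V.mkContinuous 1 fun v => by rw [one_mul, HilbertModule.norm_eq D, HilbertModule.norm_eq D v, hV]

theorem SecRep.IsIntegrated.intertwines_iff {S₁ : SecRep A α D F₁} {S₂ : SecRep A α D F₂}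
    {R₁ : FellRep A α D F₁} {R₂ : FellRep A α D F₂} (h₁ : S₁.IsIntegrated R₁)
    (h₂ : S₂.IsIntegrated R₂) (V : F₁ →ₗ[ℂ] F₂)
    (hV : ∀ x y, (inn (V x) (V y) : D) = inn x y) :
    R₁.Intertwines R₂ V hV ↔ ∀ ξ v, V (S₁.L ξ v) = S₂.L ξ (V v) := by
  constructor
  · rintro ⟨h, hU⟩ ξ v
    obtain ⟨x, y, rfl, -⟩ := exists_pair_eq (α := α) ξ
    rw [← h₁, ← h₂, ← LeftAction.ann_mapRight _ _ V hV h, hU, LeftAction.mapRight_tens]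
  · intro hS
    have h : ∀ b v, V (R₁.φ.act b v) = R₂.φ.act b (V v) := fun b v => by
      have := S₁.nondeg.clm_ext (S := isometryL D V hV ∘L R₁.φ.op b)
        (T := R₂.φ.op b ∘L isometryL D V hV) fun p => by
          change V (R₁.φ.act b (S₁.L p.1 p.2)) = R₂.φ.act b (V (S₁.L p.1 p.2))
          rw [h₁.act, hS, hS, h₂.act]
      exact congrArg (fun T : F₁ →L[ℂ] F₂ => T v) this
    refine ⟨h, fun t => ?_⟩
    have := R₁.φ.isTotal_tens.clm_ext
      (S := LeftAction.mapRight (Xr A α).Sec R₁.φ R₂.φ V hV h ∘L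
        (R₁.U.toIso : _ →L[ℂ] R₁.φ.Tensor (Xr A α).Sec))
      (T := (R₂.U.toIso : _ →L[ℂ] R₂.φ.Tensor (Xr A α).Sec) ∘L
        LeftAction.mapRight (Xs A α).Sec R₁.φ R₂.φ V hV h) fun p => by
          change LeftAction.mapRight (Xr A α).Sec R₁.φ R₂.φ V hV h (R₁.U.toEquiv (R₁.φ.tens p.1 p.2))
            = R₂.U.toEquiv (LeftAction.mapRight (Xs A α).Sec R₁.φ R₂.φ V hV h (R₁.φ.tens p.1 p.2))
          refine R₂.φ.tensor_ext fun x => ?_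
          rw [LeftAction.ann_mapRight, LeftAction.mapRight_tens, h₁, h₂, hS]
    exact congrArg (fun T : R₁.φ.Tensor (Xs A α).Sec →L[ℂ] R₂.φ.Tensor (Xr A α).Sec => T t) this

theorem NondegRep.intertwines_iff (L₁ : NondegRep (CStar A α) D F₁)
    (L₂ : NondegRep (CStar A α) D F₂) (V : F₁ →ₗ[ℂ] F₂)
    (hV : ∀ x y, (inn (V x) (V y) : D) = inn x y) : L₁.Intertwines L₂ V ↔
      ∀ ξ v, V ((secRepEquiv A α D F₁ L₁).L ξ v) = (secRepEquiv A α D F₂ L₂).L ξ (V v) := by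
  refine ⟨fun h ξ v => h _ v, fun h c v => ?_⟩
  refine denseRange_univ.induction_on (p := fun c => V (L₁.act c v) = L₂.act c (V v)) c ?_ (h · v)
  exact isClosed_eq ((isometryL D V hV).continuous.comp
    (L₁.continuous_act.comp (continuous_id.prodMk continuous_const)))
    (L₂.continuous_act.comp (continuous_id.prodMk continuous_const))

end Intertwiners

section Induction

variable {D' E : Type u} [NonUnitalCStarAlgebra D'] [NormedAddCommGroup E] [NormedSpace ℂ E]
  [HilbertModule D' E]

section Associator

variable {B X : Type u} [NonUnitalCStarAlgebra B] [AddCommGroup X] [Module ℂ X]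
  [PreHilbertModule B X] {ψ : LeftAction D D' E} {φ : LeftAction B D F}
  {φ' : LeftAction B D' (ψ.Tensor F)}

theorem exists_isAssociator (h : φ' = ψ.leftTensor φ) :
    ∃ κ : Unitary D' (ψ.Tensor (φ.Tensor X)) (φ'.Tensor X), IsAssociator ψ φ φ' κ := by
  subst h
  exact LeftAction.exists_associator ψ φ

theorem IsAssociator.ann_tens (h : φ' = ψ.leftTensor φ)
    {κ : Unitary D' (ψ.Tensor (φ.Tensor X)) (φ'.Tensor X)} (hκ : IsAssociator ψ φ φ' κ) (x : X)
    (t : φ.Tensor X) (e : E) : φ'.ann x (κ.toEquiv (ψ.tens t e)) = ψ.tens (φ.ann x t) e := by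
  have := φ.isTotal_tens.clm_ext (S := φ'.ann x ∘L (κ.toIso : _ →L[ℂ] φ'.Tensor X) ∘L ψ.creLeft e)
    (T := ψ.creLeft e ∘L φ.ann x) fun p => by
      change φ'.ann x (κ.toEquiv (ψ.tens (φ.tens p.1 p.2) e)) = ψ.tens (φ.ann x (φ.tens p.1 p.2)) e
      rw [hκ, LeftAction.ann_tens, LeftAction.ann_tens, h, LeftAction.leftTensor_tens]
  exact congrArg (fun T : φ.Tensor X →L[ℂ] ψ.Tensor F => T t) this

end Associator

theorem SecRep.IsIntegrated.isInduced_iff {ψ : NondegRep D D' E} {S : SecRep A α D F}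
    {S' : SecRep A α D' (ψ.toLeftAction.Tensor F)}
    (hS : ∀ ξ v e, S'.L ξ (ψ.tens v e) = ψ.tens (S.L ξ v) e) {R : FellRep A α D F}
    {R' : FellRep A α D' (ψ.toLeftAction.Tensor F)} (h : S.IsIntegrated R) :
    FellRep.IsInduced ψ R R' ↔ S'.IsIntegrated R' := by
  constructor
  · rintro ⟨hφ, κs, κr, hs, hr, hU⟩ x y t
    have := ψ.isTotal_tens.clm_ext
      (S := R'.φ.ann x ∘L (R'.U.toIso : _ →L[ℂ] R'.φ.Tensor (Xr A α).Sec) ∘L R'.φ.cre y)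
      (T := S'.opL (pairS x y)) fun p => by
        change R'.φ.ann x (R'.U.toEquiv (R'.φ.tens y (ψ.tens p.1 p.2)))
          = S'.L (pairS x y) (ψ.tens p.1 p.2)
        rw [hS, ← h, ← hs, ← hU, LeftAction.mapLeft_tens]
        exact hr.ann_tens hφ x _ p.2
    exact congrArg (fun T : ψ.toLeftAction.Tensor F →L[ℂ] ψ.toLeftAction.Tensor F => T t) this
  · intro h'
    have hφ : R'.φ = ψ.toLeftAction.leftTensor R.φ := LeftAction.ext (LinearMap.ext fun b => by
      have := (ψ.isTotal_tens_of_total_left S.nondeg).clm_ext (S := R'.φ.op b)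
        (T := (ψ.toLeftAction.leftTensor R.φ).op b) fun p => by
          rw [LeftAction.op_apply, LeftAction.op_apply, ← hS, h'.act, hS, hS,
            LeftAction.leftTensor_tens, h.act]
      exact LinearMap.ext fun v =>
        congrArg (fun T : ψ.toLeftAction.Tensor F →L[ℂ] ψ.toLeftAction.Tensor F => T v) this)
    obtain ⟨κs, hs⟩ := exists_isAssociator (X := (Xs A α).Sec) hφ
    obtain ⟨κr, hr⟩ := exists_isAssociator (X := (Xr A α).Sec) hφ
    refine ⟨hφ, κs, κr, hs, hr, fun t => ?_⟩
    have := (ψ.isTotal_tens_of_total_left R.φ.isTotal_tens).clm_ext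
      (S := (κr.toIso : _ →L[ℂ] R'.φ.Tensor (Xr A α).Sec) ∘L
        LeftAction.mapLeft ψ.toLeftAction R.U.toEquiv.toLinearMap R.U.inn_map)
      (T := (R'.U.toIso : _ →L[ℂ] R'.φ.Tensor (Xr A α).Sec) ∘L
        (κs.toIso : _ →L[ℂ] R'.φ.Tensor (Xs A α).Sec)) fun p => by
          change κr.toEquiv (LeftAction.mapLeft ψ.toLeftAction R.U.toEquiv.toLinearMap R.U.inn_map
            (ψ.tens (R.φ.tens p.1.1 p.1.2) p.2))
            = R'.U.toEquiv (κs.toEquiv (ψ.tens (R.φ.tens p.1.1 p.1.2) p.2))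
          refine R'.φ.tensor_ext fun x => ?_
          rw [hs, h', hS, ← h, LeftAction.mapLeft_tens]
          exact hr.ann_tens hφ x _ p.2
    exact congrArg (fun T : ψ.toLeftAction.Tensor (R.φ.Tensor (Xs A α).Sec) →L[ℂ]
      R'.φ.Tensor (Xr A α).Sec => T t) this

end Induction

end Correspondence

section Bijections

variable {G : LCGroupoid.{u}} (A : FellBundle.{u} G) (α : HaarSystem G)

open BanachBundle FellBundle L2Data

/-- The bijections between representations of the C*-algebra of a Fell bundle and representations
of the Fell bundle. -/
def fellRepBij : RepBij A α (CStar A α) := fun D F _ _ _ _ =>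
  (secRepEquiv A α D F).trans (SecRep.fellRepEquiv A α D F)

variable {A α}

theorem isIntegrated_fellRepBij {D F : Type u} [NonUnitalCStarAlgebra D] [NormedAddCommGroup F]
    [NormedSpace ℂ F] [HilbertModule D F] (L : NondegRep (CStar A α) D F) :
    (secRepEquiv A α D F L).IsIntegrated (fellRepBij A α D F L) :=
  SecRep.isIntegrated_fellRepEquiv _

section Induction

variable {D D' F E : Type u} [NonUnitalCStarAlgebra D] [NonUnitalCStarAlgebra D']
  [NormedAddCommGroup F] [NormedSpace ℂ F] [HilbertModule D F]
  [NormedAddCommGroup E] [NormedSpace ℂ E] [HilbertModule D' E]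

theorem fellRep_isInduced_iff {ψ : NondegRep D D' E} {L : NondegRep (CStar A α) D F}
    {L' : NondegRep (CStar A α) D' (ψ.toLeftAction.Tensor F)} (h : NondegRep.IsInduced ψ L L')
    {R' : FellRep A α D' (ψ.toLeftAction.Tensor F)} :
    FellRep.IsInduced ψ (fellRepBij A α D F L) R'
      ↔ (secRepEquiv A α D' (ψ.toLeftAction.Tensor F) L').IsIntegrated R' :=
  SecRep.IsIntegrated.isInduced_iff (fun ξ v e => by
    have h' : L'.toLeftAction = ψ.toLeftAction.leftTensor L.toLeftAction := h
    rw [secRepEquiv_L, h', LeftAction.leftTensor_tens]; rfl) (isIntegrated_fellRepBij L)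

theorem FellRep.existsUnique_isInduced (ψ : NondegRep D D' E) (R : FellRep A α D F) :
    ∃! R' : FellRep A α D' (ψ.toLeftAction.Tensor F), FellRep.IsInduced ψ R R' := by
  obtain ⟨L, rfl⟩ := (fellRepBij A α D F).surjective R
  have h := NondegRep.isInduced_induced ψ L
  exact ⟨_, (fellRep_isInduced_iff h).2 (isIntegrated_fellRepBij _), fun R' hR' =>
    ((fellRep_isInduced_iff h).1 hR').unique_fellRep (isIntegrated_fellRepBij _)⟩

theorem NondegRep.existsUnique_isInduced {C : Type u} [NonUnitalCStarAlgebra C]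
    (ψ : NondegRep D D' E) (L : NondegRep C D F) :
    ∃! L' : NondegRep C D' (ψ.toLeftAction.Tensor F), NondegRep.IsInduced ψ L L' :=
  ⟨_, isInduced_induced ψ L, fun _ h => h.unique (isInduced_induced ψ L)⟩

end Induction

theorem isNatural_fellRepBij : (fellRepBij A α).IsNatural where
  intertwiner _ _ _ _ _ _ _ _ _ _ L₁ L₂ V hV :=
    (NondegRep.intertwines_iff L₁ L₂ V hV).trans ((isIntegrated_fellRepBij L₁).intertwines_iff
      (isIntegrated_fellRepBij L₂) V hV).symm
  tensor _ _ _ _ _ _ _ _ _ _ _ _ _ _ L' h :=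
    (fellRep_isInduced_iff h).2 (isIntegrated_fellRepBij L')

/-- Two natural families of bijections with the representations of a Fell bundle give natural
bijections between the nondegenerate representations of the two C*-algebras. -/
def RepBij.IsNatural.repEquiv {B C : Type u} [NonUnitalCStarAlgebra B] [NonUnitalCStarAlgebra C]
    {Φ : RepBij A α B} {Ψ : RepBij A α C} (hΦ : Φ.IsNatural) (hΨ : Ψ.IsNatural) : RepEquiv B C where
  T D F := (Ψ D F).trans (Φ D F).symm
  intertwiner D F₁ F₂ _ _ _ _ _ _ _ L₁ L₂ V hV := by
    rw [hΨ.intertwiner D F₁ F₂ L₁ L₂ V hV, hΦ.intertwiner D F₁ F₂ _ _ V hV, Equiv.trans_apply,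
      Equiv.trans_apply, Equiv.apply_symm_apply, Equiv.apply_symm_apply]
  tensor D D' F E _ _ _ _ _ _ _ _ ψ L L' h := by
    have h1 := hΦ.tensor D D' F E ψ _ _ (NondegRep.isInduced_induced ψ ((Φ D F).symm (Ψ D F L)))
    rw [Equiv.apply_symm_apply] at h1
    have h2 := (FellRep.existsUnique_isInduced ψ _).unique h1 (hΨ.tensor D D' F E ψ L L' h)
    rw [Equiv.trans_apply, Equiv.trans_apply, ← h2, Equiv.symm_apply_apply]
    exact NondegRep.isInduced_induced _ _

theorem RepBij.IsNatural.existsUnique_iso {B C : Type u} [NonUnitalCStarAlgebra B]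
    [NonUnitalCStarAlgebra C] {Φ : RepBij A α B} {Ψ : RepBij A α C} (hΦ : Φ.IsNatural)
    (hΨ : Ψ.IsNatural) : ∃! θ : B ≃⋆ₐ[ℂ] C, ∀ (D F : Type u) [NonUnitalCStarAlgebra D]
      [NormedAddCommGroup F] [NormedSpace ℂ F] [HilbertModule D F] (ρ : NondegRep C D F),
      Ψ D F ρ = Φ D F (ρ.comp θ) := by
  obtain ⟨θ, h, hu⟩ := (hΦ.repEquiv hΨ).existsUnique_iso
  refine ⟨θ, fun D F _ _ _ _ ρ => ?_, fun θ' h' => hu θ' fun D F _ _ _ _ ρ => ?_⟩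
  · exact ((Φ D F).symm_apply_eq).1 (h D F ρ)
  · exact ((Φ D F).symm_apply_eq).2 (h' D F ρ)

end Bijections
end
end FellUniv

theorem mainTheorem1 (G : FellUniv.LCGroupoid.{u}) (A : FellUniv.FellBundle.{u} G)
    (α : FellUniv.HaarSystem G) :
    ∃ Φ : FellUniv.RepBij A α (FellUniv.FellBundle.CStar A α), Φ.IsNatural ∧
      (∀ (C D D' F E : Type u) [NonUnitalCStarAlgebra C] [NonUnitalCStarAlgebra D]
        [NonUnitalCStarAlgebra D'] [NormedAddCommGroup F] [NormedSpace ℂ F]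
        [FellUniv.HilbertModule D F] [NormedAddCommGroup E] [NormedSpace ℂ E]
        [FellUniv.HilbertModule D' E] (ψ : FellUniv.NondegRep D D' E)
        (L : FellUniv.NondegRep C D F),
        ∃! L' : FellUniv.NondegRep C D' (ψ.toLeftAction.Tensor F), FellUniv.NondegRep.IsInduced ψ L L') ∧
      (∀ (D D' F E : Type u) [NonUnitalCStarAlgebra D]
        [NonUnitalCStarAlgebra D'] [NormedAddCommGroup F] [NormedSpace ℂ F]
        [FellUniv.HilbertModule D F] [NormedAddCommGroup E] [NormedSpace ℂ E]
        [FellUniv.HilbertModule D' E] (ψ : FellUniv.NondegRep D D' E)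
        (R : FellUniv.FellRep A α D F),
        ∃! R' : FellUniv.FellRep A α D' (ψ.toLeftAction.Tensor F), FellUniv.FellRep.IsInduced ψ R R') ∧
      ∀ (C : Type u) [NonUnitalCStarAlgebra C] (Ψ : FellUniv.RepBij A α C), Ψ.IsNatural →
        ∃! θ : FellUniv.FellBundle.CStar A α ≃⋆ₐ[ℂ] C,
          ∀ (D F : Type u) [NonUnitalCStarAlgebra D] [NormedAddCommGroup F] [NormedSpace ℂ F]
            [FellUniv.HilbertModule D F] (ρ : FellUniv.NondegRep C D F),
            Ψ D F ρ = Φ D F (ρ.comp θ) := by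
  refine ⟨FellUniv.fellRepBij A α, FellUniv.isNatural_fellRepBij, ?_, ?_, ?_⟩
  · intro C D D' F E _ _ _ _ _ _ _ _ _ ψ L
    exact FellUniv.NondegRep.existsUnique_isInduced ψ L
  · intro D D' F E _ _ _ _ _ _ _ _ ψ R
    exact FellUniv.FellRep.existsUnique_isInduced ψ R
  · intro C _ Ψ hΨ
    exact FellUniv.isNatural_fellRepBij.existsUnique_iso hΨ
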